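/- **Setting.** Let $S\subseteq\mathbb R^2$ be a bounded Lipschitz domain with outer unit normal $\nu_S$, and let $\Gamma_n\subseteq\partial S$ be relatively open with finitely many connected components and such that $\overline{\Gamma_n}$ is contained in a one-dimensional $C^2$-submanifold of $\mathbb R^2$. *Energy.* Let $W:(-\frac12,\frac12)\times\mathbb R^{3\times3}\to[0,\infty]$ be a Borel function and $C_W>0$, $q_W>4$, $r_W:[0,\infty)\to[0,\infty]$ monotone with $r_W(\delta)\to0$ as $\delta\to0$, such that for all $x_3$: (i) $W(x_3,RF)=W(x_3,F)$ for $R\in SO(3)$; (ii) $W(x_3,F)\ge\frac1{C_W}\operatorname{dist}^2(F,SO(3))$ for all $F$, and $W(x_3,F)\le C_W\operatorname{dist}^2(F,SO(3))$ if $\operatorname{dist}^2(F,SO(3))\le\frac1{C_W}$; (iii) there is a quadratic form $Q(x_3,\cdot)$ with $|W(x_3,I+G)-Q(x_3,G)|\le|G|^2r_W(|G|)$ for all $G$; (iv) $W(x_3,F)\ge\frac1{C_W}\max\{|F|^{q_W},(\det F)^{-q_W/2}\}-C_W$ if $\det F>0$, and $W(x_3,F)=\infty$ otherwise. For $A,U\in\mathbb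 R^{2\times2}_{\rm sym}$ put $$Q_2(x_3,A)=\min_{d\in\mathbb R^3}Q(x_3,\iota(A)+\operatorname{sym}(d\otimes e_3)),\qquad Q_{\rm el}(A)=\min_{M}\int_{-1/2}^{1/2}Q_2(x_3,x_3A+M)\,dx_3,$$ $$E_{\rm res}(U)=\min_{A,M}\int_{-1/2}^{1/2}Q_2(x_3,x_3A+M+\mathbf 1(x_3>0)\tfrac12U)\,dx_3,\qquad \mathbb B(U)=\sum_{i=1}^3(U\cdot G_i)A_i,$$ where $A,M$ range over $\mathbb R^{2\times2}_{\rm sym}$, $\iota(A)$ is the $3\times3$ matrix with upper-left block $A$ and zeros elsewhere, $G_1=e_1\otimes e_1$, $G_2=e_2\otimes e_2$, $G_3=\frac1{\sqrt2}(e_1\otimes e_2+e_2\otimes e_1)$, and $(A_i,M_i)$ is the unique minimizer of $(A,M)\mapsto\int_{-1/2}^{1/2}Q_2(x_3,\mathbf 1(x_3>0)\frac12G_i-(x_3A+M))\,dx_3$. Let $\bar r\in\mathbb R$, $\bar\varepsilon>0$. Let $\mathcal A_2$ be the set of pairs $(y,n)$ with $n\in H^1(S;\mathbb S^2)$ and $y\in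 H^2(S;\mathbb R^3)$, $\nabla' y^\top\nabla' y=I$ a.e.; for such $y$ let $b_y=\partial_1y\wedge\partial_2y$, $R_y=(\partial_1y,\partial_2y,b_y)$, $\mathrm{II}_y=\nabla' y^\top\nabla' b_y$. On $L^2(S;\mathbb R^3)\times L^2(S;\mathbb R^3)$ let, for $(y,n)\in\mathcal A_2$ and with $U_{y,n}=\frac13I-\nabla' y^\top n\otimes\nabla' y^\top n$, $$\mathcal E(y,n)=\int_S Q_{\rm el}\big(\mathrm{II}_y+\bar r\,\mathbb B(U_{y,n})\big)+\bar r^2E_{\rm res}(U_{y,n})\,dx'+\frac{\bar\varepsilon^2}2\int_S|\nabla' n|^2\,dx',$$ and $\mathcal E(y,n)=+\infty$ otherwise. *Anchorings.* For $\sigma>0$ let $\Gamma_n^\sigma=\{\xi-s\nu_S(\xi):\xi\in\Gamma_n,\ 0<s<\sigma\}$. For $g\in L^2(\Gamma_n;\mathbb S^2)$ the canonical extension of $g$ to $\Gamma_n^{\bar\sigma}$ is the function $\mathrm Eg\in L^2(\Gamma_n^{\bar\sigma};\mathbb S^2)$ with $(\mathrm Eg)(\xi-s\nu_S(\xi))=g(\xi)$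 for a.e. $\xi\in\Gamma_n$ and a.e. $s\in(0,\bar\sigma)$. Given $\hat n_{BC},\hat\nu\in L^2(\Gamma_n;\mathbb S^2)$ and $\sigma\in(0,\bar\sigma)$, set for $(y,n)\in\mathcal A_2$ $$\mathcal G^\sigma(y,n)=\frac1\sigma\int_{S\cap\Gamma_n^\sigma}|R_y^\top n-\mathrm E\hat n_{BC}|^2dx',\qquad \mathcal H^\sigma(y,n)=\frac1\sigma\int_{S\cap\Gamma_n^\sigma}|R_y^\top n\cdot\mathrm E\hat\nu|^2dx',$$ $$\mathcal G_{\rm weak}(y,n)=\int_{\Gamma_n}|R_y^\top n-\hat n_{BC}|^2d\mathcal H^1,\qquad \mathcal H_{\rm weak}(y,n)=\int_{\Gamma_n}|R_y^\top n\cdot\hat\nu|^2d\mathcal H^1,$$ and let $\mathcal G_{\rm strong}(y,n)=0$ if $R_y^\top n=\hat n_{BC}$ a.e. on $\Gamma_n$ and $+\infty$ otherwise, $\mathcal H_{\rm strong}(y,n)=0$ if $R_y^\top n\cdot\hat\nu=0$ a.e. on $\Gamma_n$ and $+\infty$ otherwise; on $\Gamma_n$ the field $R_y^\top n\in H^1(S;\mathbb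 R^3)$ is understood in the sense of traces. All six functionals are $+\infty$ for $(y,n)\notin\mathcal A_2$. **Lemma.** There is $\bar\sigma>0$, depending only on $S$ and $\Gamma_n$, such that every $g\in L^2(\Gamma_n;\mathbb S^2)$ has a canonical extension to $\Gamma_n^{\bar\sigma}$, unique up to null sets, and such that the following holds for all $W$, $\bar r$, $\bar\varepsilon$, $\hat n_{BC}$, $\hat\nu$ as above, where $\Gamma$-convergence is with respect to strong convergence in $L^2(S;\mathbb R^3)\times L^2(S;\mathbb R^3)$. (a) As $\sigma\to0$, $\mathcal E+\mathcal G^\sigma$ and $\mathcal E+\mathcal H^\sigma$ $\Gamma$-converge to $\mathcal E+\mathcal G_{\rm weak}$ and $\mathcal E+\mathcal H_{\rm weak}$, respectively. (b) Let $0<\beta<\frac12$. As $\sigma\to0$, $\mathcal E+\sigma^{-\beta}\mathcal G^\sigma$ and $\mathcal E+\sigma^{-\beta}\mathcal H^\sigma$ $\Gamma$-converge to $\mathcal E+\mathcal G_{\rm strong}$ and $\mathcal E+\mathcal H_{\rm strong}$, respectively. -/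

import Mathlib

open MeasureTheory Filter Topology Set
open scoped ENNReal NNReal ContDiff Matrix RealInnerProductSpace

namespace LCEPlate

noncomputable section

/-- The plane `ℝ²` with the Euclidean norm. -/
abbrev E2 := EuclideanSpace ℝ (Fin 2)

/-- The space `ℝ³` with the Euclidean norm. -/
abbrev E3 := EuclideanSpace ℝ (Fin 3)

/-- Real `2 × 2` matrices. -/
abbrev M2 := Matrix (Fin 2) (Fin 2) ℝ

/-- Real `3 × 3` matrices. -/
abbrev M3 := Matrix (Fin 3) (Fin 3) ℝ

/-- Symmetric real `2 × 2` matrices. -/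
abbrev Sym2x2 := {A : M2 // A.IsSymm}

/-- The `i`-th coordinate direction of `ℝ²`. -/
def dir (i : Fin 2) : E2 := EuclideanSpace.single i 1

/-! ### Gamma-convergence -/

/-- `Γ`-convergence, as `σ → 0⁺`, of a family of `[0,∞]`-valued functionals on a metric space:
along every sequence `σ k → 0⁺` the lower bound holds for all convergent sequences and every point
has a recovery sequence. -/
def GammaConverges {X : Type*} [TopologicalSpace X] (F : ℝ → X → ℝ≥0∞) (F₀ : X → ℝ≥0∞) : Prop :=
  ∀ σ : ℕ → ℝ, Tendsto σ atTop (𝓝[>] 0) →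
    (∀ (x : X) (u : ℕ → X), Tendsto u atTop (𝓝 x) →
      F₀ x ≤ liminf (fun k => F (σ k) (u k)) atTop) ∧
    (∀ x : X, ∃ u : ℕ → X, Tendsto u atTop (𝓝 x) ∧
      limsup (fun k => F (σ k) (u k)) atTop ≤ F₀ x)

/-! ### Domains, boundary pieces, normals -/

/-- A bounded Lipschitz domain in the plane: open, connected, bounded, and, near each boundary
point and after a rigid motion, the strict epigraph of a Lipschitz function. -/
structure IsBoundedLipschitzDomain (S : Set E2) : Prop where
  isOpen : IsOpen S
  isConnected : IsConnected S
  isBounded : Bornology.IsBounded S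
  boundary : ∀ x ∈ frontier S, ∃ r > (0 : ℝ), ∃ (e : E2 ≃ᵢ E2) (K : ℝ≥0) (γ : ℝ → ℝ),
    LipschitzWith K γ ∧ ∀ z ∈ Metric.ball x r, (z ∈ S ↔ γ ((e z) 0) < (e z) 1)

/-- One-dimensional embedded `C²`-submanifolds (without boundary) of the plane: locally regular
level sets of `C²` functions. -/
def IsC2Curve (M : Set E2) : Prop :=
  ∀ p ∈ M, ∃ U : Set E2, IsOpen U ∧ p ∈ U ∧ ∃ g : E2 → ℝ, ContDiffOn ℝ 2 g U ∧
    (∀ z ∈ U, fderiv ℝ g z ≠ 0) ∧ M ∩ U = {z ∈ U | g z = 0}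

/-- `Γ ⊆ ∂S` is relatively open with finitely many connected components, and its closure is
contained in a one-dimensional `C²`-submanifold of the plane. -/
structure IsRegularBoundaryPart (S Γ : Set E2) : Prop where
  relOpen : ∃ O : Set E2, IsOpen O ∧ Γ = O ∩ frontier S
  finiteComponents : Finite (ConnectedComponents Γ)
  closure_subset : ∃ M : Set E2, IsC2Curve M ∧ closure Γ ⊆ M

/-- `ν` is the outer unit normal to `S` at `x`: near `x`, and up to arbitrarily narrow cones around
the line orthogonal to `ν`, the set `S` is the half plane on the side of `-ν`. -/
def IsOuterUnitNormal (S : Set E2) (x ν : E2) : Prop :=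
  ‖ν‖ = 1 ∧ ∀ ε > (0 : ℝ), ∀ᶠ z in 𝓝 x,
    (⟪z - x, ν⟫ < -(ε * ‖z - x‖) → z ∈ S) ∧ (ε * ‖z - x‖ < ⟪z - x, ν⟫ → z ∉ S)

open Classical in
/-- The outer unit normal `ν_S(x)` (set to `0` where there is none). -/
def outerNormal (S : Set E2) (x : E2) : E2 :=
  if h : ∃ ν, IsOuterUnitNormal S x ν then h.choose else 0

/-- The boundary strip `Γ^σ = {ξ - s ν_S(ξ) : ξ ∈ Γ, 0 < s < σ}`. -/
def strip (S Γ : Set E2) (σ : ℝ) : Set E2 :=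
  {z | ∃ ξ ∈ Γ, ∃ s ∈ Ioo 0 σ, z = ξ - s • outerNormal S ξ}

/-- The one-dimensional Hausdorff measure on `Γ`. -/
def arcMeasure (Γ : Set E2) : Measure E2 := (μH[1] : Measure E2).restrict Γ

/-- `g ∈ L²(Γ; 𝕊²)`. -/
def MemL2Sphere (Γ : Set E2) (g : E2 → E3) : Prop :=
  MemLp g 2 (arcMeasure Γ) ∧ ∀ᵐ x ∂(arcMeasure Γ), ‖g x‖ = 1

/-- `G ∈ L²(Γ^σ₀; 𝕊²)` is the canonical extension of `g` to the strip of width `σ₀`: it is constant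
along the fibres orthogonal to `Γ`. -/
structure IsCanonicalExtension (S Γ : Set E2) (σ₀ : ℝ) (g G : E2 → E3) : Prop where
  memLp : MemLp G 2 (volume.restrict (strip S Γ σ₀))
  norm_eq : ∀ᵐ z ∂(volume.restrict (strip S Γ σ₀)), ‖G z‖ = 1
  eq_on_fibres : ∀ᵐ ξ ∂(arcMeasure Γ), ∀ᵐ s ∂((volume : Measure ℝ).restrict (Ioo 0 σ₀)),
    G (ξ - s • outerNormal S ξ) = g ξ

/-! ### Sobolev functions and traces -/

section Sobolev

variable {F : Type*} [NormedAddCommGroup F] [NormedSpace ℝ F]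

/-- `v` is the weak partial derivative of `u` in the `i`-th direction on the open set `S`. -/
def IsWeakPartial (S : Set E2) (i : Fin 2) (u v : E2 → F) : Prop :=
  ∀ φ : E2 → ℝ, ContDiff ℝ ∞ φ → HasCompactSupport φ → tsupport φ ⊆ S →
    ∫ x in S, (fderiv ℝ φ x (dir i)) • u x = -∫ x in S, φ x • v x

open Classical in
/-- The weak partial derivative `∂ᵢ u ∈ L²(S)` (set to `0` if there is none). -/
def weakPartial (S : Set E2) (i : Fin 2) (u : E2 → F) : E2 → F :=
  if h : ∃ v, MemLp v 2 (volume.restrict S) ∧ IsWeakPartial S i u v then h.choose else 0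

/-- `u ∈ H¹(S)`. -/
def MemH1 (S : Set E2) (u : E2 → F) : Prop :=
  MemLp u 2 (volume.restrict S) ∧
    ∀ i, ∃ v, MemLp v 2 (volume.restrict S) ∧ IsWeakPartial S i u v

/-- `u ∈ H²(S)`. -/
def MemH2 (S : Set E2) (u : E2 → F) : Prop :=
  MemH1 S u ∧ ∀ i, MemH1 S (weakPartial S i u)

/-- `g ∈ L²(Γ)` is the trace on `Γ` of `u ∈ H¹(S)`: there are smooth functions `φ k` on the plane
with `φ k → u` in `H¹(S)` and `φ k → g` in `L²(Γ)`. -/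
def IsTrace (S Γ : Set E2) (u g : E2 → F) : Prop :=
  MemH1 S u ∧ MemLp g 2 (arcMeasure Γ) ∧
    ∃ φ : ℕ → E2 → F, (∀ k, ContDiff ℝ ∞ (φ k)) ∧
      Tendsto (fun k => eLpNorm (φ k - u) 2 (volume.restrict S)) atTop (𝓝 0) ∧
      (∀ i, Tendsto (fun k => eLpNorm (fun x => fderiv ℝ (φ k) x (dir i) - weakPartial S i u x) 2
        (volume.restrict S)) atTop (𝓝 0)) ∧
      Tendsto (fun k => eLpNorm (φ k - g) 2 (arcMeasure Γ)) atTop (𝓝 0)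

open Classical in
/-- The trace of `u` on `Γ` (set to `0` if there is none). -/
def traceOn (S Γ : Set E2) (u : E2 → F) : E2 → F :=
  if h : ∃ g, IsTrace S Γ u g then h.choose else 0

end Sobolev

/-! ### Stored energy function -/

/-- The square of the Frobenius norm. -/
def frobSq {m n : ℕ} (A : Matrix (Fin m) (Fin n) ℝ) : ℝ := ∑ i, ∑ j, A i j ^ 2

/-- The Frobenius norm. -/
def frob {m n : ℕ} (A : Matrix (Fin m) (Fin n) ℝ) : ℝ := Real.sqrt (frobSq A)

/-- The squared distance of `F` to the group of rotations. -/
def distSqSO3 (F : M3) : ℝ := ⨅ R : Matrix.specialOrthogonalGroup (Fin 3) ℝ, frobSq (F - R.1)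

/-- The assumptions on the stored energy function `W(x₃,F)`, `x₃ ∈ (-1/2,1/2)`, with constants
`C_W`, `q_W`, modulus `r_W` and quadratic form `Q(x₃,·)` in the expansion at the identity. -/
structure StoredEnergy (W : ℝ → M3 → ℝ≥0∞) (Q : ℝ → QuadraticForm ℝ M3) (C q : ℝ)
    (r : ℝ≥0 → ℝ≥0∞) : Prop where
  C_pos : 0 < C
  q_gt : 4 < q
  r_mono : Monotone r
  r_lim : Tendsto r (𝓝[>] 0) (𝓝 0)
  borel : Measurable fun p : Ioo (-(1 / 2) : ℝ) (1 / 2) × (Fin 3 → Fin 3 → ℝ) =>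
    W p.1 (Matrix.of p.2)
  frame_indifference : ∀ t ∈ Ioo (-(1 / 2) : ℝ) (1 / 2),
    ∀ R ∈ Matrix.specialOrthogonalGroup (Fin 3) ℝ, ∀ F : M3, W t (R * F) = W t F
  lower : ∀ t ∈ Ioo (-(1 / 2) : ℝ) (1 / 2), ∀ F : M3,
    ENNReal.ofReal (1 / C * distSqSO3 F) ≤ W t F
  upper : ∀ t ∈ Ioo (-(1 / 2) : ℝ) (1 / 2), ∀ F : M3, distSqSO3 F ≤ 1 / C →
    W t F ≤ ENNReal.ofReal (C * distSqSO3 F)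
  expansion : ∀ t ∈ Ioo (-(1 / 2) : ℝ) (1 / 2), ∀ G : M3,
    ((W t (1 + G) : EReal) - ((Q t G : ℝ) : EReal)).abs
      ≤ ENNReal.ofReal (frobSq G) * r (frob G).toNNReal
  growth : ∀ t ∈ Ioo (-(1 / 2) : ℝ) (1 / 2), ∀ F : M3, 0 < F.det →
    ENNReal.ofReal (1 / C * max (frob F ^ q) (F.det ^ (-(q / 2))) - C) ≤ W t F
  eq_top : ∀ t ∈ Ioo (-(1 / 2) : ℝ) (1 / 2), ∀ F : M3, ¬ 0 < F.det → W t F = ⊤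

/-! ### Effective quantities -/

/-- `ι(A)`: the `3 × 3` matrix with upper-left block `A` and zeros elsewhere. -/
def iota (A : M2) : M3 := !![A 0 0, A 0 1, 0; A 1 0, A 1 1, 0; 0, 0, 0]

/-- `sym(d ⊗ e₃)`. -/
def symE3 (d : Fin 3 → ℝ) : M3 :=
  (1 / 2 : ℝ) • (Matrix.vecMulVec d ![0, 0, 1] + Matrix.vecMulVec ![0, 0, 1] d)

/-- `Q₂(x₃,A) = min_d Q(x₃, ι(A) + sym(d ⊗ e₃))`. -/
def Q2 (Q : ℝ → QuadraticForm ℝ M3) (t : ℝ) (A : M2) : ℝ :=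
  ⨅ d : Fin 3 → ℝ, Q t (iota A + symE3 d)

/-- The indicator function of the top layer `x₃ > 0`. -/
def topLayer (t : ℝ) : ℝ := if 0 < t then 1 else 0

/-- `Q_el(A) = min_M ∫ Q₂(x₃, x₃ A + M) dx₃`. -/
def Qel (Q : ℝ → QuadraticForm ℝ M3) (A : M2) : ℝ :=
  ⨅ M : Sym2x2, ∫ t in (-(1 / 2) : ℝ)..(1 / 2), Q2 Q t (t • A + M.1)

/-- `E_res(U) = min_{A,M} ∫ Q₂(x₃, x₃ A + M + 1(x₃ > 0) U / 2) dx₃`. -/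
def Eres (Q : ℝ → QuadraticForm ℝ M3) (U : M2) : ℝ :=
  ⨅ p : Sym2x2 × Sym2x2, ∫ t in (-(1 / 2) : ℝ)..(1 / 2),
    Q2 Q t (t • p.1.1 + p.2.1 + (topLayer t * (1 / 2)) • U)

/-- The orthonormal basis `G₁, G₂, G₃` of the symmetric `2 × 2` matrices. -/
def basisG : Fin 3 → M2 :=
  ![!![1, 0; 0, 0], !![0, 0; 0, 1], (1 / Real.sqrt 2) • !![0, 1; 1, 0]]

/-- The quadratic function whose minimizer `(Aᵢ, Mᵢ)` defines the map `𝔹`. -/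
def cellEnergy (Q : ℝ → QuadraticForm ℝ M3) (i : Fin 3) (p : Sym2x2 × Sym2x2) : ℝ :=
  ∫ t in (-(1 / 2) : ℝ)..(1 / 2), Q2 Q t ((topLayer t * (1 / 2)) • basisG i - (t • p.1.1 + p.2.1))

open Classical in
/-- The matrix `Aᵢ`, the first component of the minimizer of `cellEnergy Q i` (which is unique for
the quadratic forms of a stored energy function). -/
def cellA (Q : ℝ → QuadraticForm ℝ M3) (i : Fin 3) : M2 :=
  if h : ∃ p : Sym2x2 × Sym2x2, ∀ p', cellEnergy Q i p ≤ cellEnergy Q i p'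
  then h.choose.1.1 else 0

/-- The linear map `𝔹(U) = ∑ᵢ (U · Gᵢ) Aᵢ`. -/
def BB (Q : ℝ → QuadraticForm ℝ M3) (U : M2) : M2 :=
  ∑ i, (Uᵀ * basisG i).trace • cellA Q i

/-! ### The two-dimensional plate energy -/

/-- The normal field `b_y = ∂₁y ∧ ∂₂y`. -/
def normalField (S : Set E2) (y : E2 → E3) (x : E2) : E3 :=
  WithLp.toLp 2 ((weakPartial S 0 y x).ofLp ⨯₃ (weakPartial S 1 y x).ofLp)

/-- The frame `R_y = (∂₁y, ∂₂y, b_y)`, given by its columns. -/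
def frame (S : Set E2) (y : E2 → E3) (x : E2) : M3 :=
  Matrix.of fun i j => (![weakPartial S 0 y x, weakPartial S 1 y x, normalField S y x] j) i

/-- The director in local coordinates `R_yᵀ n`. -/
def localDirector (S : Set E2) (y n : E2 → E3) (x : E2) : E3 :=
  WithLp.toLp 2 ((frame S y x)ᵀ *ᵥ (n x).ofLp)

/-- `II_y = ∇'yᵀ ∇'b_y`. -/
def secondForm (S : Set E2) (y : E2 → E3) (x : E2) : M2 :=
  Matrix.of fun i j => ⟪weakPartial S i y x, weakPartial S j (normalField S y) x⟫

/-- The tangential components `∇'yᵀ n`. -/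
def tangential (S : Set E2) (y n : E2 → E3) (x : E2) : Fin 2 → ℝ :=
  fun i => ⟪weakPartial S i y x, n x⟫

/-- `y ∈ H²_iso(S; ℝ³)`. -/
def MemH2iso (S : Set E2) (y : E2 → E3) : Prop :=
  MemH2 S y ∧ ∀ᵐ x ∂(volume.restrict S), ∀ i j : Fin 2,
    ⟪weakPartial S i y x, weakPartial S j y x⟫ = if i = j then 1 else 0

/-- `(y,n) ∈ 𝒜₂`, i.e. `y ∈ H²_iso(S; ℝ³)` and `n ∈ H¹(S; 𝕊²)`. -/
def MemA2 (S : Set E2) (y n : E2 → E3) : Prop :=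
  MemH2iso S y ∧ MemH1 S n ∧ ∀ᵐ x ∂(volume.restrict S), ‖n x‖ = 1

/-- The matrix `I/3 - ∇'yᵀn ⊗ ∇'yᵀn`. -/
def nematicStrain (S : Set E2) (y n : E2 → E3) (x : E2) : M2 :=
  (1 / 3 : ℝ) • (1 : M2) - Matrix.vecMulVec (tangential S y n x) (tangential S y n x)

/-- The elastic energy `ℰ_el(y,n)` with parameter `r̄`. -/
def elasticEnergy (Q : ℝ → QuadraticForm ℝ M3) (rbar : ℝ) (S : Set E2) (y n : E2 → E3) : ℝ≥0∞ :=
  ∫⁻ x in S, ENNReal.ofReal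
    (Qel Q (secondForm S y x + rbar • BB Q (nematicStrain S y n x))
      + rbar ^ 2 * Eres Q (nematicStrain S y n x))

/-- The Oseen-Frank energy `½ ∫ |∇'n|²`. -/
def oseenFrank (S : Set E2) (n : E2 → E3) : ℝ≥0∞ :=
  ENNReal.ofReal (1 / 2) * ∫⁻ x in S, ENNReal.ofReal (∑ i, ‖weakPartial S i n x‖ ^ 2)

/-- The space `L²(S; ℝ³) × L²(S; ℝ³)` with its strong topology. -/
abbrev State (S : Set E2) :=
  Lp E3 2 ((volume : Measure E2).restrict S) × Lp E3 2 ((volume : Measure E2).restrict S)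

open Classical in
/-- A functional on `𝒜₂`, extended by `+∞` to `L²(S; ℝ³) × L²(S; ℝ³)`. -/
def extendTop (S : Set E2) (Φ : (E2 → E3) → (E2 → E3) → ℝ≥0∞) (p : State S) : ℝ≥0∞ :=
  if MemA2 S p.1 p.2 then Φ p.1 p.2 else ⊤

/-- The plate energy `ℰ = ℰ_el + ε̄² ℰ_OF`. -/
def plateEnergy (Q : ℝ → QuadraticForm ℝ M3) (rbar ebar : ℝ) (S : Set E2) :
    State S → ℝ≥0∞ :=
  extendTop S fun y n =>
    elasticEnergy Q rbar S y n + ENNReal.ofReal (ebar ^ 2) * oseenFrank S n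

/-! ### Anchoring functionals -/

/-- The strip anchoring `𝒢^σ`, with `N` the extended Dirichlet datum. -/
def stripG (S Γ : Set E2) (N : E2 → E3) (σ : ℝ) : State S → ℝ≥0∞ :=
  extendTop S fun y n => ENNReal.ofReal (1 / σ) *
    ∫⁻ x in S ∩ strip S Γ σ, ENNReal.ofReal (‖localDirector S y n x - N x‖ ^ 2)

/-- The strip anchoring `ℋ^σ`, with `N` the extended direction. -/
def stripH (S Γ : Set E2) (N : E2 → E3) (σ : ℝ) : State S → ℝ≥0∞ :=
  extendTop S fun y n => ENNReal.ofReal (1 / σ) *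
    ∫⁻ x in S ∩ strip S Γ σ, ENNReal.ofReal (|⟪localDirector S y n x, N x⟫| ^ 2)

/-- The weak boundary anchoring `∫_Γ |R_yᵀ n - g|² dℋ¹`, in the sense of traces. -/
def weakG (S Γ : Set E2) (g : E2 → E3) : State S → ℝ≥0∞ :=
  extendTop S fun y n =>
    ∫⁻ x, ENNReal.ofReal (‖traceOn S Γ (localDirector S y n) x - g x‖ ^ 2) ∂(arcMeasure Γ)

/-- The weak boundary anchoring `∫_Γ |R_yᵀ n · g|² dℋ¹`, in the sense of traces. -/
def weakH (S Γ : Set E2) (g : E2 → E3) : State S → ℝ≥0∞ :=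
  extendTop S fun y n =>
    ∫⁻ x, ENNReal.ofReal (|⟪traceOn S Γ (localDirector S y n) x, g x⟫| ^ 2) ∂(arcMeasure Γ)

open Classical in
/-- The strong boundary anchoring `R_yᵀ n = g` a.e. on `Γ`, in the sense of traces. -/
def strongG (S Γ : Set E2) (g : E2 → E3) : State S → ℝ≥0∞ :=
  extendTop S fun y n =>
    if ∀ᵐ x ∂(arcMeasure Γ), traceOn S Γ (localDirector S y n) x = g x then 0 else ⊤

open Classical in
/-- The strong boundary anchoring `R_yᵀ n · g = 0` a.e. on `Γ`, in the sense of traces. -/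
def strongH (S Γ : Set E2) (g : E2 → E3) : State S → ℝ≥0∞ :=
  extendTop S fun y n =>
    if ∀ᵐ x ∂(arcMeasure Γ), ⟪traceOn S Γ (localDirector S y n) x, g x⟫ = 0 then 0 else ⊤

end

end LCEPlate

open LCEPlate

/-!
The proof rests on three facts: the geometry of normal strips, compactness and lower semicontinuity
for the plate energy, and one-dimensional calculus along the fibres of a strip.

*Geometry.* Where the boundary of a Lipschitz domain lies on a `C²` curve, the Lipschitz chart
forces the domain to one side of the curve, and the outer normal is a Lipschitz function of the
foot point (`exists_hasSmoothNormal`). The map `stripMap : (ξ, s) ↦ ξ - s ν(ξ)` is then almost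
isometric on short pieces. It is injective for small widths, and it distorts the product of arc
length and Lebesgue measure by a factor that tends to one with the width
(`HasSmoothNormal.exists_isGoodWidth`). Canonical extensions are therefore obtained by composing
with the foot point (`IsGoodWidth.exists_canonicalExtension`). Near the end points of the
components of `Γ` a fibre may leave the domain. As there are finitely many components, the base
points whose fibre of length `σ` is not known to lie in `S` have length `O(σ)`
(`exists_measure_diff_innerPart_le`).

*The plate energy.* The bounds for the stored energy pass to its quadratic form, since `1 - sym R`
is quadratic in `R - 1` for rotations `R`. So `Q_el` and `E_res` are convex and continuous, and
`Q_el` is coercive on symmetric matrices (`StoredEnergy.le_Qel`). For an isometric immersion `y`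
the products of first and second derivatives are symmetric in one pair of indices and skew in
another, and hence vanish: the Hessian is normal, its length is that of the second fundamental
form, and the energy bounds it in `L²`. Thus along sequences of bounded energy, after passing to
subsequences, `∇y` converges strongly, the second fundamental form and `∇n` converge weakly, and
the local director `Rᵀ n` converges strongly and stays bounded in `H¹`. Lower semicontinuity is
that of convex integrals (`exists_subseq_plateEnergy_le_liminf`).

*Fibres.* By the fundamental theorem of calculus, a Sobolev function and its trace differ on fibres
of length `σ` by `O(σ)` in `L²`, with a constant given by the gradient
(`IsFibred.sq_eLpNorm_sub_trace_le`); the same calculus on fibres of a fixed length shows that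
bounded Sobolev functions have traces (`exists_isTrace`). Applied to the local directors, it
compares strip means with boundary integrals:
* for a sequence bounded in `H¹`, fix a length `d`. Over the base points whose fibres of length `d`
  lie in `S`, the difference to the limit on fibres of length `σ` is controlled by its `L²` norm in
  `S` and by `d`. Letting `σ → 0` and then `d → 0` bounds the boundary penalty by the lower limit
  of the strip means (`lintegral_trace_le_liminf`);
* for a fixed state the strip mean does not exceed the boundary penalty in the limit
  (`limsup_stripMean_le`), and it is `O(σ)` if the boundary penalty vanishes
  (`tendsto_mul_stripMean_zero`).

The first item is the lower bound. The second shows that the constant sequence is a recovery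
sequence, for the weak anchoring and, as `σ^(-β) σ → 0`, for the strong one
(`gammaConverges_of_director`, `gammaConverges_weak`, `gammaConverges_strong`). The two kinds of
anchoring enter only through the penalties `|w - N|` and `|w · N|`, which are nonnegative and
continuous, `1`-Lipschitz in `w`, and bounded on unit vectors (`IsPenalty`).
-/

namespace LCEPlate

/-! ### Orthonormal frames of the plane -/

lemma exists_orthonormalBasis {a b : E2} (ha : ‖a‖ = 1) (hb : ‖b‖ = 1) (hab : ⟪a, b⟫ = 0) :
    ∃ B : OrthonormalBasis (Fin 2) ℝ E2, B 0 = a ∧ B 1 = b := by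
  have ho : Orthonormal ℝ ![a, b] := by
    rw [orthonormal_iff_ite]
    intro i j
    fin_cases i <;> fin_cases j <;> simp [ha, hb, hab, real_inner_comm]
  have hc : Fintype.card (Fin 2) = Module.finrank ℝ E2 := by simp
  refine ⟨(basisOfOrthonormalOfCardEqFinrank ho hc).toOrthonormalBasis (by simpa using ho), ?_, ?_⟩
  · simp
  · simp

lemma eq_frame_expansion {a b : E2} (ha : ‖a‖ = 1) (hb : ‖b‖ = 1) (hab : ⟪a, b⟫ = 0) (z : E2) :
    z = ⟪z, a⟫ • a + ⟪z, b⟫ • b := by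
  obtain ⟨B, rfl, rfl⟩ := exists_orthonormalBasis ha hb hab
  conv_lhs => rw [← B.sum_repr' z]
  simp [Fin.sum_univ_two, real_inner_comm]

lemma norm_sq_frame {a b : E2} (ha : ‖a‖ = 1) (hb : ‖b‖ = 1) (hab : ⟪a, b⟫ = 0) (z : E2) :
    ‖z‖ ^ 2 = ⟪z, a⟫ ^ 2 + ⟪z, b⟫ ^ 2 := by
  obtain ⟨B, rfl, rfl⟩ := exists_orthonormalBasis ha hb hab
  rw [← B.sum_sq_norm_inner_left z]
  simp [Fin.sum_univ_two]

lemma exists_unit_orthogonal {n : E2} (hn : ‖n‖ = 1) : ∃ t : E2, ‖t‖ = 1 ∧ ⟪t, n⟫ = 0 := by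
  refine ⟨!₂[-(n 1), n 0], ?_, ?_⟩
  · rw [EuclideanSpace.norm_eq] at hn ⊢
    rw [← hn]
    simp [Fin.sum_univ_two, add_comm]
  · simp [PiLp.inner_apply, Fin.sum_univ_two]
    ring

/-- A connected set that meets an open set and its complement meets its boundary. -/
lemma exists_mem_inter_frontier {X : Type*} [TopologicalSpace X] {S t : Set X} (hS : IsOpen S)
    (ht : IsPreconnected t) (h1 : (t ∩ S).Nonempty) (h2 : (t ∩ Sᶜ).Nonempty) :
    (t ∩ frontier S).Nonempty := by
  by_contra hne
  have hsub : t ⊆ S ∪ (closure S)ᶜ := by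
    intro z hz
    by_contra hz'
    simp only [mem_union, mem_compl_iff, not_or, not_not] at hz'
    exact hne ⟨z, hz, by rw [hS.frontier_eq]; exact ⟨hz'.2, hz'.1⟩⟩
  obtain ⟨z, hz, hzS⟩ := h2
  have hz2 : z ∈ (closure S)ᶜ := (hsub hz).resolve_left hzS
  obtain ⟨w, _, hw1, hw2⟩ := ht S (closure S)ᶜ hS isClosed_closure.isOpen_compl hsub h1 ⟨z, hz, hz2⟩
  exact hw2 (subset_closure hw1)

/-! ### Lipschitz charts and outer normals -/

/-- A Lipschitz chart of `S` on a ball: in the orthonormal frame `(a, b)` the set `S` is the strict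
epigraph of `γ`. -/
structure IsLipschitzChart (S : Set E2) (x : E2) (r : ℝ) (a b : E2) (K : ℝ≥0) (γ : ℝ → ℝ) :
    Prop where
  r_pos : 0 < r
  norm_a : ‖a‖ = 1
  norm_b : ‖b‖ = 1
  inner_ab : ⟪a, b⟫ = 0
  lip : LipschitzWith K γ
  mem_iff : ∀ z ∈ Metric.ball x r, (z ∈ S ↔ γ ⟪z, a⟫ < ⟪z, b⟫)

lemma IsBoundedLipschitzDomain.exists_chart {S : Set E2} (hS : IsBoundedLipschitzDomain S) {x : E2}
    (hx : x ∈ frontier S) : ∃ r a b K γ, IsLipschitzChart S x r a b K γ := by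
  obtain ⟨r, hr, e, K, γ, hγ, h⟩ := hS.boundary x hx
  -- by Mazur–Ulam the rigid motion is affine, so the chart may be written in the frame `(a, b)`
  -- given by the preimages of the coordinate directions under its linear part
  set ℓ := e.toRealAffineIsometryEquiv.linearIsometryEquiv with hℓ
  have he : ∀ z, e z = ℓ z + e 0 := by
    intro z
    have := e.toRealAffineIsometryEquiv.map_vadd 0 z
    simpa using this
  have hc : ∀ i z, (e z) i = ⟪z, ℓ.symm (EuclideanSpace.single i 1)⟫ + (e 0) i := by
    intro i z
    rw [he z]
    have : ⟪z, ℓ.symm (EuclideanSpace.single i 1)⟫ = ⟪ℓ z, EuclideanSpace.single i (1 : ℝ)⟫ := by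
      rw [← ℓ.inner_map_map]; simp
    rw [this]
    simp [EuclideanSpace.inner_single_right]
  refine ⟨r, ℓ.symm (EuclideanSpace.single 0 1), ℓ.symm (EuclideanSpace.single 1 1), K,
    fun t => γ (t + (e 0) 0) - (e 0) 1, hr, by simp, by simp, ?_, ?_, ?_⟩
  · rw [ℓ.symm.inner_map_map]; simp [EuclideanSpace.inner_single_left]
  · refine LipschitzWith.of_dist_le_mul fun s t => ?_
    have := hγ.dist_le_mul (s + (e 0) 0) (t + (e 0) 0)
    simpa [Real.dist_eq] using this
  · intro z hz
    rw [h z hz, hc 0 z, hc 1 z]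
    constructor <;> intro h <;> linarith

namespace IsLipschitzChart

variable {S : Set E2} {x : E2} {r : ℝ} {a b : E2} {K : ℝ≥0} {γ : ℝ → ℝ}

lemma mem_frontier_iff (h : IsLipschitzChart S x r a b K γ) (hS : IsOpen S) {z : E2}
    (hz : z ∈ Metric.ball x r) : z ∈ frontier S ↔ ⟪z, b⟫ = γ ⟪z, a⟫ := by
  have hcont : Continuous fun z : E2 => ⟪z, b⟫ - γ ⟪z, a⟫ := by
    have := h.lip.continuous
    fun_prop
  have hba : ⟪b, a⟫ = (0 : ℝ) := by rw [real_inner_comm]; exact h.inner_ab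
  rw [hS.frontier_eq]
  constructor
  · rintro ⟨h1, h2⟩
    rw [h.mem_iff z hz, not_lt] at h2
    refine le_antisymm h2 ?_
    by_contra hlt
    rw [not_le] at hlt
    have hev : ∀ᶠ w in 𝓝 z, ⟪w, b⟫ - γ ⟪w, a⟫ < 0 :=
      hcont.continuousAt.eventually_lt_const (by linarith)
    rw [mem_closure_iff_frequently] at h1
    obtain ⟨w, hw1, hw2, hw3⟩ :=
      (h1.and_eventually (hev.and (Metric.isOpen_ball.mem_nhds hz))).exists
    have := (h.mem_iff w hw3).1 hw1
    linarith
  · intro heq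
    refine ⟨?_, fun hzS => ?_⟩
    · rw [Metric.mem_closure_iff]
      intro ε hε
      set d := r - dist z x with hd
      have hdp : 0 < d := by have := Metric.mem_ball.1 hz; linarith
      have hm : 0 < min ε d / 2 := by positivity
      refine ⟨z + (min ε d / 2) • b, ?_, ?_⟩
      · rw [h.mem_iff]
        · simp only [inner_add_left, inner_smul_left, hba, real_inner_self_eq_norm_sq, h.norm_b]
          simp; rw [← heq]; linarith
        · rw [Metric.mem_ball]
          calc dist (z + (min ε d / 2) • b) x ≤ dist (z + (min ε d / 2) • b) z + dist z x :=
                dist_triangle _ _ _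
            _ < r := by
              rw [dist_eq_norm]
              simp only [add_sub_cancel_left, norm_smul, h.norm_b, Real.norm_eq_abs, abs_of_pos hm]
              have := min_le_right ε d
              linarith
      · rw [dist_eq_norm]
        simp only [sub_add_cancel_left, norm_neg, norm_smul, h.norm_b, Real.norm_eq_abs,
          abs_of_pos hm]
        have := min_le_left ε d
        linarith
    · rw [h.mem_iff z hz] at hzS
      linarith

/-- The graph map `t ↦ t a + γ(t) b` of a Lipschitz chart is Lipschitz. -/
lemma norm_graph_sub_le (h : IsLipschitzChart S x r a b K γ) (s t : ℝ) :
    ‖(s • a + γ s • b) - (t • a + γ t • b)‖ ≤ (1 + K) * |s - t| := by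
  have h1 : (s • a + γ s • b) - (t • a + γ t • b) = (s - t) • a + (γ s - γ t) • b := by
    module
  rw [h1]
  have h2 := h.lip.dist_le_mul s t
  rw [Real.dist_eq, Real.dist_eq] at h2
  calc _ ≤ ‖(s - t) • a‖ + ‖(γ s - γ t) • b‖ := norm_add_le _ _
    _ = |s - t| + |γ s - γ t| := by simp [norm_smul, h.norm_a, h.norm_b]
    _ ≤ _ := by linarith

lemma eq_graph (h : IsLipschitzChart S x r a b K γ) (hS : IsOpen S) {z : E2}
    (hz : z ∈ Metric.ball x r) (hf : z ∈ frontier S) :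
    z = ⟪z, a⟫ • a + γ ⟪z, a⟫ • b := by
  rw [← (h.mem_frontier_iff hS hz).1 hf]
  exact eq_frame_expansion h.norm_a h.norm_b h.inner_ab z

lemma inner_graph_left (h : IsLipschitzChart S x r a b K γ) (t : ℝ) :
    ⟪t • a + γ t • b, a⟫ = t := by
  have hba : ⟪b, a⟫ = (0 : ℝ) := by rw [real_inner_comm]; exact h.inner_ab
  simp [inner_add_left, inner_smul_left, hba, h.norm_a]

lemma inner_graph_right (h : IsLipschitzChart S x r a b K γ) (t : ℝ) :
    ⟪t • a + γ t • b, b⟫ = γ t := by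
  simp [inner_add_left, inner_smul_left, h.inner_ab, h.norm_b]

lemma graph_mem_frontier (h : IsLipschitzChart S x r a b K γ) (hS : IsOpen S) {t : ℝ}
    (ht : t • a + γ t • b ∈ Metric.ball x r) : t • a + γ t • b ∈ frontier S := by
  rw [h.mem_frontier_iff hS ht, h.inner_graph_left, h.inner_graph_right]

/-- If the boundary is tangent at `ξ` to the line orthogonal to `n`, then `n` is not orthogonal to
the vertical direction of the chart, quantitatively. -/
lemma slope_le (h : IsLipschitzChart S x r a b K γ) (hS : IsOpen S) {ξ n : E2}
    (hξ : ξ ∈ Metric.ball x r) (hf : ξ ∈ frontier S)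
    (hflat : ∀ η > (0 : ℝ), ∀ᶠ z in 𝓝 ξ, z ∈ frontier S → |⟪z - ξ, n⟫| ≤ η * ‖z - ξ‖) :
    |⟪n, a⟫| ≤ K * |⟪n, b⟫| := by
  set t₀ : ℝ := ⟪ξ, a⟫ with ht₀
  have hξ' : ξ = t₀ • a + γ t₀ • b := h.eq_graph hS hξ hf
  have hcont : Continuous fun t : ℝ => t • a + γ t • b := by
    have := h.lip.continuous
    fun_prop
  -- test the tangency with nearby points of the graph and divide by the increment of `t`
  have key : ∀ η > (0 : ℝ), |⟪n, a⟫| ≤ K * |⟪n, b⟫| + η * (1 + K) := by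
    intro η hη
    have hev : ∀ᶠ z in 𝓝 ξ, z ∈ Metric.ball x r ∧
        (z ∈ frontier S → |⟪z - ξ, n⟫| ≤ η * ‖z - ξ‖) :=
      Filter.Eventually.and (Metric.isOpen_ball.mem_nhds hξ) (hflat η hη)
    have hto : Tendsto (fun t : ℝ => t • a + γ t • b) (𝓝 t₀) (𝓝 ξ) := by
      have := hcont.tendsto t₀
      rwa [← hξ'] at this
    have hev2 := hto.eventually hev
    obtain ⟨ε, hε, hb⟩ := Metric.eventually_nhds_iff.1 hev2
    have hm := hb (y := t₀ + ε / 2) (by simp [abs_of_pos hε, hε])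
    have h1 := hm.2 (h.graph_mem_frontier hS hm.1)
    set t := t₀ + ε / 2 with ht
    have htt : t - t₀ = ε / 2 := by rw [ht]; ring
    have h2 := h.norm_graph_sub_le t t₀
    rw [← hξ'] at h2
    have h3 : ⟪(t • a + γ t • b) - ξ, n⟫ = (t - t₀) * ⟪n, a⟫ + (γ t - γ t₀) * ⟪n, b⟫ := by
      conv_lhs => rw [hξ']
      rw [real_inner_comm]
      simp only [inner_sub_right, inner_add_right, inner_smul_right]
      ring
    have h4 := h.lip.dist_le_mul t t₀
    rw [Real.dist_eq, Real.dist_eq] at h4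
    have h5 : |(t - t₀) * ⟪n, a⟫| ≤ η * ((1 + K) * |t - t₀|) + K * |t - t₀| * |⟪n, b⟫| := by
      have e1 : (t - t₀) * ⟪n, a⟫ = ⟪(t • a + γ t • b) - ξ, n⟫ - (γ t - γ t₀) * ⟪n, b⟫ := by
        rw [h3]; ring
      rw [e1]
      calc _ ≤ |⟪(t • a + γ t • b) - ξ, n⟫| + |(γ t - γ t₀) * ⟪n, b⟫| := abs_sub _ _
        _ ≤ η * ‖(t • a + γ t • b) - ξ‖ + |γ t - γ t₀| * |⟪n, b⟫| := by
          rw [abs_mul]; gcongr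
        _ ≤ _ := by gcongr
    rw [abs_mul] at h5
    have hp : 0 < |t - t₀| := by rw [htt]; positivity
    have h6 : |t - t₀| * |⟪n, a⟫| ≤ |t - t₀| * (K * |⟪n, b⟫| + η * (1 + K)) := by
      calc _ ≤ _ := h5
        _ = _ := by ring
    exact le_of_mul_le_mul_left h6 hp
  refine le_of_forall_pos_le_add fun ε hε => ?_
  have hK : (0 : ℝ) < 1 + K := by positivity
  have := key (ε / (1 + K)) (by positivity)
  rwa [div_mul_cancel₀ _ hK.ne'] at this

/-- A unit vector normal to the boundary at `ξ` and pointing downwards in the chart is the outer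
unit normal: the cones around `±n` are connected and miss the boundary. -/
lemma isOuterUnitNormal (h : IsLipschitzChart S x r a b K γ) (hS : IsOpen S) {ξ n : E2}
    (hξ : ξ ∈ Metric.ball x r) (hf : ξ ∈ frontier S) (hn : ‖n‖ = 1)
    (hflat : ∀ η > (0 : ℝ), ∀ᶠ z in 𝓝 ξ, z ∈ frontier S → |⟪z - ξ, n⟫| ≤ η * ‖z - ξ‖)
    (hnb : ⟪n, b⟫ < 0) : IsOuterUnitNormal S ξ n := by
  refine ⟨hn, fun ε hε => ?_⟩
  have hba : ⟪b, a⟫ = (0 : ℝ) := by rw [real_inner_comm]; exact h.inner_ab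
  set ε' := min ε (-⟪n, b⟫ / 2) with hε'
  have hε'p : 0 < ε' := lt_min hε (by linarith)
  have hle1 : ε' ≤ ε := min_le_left _ _
  have hle2 : ε' ≤ -⟪n, b⟫ / 2 := min_le_right _ _
  have hev : ∀ᶠ z in 𝓝 ξ, z ∈ Metric.ball x r ∧
      (z ∈ frontier S → |⟪z - ξ, n⟫| ≤ ε' / 2 * ‖z - ξ‖) :=
    Filter.Eventually.and (Metric.isOpen_ball.mem_nhds hξ) (hflat (ε' / 2) (by positivity))
  obtain ⟨ρ, hρ, hb⟩ := Metric.eventually_nhds_iff_ball.1 hev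
  have hsub : ∀ z ∈ Metric.ball ξ ρ, z ∈ Metric.ball x r := fun z hz => (hb z hz).1
  -- for `c = 1` and `c = -1` the two open cones at `ξ`; they are convex and, by the choice of `ρ`,
  -- contain no boundary points, so each of them lies in `S` or in its complement
  have hcone : ∀ c : ℝ, c = 1 ∨ c = -1 →
      IsPreconnected {z | z ∈ Metric.ball ξ ρ ∧ c * ⟪z - ξ, n⟫ + ε' * ‖z - ξ‖ < 0} := by
    intro c _
    apply Convex.isPreconnected
    have h1 : ConvexOn ℝ (Metric.ball ξ ρ) fun z => c * ⟪z - ξ, n⟫ + ε' * ‖z - ξ‖ := by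
      refine ⟨convex_ball _ _, ?_⟩
      intro z _ w _ s t hs ht hst
      have e : s • z + t • w - ξ = s • (z - ξ) + t • (w - ξ) := by
        rw [smul_sub, smul_sub]
        have : ξ = s • ξ + t • ξ := by rw [← add_smul, hst, one_smul]
        nth_rewrite 1 [this]; abel
      simp only [e, inner_add_left, inner_smul_left, smul_eq_mul]
      have := norm_add_le (s • (z - ξ)) (t • (w - ξ))
      rw [norm_smul, norm_smul, Real.norm_of_nonneg hs, Real.norm_of_nonneg ht] at this
      have := mul_le_mul_of_nonneg_left this hε'p.le
      simp
      nlinarith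
    exact h1.convex_lt 0
  have hmiss : ∀ c : ℝ, c = 1 ∨ c = -1 →
      ¬ ({z | z ∈ Metric.ball ξ ρ ∧ c * ⟪z - ξ, n⟫ + ε' * ‖z - ξ‖ < 0} ∩ frontier S).Nonempty := by
    rintro c hc ⟨z, ⟨hz1, hz2⟩, hz3⟩
    have h1 := (hb z hz1).2 hz3
    have h2 : -|⟪z - ξ, n⟫| ≤ c * ⟪z - ξ, n⟫ := by
      rcases hc with rfl | rfl
      · simpa using neg_abs_le _
      · simpa using le_abs_self (⟪z - ξ, n⟫ : ℝ)
    have := norm_nonneg (z - ξ)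
    nlinarith
  -- points straight above and below `ξ`
  have hpt : ∀ c : ℝ, c = 1 ∨ c = -1 →
      ξ + (c * (ρ / 2)) • b ∈ {z | z ∈ Metric.ball ξ ρ ∧ c * ⟪z - ξ, n⟫ + ε' * ‖z - ξ‖ < 0} := by
    intro c hc
    have habs : |c| = 1 := by rcases hc with rfl | rfl <;> simp
    have hcc : c * c = 1 := by rcases hc with rfl | rfl <;> simp
    refine ⟨?_, ?_⟩
    · rw [Metric.mem_ball, dist_eq_norm, add_sub_cancel_left, norm_smul, h.norm_b]
      simp [habs, abs_of_pos hρ, hρ]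
    · rw [add_sub_cancel_left, norm_smul, h.norm_b, inner_smul_left, real_inner_comm]
      simp only [Real.norm_eq_abs, abs_mul, habs, abs_of_pos (half_pos hρ)]
      have : c * ((starRingEnd ℝ) (c * (ρ / 2)) * ⟪n, b⟫) = (c * c) * (ρ / 2 * ⟪n, b⟫) := by
        simp; ring
      rw [this, hcc]
      nlinarith
  have hξf := (h.mem_frontier_iff hS hξ).1 hf
  have hSpt : ∀ c : ℝ, c = 1 ∨ c = -1 → (ξ + (c * (ρ / 2)) • b ∈ S ↔ 0 < c) := by
    intro c hc
    rw [h.mem_iff _ (hsub _ (hpt c hc).1)]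
    simp only [inner_add_left, inner_smul_left, hba, real_inner_self_eq_norm_sq, h.norm_b]
    simp only [mul_zero, add_zero, ← hξf]
    rcases hc with rfl | rfl
    · simp [hρ]
    · constructor <;> intro <;> simp at * <;> linarith
  rw [Metric.eventually_nhds_iff_ball]
  refine ⟨ρ, hρ, fun z hz => ⟨fun hlt => ?_, fun hlt hzS => ?_⟩⟩
  · by_contra hzS
    refine hmiss 1 (Or.inl rfl) (exists_mem_inter_frontier hS (hcone 1 (Or.inl rfl))
      ⟨_, hpt 1 (Or.inl rfl), (hSpt 1 (Or.inl rfl)).2 one_pos⟩ ⟨z, ⟨hz, ?_⟩, hzS⟩)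
    have := mul_le_mul_of_nonneg_right hle1 (norm_nonneg (z - ξ))
    linarith
  · refine hmiss (-1) (Or.inr rfl) (exists_mem_inter_frontier hS (hcone (-1) (Or.inr rfl))
      ⟨z, ⟨hz, ?_⟩, hzS⟩ ⟨_, hpt (-1) (Or.inr rfl), fun hmem => ?_⟩)
    · have := mul_le_mul_of_nonneg_right hle1 (norm_nonneg (z - ξ))
      linarith
    · have := (hSpt (-1) (Or.inr rfl)).1 hmem
      linarith

end IsLipschitzChart

lemma IsOuterUnitNormal.unique {S : Set E2} {ξ n n' : E2} (h : IsOuterUnitNormal S ξ n)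
    (h' : IsOuterUnitNormal S ξ n') : n = n' := by
  by_contra hne
  have hlt : ⟪n, n'⟫ < (1 : ℝ) := (inner_lt_one_iff_real_of_norm_eq_one h.1 h'.1).2 hne
  -- the direction `n' - n` lies in the inner cone of one normal and in the outer cone of the other
  set v := n' - n with hv
  have hvn : ⟪v, n⟫ = ⟪n, n'⟫ - 1 := by
    rw [hv, inner_sub_left, real_inner_self_eq_norm_sq, h.1, real_inner_comm]; norm_num
  have hvn' : ⟪v, n'⟫ = 1 - ⟪n, n'⟫ := by
    rw [hv, inner_sub_left, real_inner_self_eq_norm_sq, h'.1]; norm_num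
  have hvp : 0 < ‖v‖ := norm_pos_iff.2 (sub_ne_zero.2 (Ne.symm hne))
  set d := 1 - ⟪n, n'⟫ with hd
  have hdp : 0 < d := by linarith
  set ε := d / (2 * ‖v‖) with hε
  have hεp : 0 < ε := by positivity
  have hεv : ε * ‖v‖ = d / 2 := by rw [hε]; field_simp
  have hto : Tendsto (fun s : ℝ => ξ + s • v) (𝓝[>] 0) (𝓝 ξ) := by
    have : Tendsto (fun s : ℝ => ξ + s • v) (𝓝 0) (𝓝 (ξ + (0 : ℝ) • v)) :=
      Continuous.tendsto (by fun_prop) 0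
    simpa using this.mono_left nhdsWithin_le_nhds
  obtain ⟨s, ⟨h1, h2⟩, hs⟩ := (((hto.eventually (h.2 ε hεp)).and
    (hto.eventually (h'.2 ε hεp))).and self_mem_nhdsWithin).exists
  have hs : 0 < s := hs
  have hnorm : ‖ξ + s • v - ξ‖ = s * ‖v‖ := by
    rw [add_sub_cancel_left, norm_smul, Real.norm_of_nonneg hs.le]
  have hin : ∀ m : E2, ⟪ξ + s • v - ξ, m⟫ = s * ⟪v, m⟫ := by
    intro m; rw [add_sub_cancel_left, inner_smul_left]; simp
  refine h2.2 ?_ (h1.1 ?_)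
  · rw [hnorm, hin, hvn']; nlinarith
  · rw [hnorm, hin, hvn]; nlinarith

lemma IsOuterUnitNormal.outerNormal_eq {S : Set E2} {ξ n : E2} (h : IsOuterUnitNormal S ξ n) :
    outerNormal S ξ = n := by
  have hex : ∃ ν, IsOuterUnitNormal S ξ ν := ⟨n, h⟩
  rw [outerNormal, dif_pos hex]
  exact hex.choose_spec.unique h

/-! ### Uniform smoothness of the boundary part -/

/-- A `C²` curve has, locally, a Lipschitz unit normal `N`, and it deviates from its tangent lines
only quadratically. -/
lemma IsC2Curve.exists_normal {M : Set E2} (hM : IsC2Curve M) {p : E2} (hp : p ∈ M) :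
    ∃ (N : E2 → E2) (L δ : ℝ), 0 < L ∧ 0 < δ ∧ ∀ z ∈ M ∩ Metric.ball p δ, ‖N z‖ = 1 ∧
      ∀ z' ∈ M ∩ Metric.ball p δ, ‖N z - N z'‖ ≤ L * ‖z - z'‖ ∧
        |⟪z' - z, N z⟫| ≤ L * ‖z' - z‖ ^ 2 := by
  obtain ⟨U, hU, hpU, g, hg, hg0, hMU⟩ := hM p hp
  have hgp : ContDiffAt ℝ 2 g p := hg.contDiffAt (hU.mem_nhds hpU)
  have hfd : ContDiffAt ℝ 1 (fderiv ℝ g) p := hgp.fderiv_right (by norm_num)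
  -- the normal is the normalized gradient `G` of the defining function
  set G : E2 → E2 := fun z => (InnerProductSpace.toDual ℝ E2).symm (fderiv ℝ g z) with hG
  have hGinner : ∀ z v, ⟪G z, v⟫ = fderiv ℝ g z v := fun z v =>
    InnerProductSpace.toDual_symm_apply
  have hGd : ContDiffAt ℝ 1 G p :=
    (InnerProductSpace.toDual ℝ E2).symm.contDiff.contDiffAt.comp p hfd
  have hGp : G p ≠ 0 := by
    simpa [hG] using hg0 p hpU
  have hNd : ContDiffAt ℝ 1 (fun z => ‖G z‖⁻¹ • G z) p :=
    ((hGd.norm ℝ hGp).inv (norm_ne_zero_iff.2 hGp)).smul hGd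
  obtain ⟨K₁, t₁, ht₁, hK₁⟩ := hfd.exists_lipschitzOnWith
  obtain ⟨K₂, t₂, ht₂, hK₂⟩ := hNd.exists_lipschitzOnWith
  have hm : ∀ᶠ z in 𝓝 p, ‖G p‖ / 2 < ‖G z‖ :=
    hGd.continuousAt.norm.eventually_const_lt (by have := norm_pos_iff.2 hGp; linarith)
  have hall : ∀ᶠ z in 𝓝 p, z ∈ U ∧ z ∈ t₁ ∧ z ∈ t₂ ∧ ‖G p‖ / 2 < ‖G z‖ :=
    (hU.eventually_mem hpU).and (Filter.Eventually.and ht₁ (Filter.Eventually.and ht₂ hm))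
  obtain ⟨δ, hδ, hb⟩ := Metric.eventually_nhds_iff_ball.1 hall
  have hpos : 0 < ‖G p‖ := norm_pos_iff.2 hGp
  refine ⟨fun z => ‖G z‖⁻¹ • G z, K₂ + K₁ / (‖G p‖ / 2) + 1, δ, by positivity, hδ, ?_⟩
  rintro z ⟨hzM, hz⟩
  have hz' := hb z hz
  have hGz : 0 < ‖G z‖ := by linarith [hz'.2.2.2]
  refine ⟨by simp [norm_smul, hGz.ne'], ?_⟩
  rintro w ⟨hwM, hw⟩
  have hw' := hb w hw
  constructor
  · have h1 := hK₂.dist_le_mul z hz'.2.2.1 w hw'.2.2.1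
    rw [dist_eq_norm, dist_eq_norm] at h1
    refine h1.trans ?_
    gcongr
    have : (0 : ℝ) ≤ K₁ / (‖G p‖ / 2) := by positivity
    linarith
  · have hgz : g z = 0 := by
      have : z ∈ M ∩ U := ⟨hzM, hz'.1⟩
      rw [hMU] at this; exact this.2
    have hgw : g w = 0 := by
      have : w ∈ M ∩ U := ⟨hwM, hw'.1⟩
      rw [hMU] at this; exact this.2
    have hseg : ∀ v ∈ segment ℝ z w, v ∈ Metric.ball p δ ∧ ‖v - z‖ ≤ ‖w - z‖ := by
      intro v hv
      exact ⟨(convex_ball p δ).segment_subset hz hw hv, norm_sub_le_of_mem_segment hv⟩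
    -- Taylor's formula for `g`, which vanishes at both points
    have htay := (convex_segment z w).norm_image_sub_le_of_norm_fderiv_le' (𝕜 := ℝ) (f := g)
      (φ := fderiv ℝ g z) (C := K₁ * ‖w - z‖)
      (fun v hv => (hg.contDiffAt (hU.mem_nhds (hb v (hseg v hv).1).1)).differentiableAt
        (by norm_num))
      (fun v hv => by
        have h1 := hK₁.dist_le_mul v (hb v (hseg v hv).1).2.1 z hz'.2.1
        rw [dist_eq_norm, dist_eq_norm] at h1
        exact h1.trans (by have := (hseg v hv).2; gcongr))
      (left_mem_segment ℝ z w) (right_mem_segment ℝ z w)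
    rw [hgz, hgw, ← hGinner] at htay
    simp only [sub_zero, zero_sub, norm_neg, Real.norm_eq_abs] at htay
    rw [inner_smul_right, abs_mul, abs_of_pos (inv_pos.2 hGz), real_inner_comm]
    have h2 : ‖G z‖⁻¹ ≤ (‖G p‖ / 2)⁻¹ := by
      gcongr
      exact hz'.2.2.2.le
    calc ‖G z‖⁻¹ * |⟪G z, w - z⟫| ≤ (‖G p‖ / 2)⁻¹ * (K₁ * ‖w - z‖ * ‖w - z‖) := by gcongr
      _ = K₁ / (‖G p‖ / 2) * ‖w - z‖ ^ 2 := by ring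
      _ ≤ _ := by
        gcongr
        have : (0 : ℝ) ≤ K₂ := K₂.2
        linarith

/-- The outer normal exists on `Γ`, and at distances below `δ` it is Lipschitz and `Γ` deviates
from its tangent lines only quadratically. The measure theory of the boundary strips depends on
`S` and `Γ` only through these bounds. -/
structure HasSmoothNormal (S Γ : Set E2) (L δ : ℝ) : Prop where
  L_pos : 0 < L
  δ_pos : 0 < δ
  isNormal : ∀ ξ ∈ Γ, IsOuterUnitNormal S ξ (outerNormal S ξ)
  lip : ∀ ξ ∈ Γ, ∀ ξ' ∈ Γ, ‖ξ' - ξ‖ < δ →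
    ‖outerNormal S ξ' - outerNormal S ξ‖ ≤ L * ‖ξ' - ξ‖
  flat : ∀ ξ ∈ Γ, ∀ ξ' ∈ Γ, ‖ξ' - ξ‖ < δ →
    |⟪ξ' - ξ, outerNormal S ξ⟫| ≤ L * ‖ξ' - ξ‖ ^ 2

lemma IsRegularBoundaryPart.subset_frontier {S Γ : Set E2} (hΓ : IsRegularBoundaryPart S Γ) :
    Γ ⊆ frontier S := by
  obtain ⟨O, _, rfl⟩ := hΓ.relOpen
  exact inter_subset_right

lemma IsRegularBoundaryPart.closure_subset_frontier {S Γ : Set E2}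
    (hΓ : IsRegularBoundaryPart S Γ) : closure Γ ⊆ frontier S :=
  closure_minimal hΓ.subset_frontier isClosed_frontier

/-- Near a point of `closure Γ` the outer normal is, up to a constant sign, the normal of the `C²`
curve. The Lipschitz chart bounds the vertical component of this normal away from zero, which
excludes a change of sign. -/
lemma exists_local_smooth_normal {S Γ : Set E2} (hS : IsBoundedLipschitzDomain S)
    (hΓ : IsRegularBoundaryPart S Γ) {p : E2} (hp : p ∈ closure Γ) :
    ∃ L δ : ℝ, 0 < L ∧ 0 < δ ∧ ∀ ξ ∈ Γ ∩ Metric.ball p δ,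
      IsOuterUnitNormal S ξ (outerNormal S ξ) ∧ ∀ ξ' ∈ Γ ∩ Metric.ball p δ,
        ‖outerNormal S ξ' - outerNormal S ξ‖ ≤ L * ‖ξ' - ξ‖ ∧
        |⟪ξ' - ξ, outerNormal S ξ⟫| ≤ L * ‖ξ' - ξ‖ ^ 2 := by
  obtain ⟨r, a, b, K, γ, hch⟩ := hS.exists_chart (hΓ.closure_subset_frontier hp)
  obtain ⟨M, hM, hΓM⟩ := hΓ.closure_subset
  obtain ⟨N, L, δ₀, hL, hδ₀, hN⟩ := hM.exists_normal (hΓM hp)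
  obtain ⟨O, hO, hΓO⟩ := hΓ.relOpen
  set m : ℝ := 1 / (1 + K) with hm
  have hmpos : 0 < m := by positivity
  set δ := min (min r δ₀) (m / (2 * L)) with hδ
  have hδpos : 0 < δ := lt_min (lt_min hch.r_pos hδ₀) (by positivity)
  have hmemM : ∀ ξ ∈ Γ ∩ Metric.ball p δ, ξ ∈ M ∩ Metric.ball p δ₀ := fun ξ hξ =>
    ⟨hΓM (subset_closure hξ.1), Metric.ball_subset_ball
      ((min_le_left _ _).trans (min_le_right _ _)) hξ.2⟩
  have hmemr : ∀ ξ ∈ Γ ∩ Metric.ball p δ, ξ ∈ Metric.ball p r := fun ξ hξ =>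
    Metric.ball_subset_ball ((min_le_left _ _).trans (min_le_left _ _)) hξ.2
  have hflat : ∀ ξ ∈ Γ ∩ Metric.ball p δ, ∀ η > (0 : ℝ), ∀ᶠ z in 𝓝 ξ, z ∈ frontier S →
      |⟪z - ξ, N ξ⟫| ≤ η * ‖z - ξ‖ := by
    intro ξ hξ η hη
    have hξO : ξ ∈ O := by have := hξ.1; rw [hΓO] at this; exact this.1
    filter_upwards [hO.mem_nhds hξO, Metric.isOpen_ball.mem_nhds hξ.2,
      Metric.ball_mem_nhds ξ (show 0 < η / L by positivity)] with z h1 h2 h3 hz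
    have hzΓ : z ∈ Γ := by rw [hΓO]; exact ⟨h1, hz⟩
    have h4 := ((hN ξ (hmemM ξ hξ)).2 z (hmemM z ⟨hzΓ, h2⟩)).2
    rw [Metric.mem_ball, dist_eq_norm, lt_div_iff₀ hL] at h3
    calc _ ≤ _ := h4
      _ = (‖z - ξ‖ * L) * ‖z - ξ‖ := by ring
      _ ≤ _ := by gcongr
  -- the vertical component of the normal is bounded below by the Lipschitz constant of the chart
  have hslope : ∀ ξ ∈ Γ ∩ Metric.ball p δ, m ≤ |⟪N ξ, b⟫| := by
    intro ξ hξ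
    have h1 := hch.slope_le hS.isOpen (hmemr ξ hξ) (hΓ.subset_frontier hξ.1) (hflat ξ hξ)
    have h2 := norm_sq_frame hch.norm_a hch.norm_b hch.inner_ab (N ξ)
    rw [(hN ξ (hmemM ξ hξ)).1] at h2
    rw [hm, div_le_iff₀ (by positivity)]
    have hK : (0 : ℝ) ≤ K := K.2
    have h3 : (1 : ℝ) ≤ |⟪N ξ, a⟫| + |⟪N ξ, b⟫| := by
      have := abs_nonneg (⟪N ξ, a⟫ : ℝ)
      have := abs_nonneg (⟪N ξ, b⟫ : ℝ)
      have := sq_abs (⟪N ξ, a⟫ : ℝ)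
      have := sq_abs (⟪N ξ, b⟫ : ℝ)
      nlinarith
    linarith
  -- the downward choice of sign gives the outer normal
  have hnormal : ∀ ξ ∈ Γ ∩ Metric.ball p δ, ∀ c : ℝ, (c = 1 ∨ c = -1) → c * ⟪N ξ, b⟫ < 0 →
      IsOuterUnitNormal S ξ (c • N ξ) := by
    intro ξ hξ c hc hneg
    have habs : |c| = 1 := by rcases hc with rfl | rfl <;> simp
    refine hch.isOuterUnitNormal hS.isOpen (hmemr ξ hξ) (hΓ.subset_frontier hξ.1) ?_ ?_ ?_
    · rw [norm_smul, (hN ξ (hmemM ξ hξ)).1, Real.norm_eq_abs, habs, one_mul]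
    · intro η hη
      filter_upwards [hflat ξ hξ η hη] with z hz hzf
      rw [inner_smul_right, abs_mul, habs, one_mul]
      exact hz hzf
    · rw [inner_smul_left]; simpa using hneg
  have hsign : ∀ ξ ∈ Γ ∩ Metric.ball p δ, ∃ c : ℝ, (c = 1 ∨ c = -1) ∧ c * ⟪N ξ, b⟫ < 0 := by
    intro ξ hξ
    have h1 := hslope ξ hξ
    rcases lt_or_ge (⟪N ξ, b⟫ : ℝ) 0 with h | h
    · exact ⟨1, Or.inl rfl, by linarith⟩
    · refine ⟨-1, Or.inr rfl, ?_⟩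
      rw [abs_of_nonneg h] at h1
      linarith
  refine ⟨L, δ, hL, hδpos, fun ξ hξ => ?_⟩
  obtain ⟨c, hc, hneg⟩ := hsign ξ hξ
  have hnξ := hnormal ξ hξ c hc hneg
  rw [hnξ.outerNormal_eq]
  refine ⟨hnξ, fun ξ' hξ' => ?_⟩
  have habs : |c| = 1 := by rcases hc with rfl | rfl <;> simp
  have hN2 := (hN ξ (hmemM ξ hξ)).2 ξ' (hmemM ξ' hξ')
  have hdist : ‖ξ' - ξ‖ < m / L := by
    have h1 := Metric.mem_ball.1 hξ.2
    have h2 := Metric.mem_ball.1 hξ'.2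
    have h3 : δ ≤ m / (2 * L) := min_le_right _ _
    have h4 : m / L = m / (2 * L) + m / (2 * L) := by field_simp; norm_num
    rw [← dist_eq_norm]
    calc dist ξ' ξ ≤ dist ξ' p + dist ξ p := dist_triangle_right _ _ _
      _ < _ := by linarith
  -- the normal cannot change its sign within the ball
  have hneg' : c * ⟪N ξ', b⟫ < 0 := by
    by_contra hcon
    rw [not_lt] at hcon
    have h1 : |⟪N ξ, b⟫ - ⟪N ξ', b⟫| < m := by
      rw [← inner_sub_left]
      calc _ ≤ ‖N ξ - N ξ'‖ * ‖b‖ := abs_real_inner_le_norm _ _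
        _ ≤ L * ‖ξ - ξ'‖ := by rw [hch.norm_b, mul_one]; exact hN2.1
        _ < m := by
          rw [norm_sub_rev, mul_comm]
          rwa [lt_div_iff₀ hL] at hdist
    have h2 := hslope ξ hξ
    have h3 : |c * ⟪N ξ, b⟫ - c * ⟪N ξ', b⟫| < m := by
      rw [← mul_sub, abs_mul, habs, one_mul]; exact h1
    have h4 : |c * ⟪N ξ, b⟫| = |⟪N ξ, b⟫| := by rw [abs_mul, habs, one_mul]
    rw [abs_of_neg hneg] at h4
    have := (abs_lt.1 h3).1
    linarith
  rw [(hnormal ξ' hξ' c hc hneg').outerNormal_eq]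
  constructor
  · rw [← smul_sub, norm_smul, Real.norm_eq_abs, habs, one_mul, norm_sub_rev, norm_sub_rev ξ']
    exact hN2.1
  · rw [inner_smul_right, abs_mul, habs, one_mul]
    exact hN2.2

lemma IsRegularBoundaryPart.isCompact_closure {S Γ : Set E2} (hS : IsBoundedLipschitzDomain S)
    (hΓ : IsRegularBoundaryPart S Γ) : IsCompact (closure Γ) := by
  refine Metric.isCompact_of_isClosed_isBounded isClosed_closure ?_
  exact hS.isBounded.closure.subset (hΓ.closure_subset_frontier.trans frontier_subset_closure)

/-- The local bounds on the normal hold uniformly, by compactness of `closure Γ`. -/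
theorem exists_hasSmoothNormal {S Γ : Set E2} (hS : IsBoundedLipschitzDomain S)
    (hΓ : IsRegularBoundaryPart S Γ) : ∃ L δ : ℝ, HasSmoothNormal S Γ L δ := by
  have key : ∃ L δ : ℝ, 0 < L ∧ 0 < δ ∧ ∀ ξ ∈ Γ ∩ closure Γ,
      IsOuterUnitNormal S ξ (outerNormal S ξ) ∧ ∀ ξ' ∈ Γ, ‖ξ' - ξ‖ < δ →
        ‖outerNormal S ξ' - outerNormal S ξ‖ ≤ L * ‖ξ' - ξ‖ ∧
        |⟪ξ' - ξ, outerNormal S ξ⟫| ≤ L * ‖ξ' - ξ‖ ^ 2 := by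
    refine (hΓ.isCompact_closure hS).induction_on (p := fun s => ∃ L δ : ℝ, 0 < L ∧ 0 < δ ∧
      ∀ ξ ∈ Γ ∩ s, IsOuterUnitNormal S ξ (outerNormal S ξ) ∧ ∀ ξ' ∈ Γ, ‖ξ' - ξ‖ < δ →
        ‖outerNormal S ξ' - outerNormal S ξ‖ ≤ L * ‖ξ' - ξ‖ ∧
        |⟪ξ' - ξ, outerNormal S ξ⟫| ≤ L * ‖ξ' - ξ‖ ^ 2) ?_ ?_ ?_ ?_
    · exact ⟨1, 1, one_pos, one_pos, by simp⟩
    · rintro s t hst ⟨L, δ, hL, hδ, h⟩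
      exact ⟨L, δ, hL, hδ, fun ξ hξ => h ξ ⟨hξ.1, hst hξ.2⟩⟩
    · rintro s t ⟨L, δ, hL, hδ, h⟩ ⟨L', δ', hL', hδ', h'⟩
      refine ⟨max L L', min δ δ', lt_max_of_lt_left hL, lt_min hδ hδ', ?_⟩
      rintro ξ ⟨hξ, hξs | hξt⟩
      · refine ⟨(h ξ ⟨hξ, hξs⟩).1, fun ξ' hξ' hlt => ?_⟩
        have := (h ξ ⟨hξ, hξs⟩).2 ξ' hξ' (hlt.trans_le (min_le_left _ _))
        exact ⟨this.1.trans (by gcongr; exact le_max_left _ _),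
          this.2.trans (by gcongr; exact le_max_left _ _)⟩
      · refine ⟨(h' ξ ⟨hξ, hξt⟩).1, fun ξ' hξ' hlt => ?_⟩
        have := (h' ξ ⟨hξ, hξt⟩).2 ξ' hξ' (hlt.trans_le (min_le_right _ _))
        exact ⟨this.1.trans (by gcongr; exact le_max_right _ _),
          this.2.trans (by gcongr; exact le_max_right _ _)⟩
    · intro p hp
      obtain ⟨L, δ, hL, hδ, h⟩ := exists_local_smooth_normal hS hΓ hp
      refine ⟨Metric.ball p (δ / 2), mem_nhdsWithin_of_mem_nhds
        (Metric.ball_mem_nhds _ (by positivity)), L, δ / 2, hL, by positivity, ?_⟩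
      rintro ξ ⟨hξ, hξb⟩
      have hξδ : ξ ∈ Γ ∩ Metric.ball p δ :=
        ⟨hξ, Metric.ball_subset_ball (by linarith) hξb⟩
      refine ⟨(h ξ hξδ).1, fun ξ' hξ' hlt => (h ξ hξδ).2 ξ' ⟨hξ', ?_⟩⟩
      rw [Metric.mem_ball] at hξb ⊢
      rw [← dist_eq_norm] at hlt
      linarith [dist_triangle ξ' ξ p]
  obtain ⟨L, δ, hL, hδ, h⟩ := key
  exact ⟨L, δ, hL, hδ, fun ξ hξ => (h ξ ⟨hξ, subset_closure hξ⟩).1,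
    fun ξ hξ ξ' hξ' hlt => ((h ξ ⟨hξ, subset_closure hξ⟩).2 ξ' hξ' hlt).1,
    fun ξ hξ ξ' hξ' hlt => ((h ξ ⟨hξ, subset_closure hξ⟩).2 ξ' hξ' hlt).2⟩

/-! ### Comparison of measures by distance estimates -/

/-- If `u` increases distances at most by the factor `c` compared with `v`, then the Hausdorff
measure of the image under `u` is controlled by that of the image under `v`. -/
lemma hausdorffMeasure_image_le_of_edist_le {X Y Z : Type*} [EMetricSpace Y] [MeasurableSpace Y]
    [BorelSpace Y] [EMetricSpace Z] [MeasurableSpace Z] [BorelSpace Z] (u : X → Y) (v : X → Z)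
    (E : Set X) (c : ℝ≥0) (h : ∀ x ∈ E, ∀ x' ∈ E, edist (u x) (u x') ≤ c * edist (v x) (v x'))
    {d : ℝ} (hd : 0 ≤ d) :
    (μH[d] : Measure Y) (u '' E) ≤ (c : ℝ≥0∞) ^ d * (μH[d] : Measure Z) (v '' E) := by
  rcases isEmpty_or_nonempty X with hX | hX
  · rw [Set.eq_empty_of_isEmpty E]; simp
  set f : Z → Y := u ∘ Function.invFunOn v E
  have hinv : ∀ x ∈ E, Function.invFunOn v E (v x) ∈ E ∧ v (Function.invFunOn v E (v x)) = v x :=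
    fun x hx => ⟨Function.invFunOn_mem ⟨x, hx, rfl⟩, Function.invFunOn_eq ⟨x, hx, rfl⟩⟩
  have hf : ∀ x ∈ E, f (v x) = u x := by
    intro x hx
    have h1 := h _ (hinv x hx).1 x hx
    rw [(hinv x hx).2, edist_self, mul_zero] at h1
    exact edist_le_zero.1 h1
  have himg : u '' E = f '' (v '' E) := by
    rw [image_image]
    exact image_congr fun x hx => (hf x hx).symm
  have hlip : LipschitzOnWith c f (v '' E) := by
    rintro _ ⟨x, hx, rfl⟩ _ ⟨x', hx', rfl⟩
    rw [hf x hx, hf x' hx']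
    exact h x hx x' hx'
  rw [himg]
  exact hlip.hausdorffMeasure_image_le hd

lemma volume_image_le_of_edist_le {X : Type*} (u v : X → E2) (E : Set X) (c : ℝ≥0)
    (h : ∀ x ∈ E, ∀ x' ∈ E, edist (u x) (u x') ≤ c * edist (v x) (v x')) :
    (volume : Measure E2) (u '' E) ≤ (c : ℝ≥0∞) ^ 2 * volume (v '' E) := by
  have hfin : ((Module.finrank ℝ E2 : ℕ) : ℝ) = 2 := by simp
  have : ((μH[2] : Measure E2)).IsAddHaarMeasure := by
    rw [← hfin]; exact isAddHaarMeasure_hausdorffMeasure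
  have h2 := Measure.isAddLeftInvariant_eq_smul (volume : Measure E2) (μH[2] : Measure E2)
  have h1 := hausdorffMeasure_image_le_of_edist_le u v E c h (d := 2) (by norm_num)
  rw [h2]
  simp only [Measure.smul_apply]
  have e : ((c : ℝ≥0∞) ^ 2) = (c : ℝ≥0∞) ^ (2 : ℝ) := by
    rw [← ENNReal.rpow_natCast]; norm_num
  rw [e]
  simp only [ENNReal.smul_def, smul_eq_mul]
  rw [mul_left_comm]
  gcongr

/-- Planar coordinates in an orthonormal frame preserve the measure. -/
lemma volume_image_frame {a b : E2} (ha : ‖a‖ = 1) (hb : ‖b‖ = 1) (hab : ⟪a, b⟫ = 0)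
    (A : Set (ℝ × ℝ)) :
    (volume : Measure E2) ((fun p : ℝ × ℝ => p.1 • a + p.2 • b) '' A) = volume A := by
  obtain ⟨B, rfl, rfl⟩ := exists_orthonormalBasis ha hb hab
  have h1 : MeasurePreserving (B.repr.toHomeomorph.toMeasurableEquiv.trans
      ((MeasurableEquiv.toLp 2 (Fin 2 → ℝ)).symm.trans MeasurableEquiv.finTwoArrow))
      volume volume :=
    (B.measurePreserving_repr).trans
      ((EuclideanSpace.volume_preserving_symm_measurableEquiv_toLp (Fin 2)).trans
        (volume_preserving_finTwoArrow ℝ))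
  rw [← h1.measure_preimage_equiv A]
  congr 1
  ext z
  have hz : (B.repr.toHomeomorph.toMeasurableEquiv.trans
      ((MeasurableEquiv.toLp 2 (Fin 2 → ℝ)).symm.trans MeasurableEquiv.finTwoArrow)) z =
      (⟪z, B 0⟫, ⟪z, B 1⟫) := by
    have hc : ∀ i, ⟪z, B i⟫ = B.repr z i := fun i => by rw [B.repr_apply_apply, real_inner_comm]
    rw [hc, hc]
    rfl
  rw [mem_preimage, hz, mem_image]
  constructor
  · rintro ⟨p, hp, rfl⟩
    have e0 : ⟪p.1 • B 0 + p.2 • B 1, B 0⟫ = p.1 := by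
      simp [inner_add_left, inner_smul_left, real_inner_comm (B 0) (B 1), hab]
    have e1 : ⟪p.1 • B 0 + p.2 • B 1, B 1⟫ = p.2 := by
      simp [inner_add_left, inner_smul_left, hab]
    rw [e0, e1]; exact hp
  · intro h
    exact ⟨_, h, (eq_frame_expansion ha hb hab z).symm⟩

/-! ### Measure of boundary strips -/

/-- The normal coordinates `(ξ, s) ↦ ξ - s ν_S(ξ)`; the normal is replaced by `0` off `Γ`, which
makes the map Borel. -/
noncomputable def stripMap (S Γ : Set E2) (x : E2 × ℝ) : E2 :=
  x.1 - x.2 • Γ.indicator (outerNormal S) x.1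

lemma stripMap_of_mem {S Γ : Set E2} {x : E2 × ℝ} (hx : x.1 ∈ Γ) :
    stripMap S Γ x = x.1 - x.2 • outerNormal S x.1 := by
  rw [stripMap, indicator_of_mem hx]

lemma strip_eq_image (S Γ : Set E2) (σ : ℝ) :
    strip S Γ σ = stripMap S Γ '' (Γ ×ˢ Ioo 0 σ) := by
  ext z
  constructor
  · rintro ⟨ξ, hξ, s, hs, rfl⟩
    exact ⟨(ξ, s), ⟨hξ, hs⟩, stripMap_of_mem hξ⟩
  · rintro ⟨⟨ξ, s⟩, ⟨hξ, hs⟩, rfl⟩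
    exact ⟨ξ, hξ, s, hs, stripMap_of_mem hξ⟩

lemma IsRegularBoundaryPart.measurableSet {S Γ : Set E2} (hΓ : IsRegularBoundaryPart S Γ) :
    MeasurableSet Γ := by
  obtain ⟨O, hO, rfl⟩ := hΓ.relOpen
  exact hO.measurableSet.inter isClosed_frontier.measurableSet

namespace HasSmoothNormal

variable {S Γ : Set E2} {L δ : ℝ}

lemma continuousOn_outerNormal (H : HasSmoothNormal S Γ L δ) : ContinuousOn (outerNormal S) Γ := by
  rw [Metric.continuousOn_iff]
  intro ξ hξ ε hε
  have hL := H.L_pos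
  refine ⟨min δ (ε / L), lt_min H.δ_pos (by positivity), fun ξ' hξ' hd => ?_⟩
  rw [dist_eq_norm] at hd ⊢
  have h1 := H.lip ξ hξ ξ' hξ' (hd.trans_le (min_le_left _ _))
  have h2 := hd.trans_le (min_le_right _ _)
  rw [lt_div_iff₀ hL] at h2
  linarith

lemma norm_outerNormal (H : HasSmoothNormal S Γ L δ) {ξ : E2} (hξ : ξ ∈ Γ) :
    ‖outerNormal S ξ‖ = 1 := (H.isNormal ξ hξ).1

lemma continuousOn_stripMap (H : HasSmoothNormal S Γ L δ) :
    ContinuousOn (stripMap S Γ) (Γ ×ˢ univ) := by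
  have h : ContinuousOn (fun x : E2 × ℝ => x.1 - x.2 • outerNormal S x.1) (Γ ×ˢ univ) := by
    have := H.continuousOn_outerNormal.comp (continuous_fst.continuousOn (s := Γ ×ˢ (univ : Set ℝ)))
      (fun x hx => hx.1)
    exact continuous_fst.continuousOn.sub (continuous_snd.continuousOn.smul this)
  exact h.congr fun x hx => stripMap_of_mem hx.1

lemma measurable_stripMap (H : HasSmoothNormal S Γ L δ) (hΓ : MeasurableSet Γ) :
    Measurable (stripMap S Γ) := by
  classical
  have h : Measurable (Γ.indicator (outerNormal S)) := by
    rw [← Set.piecewise_eq_indicator]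
    exact H.continuousOn_outerNormal.measurable_piecewise continuousOn_const hΓ
  exact measurable_fst.sub (measurable_snd.smul (h.comp measurable_fst))

/-- On a piece `D` of `Γ` of small diameter, and for small `s`, both the projection of `D` to its
tangent line and the normal coordinates are isometric up to a factor close to `1`. -/
lemma exists_almost_isometric (H : HasSmoothNormal S Γ L δ) {k : ℝ} (hk : 1 < k) :
    ∃ ρ > (0 : ℝ), ∀ D : Set E2, D ⊆ Γ → (∀ ξ ∈ D, ∀ ξ' ∈ D, ‖ξ' - ξ‖ < ρ) → D.Nonempty →
      ∃ t n : E2, ‖t‖ = 1 ∧ ‖n‖ = 1 ∧ ⟪t, n⟫ = 0 ∧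
        (∀ ξ ∈ D, ∀ ξ' ∈ D, ‖ξ' - ξ‖ ≤ k * |⟪ξ' - ξ, t⟫|) ∧
        ∀ x ∈ D ×ˢ Ioo 0 ρ, ∀ x' ∈ D ×ˢ Ioo 0 ρ,
          ‖stripMap S Γ x' - stripMap S Γ x‖ ≤
            k * ‖⟪x'.1 - x.1, t⟫ • t + (x'.2 - x.2) • n‖ ∧
          ‖⟪x'.1 - x.1, t⟫ • t + (x'.2 - x.2) • n‖ ≤
            k * ‖stripMap S Γ x' - stripMap S Γ x‖ := by
  have hL := H.L_pos
  -- `η` bounds the tilt of the normals within a piece; the distortion is at most `7 η`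
  set η : ℝ := (1 - 1 / k) / 7 with hη
  have hk0 : 0 < k := by linarith
  have hk1 : 1 / k < 1 := by rw [div_lt_one hk0]; exact hk
  have hk2 : 0 < 1 / k := by positivity
  have hηp : 0 < η := by rw [hη]; linarith
  have hη4 : η ≤ 1 / 4 := by rw [hη]; linarith
  have h7 : 1 - 7 * η = 1 / k := by rw [hη]; ring
  have hk3 : 1 + 7 * η ≤ k := by
    have : 1 / k * k = 1 := by field_simp
    nlinarith
  have hk4 : 1 = k * (1 - 7 * η) := by rw [h7]; field_simp
  refine ⟨min δ (η / L), lt_min H.δ_pos (by positivity), ?_⟩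
  rintro D hD hDρ ⟨ξ₀, hξ₀⟩
  set m := outerNormal S ξ₀ with hm
  have hm1 : ‖m‖ = 1 := H.norm_outerNormal (hD hξ₀)
  obtain ⟨t, ht1, htm⟩ := exists_unit_orthogonal hm1
  have hlt1 : ∀ ξ ∈ D, ∀ ξ' ∈ D, ‖ξ' - ξ‖ < δ := fun ξ hξ ξ' hξ' =>
    (hDρ ξ hξ ξ' hξ').trans_le (min_le_left _ _)
  have hlt2 : ∀ ξ ∈ D, ∀ ξ' ∈ D, L * ‖ξ' - ξ‖ ≤ η := by
    intro ξ hξ ξ' hξ'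
    have := (hDρ ξ hξ ξ' hξ').trans_le (min_le_right _ _)
    rw [lt_div_iff₀ hL] at this
    linarith
  have hnear : ∀ ξ ∈ D, ‖outerNormal S ξ - m‖ ≤ η := fun ξ hξ =>
    (H.lip ξ₀ (hD hξ₀) ξ (hD hξ) (hlt1 ξ₀ hξ₀ ξ hξ)).trans (hlt2 ξ₀ hξ₀ ξ hξ)
  have hflat : ∀ ξ ∈ D, ∀ ξ' ∈ D, |⟪ξ' - ξ, m⟫| ≤ 2 * η * ‖ξ' - ξ‖ := by
    intro ξ hξ ξ' hξ'
    have h1 := H.flat ξ (hD hξ) ξ' (hD hξ') (hlt1 ξ hξ ξ' hξ')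
    have h2 : |⟪ξ' - ξ, outerNormal S ξ - m⟫| ≤ ‖ξ' - ξ‖ * η :=
      (abs_real_inner_le_norm _ _).trans (by have := hnear ξ hξ; gcongr)
    have h3 := hlt2 ξ hξ ξ' hξ'
    have e : ⟪ξ' - ξ, m⟫ = ⟪ξ' - ξ, outerNormal S ξ⟫ - ⟪ξ' - ξ, outerNormal S ξ - m⟫ := by
      rw [inner_sub_right]; ring
    rw [e]
    calc _ ≤ _ := abs_sub _ _
      _ ≤ L * ‖ξ' - ξ‖ ^ 2 + ‖ξ' - ξ‖ * η := add_le_add h1 h2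
      _ = (L * ‖ξ' - ξ‖) * ‖ξ' - ξ‖ + ‖ξ' - ξ‖ * η := by ring
      _ ≤ η * ‖ξ' - ξ‖ + ‖ξ' - ξ‖ * η := by gcongr
      _ = _ := by ring
  have hproj : ∀ ξ ∈ D, ∀ ξ' ∈ D, (1 - 2 * η) * ‖ξ' - ξ‖ ≤ |⟪ξ' - ξ, t⟫| := by
    intro ξ hξ ξ' hξ'
    have h1 := hflat ξ hξ ξ' hξ'
    have h2 := eq_frame_expansion ht1 hm1 htm (ξ' - ξ)
    have h3 : ‖ξ' - ξ‖ ≤ |⟪ξ' - ξ, t⟫| + |⟪ξ' - ξ, m⟫| := by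
      conv_lhs => rw [h2]
      refine (norm_add_le _ _).trans ?_
      simp [norm_smul, ht1, hm1]
    linarith
  refine ⟨t, -m, ht1, by simpa using hm1, by simpa using htm, ?_, ?_⟩
  · intro ξ hξ ξ' hξ'
    have h1 := hproj ξ hξ ξ' hξ'
    have h2 := norm_nonneg (ξ' - ξ)
    have h3 : ‖ξ' - ξ‖ ≤ k * ((1 - 2 * η) * ‖ξ' - ξ‖) := by nlinarith
    exact h3.trans (by gcongr)
  · rintro ⟨ξ, s⟩ ⟨hξ, hs⟩ ⟨ξ', s'⟩ ⟨hξ', hs'⟩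
    simp only at hξ hs hξ' hs' ⊢
    rw [stripMap_of_mem (x := (ξ, s)) (hD hξ), stripMap_of_mem (x := (ξ', s')) (hD hξ')]
    simp only
    set q : E2 := ⟪ξ' - ξ, t⟫ • t + (s' - s) • -m with hq
    set Ψ : E2 := ξ' - s' • outerNormal S ξ' - (ξ - s • outerNormal S ξ) with hΨ
    have hqsq : ‖q‖ ^ 2 = ⟪ξ' - ξ, t⟫ ^ 2 + (s' - s) ^ 2 := by
      rw [norm_sq_frame ht1 hm1 htm q]
      have h1 : ⟪q, t⟫ = ⟪ξ' - ξ, t⟫ := by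
        rw [hq, inner_add_left, inner_smul_left, inner_smul_left, inner_neg_left,
          real_inner_comm t m, htm, real_inner_self_eq_norm_sq, ht1]
        simp
      have h2 : ⟪q, m⟫ = -(s' - s) := by
        rw [hq, inner_add_left, inner_smul_left, inner_smul_left, inner_neg_left, htm,
          real_inner_self_eq_norm_sq, hm1]
        simp
      rw [h1, h2]; ring
    have hq1 : |⟪ξ' - ξ, t⟫| ≤ ‖q‖ := abs_le_of_sq_le_sq (by nlinarith) (norm_nonneg q)
    have hq2 : |s' - s| ≤ ‖q‖ := abs_le_of_sq_le_sq (by nlinarith) (norm_nonneg q)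
    have hdist : ‖ξ' - ξ‖ ≤ 2 * ‖q‖ := by
      have := hproj ξ hξ ξ' hξ'
      have := norm_nonneg (ξ' - ξ)
      nlinarith
    have hsσ : s * L ≤ η := by
      have := hs.2.trans_le (min_le_right _ _)
      rw [lt_div_iff₀ hL] at this
      linarith
    have hdiff : ‖Ψ - q‖ ≤ 7 * η * ‖q‖ := by
      have e : Ψ - q = ⟪ξ' - ξ, m⟫ • m - (s' - s) • (outerNormal S ξ' - m)
          - s • (outerNormal S ξ' - outerNormal S ξ) := by
        have h2 := eq_frame_expansion ht1 hm1 htm (ξ' - ξ)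
        have h3 : ⟪ξ' - ξ, m⟫ • m = (ξ' - ξ) - ⟪ξ' - ξ, t⟫ • t := by
          nth_rewrite 2 [h2]; abel
        rw [h3, hΨ, hq]
        module
      rw [e]
      have b1 : ‖⟪ξ' - ξ, m⟫ • m‖ ≤ 4 * η * ‖q‖ := by
        rw [norm_smul, hm1, mul_one, Real.norm_eq_abs]
        have := hflat ξ hξ ξ' hξ'
        nlinarith
      have b2 : ‖(s' - s) • (outerNormal S ξ' - m)‖ ≤ η * ‖q‖ := by
        rw [norm_smul, Real.norm_eq_abs, mul_comm]
        have := hnear ξ' hξ'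
        gcongr
      have b3 : ‖s • (outerNormal S ξ' - outerNormal S ξ)‖ ≤ 2 * η * ‖q‖ := by
        rw [norm_smul, Real.norm_of_nonneg hs.1.le]
        have h1 := H.lip ξ (hD hξ) ξ' (hD hξ') (hlt1 ξ hξ ξ' hξ')
        calc _ ≤ s * (L * ‖ξ' - ξ‖) := by have := hs.1; gcongr
          _ = (s * L) * ‖ξ' - ξ‖ := by ring
          _ ≤ η * (2 * ‖q‖) := by gcongr
          _ = _ := by ring
      calc _ ≤ _ := norm_sub_le _ _
        _ ≤ (4 * η * ‖q‖ + η * ‖q‖) + 2 * η * ‖q‖ :=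
          add_le_add ((norm_sub_le _ _).trans (add_le_add b1 b2)) b3
        _ = _ := by ring
    have hqn := norm_nonneg q
    constructor
    · have h1 : ‖Ψ‖ ≤ ‖q‖ + ‖Ψ - q‖ := by
        calc ‖Ψ‖ = ‖q + (Ψ - q)‖ := by rw [add_sub_cancel]
          _ ≤ _ := norm_add_le _ _
      nlinarith
    · have h1 : ‖q‖ ≤ ‖Ψ‖ + ‖Ψ - q‖ := by
        calc ‖q‖ = ‖Ψ - (Ψ - q)‖ := by rw [sub_sub_cancel]
          _ ≤ _ := norm_sub_le _ _
      have h2 : (1 - 7 * η) * ‖q‖ ≤ ‖Ψ‖ := by linarith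
      calc ‖q‖ = k * ((1 - 7 * η) * ‖q‖) := by rw [← mul_assoc, ← hk4, one_mul]
        _ ≤ k * ‖Ψ‖ := by gcongr

end HasSmoothNormal

namespace HasSmoothNormal

variable {S Γ : Set E2} {L δ : ℝ}

/-- Over a piece `D` of `Γ` of small diameter, lengths in `D` and areas in the strip over `D` agree,
up to powers of `k`, with lengths and areas after projection to a tangent line. -/
lemma exists_length_comparison (H : HasSmoothNormal S Γ L δ) {k : ℝ} (hk : 1 < k) :
    ∃ ρ > (0 : ℝ), ∀ D : Set E2, D ⊆ Γ → (∀ ξ ∈ D, ∀ ξ' ∈ D, ‖ξ' - ξ‖ < ρ) → D.Nonempty →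
      ∃ t n : E2, ‖t‖ = 1 ∧ ‖n‖ = 1 ∧ ⟪t, n⟫ = 0 ∧ InjOn (fun ξ : E2 => ⟪ξ, t⟫) D ∧
        (∀ A ⊆ D, (volume : Measure ℝ) ((fun ξ : E2 => ⟪ξ, t⟫) '' A) ≤ μH[1] A ∧
          μH[1] A ≤ ENNReal.ofReal k * (volume : Measure ℝ) ((fun ξ : E2 => ⟪ξ, t⟫) '' A)) ∧
        InjOn (stripMap S Γ) (D ×ˢ Ioo 0 ρ) ∧
        ∀ E ⊆ D ×ˢ Ioo 0 ρ,
          volume (stripMap S Γ '' E) ≤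
            ENNReal.ofReal k ^ 2 * volume ((fun x : E2 × ℝ => (⟪x.1, t⟫, x.2)) '' E) ∧
          volume ((fun x : E2 × ℝ => (⟪x.1, t⟫, x.2)) '' E) ≤
            ENNReal.ofReal k ^ 2 * volume (stripMap S Γ '' E) := by
  have hk0 : 0 < k := by linarith
  obtain ⟨ρ, hρ, h⟩ := H.exists_almost_isometric hk
  refine ⟨ρ, hρ, fun D hD hDρ hDn => ?_⟩
  obtain ⟨t, n, ht, hn, htn, h1, h2⟩ := h D hD hDρ hDn
  have hkn : ENNReal.ofReal k = ((k.toNNReal : ℝ≥0) : ℝ≥0∞) := rfl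
  have hkc : ((k.toNNReal : ℝ≥0) : ℝ) = k := Real.coe_toNNReal k hk0.le
  have hP : ∀ ξ ξ' : E2, dist (⟪ξ, t⟫ : ℝ) ⟪ξ', t⟫ = |⟪ξ - ξ', t⟫| := by
    intro ξ ξ'; rw [Real.dist_eq, inner_sub_left]
  -- the normal coordinates with `D` replaced by its tangent line
  set Q : E2 × ℝ → E2 := fun x => ⟪x.1, t⟫ • t + x.2 • n with hQ
  have hQd : ∀ x x' : E2 × ℝ, Q x - Q x' = ⟪x.1 - x'.1, t⟫ • t + (x.2 - x'.2) • n := by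
    intro x x'; rw [hQ, inner_sub_left]; module
  have hQimg : ∀ E : Set (E2 × ℝ),
      volume (Q '' E) = volume ((fun x : E2 × ℝ => (⟪x.1, t⟫, x.2)) '' E) := by
    intro E
    rw [← volume_image_frame ht hn htn, image_image]
  refine ⟨t, n, ht, hn, htn, ?_, ?_, ?_, ?_⟩
  · intro ξ hξ ξ' hξ' heq
    have h3 := h1 ξ' hξ' ξ hξ
    simp only at heq
    rw [inner_sub_left, heq] at h3
    simpa [sub_eq_zero] using h3
  · intro A hA
    constructor
    · rw [← hausdorffMeasure_real]
      have := hausdorffMeasure_image_le_of_edist_le (fun ξ : E2 => (⟪ξ, t⟫ : ℝ)) (id : E2 → E2) A 1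
        (fun ξ _ ξ' _ => by
          rw [edist_dist, edist_dist, hP, ENNReal.coe_one, one_mul]
          refine ENNReal.ofReal_le_ofReal ?_
          simpa [ht, dist_eq_norm] using abs_real_inner_le_norm (ξ - ξ') t) (d := 1) zero_le_one
      simpa using this
    · rw [← hausdorffMeasure_real]
      have := hausdorffMeasure_image_le_of_edist_le (id : E2 → E2) (fun ξ : E2 => (⟪ξ, t⟫ : ℝ)) A
        k.toNNReal (fun ξ hξ ξ' hξ' => by
          rw [edist_dist, edist_dist, hP, ← hkn, ← ENNReal.ofReal_mul hk0.le]
          refine ENNReal.ofReal_le_ofReal ?_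
          simpa [dist_eq_norm] using h1 ξ' (hA hξ') ξ (hA hξ)) (d := 1) zero_le_one
      simpa [hkn] using this
  · intro x hx x' hx' heq
    have h3 := (h2 x' hx' x hx).2
    rw [heq, sub_self, norm_zero, mul_zero] at h3
    have h4 : Q x - Q x' = 0 := by rw [hQd]; exact norm_le_zero_iff.1 h3
    rw [hQd] at h4
    have h5 := norm_sq_frame ht hn htn (⟪x.1 - x'.1, t⟫ • t + (x.2 - x'.2) • n)
    rw [h4] at h5
    have hnt : ⟪n, t⟫ = (0 : ℝ) := by rw [real_inner_comm]; exact htn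
    have e1 : ⟪x.1 - x'.1, t⟫ = (0 : ℝ) := by
      have := congrArg (fun z : E2 => (⟪z, t⟫ : ℝ)) h4
      simpa [inner_add_left, inner_smul_left, ht, hnt] using this
    have e2 : x.2 - x'.2 = 0 := by
      have := congrArg (fun z : E2 => (⟪z, n⟫ : ℝ)) h4
      simpa [inner_add_left, inner_smul_left, hn, htn] using this
    have h6 := h1 x'.1 hx'.1 x.1 hx.1
    rw [e1, abs_zero, mul_zero] at h6
    exact Prod.ext (sub_eq_zero.1 (norm_le_zero_iff.1 h6)) (sub_eq_zero.1 e2)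
  · intro E hE
    constructor
    · rw [← hQimg]
      refine volume_image_le_of_edist_le _ _ E k.toNNReal fun x hx x' hx' => ?_
      rw [edist_dist, edist_dist, ← hkn, ← ENNReal.ofReal_mul hk0.le, dist_eq_norm, dist_eq_norm,
        hQd]
      exact ENNReal.ofReal_le_ofReal (h2 x' (hE hx') x (hE hx)).1
    · rw [← hQimg]
      refine volume_image_le_of_edist_le _ _ E k.toNNReal fun x hx x' hx' => ?_
      rw [edist_dist, edist_dist, ← hkn, ← ENNReal.ofReal_mul hk0.le, dist_eq_norm, dist_eq_norm,
        hQd]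
      exact ENNReal.ofReal_le_ofReal (h2 x' (hE hx') x (hE hx)).2

/-- A bounded `Γ` is covered by finitely many pieces of small diameter. -/
lemma exists_finite_cover {Γ : Set E2} (hb : Bornology.IsBounded Γ) {ρ : ℝ} (hρ : 0 < ρ) :
    ∃ T : Finset E2, Γ ⊆ ⋃ c ∈ T, (Γ ∩ Metric.ball c (ρ / 2)) ∧
      ∀ c, ∀ ξ ∈ Γ ∩ Metric.ball c (ρ / 2), ∀ ξ' ∈ Γ ∩ Metric.ball c (ρ / 2), ‖ξ' - ξ‖ < ρ := by
  obtain ⟨T, hT, hsub⟩ := Metric.totallyBounded_iff.1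
    (hb.isCompact_closure.totallyBounded.subset subset_closure) (ρ / 2) (by positivity)
  refine ⟨hT.toFinset, fun ξ hξ => ?_, fun c ξ hξ ξ' hξ' => ?_⟩
  · obtain ⟨c, hc, hξc⟩ := mem_iUnion₂.1 (hsub hξ)
    exact mem_iUnion₂.2 ⟨c, hT.mem_toFinset.2 hc, hξ, hξc⟩
  · rw [← dist_eq_norm]
    have h1 := Metric.mem_ball.1 hξ.2
    have h2 := Metric.mem_ball.1 hξ'.2
    linarith [dist_triangle_right ξ' ξ c]

lemma isFiniteMeasure_arcMeasure (H : HasSmoothNormal S Γ L δ) (hb : Bornology.IsBounded Γ) :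
    IsFiniteMeasure (arcMeasure Γ) := by
  refine ⟨?_⟩
  rw [arcMeasure, Measure.restrict_apply_univ]
  obtain ⟨ρ, hρ, h⟩ := H.exists_length_comparison (k := 2) (by norm_num)
  obtain ⟨T, hT, hd⟩ := exists_finite_cover hb hρ
  refine (measure_mono hT).trans_lt ((measure_biUnion_finset_le _ _).trans_lt ?_)
  refine ENNReal.sum_lt_top.2 fun c _ => ?_
  rcases (Γ ∩ Metric.ball c (ρ / 2)).eq_empty_or_nonempty with he | hne
  · rw [he]; simp
  obtain ⟨t, n, ht, _, _, _, h1, _⟩ := h _ inter_subset_left (hd c) hne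
  refine (h1 _ Subset.rfl).2.trans_lt (ENNReal.mul_lt_top ENNReal.ofReal_lt_top ?_)
  obtain ⟨ξ₀, hξ₀⟩ := hne
  have hsub : (fun ξ : E2 => (⟪ξ, t⟫ : ℝ)) '' (Γ ∩ Metric.ball c (ρ / 2)) ⊆
      Metric.closedBall ⟪ξ₀, t⟫ ρ := by
    rintro _ ⟨ξ, hξ, rfl⟩
    rw [Metric.mem_closedBall, Real.dist_eq, ← inner_sub_left]
    refine (abs_real_inner_le_norm _ _).trans ?_
    rw [ht, mul_one]
    exact (hd c ξ₀ hξ₀ ξ hξ).le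
  exact (measure_mono hsub).trans_lt (by rw [Real.volume_closedBall]; exact ENNReal.ofReal_lt_top)

/-- In normal coordinates the area of small strips is the product of the length of `Γ` and the
width, up to a factor close to `1`. -/
theorem exists_strip_comparison (H : HasSmoothNormal S Γ L δ) (hb : Bornology.IsBounded Γ)
    (hΓ : MeasurableSet Γ) {ε : ℝ} (hε : 0 < ε) :
    ∃ ρ > (0 : ℝ), InjOn (stripMap S Γ) (Γ ×ˢ Ioo 0 ρ) ∧
      ∀ E : Set (E2 × ℝ), MeasurableSet E → E ⊆ Γ ×ˢ Ioo 0 ρ →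
        MeasurableSet (stripMap S Γ '' E) ∧
        volume (stripMap S Γ '' E) ≤ ENNReal.ofReal (1 + ε) * ((arcMeasure Γ).prod volume) E ∧
        ((arcMeasure Γ).prod volume) E ≤
          ENNReal.ofReal (1 + ε) * volume (stripMap S Γ '' E) := by
  have hfin := H.isFiniteMeasure_arcMeasure hb
  -- the comparison of lengths loses one factor `k`, the comparison of areas two
  obtain ⟨k, hk1, hk3⟩ : ∃ k : ℝ, 1 < k ∧ k ^ 3 ≤ 1 + ε := by
    have hc : Tendsto (fun k : ℝ => k ^ 3) (𝓝[>] 1) (𝓝 (1 ^ 3)) :=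
      (Continuous.tendsto (by fun_prop) 1).mono_left nhdsWithin_le_nhds
    have hev := hc.eventually_le_const (u := 1 + ε) (by linarith)
    obtain ⟨k, h1, h2⟩ := (hev.and self_mem_nhdsWithin).exists
    exact ⟨k, h2, h1⟩
  have hk0 : 0 ≤ k := by linarith
  have hk2 : k ^ 2 ≤ 1 + ε := by nlinarith [sq_nonneg k]
  obtain ⟨ρ₀, hρ₀, h⟩ := H.exists_length_comparison hk1
  -- two fibres of length `ρ₀ / 4` that meet start at distance less than `ρ₀`
  set ρ := ρ₀ / 4 with hρdef
  have hρ : 0 < ρ := by positivity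
  have hρle : ∀ D : Set E2, D ×ˢ Ioo (0 : ℝ) ρ ⊆ D ×ˢ Ioo 0 ρ₀ := fun D =>
    prod_mono Subset.rfl (Ioo_subset_Ioo_right (by linarith))
  have hinj : InjOn (stripMap S Γ) (Γ ×ˢ Ioo 0 ρ) := by
    rintro ⟨ξ, s⟩ ⟨hξ, hs⟩ ⟨ξ', s'⟩ ⟨hξ', hs'⟩ heq
    simp only at hξ hs hξ' hs'
    have hdist : ‖ξ' - ξ‖ < ρ₀ := by
      rw [stripMap_of_mem (x := (ξ, s)) hξ, stripMap_of_mem (x := (ξ', s')) hξ'] at heq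
      simp only at heq
      have e : ξ' - ξ = s' • outerNormal S ξ' - s • outerNormal S ξ := by
        have h2 : ξ' - ξ = (ξ' - s' • outerNormal S ξ') - (ξ - s • outerNormal S ξ) +
            (s' • outerNormal S ξ' - s • outerNormal S ξ) := by abel
        rw [h2, heq, sub_self, zero_add]
      rw [e]
      refine (norm_sub_le _ _).trans_lt ?_
      rw [norm_smul, norm_smul, H.norm_outerNormal hξ, H.norm_outerNormal hξ',
        Real.norm_of_nonneg hs.1.le, Real.norm_of_nonneg hs'.1.le]
      linarith [hs.2, hs'.2]
    obtain ⟨t, n, -, -, -, -, -, hi, -⟩ := h {ξ, ξ'} (by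
        intro z hz; rcases hz with rfl | rfl <;> assumption) (by
        rintro z hz w hw
        rcases hz with rfl | rfl <;> rcases hw with rfl | rfl
        · simpa using hρ₀
        · exact hdist
        · rw [norm_sub_rev]; exact hdist
        · simpa using hρ₀) ⟨ξ, by simp⟩
    exact hi (hρle _ ⟨by simp, hs⟩) (hρle _ ⟨by simp, hs'⟩) heq
  -- injectivity on the product makes images of measurable sets measurable
  have hcont := H.continuousOn_stripMap
  have hmeas : ∀ E : Set (E2 × ℝ), MeasurableSet E → E ⊆ Γ ×ˢ Ioo 0 ρ →
      MeasurableSet (stripMap S Γ '' E) := fun E hE hsub =>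
    hE.image_of_continuousOn_injOn (hcont.mono (hsub.trans (prod_mono Subset.rfl (subset_univ _))))
      (hinj.mono hsub)
  -- the comparison on sets over a piece of `Γ` of small diameter
  have hlocal : ∀ D ⊆ Γ, (∀ ξ ∈ D, ∀ ξ' ∈ D, ‖ξ' - ξ‖ < ρ₀) → ∀ E : Set (E2 × ℝ),
      MeasurableSet E → E ⊆ D ×ˢ Ioo 0 ρ →
      volume (stripMap S Γ '' E) ≤ ENNReal.ofReal (1 + ε) * ((arcMeasure Γ).prod volume) E ∧
        ((arcMeasure Γ).prod volume) E ≤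
          ENNReal.ofReal (1 + ε) * volume (stripMap S Γ '' E) := by
    intro D hD hDρ E hE hED
    rcases D.eq_empty_or_nonempty with rfl | hDn
    · have : E = ∅ := by simpa using hED
      subst this; simp
    obtain ⟨t, n, ht, hn, htn, hPinj, hlen, -, hvol⟩ := h D hD hDρ hDn
    set q : E2 × ℝ → ℝ × ℝ := fun x => (⟪x.1, t⟫, x.2) with hq
    have hqc : Continuous q := by fun_prop
    have hqinj : InjOn q E := by
      intro x hx x' hx' heq
      have e1 := congrArg Prod.fst heq
      have e2 := congrArg Prod.snd heq
      exact Prod.ext (hPinj (hED hx).1 (hED hx').1 e1) e2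
    have hqm : MeasurableSet (q '' E) := hE.image_of_continuousOn_injOn hqc.continuousOn hqinj
    -- compare the slices at height `s` and integrate over `s`
    have hsec : ∀ s : ℝ, (fun r : ℝ => (r, s)) ⁻¹' (q '' E) =
        (fun ξ : E2 => (⟪ξ, t⟫ : ℝ)) '' ((fun ξ => (ξ, s)) ⁻¹' E) := by
      intro s
      ext r
      constructor
      · rintro ⟨⟨ξ, s'⟩, hx, heq⟩
        rw [hq, Prod.mk.injEq] at heq
        obtain ⟨e1, e2⟩ := heq
        simp only at e1 e2
        subst e2
        exact ⟨ξ, hx, e1⟩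
      · rintro ⟨ξ, hx, rfl⟩
        exact ⟨(ξ, s), hx, rfl⟩
    have hsecD : ∀ s : ℝ, (fun ξ => (ξ, s)) ⁻¹' E ⊆ D := fun s ξ hξ => (hED hξ).1
    have harc : ∀ s : ℝ, arcMeasure Γ ((fun ξ => (ξ, s)) ⁻¹' E) =
        μH[1] ((fun ξ => (ξ, s)) ⁻¹' E) := by
      intro s
      rw [arcMeasure, Measure.restrict_apply' hΓ, inter_eq_left.2 ((hsecD s).trans hD)]
    have hprod : ((arcMeasure Γ).prod volume) E =
        ∫⁻ s, μH[1] ((fun ξ => (ξ, s)) ⁻¹' E) := by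
      rw [Measure.prod_apply_symm hE]
      exact lintegral_congr harc
    have hprod2 : (volume : Measure (ℝ × ℝ)) (q '' E) =
        ∫⁻ s, volume ((fun ξ : E2 => (⟪ξ, t⟫ : ℝ)) '' ((fun ξ => (ξ, s)) ⁻¹' E)) := by
      rw [Measure.volume_eq_prod, Measure.prod_apply_symm hqm]
      exact lintegral_congr fun s => by rw [hsec]
    have hle1 : (volume : Measure (ℝ × ℝ)) (q '' E) ≤ ((arcMeasure Γ).prod volume) E := by
      rw [hprod, hprod2]
      exact lintegral_mono fun s => (hlen _ (hsecD s)).1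
    have hle2 : ((arcMeasure Γ).prod volume) E ≤ ENNReal.ofReal k * volume (q '' E) := by
      rw [hprod, hprod2, ← lintegral_const_mul' _ _ ENNReal.ofReal_ne_top]
      exact lintegral_mono fun s => (hlen _ (hsecD s)).2
    have hv := hvol E (hED.trans (hρle D))
    rw [← ENNReal.ofReal_pow hk0] at hv
    constructor
    · calc _ ≤ _ := hv.1
        _ ≤ _ := by gcongr
    · calc _ ≤ _ := hle2
        _ ≤ ENNReal.ofReal k * (ENNReal.ofReal (k ^ 2) * volume (stripMap S Γ '' E)) := by
          gcongr; exact hv.2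
        _ = ENNReal.ofReal (k ^ 3) * volume (stripMap S Γ '' E) := by
          rw [← mul_assoc, ← ENNReal.ofReal_mul hk0]; congr 2; ring
        _ ≤ _ := by gcongr
  refine ⟨ρ, hρ, hinj, fun E hE hsub => ⟨hmeas E hE hsub, ?_⟩⟩
  obtain ⟨T, hT, hd⟩ := exists_finite_cover hb hρ₀
  -- split `E` into disjoint parts over the pieces of the cover
  set e := T.equivFin.symm
  set A : Fin T.card → Set E2 := fun i => Γ ∩ Metric.ball (e i : E2) (ρ₀ / 2) with hA
  have hAm : ∀ i, MeasurableSet (A i) := fun i => hΓ.inter measurableSet_ball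
  set B : Fin T.card → Set E2 := disjointed A with hB
  have hBm : ∀ i, MeasurableSet (B i) := fun i =>
    disjointedRec (fun _ _ ht => ht.diff (hAm _)) (hAm i)
  have hBu : Γ ⊆ ⋃ i, B i := by
    rw [hB, iUnion_disjointed]
    intro ξ hξ
    obtain ⟨c, hc, hξc⟩ := mem_iUnion₂.1 (hT hξ)
    refine mem_iUnion.2 ⟨e.symm ⟨c, hc⟩, ?_⟩
    simpa [hA] using hξc
  set F : Fin T.card → Set (E2 × ℝ) := fun i => E ∩ (B i ×ˢ univ) with hF
  have hFm : ∀ i, MeasurableSet (F i) := fun i => hE.inter ((hBm i).prod MeasurableSet.univ)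
  have hFd : Pairwise (Function.onFun Disjoint F) := by
    intro i j hij
    rw [Function.onFun, Set.disjoint_left]
    rintro x ⟨_, hx⟩ ⟨_, hx'⟩
    exact Set.disjoint_left.1 (disjoint_disjointed A hij) hx.1 hx'.1
  have hFu : E = ⋃ i, F i := by
    ext x
    constructor
    · intro hx
      obtain ⟨i, hi⟩ := mem_iUnion.1 (hBu (hsub hx).1)
      exact mem_iUnion.2 ⟨i, hx, hi, mem_univ _⟩
    · intro hx
      obtain ⟨i, hi⟩ := mem_iUnion.1 hx
      exact hi.1
  have hFE : ∀ i, F i ⊆ E := fun i => inter_subset_left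
  have hFloc := fun i => hlocal (A i) inter_subset_left (hd _) (F i) (hFm i) (by
    rintro x ⟨hx, hxB⟩
    exact ⟨disjointed_subset A i hxB.1, (hsub hx).2⟩)
  have himd : Pairwise (Function.onFun Disjoint fun i => stripMap S Γ '' F i) := by
    intro i j hij
    exact (hFd hij).image hinj ((hFE i).trans hsub) ((hFE j).trans hsub)
  have hv : volume (stripMap S Γ '' E) = ∑ i, volume (stripMap S Γ '' F i) := by
    conv_lhs => rw [hFu, image_iUnion]
    rw [measure_iUnion himd fun i => hmeas _ (hFm i) ((hFE i).trans hsub), tsum_fintype]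
  have hp : ((arcMeasure Γ).prod volume) E = ∑ i, ((arcMeasure Γ).prod volume) (F i) := by
    conv_lhs => rw [hFu]
    rw [measure_iUnion hFd hFm, tsum_fintype]
  rw [hv, hp, Finset.mul_sum, Finset.mul_sum]
  exact ⟨Finset.sum_le_sum fun i _ => (hFloc i).1, Finset.sum_le_sum fun i _ => (hFloc i).2⟩

end HasSmoothNormal

/-- The measure `ℋ¹ ⊗ ds` on `Γ × (0, σ)`, to which the area of the strip of width `σ` is
compared. -/
noncomputable def fibreMeasure (Γ : Set E2) (σ : ℝ) : Measure (E2 × ℝ) :=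
  (arcMeasure Γ).prod (volume.restrict (Ioo 0 σ))

lemma fibreMeasure_eq_restrict {Γ : Set E2} [SFinite (arcMeasure Γ)] (hΓ : MeasurableSet Γ)
    (σ : ℝ) : fibreMeasure Γ σ = ((arcMeasure Γ).prod volume).restrict (Γ ×ˢ Ioo 0 σ) := by
  have h : (arcMeasure Γ).restrict Γ = arcMeasure Γ := by
    rw [arcMeasure, Measure.restrict_restrict hΓ, inter_self]
  rw [fibreMeasure, ← Measure.prod_restrict, h]

lemma ae_mem_fibreMeasure {Γ : Set E2} [SFinite (arcMeasure Γ)] (hΓ : MeasurableSet Γ) (σ : ℝ) :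
    ∀ᵐ x ∂(fibreMeasure Γ σ), x ∈ Γ ×ˢ Ioo 0 σ := by
  rw [fibreMeasure_eq_restrict hΓ]
  exact ae_restrict_mem (hΓ.prod measurableSet_Ioo)

namespace HasSmoothNormal

variable {S Γ : Set E2} {L δ : ℝ}

/-- For small widths, Lebesgue measure on the strip and the image of the product measure are
comparable with constants close to `1`. -/
theorem exists_strip_measure_comparison (H : HasSmoothNormal S Γ L δ) (hb : Bornology.IsBounded Γ)
    (hΓ : MeasurableSet Γ) {ε : ℝ} (hε : 0 < ε) :
    ∃ ρ > (0 : ℝ), InjOn (stripMap S Γ) (Γ ×ˢ Ioo 0 ρ) ∧ ∀ σ ≤ ρ,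
      MeasurableSet (strip S Γ σ) ∧
      (fibreMeasure Γ σ).map (stripMap S Γ) ≤
        ENNReal.ofReal (1 + ε) • volume.restrict (strip S Γ σ) ∧
      volume.restrict (strip S Γ σ) ≤
        ENNReal.ofReal (1 + ε) • (fibreMeasure Γ σ).map (stripMap S Γ) := by
  have hfin := H.isFiniteMeasure_arcMeasure hb
  obtain ⟨ρ, hρ, hinj, h⟩ := H.exists_strip_comparison hb hΓ hε
  refine ⟨ρ, hρ, hinj, fun σ hσ => ?_⟩
  have hm := H.measurable_stripMap hΓ
  have hsub : Γ ×ˢ Ioo (0 : ℝ) σ ⊆ Γ ×ˢ Ioo 0 ρ :=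
    prod_mono Subset.rfl (Ioo_subset_Ioo_right hσ)
  have hms : MeasurableSet (Γ ×ˢ Ioo (0 : ℝ) σ) := hΓ.prod measurableSet_Ioo
  have hstrip : MeasurableSet (strip S Γ σ) := by
    rw [strip_eq_image]; exact (h _ hms hsub).1
  have himg : ∀ A : Set E2, stripMap S Γ '' (stripMap S Γ ⁻¹' A ∩ Γ ×ˢ Ioo 0 σ) =
      A ∩ strip S Γ σ := by
    intro A
    rw [strip_eq_image, image_preimage_inter]
  refine ⟨hstrip, Measure.le_iff.2 fun A hA => ?_, Measure.le_iff.2 fun A hA => ?_⟩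
  · have h1 := (h _ ((hm hA).inter hms) (inter_subset_right.trans hsub)).2.2
    rw [himg] at h1
    rw [Measure.map_apply hm hA, fibreMeasure_eq_restrict hΓ, Measure.restrict_apply (hm hA),
      Measure.smul_apply, smul_eq_mul, Measure.restrict_apply hA]
    exact h1
  · have h1 := (h _ ((hm hA).inter hms) (inter_subset_right.trans hsub)).2.1
    rw [himg] at h1
    rw [Measure.smul_apply, smul_eq_mul, Measure.map_apply hm hA, fibreMeasure_eq_restrict hΓ,
      Measure.restrict_apply (hm hA), Measure.restrict_apply hA]
    exact h1

end HasSmoothNormal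

/-! ### Fibres inside the domain -/

/-- The points of `Γ` at distance at least `σ` from the rest of the boundary of `S`. Their normal
fibres of length `σ` lie in `S`. -/
def innerPart (S Γ : Set E2) (σ : ℝ) : Set E2 :=
  {ξ ∈ Γ | ENNReal.ofReal σ ≤ Metric.infEDist ξ (frontier S \ Γ)}

lemma measurableSet_innerPart {S Γ : Set E2} (hΓ : MeasurableSet Γ) (σ : ℝ) :
    MeasurableSet (innerPart S Γ σ) :=
  hΓ.inter (Metric.continuous_infEDist.measurable measurableSet_Ici)

lemma innerPart_subset {S Γ : Set E2} (σ : ℝ) : innerPart S Γ σ ⊆ Γ := fun _ h => h.1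

lemma innerPart_anti {S Γ : Set E2} {σ τ : ℝ} (h : σ ≤ τ) :
    innerPart S Γ τ ⊆ innerPart S Γ σ :=
  fun _ hξ => ⟨hξ.1, (ENNReal.ofReal_le_ofReal h).trans hξ.2⟩

lemma exists_mem_innerPart {S Γ : Set E2} (hΓ : IsRegularBoundaryPart S Γ) {ξ : E2} (hξ : ξ ∈ Γ) :
    ∃ σ > 0, ξ ∈ innerPart S Γ σ := by
  obtain ⟨O, hO, hΓO⟩ := hΓ.relOpen
  have hξO : ξ ∈ O := by rw [hΓO] at hξ; exact hξ.1
  obtain ⟨σ, hσ, hball⟩ := Metric.isOpen_iff.1 hO ξ hξO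
  refine ⟨σ, hσ, hξ, Metric.le_infEDist.2 fun z hz => ?_⟩
  by_contra hlt
  rw [not_le, edist_dist, ENNReal.ofReal_lt_ofReal_iff hσ, dist_comm] at hlt
  exact hz.2 (by rw [hΓO]; exact ⟨hball hlt, hz.1⟩)

lemma iUnion_innerPart {S Γ : Set E2} (hΓ : IsRegularBoundaryPart S Γ) :
    ⋃ n : ℕ, innerPart S Γ (1 / ((n : ℝ) + 1)) = Γ := by
  refine Subset.antisymm (iUnion_subset fun n => innerPart_subset _) fun ξ hξ => ?_
  obtain ⟨σ, hσ, h⟩ := exists_mem_innerPart hΓ hξ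
  obtain ⟨n, hn⟩ := exists_nat_one_div_lt hσ
  exact mem_iUnion.2 ⟨n, innerPart_anti hn.le h⟩

/-- A fibre leaving `S` would do so through `Γ`, which is impossible as fibres are transversal to
`Γ`. -/
lemma HasSmoothNormal.mem_of_innerPart {S Γ : Set E2} {L δ : ℝ} (H : HasSmoothNormal S Γ L δ)
    (hS : IsOpen S) {σ : ℝ} (hσ : σ ≤ min δ (1 / L)) {ξ : E2} (hξ : ξ ∈ innerPart S Γ σ) {s : ℝ}
    (hs : s ∈ Ioo 0 σ) : stripMap S Γ (ξ, s) ∈ S := by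
  rw [stripMap_of_mem (x := (ξ, s)) hξ.1]
  simp only
  set n := outerNormal S ξ with hn
  have hn1 : ‖n‖ = 1 := H.norm_outerNormal hξ.1
  by_contra hout
  have hc : Continuous fun t : ℝ => ξ - t • n := by fun_prop
  -- near `ξ` the fibre lies in `S`
  have hnear : ∃ t ∈ Ioo 0 s, ξ - t • n ∈ S := by
    have hto : Tendsto (fun t : ℝ => ξ - t • n) (𝓝[>] 0) (𝓝 ξ) := by
      have := (hc.tendsto 0).mono_left (nhdsWithin_le_nhds (s := Ioi (0 : ℝ)))
      simpa using this
    have hev := hto.eventually ((H.isNormal ξ hξ.1).2 (1 / 2) (by norm_num))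
    obtain ⟨t, ⟨h1, _⟩, h2⟩ := (hev.and (Ioo_mem_nhdsGT hs.1)).exists
    refine ⟨t, h2, h1 ?_⟩
    have e : ξ - t • n - ξ = -(t • n) := by abel
    rw [e, inner_neg_left, inner_smul_left, norm_neg, norm_smul, Real.norm_of_nonneg h2.1.le,
      ← hn, real_inner_self_eq_norm_sq, hn1]
    simp
    linarith [h2.1]
  obtain ⟨t, ht, htS⟩ := hnear
  have hconn : IsPreconnected ((fun t : ℝ => ξ - t • n) '' Icc t s) :=
    isPreconnected_Icc.image _ hc.continuousOn
  obtain ⟨z, ⟨τ, hτ, rfl⟩, hz⟩ := exists_mem_inter_frontier hS hconn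
    ⟨_, ⟨t, left_mem_Icc.2 ht.2.le, rfl⟩, htS⟩ ⟨_, ⟨s, right_mem_Icc.2 ht.2.le, rfl⟩, hout⟩
  simp only at hz
  have hτ0 : 0 < τ := ht.1.trans_le hτ.1
  have hτσ : τ < σ := hτ.2.trans_lt hs.2
  have e : ξ - τ • n - ξ = -(τ • n) := by abel
  have hnorm : ‖ξ - τ • n - ξ‖ = τ := by
    rw [e, norm_neg, norm_smul, hn1, Real.norm_of_nonneg hτ0.le, mul_one]
  have hzΓ : ξ - τ • n ∈ Γ := by
    by_contra hzΓ
    have h1 := hξ.2.trans (Metric.infEDist_le_edist_of_mem (x := ξ) ⟨hz, hzΓ⟩)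
    rw [edist_comm, edist_dist, dist_eq_norm, hnorm,
      ENNReal.ofReal_le_ofReal_iff hτ0.le] at h1
    linarith
  have hflat := H.flat ξ hξ.1 _ hzΓ (by
    rw [hnorm]; exact hτσ.trans_le (hσ.trans (min_le_left _ _)))
  rw [hnorm, e, inner_neg_left, inner_smul_left, abs_neg, ← hn, real_inner_self_eq_norm_sq,
    hn1] at hflat
  have hL := H.L_pos
  have h2 : τ < 1 / L := hτσ.trans_le (hσ.trans (min_le_right _ _))
  rw [lt_div_iff₀ hL] at h2
  simp [abs_of_pos hτ0] at hflat
  nlinarith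

/-- In a Lipschitz chart, the set of parameters of `Γ` has finitely many boundary points: any two
boundary points enclose an open and closed part of `Γ`. -/
lemma IsLipschitzChart.finite_frontier {S Γ : Set E2} {p : E2} {r : ℝ} {a b : E2} {K : ℝ≥0}
    {γ : ℝ → ℝ} (h : IsLipschitzChart S p r a b K γ) (hS : IsOpen S)
    (hΓ : IsRegularBoundaryPart S Γ) {I : Set ℝ} (hI : I.OrdConnected) (hIo : IsOpen I)
    (hIr : ∀ t ∈ I, t • a + γ t • b ∈ Metric.ball p r) :
    (I ∩ frontier {t ∈ I | t • a + γ t • b ∈ Γ}).Finite := by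
  obtain ⟨O, hO, hΓO⟩ := hΓ.relOpen
  set c : ℝ → E2 := fun t => t • a + γ t • b with hc
  have hcc : Continuous c := by
    have := h.lip.continuous
    fun_prop
  set T : Set ℝ := {t ∈ I | c t ∈ Γ} with hT
  have hTO : T = I ∩ c ⁻¹' O := by
    ext t
    refine ⟨fun ht => ⟨ht.1, ?_⟩, fun ht => ⟨ht.1, ?_⟩⟩
    · have := ht.2; rw [hΓO] at this; exact this.1
    · rw [hΓO]; exact ⟨ht.2, h.graph_mem_frontier hS (hIr t ht.1)⟩
  have hTopen : IsOpen T := by rw [hTO]; exact hIo.inter (hO.preimage hcc)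
  set F : Set ℝ := I ∩ frontier T with hF
  have hFT : ∀ t ∈ F, c t ∉ Γ := by
    rintro t ⟨htI, htT⟩ hmem
    rw [hTopen.frontier_eq] at htT
    exact htT.2 ⟨htI, hmem⟩
  -- choose `2 N + 3` boundary points, `N` the number of components, and a point of the open set `T`
  -- near every second of them: these `N + 1` points lie in different components of `Γ`
  by_contra hinf
  have hinf : F.Infinite := hinf
  have := hΓ.finiteComponents
  have := Fintype.ofFinite (ConnectedComponents Γ)
  set N := Fintype.card (ConnectedComponents Γ) with hN
  obtain ⟨F', hF'sub, hF'card⟩ := hinf.exists_subset_card_eq (2 * N + 3)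
  set β := F'.orderEmbOfFin hF'card with hβ
  have hβF : ∀ i, β i ∈ F := fun i => hF'sub (F'.orderEmbOfFin_mem hF'card i)
  have hpt : ∀ i : Fin (N + 1), ∃ t ∈ T,
      β ⟨2 * i, by omega⟩ < t ∧ t < β ⟨2 * i + 2, by omega⟩ := by
    intro i
    have h1 := (hβF ⟨2 * i + 1, by omega⟩).2.1
    have h2 : Ioo (β ⟨2 * i, by omega⟩) (β ⟨2 * i + 2, by omega⟩) ∈
        𝓝 (β ⟨2 * i + 1, by omega⟩) := by
      refine Ioo_mem_nhds (β.strictMono ?_) (β.strictMono ?_) <;> simp [Fin.lt_def]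
    obtain ⟨t, ht1, ht2⟩ := mem_closure_iff_nhds.1 h1 _ h2
    exact ⟨t, ht2, ht1.1, ht1.2⟩
  choose τ hτT hτl hτr using hpt
  have hsep : ∀ i j : Fin (N + 1), i < j →
      ((⟨c (τ i), (hτT i).2⟩ : Γ) : ConnectedComponents Γ) ≠
        ((⟨c (τ j), (hτT j).2⟩ : Γ) : ConnectedComponents Γ) := by
    intro i j hij heq
    set lo := β ⟨2 * i, by omega⟩ with hlo
    set hi := β ⟨2 * i + 2, by omega⟩ with hhi
    have hloF : lo ∈ F := hβF _
    have hhiF : hi ∈ F := hβF _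
    -- the part of `Γ` over the interval is open and, as the end points are not in `Γ`, closed
    set U : Set Γ := {x | (x : E2) ∈ Metric.ball p r ∧ ⟪(x : E2), a⟫ ∈ Ioo lo hi} with hU
    have hUo : IsOpen U := by
      have h1 : Continuous fun x : Γ => (⟪(x : E2), a⟫ : ℝ) := by fun_prop
      exact (Metric.isOpen_ball.preimage continuous_subtype_val).inter (isOpen_Ioo.preimage h1)
    have hUc : IsClosed U := by
      have h1 : U = Subtype.val ⁻¹' (c '' Icc lo hi) := by
        ext x
        constructor
        · rintro ⟨hx1, hx2⟩
          refine ⟨⟪(x : E2), a⟫, Ioo_subset_Icc_self hx2, ?_⟩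
          exact (h.eq_graph hS hx1 (hΓ.subset_frontier x.2)).symm
        · rintro ⟨t, ht, htx⟩
          have htI : t ∈ I := hI.out hloF.1 hhiF.1 ht
          have hmem : c t ∈ Γ := by rw [htx]; exact x.2
          have hne1 : t ≠ lo := fun e => hFT lo hloF (e ▸ hmem)
          have hne2 : t ≠ hi := fun e => hFT hi hhiF (e ▸ hmem)
          refine ⟨by rw [← htx]; exact hIr t htI, ?_⟩
          rw [← htx, h.inner_graph_left]
          exact ⟨lt_of_le_of_ne ht.1 hne1.symm, lt_of_le_of_ne ht.2 hne2⟩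
      rw [h1]
      exact (isCompact_Icc.image hcc).isClosed.preimage continuous_subtype_val
    have hiU : (⟨c (τ i), (hτT i).2⟩ : Γ) ∈ U := by
      refine ⟨hIr _ (hτT i).1, ?_⟩
      simp only [hc, h.inner_graph_left]
      exact ⟨hτl i, hτr i⟩
    have hjU : (⟨c (τ j), (hτT j).2⟩ : Γ) ∈ U := by
      refine (IsClopen.connectedComponent_subset ⟨hUc, hUo⟩ hiU) ?_
      rw [ConnectedComponents.coe_eq_coe'] at heq
      rw [← connectedComponent_eq heq]
      exact mem_connectedComponent
    have h1 : τ j < hi := by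
      have := hjU.2.2
      simpa only [hc, h.inner_graph_left] using this
    have h2 : hi ≤ β ⟨2 * j, by omega⟩ := by
      refine β.monotone ?_
      rw [Fin.le_def]
      have : (i : ℕ) < j := hij
      simp only
      omega
    linarith [hτl j]
  have hinj : Function.Injective fun i : Fin (N + 1) =>
      ((⟨c (τ i), (hτT i).2⟩ : Γ) : ConnectedComponents Γ) := by
    intro i j heq
    by_contra hne
    rcases lt_or_gt_of_ne hne with hlt | hlt
    · exact hsep i j hlt heq
    · exact hsep j i hlt heq.symm
  have := Fintype.card_le_of_injective _ hinj
  rw [Fintype.card_fin, ← hN] at this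
  omega

/-- The part of `Γ` within distance `σ` of the rest of the boundary has length of order `σ`, because
`Γ` has finitely many end points. -/
theorem exists_measure_diff_innerPart_le {S Γ : Set E2} (hS : IsBoundedLipschitzDomain S)
    (hΓ : IsRegularBoundaryPart S Γ) :
    ∃ C σ₀ : ℝ, 0 < C ∧ 0 < σ₀ ∧ ∀ σ, 0 < σ → σ ≤ σ₀ →
      arcMeasure Γ (Γ \ innerPart S Γ σ) ≤ ENNReal.ofReal (C * σ) := by
  have key : ∃ C σ₀ : ℝ, 0 < C ∧ 0 < σ₀ ∧ ∀ σ, 0 < σ → σ ≤ σ₀ →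
      μH[1] ((Γ \ innerPart S Γ σ) ∩ closure Γ) ≤ ENNReal.ofReal (C * σ) := by
    refine (hΓ.isCompact_closure hS).induction_on (p := fun s => ∃ C σ₀ : ℝ, 0 < C ∧ 0 < σ₀ ∧
      ∀ σ, 0 < σ → σ ≤ σ₀ → μH[1] ((Γ \ innerPart S Γ σ) ∩ s) ≤ ENNReal.ofReal (C * σ))
      ?_ ?_ ?_ ?_
    · exact ⟨1, 1, one_pos, one_pos, by simp⟩
    · rintro s t hst ⟨C, σ₀, hC, hσ₀, h⟩
      exact ⟨C, σ₀, hC, hσ₀, fun σ h1 h2 =>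
        (measure_mono (inter_subset_inter_right _ hst)).trans (h σ h1 h2)⟩
    · rintro s t ⟨C, σ₀, hC, hσ₀, h⟩ ⟨C', σ₀', hC', hσ₀', h'⟩
      refine ⟨C + C', min σ₀ σ₀', by positivity, lt_min hσ₀ hσ₀', fun σ h1 h2 => ?_⟩
      rw [inter_union_distrib_left, add_mul, ENNReal.ofReal_add (by positivity) (by positivity)]
      exact (measure_union_le _ _).trans (add_le_add (h σ h1 (h2.trans (min_le_left _ _)))
        (h' σ h1 (h2.trans (min_le_right _ _))))
    · intro p hp
      have hpf := hΓ.closure_subset_frontier hp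
      obtain ⟨r, a, b, K, γ, hch⟩ := hS.exists_chart hpf
      have hr := hch.r_pos
      set r' := r / (1 + K) with hr'
      have hr'p : 0 < r' := by positivity
      have hr'r : r' ≤ r := div_le_self hr.le (by have : (0 : ℝ) ≤ K := K.2; linarith)
      set t₀ : ℝ := ⟪p, a⟫ with ht₀
      set I := Ioo (t₀ - r') (t₀ + r') with hI
      set c : ℝ → E2 := fun t => t • a + γ t • b with hc
      have hp0 : p = c t₀ := hch.eq_graph hS.isOpen (Metric.mem_ball_self hr) hpf
      have hIr : ∀ t ∈ I, c t ∈ Metric.ball p r := by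
        intro t ht
        rw [Metric.mem_ball, dist_eq_norm]
        conv_lhs => rw [hp0]
        refine (hch.norm_graph_sub_le t t₀).trans_lt ?_
        have : |t - t₀| < r' := by rw [abs_lt]; constructor <;> linarith [ht.1, ht.2]
        calc (1 + (K : ℝ)) * |t - t₀| < (1 + K) * r' := by gcongr
          _ = r := by
            rw [mul_comm]
            exact (eq_div_iff (by positivity : (1 + (K : ℝ)) ≠ 0)).1 hr'
      have hfin := hch.finite_frontier hS.isOpen hΓ (I := I) ordConnected_Ioo isOpen_Ioo hIr
      set T : Set ℝ := {t ∈ I | c t ∈ Γ} with hT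
      have hTo : IsOpen T := by
        obtain ⟨O, hO, hΓO⟩ := hΓ.relOpen
        have hcc : Continuous c := by
          have := hch.lip.continuous
          fun_prop
        have : T = I ∩ c ⁻¹' O := by
          ext t
          refine ⟨fun ht => ⟨ht.1, ?_⟩, fun ht => ⟨ht.1, ?_⟩⟩
          · have := ht.2; rw [hΓO] at this; exact this.1
          · rw [hΓO]; exact ⟨ht.2, hch.graph_mem_frontier hS.isOpen (hIr t ht.1)⟩
        rw [this]; exact isOpen_Ioo.inter (hO.preimage hcc)
      refine ⟨Metric.ball p (r' / 2), mem_nhdsWithin_of_mem_nhds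
        (Metric.ball_mem_nhds _ (by positivity)), (hfin.toFinset.card + 1) * ((1 + K) * 2), r' / 2,
        mul_pos (Nat.cast_add_one_pos _) (by positivity), by positivity, fun σ hσ hσr => ?_⟩
      -- between a point of `Γ` and a close boundary point outside `Γ` there is an end point of `Γ`
      have hcover : (Γ \ innerPart S Γ σ) ∩ Metric.ball p (r' / 2) ⊆
          ⋃ β ∈ hfin.toFinset, c '' Icc (β - σ) (β + σ) := by
        rintro ξ ⟨⟨hξ, hξi⟩, hξp⟩
        have hlt : Metric.infEDist ξ (frontier S \ Γ) < ENNReal.ofReal σ := by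
          by_contra hge
          exact hξi ⟨hξ, not_lt.1 hge⟩
        obtain ⟨z, hz, hξz⟩ := Metric.infEDist_lt_iff.1 hlt
        rw [edist_dist, ENNReal.ofReal_lt_ofReal_iff hσ, dist_eq_norm] at hξz
        rw [Metric.mem_ball, dist_eq_norm] at hξp
        have hzp : ‖z - p‖ < r' := by
          have e : z - p = (ξ - p) - (ξ - z) := by abel
          rw [e]
          exact (norm_sub_le _ _).trans_lt (by linarith)
        have hin : ∀ v w : E2, |⟪v, a⟫ - ⟪w, a⟫| ≤ ‖v - w‖ := by
          intro v w
          rw [← inner_sub_left]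
          simpa [hch.norm_a] using abs_real_inner_le_norm (v - w) a
        have hξI : ⟪ξ, a⟫ ∈ I := by
          have := (hin ξ p).trans_lt hξp
          rw [abs_lt] at this
          constructor <;> linarith [this.1, this.2]
        have hzI : ⟪z, a⟫ ∈ I := by
          have := (hin z p).trans_lt hzp
          rw [abs_lt] at this
          constructor <;> linarith [this.1, this.2]
        have hξc : ξ = c ⟪ξ, a⟫ := hch.eq_graph hS.isOpen
          (by rw [Metric.mem_ball, dist_eq_norm]; linarith) (hΓ.subset_frontier hξ)
        have hzc : z = c ⟪z, a⟫ := hch.eq_graph hS.isOpen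
          (by rw [Metric.mem_ball, dist_eq_norm]; linarith) hz.1
        obtain ⟨β, hβ1, hβ2⟩ := exists_mem_inter_frontier hTo
          (isPreconnected_uIcc (a := (⟪ξ, a⟫ : ℝ)) (b := ⟪z, a⟫))
          ⟨⟪ξ, a⟫, left_mem_uIcc, hξI, by rw [← hξc]; exact hξ⟩
          ⟨⟪z, a⟫, right_mem_uIcc, fun hmem => hz.2 (by rw [hzc]; exact hmem.2)⟩
        have hβI : β ∈ I := ordConnected_Ioo.uIcc_subset hξI hzI hβ1
        refine mem_iUnion₂.2 ⟨β, hfin.mem_toFinset.2 ⟨hβI, hβ2⟩, ⟪ξ, a⟫, ?_, hξc.symm⟩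
        have h1 : |β - ⟪ξ, a⟫| ≤ |⟪z, a⟫ - ⟪ξ, a⟫| := abs_sub_left_of_mem_uIcc hβ1
        have h2 := hin ξ z
        rw [abs_sub_comm] at h2
        have h3 := abs_le.1 (h1.trans (h2.trans hξz.le))
        constructor <;> linarith [h3.1, h3.2]
      -- each end point contributes an arc of length of order `σ`
      have hpiece : ∀ β : ℝ, μH[1] (c '' Icc (β - σ) (β + σ)) ≤
          ENNReal.ofReal ((1 + K) * 2 * σ) := by
        intro β
        have h1 := hausdorffMeasure_image_le_of_edist_le c (id : ℝ → ℝ) (Icc (β - σ) (β + σ))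
          (1 + K) (fun s _ t _ => by
            rw [edist_dist, edist_dist, dist_eq_norm, Real.dist_eq]
            have h2 := hch.norm_graph_sub_le s t
            have h3 : ((1 + K : ℝ≥0) : ℝ≥0∞) = ENNReal.ofReal (1 + K) := by
              rw [← ENNReal.ofReal_coe_nnreal]; simp
            rw [h3, ← ENNReal.ofReal_mul (by positivity)]
            exact ENNReal.ofReal_le_ofReal h2) (d := 1) zero_le_one
        rw [hausdorffMeasure_real, image_id, Real.volume_Icc] at h1
        refine h1.trans ?_
        have h3 : ((1 + K : ℝ≥0) : ℝ≥0∞) = ENNReal.ofReal (1 + K) := by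
          rw [← ENNReal.ofReal_coe_nnreal]; simp
        rw [h3, ENNReal.rpow_one, ← ENNReal.ofReal_mul (by positivity)]
        refine ENNReal.ofReal_le_ofReal (le_of_eq (by ring))
      calc _ ≤ _ := measure_mono hcover
        _ ≤ ∑ β ∈ hfin.toFinset, μH[1] (c '' Icc (β - σ) (β + σ)) := measure_biUnion_finset_le _ _
        _ ≤ ∑ _β ∈ hfin.toFinset, ENNReal.ofReal ((1 + K) * 2 * σ) :=
          Finset.sum_le_sum fun β _ => hpiece β
        _ = ENNReal.ofReal (hfin.toFinset.card * ((1 + K) * 2 * σ)) := by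
          rw [Finset.sum_const, nsmul_eq_mul,
            ENNReal.ofReal_mul (p := (hfin.toFinset.card : ℝ)) (Nat.cast_nonneg _),
            ENNReal.ofReal_natCast]
        _ ≤ _ := by
          refine ENNReal.ofReal_le_ofReal ?_
          have : 0 ≤ (1 + (K : ℝ)) * 2 * σ := by positivity
          nlinarith
  obtain ⟨C, σ₀, hC, hσ₀, h⟩ := key
  refine ⟨C, σ₀, hC, hσ₀, fun σ h1 h2 => ?_⟩
  refine le_trans ?_ (h σ h1 h2)
  rw [arcMeasure]
  refine (Measure.restrict_apply_le _ _).trans (measure_mono fun ξ hξ => ⟨hξ, subset_closure hξ.1⟩)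

/-! ### Canonical extensions -/

/-- Normal coordinates on the strip of width `σ` are injective and preserve the measure up to the
constant factor `c`. -/
structure IsGoodWidth (S Γ : Set E2) (c : ℝ≥0∞) (σ : ℝ) : Prop where
  ne_top : c ≠ ⊤
  measurableSet : MeasurableSet Γ
  finite : IsFiniteMeasure (arcMeasure Γ)
  measurable : Measurable (stripMap S Γ)
  continuousOn : ContinuousOn (stripMap S Γ) (Γ ×ˢ univ)
  injOn : InjOn (stripMap S Γ) (Γ ×ˢ Ioo 0 σ)
  measurableSet_strip : MeasurableSet (strip S Γ σ)
  map_le : (fibreMeasure Γ σ).map (stripMap S Γ) ≤ c • volume.restrict (strip S Γ σ)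
  le_map : volume.restrict (strip S Γ σ) ≤ c • (fibreMeasure Γ σ).map (stripMap S Γ)

namespace IsGoodWidth

variable {S Γ : Set E2} {c : ℝ≥0∞} {σ : ℝ}

lemma measurableSet_image (h : IsGoodWidth S Γ c σ) {E : Set (E2 × ℝ)} (hE : MeasurableSet E)
    (hsub : E ⊆ Γ ×ˢ Ioo 0 σ) : MeasurableSet (stripMap S Γ '' E) :=
  hE.image_of_continuousOn_injOn
    (h.continuousOn.mono (hsub.trans (prod_mono Subset.rfl (subset_univ _)))) (h.injOn.mono hsub)

lemma quasiMeasurePreserving (h : IsGoodWidth S Γ c σ) :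
    Measure.QuasiMeasurePreserving (stripMap S Γ) (fibreMeasure Γ σ)
      (volume.restrict (strip S Γ σ)) :=
  ⟨h.measurable, Measure.absolutelyContinuous_of_le_smul h.map_le⟩

/-- A property holds almost everywhere on the strip if and only if it does in normal coordinates. -/
lemma ae_strip_iff (h : IsGoodWidth S Γ c σ) {p : E2 → Prop} :
    (∀ᵐ z ∂(volume.restrict (strip S Γ σ)), p z) ↔
      ∀ᵐ x ∂(fibreMeasure Γ σ), p (stripMap S Γ x) := by
  have := h.finite
  refine ⟨fun hp => h.quasiMeasurePreserving.ae hp, fun hp => ?_⟩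
  have hms : MeasurableSet (Γ ×ˢ Ioo (0 : ℝ) σ) := h.measurableSet.prod measurableSet_Ioo
  set N := toMeasurable (fibreMeasure Γ σ) {x | ¬ p (stripMap S Γ x)} with hN
  have hN0 : fibreMeasure Γ σ N = 0 := by rw [hN, measure_toMeasurable]; exact hp
  set N' := N ∩ Γ ×ˢ Ioo (0 : ℝ) σ with hN'
  have hN'm : MeasurableSet N' := (measurableSet_toMeasurable _ _).inter hms
  have himg := h.measurableSet_image hN'm inter_subset_right
  have hnull : volume.restrict (strip S Γ σ) (stripMap S Γ '' N') = 0 := by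
    refine le_antisymm ((h.le_map _).trans ?_) bot_le
    rw [Measure.smul_apply, smul_eq_mul, Measure.map_apply h.measurable himg,
      fibreMeasure_eq_restrict h.measurableSet, Measure.restrict_apply (h.measurable himg)]
    -- by injectivity no points are added by passing to the image and back
    have hpre : stripMap S Γ ⁻¹' (stripMap S Γ '' N') ∩ Γ ×ˢ Ioo 0 σ ⊆ N ∩ Γ ×ˢ Ioo 0 σ := by
      rintro x ⟨⟨x', hx', heq⟩, hx⟩
      rw [← h.injOn hx'.2 hx heq]
      exact hx'
    have h0 : ((arcMeasure Γ).prod volume) (N ∩ Γ ×ˢ Ioo 0 σ) = 0 := by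
      rw [← Measure.restrict_apply (measurableSet_toMeasurable _ _),
        ← fibreMeasure_eq_restrict h.measurableSet]
      exact hN0
    rw [measure_mono_null hpre h0, mul_zero]
  rw [ae_restrict_iff' h.measurableSet_strip]
  rw [Measure.restrict_apply' h.measurableSet_strip] at hnull
  refine measure_mono_null ?_ hnull
  intro z hz
  simp only [mem_compl_iff, Set.mem_ofPred_eq, Classical.not_imp] at hz
  refine ⟨?_, hz.1⟩
  obtain ⟨x, hx, rfl⟩ : z ∈ stripMap S Γ '' (Γ ×ˢ Ioo 0 σ) := by
    rw [← strip_eq_image]; exact hz.1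
  exact ⟨x, ⟨subset_toMeasurable _ _ hz.2, hx⟩, rfl⟩

/-- By Fubini, being constant along almost every fibre is a statement about the product measure. -/
lemma ae_fibreMeasure_iff (h : IsGoodWidth S Γ c σ) {g G : E2 → E3}
    (hg : AEStronglyMeasurable g (arcMeasure Γ))
    (hG : AEStronglyMeasurable G (volume.restrict (strip S Γ σ))) :
    (∀ᵐ ξ ∂(arcMeasure Γ), ∀ᵐ s ∂((volume : Measure ℝ).restrict (Ioo 0 σ)),
      G (ξ - s • outerNormal S ξ) = g ξ) ↔
    ∀ᵐ x ∂(fibreMeasure Γ σ), G (stripMap S Γ x) = g x.1 := by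
  have := h.finite
  have hmem : ∀ᵐ ξ ∂(arcMeasure Γ), ξ ∈ Γ := ae_restrict_mem h.measurableSet
  constructor
  · intro hfib
    have h1 : AEStronglyMeasurable (fun x => G (stripMap S Γ x)) (fibreMeasure Γ σ) :=
      hG.comp_quasiMeasurePreserving h.quasiMeasurePreserving
    have h2 : AEStronglyMeasurable (fun x : E2 × ℝ => g x.1) (fibreMeasure Γ σ) :=
      hg.comp_quasiMeasurePreserving Measure.quasiMeasurePreserving_fst
    have h3 := (measurableSet_eq_fun h1.stronglyMeasurable_mk.measurable
      h2.stronglyMeasurable_mk.measurable).compl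
    have h4 : ∀ᵐ x ∂(fibreMeasure Γ σ), h1.mk _ x = h2.mk _ x := by
      refine Measure.measure_prod_null_of_ae_null h3 ?_
      filter_upwards [hfib, hmem, Measure.ae_ae_of_ae_prod h1.ae_eq_mk,
        Measure.ae_ae_of_ae_prod h2.ae_eq_mk] with ξ hξ hξΓ e1 e2
      have h5 : ∀ᵐ s ∂((volume : Measure ℝ).restrict (Ioo 0 σ)),
          h1.mk _ (ξ, s) = h2.mk _ (ξ, s) := by
        filter_upwards [hξ, e1, e2] with s hs e3 e4
        rw [← e3, ← e4, stripMap_of_mem (x := (ξ, s)) hξΓ]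
        exact hs
      exact h5
    filter_upwards [h1.ae_eq_mk, h2.ae_eq_mk, h4] with x e1 e2 e3
    rw [e1, e2, e3]
  · intro hfib
    filter_upwards [Measure.ae_ae_of_ae_prod hfib, hmem] with ξ hξ hξΓ
    filter_upwards [hξ] with s hs
    rwa [stripMap_of_mem (x := (ξ, s)) hξΓ] at hs

lemma _root_.LCEPlate.IsCanonicalExtension.ae_fibre (h : IsGoodWidth S Γ c σ) {g G : E2 → E3}
    (hg : AEStronglyMeasurable g (arcMeasure Γ)) (hG : IsCanonicalExtension S Γ σ g G) :
    ∀ᵐ x ∂(fibreMeasure Γ σ), G (stripMap S Γ x) = g x.1 :=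
  (h.ae_fibreMeasure_iff hg hG.memLp.aestronglyMeasurable).1 hG.eq_on_fibres

/-- Data on `Γ` have a canonical extension, namely their composition with the foot point map, and it
is unique up to null sets. -/
theorem exists_canonicalExtension (h : IsGoodWidth S Γ c σ) {g : E2 → E3}
    (hg : MemL2Sphere Γ g) :
    ∃ G : E2 → E3, IsCanonicalExtension S Γ σ g G ∧
      ∀ G' : E2 → E3, IsCanonicalExtension S Γ σ g G' →
        G' =ᵐ[volume.restrict (strip S Γ σ)] G := by
  classical
  have hfin := h.finite
  have hgm := hg.1.aestronglyMeasurable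
  set D := Γ ×ˢ Ioo (0 : ℝ) σ with hD
  have hDm : MeasurableSet D := h.measurableSet.prod measurableSet_Ioo
  -- the foot point of the fibre through a point of the strip
  set π : E2 → E2 := fun z =>
    if z ∈ strip S Γ σ then (Function.invFunOn (stripMap S Γ) D z).1 else 0 with hπ
  have hπΨ : ∀ x ∈ D, π (stripMap S Γ x) = x.1 := by
    intro x hx
    have hmem : stripMap S Γ x ∈ strip S Γ σ := by rw [strip_eq_image]; exact ⟨x, hx, rfl⟩
    simp only [hπ, if_pos hmem]
    rw [h.injOn.leftInvOn_invFunOn hx]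
  -- preimages under `π` are images of measurable sets under the injective map `stripMap`
  have hπm : Measurable π := by
    intro A hA
    have e : π ⁻¹' A = stripMap S Γ '' (D ∩ Prod.fst ⁻¹' A) ∪
        ((strip S Γ σ)ᶜ ∩ {_z | (0 : E2) ∈ A}) := by
      ext z
      by_cases hz : z ∈ strip S Γ σ
      · obtain ⟨x, hx, rfl⟩ : z ∈ stripMap S Γ '' D := by rw [hD, ← strip_eq_image]; exact hz
        simp only [mem_preimage, hπΨ x hx, mem_union, mem_inter_iff, mem_compl_iff, hz,
          not_true_eq_false, false_and, or_false]
        constructor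
        · intro hA; exact ⟨x, ⟨hx, hA⟩, rfl⟩
        · rintro ⟨x', ⟨hx', hA'⟩, heq⟩
          rw [← h.injOn hx' hx heq]; exact hA'
      · have hz' : z ∉ stripMap S Γ '' (D ∩ Prod.fst ⁻¹' A) := by
          rintro ⟨x, hx, rfl⟩
          exact hz (by rw [strip_eq_image]; exact ⟨x, hx.1, rfl⟩)
        simp [hπ, hz, hz']
    rw [e]
    exact (h.measurableSet_image (hDm.inter (measurable_fst hA)) inter_subset_left).union
      (h.measurableSet_strip.compl.inter (MeasurableSet.const _))
  set g' := hgm.mk g with hg'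
  have hgg' : ∀ᵐ x ∂(fibreMeasure Γ σ), g x.1 = g' x.1 :=
    Measure.quasiMeasurePreserving_fst.ae hgm.ae_eq_mk
  set G : E2 → E3 := fun z => g' (π z) with hG
  have hGm : StronglyMeasurable G := hgm.stronglyMeasurable_mk.comp_measurable hπm
  have hGfib : ∀ᵐ x ∂(fibreMeasure Γ σ), G (stripMap S Γ x) = g x.1 := by
    filter_upwards [hgg', ae_mem_fibreMeasure h.measurableSet σ] with x h1 h2
    rw [hG, h1]
    simp only [hπΨ x h2]
  have hnorm : ∀ᵐ z ∂(volume.restrict (strip S Γ σ)), ‖G z‖ = 1 := by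
    rw [h.ae_strip_iff]
    have h1 : ∀ᵐ x ∂(fibreMeasure Γ σ), ‖g x.1‖ = 1 :=
      Measure.quasiMeasurePreserving_fst.ae hg.2
    filter_upwards [h1, hGfib] with x h2 h3
    rw [h3, h2]
  have hvol : IsFiniteMeasure (volume.restrict (strip S Γ σ)) := by
    refine ⟨(h.le_map _).trans_lt ?_⟩
    rw [Measure.smul_apply, smul_eq_mul]
    have : IsFiniteMeasure (fibreMeasure Γ σ) := by rw [fibreMeasure]; infer_instance
    have := Measure.isFiniteMeasure_map (fibreMeasure Γ σ) (stripMap S Γ)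
    exact ENNReal.mul_lt_top h.ne_top.lt_top (measure_lt_top _ _)
  refine ⟨G, ⟨MemLp.of_bound hGm.aestronglyMeasurable 1 (hnorm.mono fun z hz => hz.le), hnorm,
    (h.ae_fibreMeasure_iff hgm hGm.aestronglyMeasurable).2 hGfib⟩, fun G' hG' => ?_⟩
  refine h.ae_strip_iff.2 ?_
  filter_upwards [hG'.ae_fibre h hgm, hGfib] with x h1 h2
  rw [h1, h2]

end IsGoodWidth

theorem HasSmoothNormal.exists_isGoodWidth {S Γ : Set E2} {L δ : ℝ} (H : HasSmoothNormal S Γ L δ)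
    (hb : Bornology.IsBounded Γ) (hΓ : MeasurableSet Γ) {ε : ℝ} (hε : 0 < ε) :
    ∃ ρ > (0 : ℝ), ∀ σ ≤ ρ, IsGoodWidth S Γ (ENNReal.ofReal (1 + ε)) σ := by
  obtain ⟨ρ, hρ, hinj, h⟩ := H.exists_strip_measure_comparison hb hΓ hε
  exact ⟨ρ, hρ, fun σ hσ => ⟨ENNReal.ofReal_ne_top, hΓ, H.isFiniteMeasure_arcMeasure hb,
    H.measurable_stripMap hΓ, H.continuousOn_stripMap,
    hinj.mono (prod_mono Subset.rfl (Ioo_subset_Ioo_right hσ)), (h σ hσ).1, (h σ hσ).2.1,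
    (h σ hσ).2.2⟩⟩

/-! ### Weak derivatives -/

section WeakDerivatives

variable {F : Type*} [NormedAddCommGroup F]

lemma sq_eLpNorm_two {X : Type*} [MeasurableSpace X] (μ : Measure X) (f : X → F) :
    eLpNorm f 2 μ ^ 2 = ∫⁻ x, ‖f x‖ₑ ^ 2 ∂μ := by
  have := eLpNorm_nnreal_pow_eq_lintegral (f := f) (μ := μ) (p := 2) (by norm_num)
  simpa using this

variable [NormedSpace ℝ F]

lemma integrable_test_smul {μ : Measure E2} {φ : E2 → ℝ} (hφ : Continuous φ)
    (hc : HasCompactSupport φ) {u : E2 → F} (hu : Integrable u μ) :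
    Integrable (fun x => φ x • u x) μ := by
  obtain ⟨C, hC⟩ := hc.exists_bound_of_continuous hφ
  exact hu.bdd_smul C hφ.aestronglyMeasurable (Eventually.of_forall hC)

lemma continuous_partial {n : WithTop ℕ∞} {φ : E2 → F} (hφ : ContDiff ℝ n φ) (hn : n ≠ 0)
    (i : Fin 2) :
    Continuous fun x => fderiv ℝ φ x (dir i) :=
  (hφ.continuous_fderiv hn).clm_apply continuous_const

lemma hasCompactSupport_partial {φ : E2 → F} (hc : HasCompactSupport φ) (i : Fin 2) :
    HasCompactSupport fun x => fderiv ℝ φ x (dir i) :=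
  hc.fderiv_apply (𝕜 := ℝ) (dir i)

lemma IsWeakPartial.ae_eq [CompleteSpace F] {S : Set E2} (hS : IsOpen S) {i : Fin 2}
    {u v v' : E2 → F} (h : IsWeakPartial S i u v) (h' : IsWeakPartial S i u v')
    (hv : IntegrableOn v S) (hv' : IntegrableOn v' S) : v =ᵐ[volume.restrict S] v' := by
  have h0 : ∀ᵐ x, x ∈ S → v x - v' x = 0 := by
    refine IsOpen.ae_eq_zero_of_integral_contDiff_smul_eq_zero hS
      (hv.sub hv').locallyIntegrableOn fun φ hφ hc hsub => ?_
    have e : ∫ x, φ x • (v x - v' x) = ∫ x in S, φ x • (v x - v' x) := by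
      refine (setIntegral_eq_integral_of_forall_compl_eq_zero fun x hx => ?_).symm
      rw [image_eq_zero_of_notMem_tsupport (fun hx' => hx (hsub hx')), zero_smul]
    rw [e]
    have e2 : ∀ x, φ x • (v x - v' x) = φ x • v x - φ x • v' x := fun x => smul_sub _ _ _
    simp_rw [e2]
    rw [integral_sub (integrable_test_smul hφ.continuous hc hv)
      (integrable_test_smul hφ.continuous hc hv')]
    have h1 := h φ hφ hc hsub
    rw [h' φ hφ hc hsub, neg_inj] at h1
    rw [h1, sub_self]
  rw [Filter.EventuallyEq, ae_restrict_iff' hS.measurableSet]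
  filter_upwards [h0] with x hx hxS
  exact sub_eq_zero.1 (hx hxS)

/-- `u ∈ L²(S)` has the weak gradient `v = (v₀, v₁) ∈ L²(S)`. -/
structure HasWeakGrad (S : Set E2) (u : E2 → F) (v : Fin 2 → E2 → F) : Prop where
  memLp : MemLp u 2 (volume.restrict S)
  memLp_grad : ∀ i, MemLp (v i) 2 (volume.restrict S)
  weak : ∀ i, IsWeakPartial S i u (v i)

lemma MemH1.hasWeakGrad {S : Set E2} {u : E2 → F} (h : MemH1 S u) :
    HasWeakGrad S u fun i => weakPartial S i u := by
  refine ⟨h.1, fun i => ?_, fun i => ?_⟩ <;>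
  · simp only [weakPartial, dif_pos (h.2 i)]
    first
    | exact (h.2 i).choose_spec.1
    | exact (h.2 i).choose_spec.2

lemma HasWeakGrad.memH1 {S : Set E2} {u : E2 → F} {v : Fin 2 → E2 → F} (h : HasWeakGrad S u v) :
    MemH1 S u := ⟨h.memLp, fun i => ⟨v i, h.memLp_grad i, h.weak i⟩⟩

lemma IsWeakPartial.congr {S : Set E2} {i : Fin 2} {u u' v v' : E2 → F}
    (h : IsWeakPartial S i u v) (hu : u =ᵐ[volume.restrict S] u')
    (hv : v =ᵐ[volume.restrict S] v') : IsWeakPartial S i u' v' := by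
  intro φ hφ hc hsub
  have h1 := h φ hφ hc hsub
  rw [integral_congr_ae (g := fun x => fderiv ℝ φ x (dir i) • u' x)
    (by filter_upwards [hu] with x hx; rw [hx]),
    integral_congr_ae (μ := volume.restrict S) (f := fun x => φ x • v x) (g := fun x => φ x • v' x)
    (by filter_upwards [hv] with x hx; rw [hx])] at h1
  exact h1

lemma HasWeakGrad.congr {S : Set E2} {u u' : E2 → F} {v v' : Fin 2 → E2 → F}
    (h : HasWeakGrad S u v) (hu : u =ᵐ[volume.restrict S] u')
    (hv : ∀ i, v i =ᵐ[volume.restrict S] v' i) : HasWeakGrad S u' v' :=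
  ⟨h.memLp.ae_eq hu, fun i => (h.memLp_grad i).ae_eq (hv i), fun i => (h.weak i).congr hu (hv i)⟩

lemma HasWeakGrad.integrable {S : Set E2} [IsFiniteMeasure ((volume : Measure E2).restrict S)]
    {u : E2 → F} {v : Fin 2 → E2 → F} (h : HasWeakGrad S u v) : IntegrableOn u S :=
  h.memLp.integrable one_le_two

lemma HasWeakGrad.integrable_grad {S : Set E2}
    [IsFiniteMeasure ((volume : Measure E2).restrict S)]
    {u : E2 → F} {v : Fin 2 → E2 → F} (h : HasWeakGrad S u v) (i : Fin 2) : IntegrableOn (v i) S :=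
  (h.memLp_grad i).integrable one_le_two

lemma HasWeakGrad.weakPartial_ae_eq [CompleteSpace F] {S : Set E2} (hS : IsOpen S)
    [IsFiniteMeasure ((volume : Measure E2).restrict S)] {u : E2 → F} {v : Fin 2 → E2 → F}
    (h : HasWeakGrad S u v) (i : Fin 2) : weakPartial S i u =ᵐ[volume.restrict S] v i :=
  (h.memH1.hasWeakGrad.weak i).ae_eq hS (h.weak i) (h.memH1.hasWeakGrad.integrable_grad i)
    (h.integrable_grad i)

lemma IsWeakPartial.add {S : Set E2} {i : Fin 2} {u u' v v' : E2 → F}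
    (h : IsWeakPartial S i u v) (h' : IsWeakPartial S i u' v')
    (hu : IntegrableOn u S) (hu' : IntegrableOn u' S)
    (hv : IntegrableOn v S) (hv' : IntegrableOn v' S) :
    IsWeakPartial S i (fun x => u x + u' x) (fun x => v x + v' x) := by
  intro φ hφ hc hsub
  have hp := continuous_partial hφ (by simp) i
  have hpc := hasCompactSupport_partial hc i
  simp_rw [smul_add]
  rw [integral_add (integrable_test_smul hp hpc hu) (integrable_test_smul hp hpc hu'),
    integral_add (integrable_test_smul hφ.continuous hc hv)
      (integrable_test_smul hφ.continuous hc hv'), h φ hφ hc hsub, h' φ hφ hc hsub, neg_add]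

lemma IsWeakPartial.clm_comp [CompleteSpace F] {G : Type*} [NormedAddCommGroup G] [NormedSpace ℝ G]
    [CompleteSpace G] (A : F →L[ℝ] G) {S : Set E2} {i : Fin 2} {u v : E2 → F}
    (h : IsWeakPartial S i u v) (hu : IntegrableOn u S) (hv : IntegrableOn v S) :
    IsWeakPartial S i (fun x => A (u x)) (fun x => A (v x)) := by
  intro φ hφ hc hsub
  have hp := continuous_partial hφ (by simp) i
  have hpc := hasCompactSupport_partial hc i
  simp_rw [← map_smul]
  rw [A.integral_comp_comm (integrable_test_smul hp hpc hu),
    A.integral_comp_comm (integrable_test_smul hφ.continuous hc hv), h φ hφ hc hsub, map_neg]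

lemma HasWeakGrad.add {S : Set E2} [IsFiniteMeasure ((volume : Measure E2).restrict S)]
    {u u' : E2 → F} {v v' : Fin 2 → E2 → F}
    (h : HasWeakGrad S u v) (h' : HasWeakGrad S u' v') :
    HasWeakGrad S (fun x => u x + u' x) (fun i x => v i x + v' i x) :=
  ⟨h.memLp.add h'.memLp, fun i => (h.memLp_grad i).add (h'.memLp_grad i), fun i =>
    (h.weak i).add (h'.weak i) h.integrable h'.integrable (h.integrable_grad i)
      (h'.integrable_grad i)⟩

lemma HasWeakGrad.clm_comp [CompleteSpace F] {G : Type*} [NormedAddCommGroup G] [NormedSpace ℝ G]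
    [CompleteSpace G] (A : F →L[ℝ] G) {S : Set E2}
    [IsFiniteMeasure ((volume : Measure E2).restrict S)] {u : E2 → F} {v : Fin 2 → E2 → F}
    (h : HasWeakGrad S u v) : HasWeakGrad S (fun x => A (u x)) (fun i x => A (v i x)) :=
  ⟨A.comp_memLp' h.memLp, fun i => A.comp_memLp' (h.memLp_grad i), fun i =>
    (h.weak i).clm_comp A h.integrable (h.integrable_grad i)⟩

lemma HasWeakGrad.sub [CompleteSpace F] {S : Set E2}
    [IsFiniteMeasure ((volume : Measure E2).restrict S)]
    {u u' : E2 → F} {v v' : Fin 2 → E2 → F}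
    (h : HasWeakGrad S u v) (h' : HasWeakGrad S u' v') :
    HasWeakGrad S (fun x => u x - u' x) (fun i x => v i x - v' i x) := by
  have := h.add (h'.clm_comp (-(ContinuousLinearMap.id ℝ F)))
  simpa [sub_eq_add_neg] using this

/-- Product rule with a smooth compactly supported factor `ζ`; the test function need only vanish
outside `S` on the support of `ζ`. -/
lemma IsWeakPartial.integral_smooth_smul {S : Set E2} {i : Fin 2} {u v : E2 → F} {ζ : E2 → ℝ}
    (hζ : ContDiff ℝ ∞ ζ) (hζc : HasCompactSupport ζ) (h : IsWeakPartial S i u v)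
    (hu : IntegrableOn u S) (hv : IntegrableOn v S) {φ : E2 → ℝ} (hφ : ContDiff ℝ ∞ φ)
    (hc : HasCompactSupport φ) (hsub : tsupport φ ∩ tsupport ζ ⊆ S) :
    ∫ x in S, fderiv ℝ φ x (dir i) • (ζ x • u x) =
      -∫ x in S, φ x • (fderiv ℝ ζ x (dir i) • u x + ζ x • v x) := by
  have h1 := h (fun x => φ x * ζ x) (hφ.mul hζ) hc.mul_right
    ((subset_inter (closure_mono (Function.support_mul_subset_left φ ζ))
      (closure_mono (Function.support_mul_subset_right φ ζ))).trans hsub)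
  have hd : ∀ x, fderiv ℝ (fun x => φ x * ζ x) x (dir i) =
      φ x * fderiv ℝ ζ x (dir i) + ζ x * fderiv ℝ φ x (dir i) := by
    intro x
    have e := fderiv_fun_mul (𝕜 := ℝ) (hφ.differentiable (by simp) x)
      (hζ.differentiable (by simp) x)
    rw [e]; simp
  have hφ' := continuous_partial hφ (by simp) i
  have hφc' := hasCompactSupport_partial hc i
  have hζ' := continuous_partial hζ (by simp) i
  have hζc' := hasCompactSupport_partial hζc i
  have i1 : Integrable (fun x => φ x • fderiv ℝ ζ x (dir i) • u x) (volume.restrict S) :=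
    integrable_test_smul hφ.continuous hc (integrable_test_smul hζ' hζc' hu)
  have i2 : Integrable (fun x => fderiv ℝ φ x (dir i) • ζ x • u x) (volume.restrict S) :=
    integrable_test_smul hφ' hφc' (integrable_test_smul hζ.continuous hζc hu)
  have i3 : Integrable (fun x => φ x • ζ x • v x) (volume.restrict S) :=
    integrable_test_smul hφ.continuous hc (integrable_test_smul hζ.continuous hζc hv)
  have e1 : ∀ x, fderiv ℝ (fun x => φ x * ζ x) x (dir i) • u x =
      φ x • fderiv ℝ ζ x (dir i) • u x + fderiv ℝ φ x (dir i) • ζ x • u x := by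
    intro x; rw [hd, add_smul, smul_smul, smul_smul, mul_comm (ζ x)]
  simp_rw [e1, mul_smul] at h1
  rw [integral_add i1 i2] at h1
  simp_rw [smul_add]
  rw [integral_add i1 i3, neg_add, ← h1]
  abel

end WeakDerivatives

/-! ### Mollification -/

section Mollification

variable {F : Type*} [NormedAddCommGroup F]

/-- Translations are continuous in `L²`. -/
lemma exists_eLpNorm_translate_sub_le {f : E2 → F} (hf : MemLp f 2 volume)
    {ε : ℝ≥0∞} (hε : 0 < ε) :
    ∃ r > (0 : ℝ), ∀ z : E2, ‖z‖ < r → eLpNorm (fun x => f (x - z) - f x) 2 volume ≤ ε := by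
  have : Fact ((2 : ℝ≥0∞) ≠ ⊤) := ⟨by norm_num⟩
  set f' := hf.toLp f with hf'
  have hcont : Continuous fun z : E2 => (DomAddAct.mk (-z)) +ᵥ f' :=
    (DomAddAct.continuous_mk.comp continuous_neg).vadd continuous_const
  have h0 : (DomAddAct.mk (-(0 : E2))) +ᵥ f' = f' := by simp
  have ht := hcont.tendsto 0
  rw [h0] at ht
  have hev := ht.eventually (Metric.eball_mem_nhds f' hε)
  obtain ⟨r, hr, hb⟩ := Metric.eventually_nhds_iff.1 hev
  refine ⟨r, hr, fun z hz => ?_⟩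
  have h1 : edist (DomAddAct.mk (-z) +ᵥ f') f' < ε := hb (y := z) (by simpa using hz)
  rw [hf', DomAddAct.mk_vadd_toLp, Lp.edist_toLp_toLp] at h1
  refine le_of_eq_of_le (congrArg (eLpNorm · 2 volume) ?_) h1.le
  ext x
  simp only [Pi.sub_apply, vadd_eq_add, sub_eq_neg_add]

variable [NormedSpace ℝ F]

/-- The convolution `∫ ρ(z) g(x - z) dz`. -/
noncomputable def mollify (ρ : E2 → ℝ) (g : E2 → F) (x : E2) : F := ∫ z, ρ z • g (x - z)

lemma mollify_eq_convolution (ρ : E2 → ℝ) (g : E2 → F) :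
    mollify ρ g = convolution ρ g (ContinuousLinearMap.lsmul ℝ ℝ) volume := rfl

lemma mollify_eq_integral_sub (ρ : E2 → ℝ) (g : E2 → F) (x : E2) :
    mollify ρ g x = ∫ y, ρ (x - y) • g y := by
  rw [mollify, ← integral_sub_left_eq_self _ volume x]
  simp

/-- A nonnegative smooth weight of total mass one, supported in the ball of radius `r`. -/
structure IsMollifier (ρ : E2 → ℝ) (r : ℝ) : Prop where
  nonneg : ∀ z, 0 ≤ ρ z
  contDiff : ContDiff ℝ ∞ ρ
  compact : HasCompactSupport ρ
  integral_eq : ∫ z, ρ z = 1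
  norm_lt : ∀ z, ρ z ≠ 0 → ‖z‖ < r

lemma IsMollifier.integrable {ρ : E2 → ℝ} {r : ℝ} (h : IsMollifier ρ r) : Integrable ρ :=
  h.contDiff.continuous.integrable_of_hasCompactSupport h.compact

lemma IsMollifier.contDiff_mollify {ρ : E2 → ℝ} {r : ℝ} (h : IsMollifier ρ r) [CompleteSpace F]
    {g : E2 → F} (hg : LocallyIntegrable g) : ContDiff ℝ ∞ (mollify ρ g) := by
  rw [mollify_eq_convolution]
  exact h.compact.contDiff_convolution_left _ h.contDiff hg

lemma IsMollifier.norm_mollify_le {ρ : E2 → ℝ} {r : ℝ} (h : IsMollifier ρ r) {g : E2 → F} {B : ℝ}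
    (hg : ∀ᵐ x, ‖g x‖ ≤ B) (x : E2) : ‖mollify ρ g x‖ ≤ B := by
  have h1 : ∀ᵐ z, ‖g (x - z)‖ ≤ B :=
    (quasiMeasurePreserving_sub_left_of_right_invariant volume x).ae hg
  calc ‖mollify ρ g x‖ ≤ ∫ z, ρ z * B := by
        refine norm_integral_le_of_norm_le (h.integrable.mul_const B) ?_
        filter_upwards [h1] with z hz
        rw [norm_smul, Real.norm_of_nonneg (h.nonneg z)]
        exact mul_le_mul_of_nonneg_left hz (h.nonneg z)
    _ = B := by rw [integral_mul_const, h.integral_eq, one_mul]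

/-- The distance of a function to its mollification is an average of its distances to its
translates. -/
lemma IsMollifier.eLpNorm_mollify_sub_le {ρ : E2 → ℝ} {r : ℝ} (h : IsMollifier ρ r)
    [CompleteSpace F] {g : E2 → F} (hg : MemLp g 2 volume) {ε : ℝ≥0∞}
    (hε : ∀ z : E2, ‖z‖ < r → eLpNorm (fun x => g (x - z) - g x) 2 volume ≤ ε) :
    eLpNorm (fun x => mollify ρ g x - g x) 2 volume ≤ ε := by
  set μ : Measure E2 := volume.withDensity fun z => ENNReal.ofReal (ρ z) with hμ
  have hρm : Measurable fun z => ENNReal.ofReal (ρ z) :=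
    h.contDiff.continuous.measurable.ennreal_ofReal
  have hprob : IsProbabilityMeasure μ := by
    refine ⟨?_⟩
    rw [hμ, withDensity_apply _ MeasurableSet.univ, Measure.restrict_univ,
      ← ofReal_integral_eq_lintegral_ofReal h.integrable (Eventually.of_forall h.nonneg),
      h.integral_eq, ENNReal.ofReal_one]
  have hsf : SFinite μ := inferInstance
  have hloc : LocallyIntegrable g := hg.locallyIntegrable one_le_two
  have hac : μ ≪ volume := withDensity_absolutelyContinuous _ _
  have hgm := hg.aestronglyMeasurable
  have hpair : AEStronglyMeasurable (fun p : E2 × E2 => g (p.1 - p.2) - g p.1)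
      ((volume : Measure E2).prod volume) :=
    (hgm.comp_quasiMeasurePreserving
        (quasiMeasurePreserving_sub_of_right_invariant volume volume)).sub
      (hgm.comp_quasiMeasurePreserving Measure.quasiMeasurePreserving_fst)
  -- Jensen's inequality for the probability measure `μ = ρ dz`, in the form `L² ⊆ L¹`
  have hpt : ∀ x, ‖mollify ρ g x - g x‖ₑ ^ 2 ≤ ∫⁻ z, ‖g (x - z) - g x‖ₑ ^ 2 ∂μ := by
    intro x
    have hi1 : Integrable fun z => ρ z • g (x - z) :=
      (h.compact.convolutionExists_left (ContinuousLinearMap.lsmul ℝ ℝ) h.contDiff.continuous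
        hloc) x
    have hi2 : Integrable fun z => ρ z • g x := h.integrable.smul_const _
    have e1 : mollify ρ g x - g x = ∫ z, ρ z • (g (x - z) - g x) := by
      simp_rw [smul_sub]
      rw [integral_sub hi1 hi2, integral_smul_const, h.integral_eq, one_smul, mollify]
    have hm : AEStronglyMeasurable (fun z => g (x - z) - g x) volume :=
      (hgm.comp_quasiMeasurePreserving
        (quasiMeasurePreserving_sub_left_of_right_invariant volume x)).sub
        aestronglyMeasurable_const
    have e2 : ‖mollify ρ g x - g x‖ₑ ≤ eLpNorm (fun z => g (x - z) - g x) 1 μ := by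
      rw [e1, eLpNorm_one_eq_lintegral_enorm, hμ,
        lintegral_withDensity_eq_lintegral_mul₀ hρm.aemeasurable hm.enorm]
      refine (enorm_integral_le_lintegral_enorm _).trans (lintegral_mono fun z => ?_)
      rw [enorm_smul, Pi.mul_apply, Real.enorm_of_nonneg (h.nonneg z)]
    have e3 := e2.trans (eLpNorm_le_eLpNorm_of_exponent_le one_le_two (hm.mono_ac hac))
    calc _ ≤ eLpNorm (fun z => g (x - z) - g x) 2 μ ^ 2 := by gcongr
      _ = _ := sq_eLpNorm_two _ _
  rw [← ENNReal.pow_le_pow_left_iff (two_ne_zero), sq_eLpNorm_two]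
  calc ∫⁻ x, ‖mollify ρ g x - g x‖ₑ ^ 2
      ≤ ∫⁻ x, ∫⁻ z, ‖g (x - z) - g x‖ₑ ^ 2 ∂μ := lintegral_mono hpt
    _ = ∫⁻ z, ∫⁻ x, ‖g (x - z) - g x‖ₑ ^ 2 ∂volume ∂μ := by
        refine lintegral_lintegral_swap ?_
        refine ((hpair.mono_ac ?_).enorm.pow_const 2)
        exact Measure.AbsolutelyContinuous.rfl.prod hac
    _ ≤ ∫⁻ _, ε ^ 2 ∂μ := by
        refine lintegral_mono_ae ?_
        have : ∀ᵐ z ∂μ, ‖z‖ < r := by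
          rw [hμ, ae_withDensity_iff hρm]
          refine Eventually.of_forall fun z hz => h.norm_lt z fun h0 => hz (by simp [h0])
        filter_upwards [this] with z hz
        rw [← sq_eLpNorm_two]
        gcongr
        exact hε z hz
    _ = ε ^ 2 := by simp

lemma IsMollifier.fderiv_mollify_apply {ρ : E2 → ℝ} {r : ℝ} (h : IsMollifier ρ r) [CompleteSpace F]
    {g : E2 → F} (hg : LocallyIntegrable g) (x w : E2) :
    fderiv ℝ (mollify ρ g) x w = ∫ z, fderiv ℝ ρ z w • g (x - z) := by
  have hd := h.compact.hasFDerivAt_convolution_left (ContinuousLinearMap.lsmul ℝ ℝ)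
    (h.contDiff.of_le (by simp)) hg x
  have hρ' : Continuous fun z => fderiv ℝ ρ z := h.contDiff.continuous_fderiv (by simp)
  have hex := ((h.compact.fderiv ℝ).convolutionExists_left
      ((ContinuousLinearMap.lsmul ℝ ℝ : ℝ →L[ℝ] F →L[ℝ] F).precompL E2) hρ' hg) x
  have e := ContinuousLinearMap.integral_apply hex w
  rw [mollify_eq_convolution, hd.fderiv, convolution_def, e]
  rfl

/-- If the test function `ρ(x - ·)` sees only points of `S` on the support of `ζ`, mollification
commutes with weak differentiation at `x`. -/
lemma IsMollifier.fderiv_mollify {ρ : E2 → ℝ} {r : ℝ} (h : IsMollifier ρ r) [CompleteSpace F]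
    {S : Set E2} (hS : MeasurableSet S) {i : Fin 2} {u v : E2 → F} {ζ : E2 → ℝ}
    (hζ : ContDiff ℝ ∞ ζ) (hζc : HasCompactSupport ζ) (huv : IsWeakPartial S i u v)
    (hu : IntegrableOn u S) (hv : IntegrableOn v S) {x : E2}
    (hx : ∀ y ∈ tsupport ζ, x - y ∈ tsupport ρ → y ∈ S) :
    fderiv ℝ (mollify ρ (S.indicator fun y => ζ y • u y)) x (dir i) =
      mollify ρ (S.indicator fun y => fderiv ℝ ζ y (dir i) • u y + ζ y • v y) x := by
  have hint : Integrable (S.indicator fun y => ζ y • u y) :=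
    (integrable_indicator_iff hS).2 (integrable_test_smul hζ.continuous hζc hu)
  have hloc := hint.locallyIntegrable
  have hsub : ContDiff ℝ ∞ fun y => ρ (x - y) :=
    h.contDiff.comp (contDiff_const.sub contDiff_id)
  have hcs : HasCompactSupport fun y => ρ (x - y) :=
    h.compact.comp_homeomorph (Homeomorph.subLeft x)
  have hts : tsupport (fun y => ρ (x - y)) ⊆ (fun y => x - y) ⁻¹' tsupport ρ :=
    tsupport_comp_subset_preimage ρ (f := fun y => x - y) (by fun_prop)
  have hfd : ∀ y, fderiv ℝ (fun y => ρ (x - y)) y (dir i) = -fderiv ℝ ρ (x - y) (dir i) := by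
    intro y
    have h1 : HasFDerivAt (fun y => ρ (x - y))
        ((fderiv ℝ ρ (x - y)).comp (-ContinuousLinearMap.id ℝ E2)) y :=
      ((h.contDiff.differentiable (by simp) (x - y)).hasFDerivAt).comp y
        ((hasFDerivAt_id y).const_sub x)
    rw [h1.fderiv]; simp
  -- test the weak derivative of `ζ u` with `ρ(x - ·)`
  have hkey := huv.integral_smooth_smul hζ hζc hu hv hsub hcs
    (fun y hy => hx y hy.2 (hts hy.1))
  rw [h.fderiv_mollify_apply hloc, mollify_eq_integral_sub]
  rw [← integral_sub_left_eq_self _ volume x]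
  simp_rw [sub_sub_cancel]
  have e2 : ∀ (k : E2 → ℝ) (w : E2 → F), ∫ y, k y • S.indicator w y = ∫ y in S, k y • w y := by
    intro k w
    rw [← integral_indicator hS]
    congr 1; ext y
    by_cases hy : y ∈ S <;> simp [hy]
  rw [e2 (fun y => fderiv ℝ ρ (x - y) (dir i)), e2 (fun y => ρ (x - y))]
  simp_rw [hfd, neg_smul, integral_neg] at hkey
  exact neg_inj.1 hkey

end Mollification

/-! ### Approximation by smooth functions -/

/-- A Lipschitz domain satisfies a uniform cone condition near each point of its closure. -/
lemma IsBoundedLipschitzDomain.exists_cone {S : Set E2} (hS : IsBoundedLipschitzDomain S) {x₀ : E2}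
    (hx₀ : x₀ ∈ closure S) : ∃ R > (0 : ℝ), ∃ e : E2, ‖e‖ ≤ 1 ∧ ∃ κ > (0 : ℝ), κ ≤ 1 ∧
      ∃ t₀ > (0 : ℝ),
      ∀ x ∈ S, x ∈ Metric.ball x₀ R → ∀ t ∈ Ioo 0 t₀, Metric.ball (x + t • e) (t * κ) ⊆ S := by
  by_cases hxS : x₀ ∈ S
  · obtain ⟨r, hr, hb⟩ := Metric.isOpen_iff.1 hS.isOpen x₀ hxS
    refine ⟨r / 2, by positivity, 0, by simp, 1, one_pos, le_rfl, r / 2, by positivity,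
      fun x _ hxb t ht z hz => hb ?_⟩
    simp only [smul_zero, add_zero, mul_one, Metric.mem_ball] at hz hxb ⊢
    have := dist_triangle z x x₀
    linarith [ht.2]
  · have hfr : x₀ ∈ frontier S := by rw [hS.isOpen.frontier_eq]; exact ⟨hx₀, hxS⟩
    obtain ⟨r, a, b, K, γ, hc⟩ := hS.exists_chart hfr
    have hr := hc.r_pos
    have hK : (0 : ℝ) < 1 + K := by positivity
    refine ⟨r / 2, by positivity, b, hc.norm_b.le, 1 / (1 + K), by positivity, ?_, r / 4,
      by positivity, fun x hx hxb t ht z hz => ?_⟩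
    · rw [div_le_one hK]; linarith [K.2]
    have ht0 := ht.1
    obtain ⟨h, rfl⟩ : ∃ h, z = x + t • b + h := ⟨z - (x + t • b), by abel⟩
    rw [Metric.mem_ball, dist_eq_norm, add_sub_cancel_left, mul_one_div, lt_div_iff₀ hK] at hz
    rw [Metric.mem_ball, dist_eq_norm] at hxb
    have hx' : x ∈ Metric.ball x₀ r := by rw [Metric.mem_ball, dist_eq_norm]; linarith
    have hh : ‖h‖ ≤ t := by nlinarith [norm_nonneg h, K.2, mul_nonneg (norm_nonneg h) K.2]
    have hz' : x + t • b + h ∈ Metric.ball x₀ r := by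
      rw [Metric.mem_ball, dist_eq_norm]
      have e : x + t • b + h - x₀ = (x - x₀) + (t • b + h) := by abel
      rw [e]
      have h1 := norm_add_le (x - x₀) (t • b + h)
      have h2 := norm_add_le (t • b) h
      rw [norm_smul, hc.norm_b, Real.norm_of_nonneg ht0.le] at h2
      linarith [ht.2]
    rw [hc.mem_iff _ hz']
    have hxm := (hc.mem_iff x hx').1 hx
    have hba : ⟪b, a⟫ = (0 : ℝ) := by rw [real_inner_comm]; exact hc.inner_ab
    have hbb : ⟪b, b⟫ = (1 : ℝ) := by rw [real_inner_self_eq_norm_sq, hc.norm_b]; norm_num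
    have ea : ⟪x + t • b + h, a⟫ = ⟪x, a⟫ + ⟪h, a⟫ := by
      rw [inner_add_left, inner_add_left, real_inner_smul_left, hba]; ring
    have eb : ⟪x + t • b + h, b⟫ = ⟪x, b⟫ + t + ⟪h, b⟫ := by
      rw [inner_add_left, inner_add_left, real_inner_smul_left, hbb]; ring
    have hna : |⟪h, a⟫| ≤ ‖h‖ := by
      have := abs_real_inner_le_norm h a; rwa [hc.norm_a, mul_one] at this
    have hnb : |⟪h, b⟫| ≤ ‖h‖ := by
      have := abs_real_inner_le_norm h b; rwa [hc.norm_b, mul_one] at this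
    have hlip := hc.lip.dist_le_mul (⟪x, a⟫ + ⟪h, a⟫) ⟪x, a⟫
    rw [Real.dist_eq, Real.dist_eq, add_sub_cancel_left] at hlip
    have h3 := (abs_le.1 hlip).2
    have h4 := (abs_le.1 hnb).1
    have h5 : (K : ℝ) * |⟪h, a⟫| ≤ K * ‖h‖ := by gcongr
    rw [ea, eb]
    nlinarith

section Density

variable {F : Type*} [NormedAddCommGroup F] [NormedSpace ℝ F]

lemma memLp_test_smul {μ : Measure E2} {φ : E2 → ℝ} (hφ : Continuous φ)
    (hc : HasCompactSupport φ) {u : E2 → F} (hu : MemLp u 2 μ) :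
    MemLp (fun x => φ x • u x) 2 μ := by
  obtain ⟨C, hC⟩ := hc.exists_bound_of_continuous hφ
  refine hu.of_le_mul (c := C) (hφ.aestronglyMeasurable.smul hu.aestronglyMeasurable)
    (Eventually.of_forall fun x => ?_)
  rw [norm_smul]
  gcongr
  exact hC x

/-- The mollifier centred at `-t e`, of radius `t κ / 2`: it averages over the part
`x + t e + B(0, t κ / 2)` of the cone at `x`. -/
lemma exists_isMollifier_cone {e : E2} (he : ‖e‖ ≤ 1) {κ : ℝ} (hκ : 0 < κ) (hκ1 : κ ≤ 1) {t : ℝ}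
    (ht : 0 < t) : ∃ ρ, IsMollifier ρ (2 * t) ∧
      ∀ x y : E2, x - y ∈ tsupport ρ → y ∈ Metric.ball (x + t • e) (t * κ) := by
  have htκ : 0 < t * κ := mul_pos ht hκ
  let f : ContDiffBump (-(t • e)) := ⟨t * κ / 4, t * κ / 2, by linarith, by linarith⟩
  have htκ1 : t * κ ≤ t := by nlinarith
  refine ⟨f.normed volume, ⟨f.nonneg_normed, f.contDiff_normed, f.hasCompactSupport_normed,
    f.integral_normed, fun z hz => ?_⟩, fun x y hxy => ?_⟩
  · have h1 : z ∈ Function.support (f.normed volume) := hz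
    rw [f.support_normed_eq, Metric.mem_ball, dist_eq_norm, sub_neg_eq_add] at h1
    have h2 := norm_sub_le (z + t • e) (t • e)
    rw [add_sub_cancel_right, norm_smul, Real.norm_of_nonneg ht.le] at h2
    have h3 : t * ‖e‖ ≤ t := by nlinarith
    change ‖z + t • e‖ < t * κ / 2 at h1
    linarith
  · rw [f.tsupport_normed_eq, Metric.mem_closedBall, dist_eq_norm] at hxy
    change _ ≤ t * κ / 2 at hxy
    rw [Metric.mem_ball, dist_eq_norm]
    have e1 : y - (x + t • e) = -(x - y - -(t • e)) := by abel
    rw [e1, norm_neg]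
    linarith

lemma eLpNorm_restrict_sub_indicator_le {G : Type*} [NormedAddCommGroup G] {S : Set E2}
    (hS : MeasurableSet S) (φ w : E2 → G) :
    eLpNorm (fun x => φ x - w x) 2 (volume.restrict S) ≤
      eLpNorm (fun x => φ x - S.indicator w x) 2 volume := by
  refine le_trans (le_of_eq (eLpNorm_congr_ae ?_)) (eLpNorm_mono_measure _ Measure.restrict_le_self)
  filter_upwards [ae_restrict_mem hS] with x hx
  rw [indicator_of_mem hx]

/-- A Sobolev function localized to a set on which a cone condition holds is approximated by its
mollifications inside the cone. -/
lemma HasWeakGrad.exists_local_approx [CompleteSpace F] {S : Set E2} (hS : IsOpen S)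
    [IsFiniteMeasure ((volume : Measure E2).restrict S)] {u : E2 → F} {v : Fin 2 → E2 → F}
    (h : HasWeakGrad S u v) {x₀ : E2} {R : ℝ} (hR : 0 < R) {e : E2} (he : ‖e‖ ≤ 1) {κ : ℝ}
    (hκ : 0 < κ) (hκ1 : κ ≤ 1) {t₀ : ℝ} (ht₀ : 0 < t₀)
    (hcone : ∀ x ∈ S, x ∈ Metric.ball x₀ R → ∀ t ∈ Ioo 0 t₀, Metric.ball (x + t • e) (t * κ) ⊆ S)
    {ζ : E2 → ℝ} (hζ : ContDiff ℝ ∞ ζ) (hζR : tsupport ζ ⊆ Metric.ball x₀ (R / 2))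
    (hζ01 : ∀ x, ζ x ∈ Icc (0 : ℝ) 1) {ε : ℝ≥0∞} (hε : 0 < ε) :
    ∃ φ : E2 → F, ContDiff ℝ ∞ φ ∧
      eLpNorm (fun x => φ x - ζ x • u x) 2 (volume.restrict S) ≤ ε ∧
      (∀ i, eLpNorm (fun x => fderiv ℝ φ x (dir i) -
        (fderiv ℝ ζ x (dir i) • u x + ζ x • v i x)) 2 (volume.restrict S) ≤ ε) ∧
      ∀ B : ℝ, 0 ≤ B → (∀ᵐ x ∂(volume.restrict S), ‖u x‖ ≤ B) → ∀ x, ‖φ x‖ ≤ B := by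
  have hζc : HasCompactSupport ζ :=
    (Metric.isBounded_ball.subset hζR).isCompact_closure.of_isClosed_subset (isClosed_tsupport _)
      subset_closure
  have hSm := hS.measurableSet
  have m0 : MemLp (S.indicator fun y => ζ y • u y) 2 volume :=
    (memLp_indicator_iff_restrict hSm).2 (memLp_test_smul hζ.continuous hζc h.memLp)
  have m1 : ∀ i, MemLp (S.indicator fun y => fderiv ℝ ζ y (dir i) • u y + ζ y • v i y) 2 volume :=
    fun i => (memLp_indicator_iff_restrict hSm).2
      ((memLp_test_smul (continuous_partial hζ (by simp) i) (hasCompactSupport_partial hζc i)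
        h.memLp).add (memLp_test_smul hζ.continuous hζc (h.memLp_grad i)))
  obtain ⟨r0, hr0, h0⟩ := exists_eLpNorm_translate_sub_le m0 hε
  obtain ⟨r1, hr1, h1⟩ := exists_eLpNorm_translate_sub_le (m1 0) hε
  obtain ⟨r2, hr2, h2⟩ := exists_eLpNorm_translate_sub_le (m1 1) hε
  obtain ⟨t, ht0, htt⟩ : ∃ t : ℝ, 0 < t ∧
      t < min (min (min r0 r1) (min r2 (R / 2))) t₀ / 2 :=
    exists_between (by positivity)
  obtain ⟨ρ, hρ, hρs⟩ := exists_isMollifier_cone he hκ hκ1 ht0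
  have ht1 : 2 * t < r0 ∧ 2 * t < r1 ∧ 2 * t < r2 ∧ 2 * t < R / 2 ∧ t < t₀ := by
    have := (lt_div_iff₀ (two_pos)).1 htt
    simp only [lt_min_iff] at this
    refine ⟨?_, ?_, ?_, ?_, ?_⟩ <;>
      linarith [this.1.1.1, this.1.1.2, this.1.2.1, this.1.2.2, this.2]
  -- on `S` the mollification only sees the cone at `x`, hence commutes with differentiation
  have hder : ∀ x ∈ S, ∀ i, fderiv ℝ (mollify ρ (S.indicator fun y => ζ y • u y)) x (dir i) =
      mollify ρ (S.indicator fun y => fderiv ℝ ζ y (dir i) • u y + ζ y • v i y) x := by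
    intro x hx i
    refine hρ.fderiv_mollify hSm hζ hζc (h.weak i) h.integrable (h.integrable_grad i)
      fun y hy hxy => ?_
    have hyb := hρs x y hxy
    refine hcone x hx ?_ t ⟨ht0, ht1.2.2.2.2⟩ hyb
    rw [Metric.mem_ball] at hyb ⊢
    have hy' := Metric.mem_ball.1 (hζR hy)
    have d1 : dist (x + t • e) x ≤ t := by
      rw [dist_eq_norm, add_sub_cancel_left, norm_smul, Real.norm_of_nonneg ht0.le]
      nlinarith
    have d2 := dist_triangle4 x (x + t • e) y x₀
    rw [dist_comm x (x + t • e), dist_comm (x + t • e) y] at d2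
    have d3 : t * κ ≤ t := by nlinarith
    linarith [ht1.2.2.2.1]
  refine ⟨mollify ρ (S.indicator fun y => ζ y • u y),
    hρ.contDiff_mollify (m0.locallyIntegrable one_le_two), ?_, fun i => ?_, fun B hB0 hB x => ?_⟩
  · exact (eLpNorm_restrict_sub_indicator_le hSm _ _).trans
      (hρ.eLpNorm_mollify_sub_le m0 fun z hz => h0 z (hz.trans ht1.1))
  · have e1 : eLpNorm (fun x => fderiv ℝ (mollify ρ (S.indicator fun y => ζ y • u y)) x (dir i) -
        (fderiv ℝ ζ x (dir i) • u x + ζ x • v i x)) 2 (volume.restrict S) =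
        eLpNorm (fun x => mollify ρ (S.indicator fun y =>
          fderiv ℝ ζ y (dir i) • u y + ζ y • v i y) x -
        (fderiv ℝ ζ x (dir i) • u x + ζ x • v i x)) 2 (volume.restrict S) := by
      refine eLpNorm_congr_ae ?_
      filter_upwards [ae_restrict_mem hSm] with x hx
      rw [hder x hx i]
    rw [e1]
    refine (eLpNorm_restrict_sub_indicator_le hSm _ _).trans (hρ.eLpNorm_mollify_sub_le (m1 i) ?_)
    fin_cases i
    · exact fun z hz => h1 z (hz.trans ht1.2.1)
    · exact fun z hz => h2 z (hz.trans ht1.2.2.1)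
  · refine hρ.norm_mollify_le ?_ x
    filter_upwards [(ae_restrict_iff' hSm).1 hB] with y hy
    by_cases hyS : y ∈ S
    · rw [indicator_of_mem hyS, norm_smul, Real.norm_of_nonneg (hζ01 y).1]
      nlinarith [hy hyS, (hζ01 y).2, (hζ01 y).1, norm_nonneg (u y)]
    · rw [indicator_of_notMem hyS, norm_zero]; exact hB0

open scoped Manifold in
/-- Smooth functions on the plane are dense in `H¹(S)`, with uniform bounds for bounded
functions. -/
theorem IsBoundedLipschitzDomain.exists_smooth_approx [CompleteSpace F] {S : Set E2}
    (hS : IsBoundedLipschitzDomain S) [IsFiniteMeasure ((volume : Measure E2).restrict S)] :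
    ∃ J : ℝ, 0 ≤ J ∧ ∀ (u : E2 → F) (v : Fin 2 → E2 → F), HasWeakGrad S u v →
      ∃ φ : ℕ → E2 → F, (∀ k, ContDiff ℝ ∞ (φ k)) ∧
        Tendsto (fun k => eLpNorm (fun x => φ k x - u x) 2 (volume.restrict S)) atTop (𝓝 0) ∧
        (∀ i, Tendsto (fun k => eLpNorm (fun x => fderiv ℝ (φ k) x (dir i) - v i x) 2
          (volume.restrict S)) atTop (𝓝 0)) ∧
        ∀ B : ℝ, 0 ≤ B → (∀ᵐ x ∂(volume.restrict S), ‖u x‖ ≤ B) → ∀ k x, ‖φ k x‖ ≤ J * B := by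
  have hcomp : IsCompact (closure S) := hS.isBounded.isCompact_closure
  choose! R hR e he κ hκ hκ1 t₀ ht₀ hcone using fun x (hx : x ∈ closure S) => hS.exists_cone hx
  obtain ⟨T, hTc, hTcov⟩ := hcomp.elim_nhds_subcover (fun x => Metric.ball x (R x / 2))
    fun x hx => Metric.ball_mem_nhds x (half_pos (hR x hx))
  -- localize with a partition of unity subordinate to balls on which the cone condition holds
  obtain ⟨f, hf⟩ := SmoothPartitionOfUnity.exists_isSubordinate 𝓘(ℝ, E2) isClosed_closure
    (fun x : T => Metric.ball (x : E2) (R x / 2)) (fun _ => Metric.isOpen_ball) (by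
      intro x hx; have := hTcov hx; simpa using this)
  have hζ : ∀ j, ContDiff ℝ ∞ (f j) := fun j => contMDiff_iff_contDiff.1 (f j).contMDiff
  have hsum : ∀ x ∈ S, ∑ j, f j x = 1 := fun x hx => by
    rw [← finsum_eq_sum_of_fintype]; exact f.sum_eq_one (subset_closure hx)
  have hdsum : ∀ x ∈ S, ∀ i, ∑ j, fderiv ℝ (f j) x (dir i) = 0 := fun x hx i => by
    have h1 : fderiv ℝ (fun y => ∑ j, f j y) x = 0 := by
      have : (fun y => ∑ j, f j y) =ᶠ[𝓝 x] fun _ => (1 : ℝ) := by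
        filter_upwards [hS.isOpen.mem_nhds hx] with y hy using hsum y hy
      rw [this.fderiv_eq]; simp
    rw [fderiv_fun_sum fun j _ => (hζ j).differentiable (by simp) x] at h1
    have := congrArg (fun A : E2 →L[ℝ] ℝ => A (dir i)) h1
    simpa using this
  refine ⟨T.card, by positivity, fun u v h => ?_⟩
  have hex : ∀ (k : ℕ) (j : T), _ := fun k j =>
    h.exists_local_approx hS.isOpen (hR j (hTc j j.2)) (he j (hTc j j.2)) (hκ j (hTc j j.2))
      (hκ1 j (hTc j j.2)) (ht₀ j (hTc j j.2)) (hcone j (hTc j j.2)) (hζ j) (hf j)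
      (fun x => ⟨f.nonneg j x, f.le_one j x⟩) (ε := ENNReal.ofReal (1 / (k + 1)))
      (ENNReal.ofReal_pos.2 (by positivity))
  choose φ hφ hφ0 hφ1 hφB using hex
  have hlim : Tendsto (fun k : ℕ => (T.card : ℝ≥0∞) * ENNReal.ofReal (1 / ((k : ℝ) + 1))) atTop
      (𝓝 0) := by
    have h1 := ENNReal.tendsto_ofReal (tendsto_one_div_add_atTop_nhds_zero_nat (𝕜 := ℝ))
    have h2 := ENNReal.Tendsto.const_mul (a := (T.card : ℝ≥0∞)) h1 (Or.inr (by simp))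
    simpa using h2
  -- the errors of the localized approximations add up to at most `|T| / (k + 1)`
  have hest : ∀ (k : ℕ) (g : T → E2 → F) (w : E2 → F) (wj : T → E2 → F),
      (∀ x ∈ S, ∑ j, wj j x = w x) → (∀ j, AEStronglyMeasurable (fun x => g j x - wj j x)
        (volume.restrict S)) →
      (∀ j, eLpNorm (fun x => g j x - wj j x) 2 (volume.restrict S) ≤
        ENNReal.ofReal (1 / (k + 1))) →
      eLpNorm (fun x => ∑ j, g j x - w x) 2 (volume.restrict S) ≤
        T.card * ENNReal.ofReal (1 / ((k : ℝ) + 1)) := by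
    intro k g w wj hw hm hj
    have e1 : eLpNorm (fun x => ∑ j, g j x - w x) 2 (volume.restrict S) =
        eLpNorm (∑ j, fun x => g j x - wj j x) 2 (volume.restrict S) := by
      refine eLpNorm_congr_ae ?_
      filter_upwards [ae_restrict_mem hS.isOpen.measurableSet] with x hx
      rw [Finset.sum_apply, Finset.sum_sub_distrib, hw x hx]
    rw [e1]
    refine (eLpNorm_sum_le (fun j _ => hm j) one_le_two).trans ?_
    refine (Finset.sum_le_card_nsmul _ _ _ fun j _ => hj j).trans (le_of_eq ?_)
    simp
  have hζc : ∀ j, HasCompactSupport (f j) := fun j =>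
    (Metric.isBounded_ball.subset (hf j)).isCompact_closure.of_isClosed_subset
      (isClosed_tsupport _) subset_closure
  refine ⟨fun k x => ∑ j, φ k j x, fun k => ContDiff.sum fun j _ => hφ k j, ?_, fun i => ?_,
    fun B hB0 hB k x => ?_⟩
  · refine tendsto_of_tendsto_of_tendsto_of_le_of_le tendsto_const_nhds hlim (fun _ => bot_le)
      fun k => hest k (φ k) u (fun j x => f j x • u x) (fun x hx => ?_) (fun j => ?_) (hφ0 k)
    · rw [← Finset.sum_smul, hsum x hx, one_smul]
    · exact (hφ k j).continuous.aestronglyMeasurable.sub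
        (memLp_test_smul (hζ j).continuous (hζc j) h.memLp).aestronglyMeasurable
  · have e2 : ∀ k x, fderiv ℝ (fun x => ∑ j, φ k j x) x (dir i) =
        ∑ j, fderiv ℝ (φ k j) x (dir i) := fun k x => by
      rw [fderiv_fun_sum fun j _ => (hφ k j).differentiable (by simp) x]; simp
    simp_rw [e2]
    refine tendsto_of_tendsto_of_tendsto_of_le_of_le tendsto_const_nhds hlim (fun _ => bot_le)
      fun k => hest k (fun j x => fderiv ℝ (φ k j) x (dir i)) (v i)
        (fun j x => fderiv ℝ (f j) x (dir i) • u x + f j x • v i x) (fun x hx => ?_) (fun j => ?_)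
        (fun j => hφ1 k j i)
    · rw [Finset.sum_add_distrib, ← Finset.sum_smul, ← Finset.sum_smul, hsum x hx, hdsum x hx i,
        one_smul, zero_smul, zero_add]
    · exact (continuous_partial (hφ k j) (by simp) i).aestronglyMeasurable.sub
        ((memLp_test_smul (continuous_partial (hζ j) (by simp) i)
          (hasCompactSupport_partial (hζc j) i) h.memLp).add
          (memLp_test_smul (hζ j).continuous (hζc j) (h.memLp_grad i))).aestronglyMeasurable
  · calc ‖∑ j, φ k j x‖ ≤ ∑ j : T, ‖φ k j x‖ := norm_sum_le _ _
      _ ≤ ∑ _j : T, B := Finset.sum_le_sum fun j _ => hφB k j B hB0 hB x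
      _ = T.card * B := by simp

end Density

/-! ### Strong and weak convergence in `L²` -/

section L2

variable {X : Type*} [MeasurableSpace X] {μ : Measure X}

lemma tendsto_toLp {F : Type*} [NormedAddCommGroup F] {f : ℕ → X → F} {g : X → F}
    (hf : ∀ k, MemLp (f k) 2 μ) (hg : MemLp g 2 μ)
    (h : Tendsto (fun k => eLpNorm (fun x => f k x - g x) 2 μ) atTop (𝓝 0)) :
    Tendsto (fun k => (hf k).toLp (f k)) atTop (𝓝 (hg.toLp g)) :=
  (Lp.tendsto_Lp_iff_tendsto_eLpNorm'' f hf g hg).2 h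

section Bilinear

variable {F G H : Type*} [NormedAddCommGroup F] [NormedSpace ℝ F] [NormedAddCommGroup G]
  [NormedSpace ℝ G] [NormedAddCommGroup H] [NormedSpace ℝ H]

lemma integrable_bilin (B : F →L[ℝ] G →L[ℝ] H) {f : X → F} {g : X → G} (hf : MemLp f 2 μ)
    (hg : MemLp g 2 μ) : Integrable (fun x => B (f x) (g x)) μ := by
  refine Integrable.mono' ((hf.norm.integrable_mul hg.norm).const_mul ‖B‖)
    (B.aestronglyMeasurable_comp₂ hf.aestronglyMeasurable hg.aestronglyMeasurable)
    (Eventually.of_forall fun x => ?_)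
  simpa [mul_assoc] using B.le_opNorm₂ (f x) (g x)

variable [CompleteSpace H]

lemma lpPairing_toLp (B : F →L[ℝ] G →L[ℝ] H) {f : X → F} {g : X → G} (hf : MemLp f 2 μ)
    (hg : MemLp g 2 μ) :
    B.lpPairing μ 2 2 (hf.toLp f) (hg.toLp g) = ∫ x, B (f x) (g x) ∂μ := by
  rw [ContinuousLinearMap.lpPairing_eq_integral]
  refine integral_congr_ae ?_
  filter_upwards [hf.coeFn_toLp, hg.coeFn_toLp] with x h1 h2
  rw [h1, h2]

lemma tendsto_integral_bilin (B : F →L[ℝ] G →L[ℝ] H) {f : ℕ → X → F} {f₀ : X → F}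
    {g : ℕ → X → G} {g₀ : X → G} (hf : ∀ k, MemLp (f k) 2 μ) (hf₀ : MemLp f₀ 2 μ)
    (hg : ∀ k, MemLp (g k) 2 μ) (hg₀ : MemLp g₀ 2 μ)
    (hft : Tendsto (fun k => eLpNorm (fun x => f k x - f₀ x) 2 μ) atTop (𝓝 0))
    (hgt : Tendsto (fun k => eLpNorm (fun x => g k x - g₀ x) 2 μ) atTop (𝓝 0)) :
    Tendsto (fun k => ∫ x, B (f k x) (g k x) ∂μ) atTop (𝓝 (∫ x, B (f₀ x) (g₀ x) ∂μ)) := by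
  have h2 := ((B.lpPairing μ 2 2).continuous₂.tendsto (hf₀.toLp f₀, hg₀.toLp g₀)).comp
    ((tendsto_toLp hf hf₀ hft).prodMk_nhds (tendsto_toLp hg hg₀ hgt))
  simp only [Function.uncurry] at h2
  rw [lpPairing_toLp] at h2
  refine h2.congr fun k => ?_
  exact lpPairing_toLp B (hf k) (hg k)

end Bilinear

variable {G : Type*} [NormedAddCommGroup G] [InnerProductSpace ℝ G]

/-- Weak convergence in `L²(μ; G)`. -/
def WeakL2 (μ : Measure X) (f : ℕ → X → G) (f₀ : X → G) : Prop :=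
  ∀ h : X → G, MemLp h 2 μ →
    Tendsto (fun k => ∫ x, ⟪h x, f k x⟫ ∂μ) atTop (𝓝 (∫ x, ⟪h x, f₀ x⟫ ∂μ))

lemma inner_toLp {f g : X → G} (hf : MemLp f 2 μ) (hg : MemLp g 2 μ) :
    ⟪hf.toLp f, hg.toLp g⟫ = ∫ x, ⟪f x, g x⟫ ∂μ := by
  rw [L2.inner_def]
  refine integral_congr_ae ?_
  filter_upwards [hf.coeFn_toLp, hg.coeFn_toLp] with x h1 h2
  rw [h1, h2]

lemma WeakL2.of_strong {f : ℕ → X → G} {f₀ : X → G} (hf : ∀ k, MemLp (f k) 2 μ)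
    (hf₀ : MemLp f₀ 2 μ) (h : Tendsto (fun k => eLpNorm (fun x => f k x - f₀ x) 2 μ) atTop (𝓝 0)) :
    WeakL2 μ f f₀ := fun w hw => by
  have := (tendsto_toLp hf hf₀ h).inner (tendsto_const_nhds (x := hw.toLp w)) (𝕜 := ℝ)
  simp_rw [inner_toLp] at this
  simpa only [real_inner_comm] using this

lemma WeakL2.subseq {f : ℕ → X → G} {f₀ : X → G} (h : WeakL2 μ f f₀) {θ : ℕ → ℕ}
    (hθ : StrictMono θ) : WeakL2 μ (fun k => f (θ k)) f₀ :=
  fun w hw => (h w hw).comp hθ.tendsto_atTop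

lemma WeakL2.congr {f f' : ℕ → X → G} {f₀ f₀' : X → G} (h : WeakL2 μ f f₀)
    (hf : ∀ k, f k =ᵐ[μ] f' k) (hf₀ : f₀ =ᵐ[μ] f₀') : WeakL2 μ f' f₀' := by
  intro w hw
  have e : ∫ x, ⟪w x, f₀ x⟫ ∂μ = ∫ x, ⟪w x, f₀' x⟫ ∂μ :=
    integral_congr_ae (by filter_upwards [hf₀] with x hx; rw [hx])
  rw [← e]
  refine (h w hw).congr fun k => integral_congr_ae ?_
  filter_upwards [hf k] with x hx
  rw [hx]

/-- The pairing of a strongly and a weakly convergent sequence converges. -/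
lemma WeakL2.tendsto_integral {f : ℕ → X → G} {f₀ : X → G} (h : WeakL2 μ f f₀)
    (hf : ∀ k, MemLp (f k) 2 μ) {C : ℝ}
    (hC : ∀ k, eLpNorm (f k) 2 μ ≤ ENNReal.ofReal C) {w : ℕ → X → G} {w₀ : X → G}
    (hw : ∀ k, MemLp (w k) 2 μ) (hw₀ : MemLp w₀ 2 μ)
    (ht : Tendsto (fun k => eLpNorm (fun x => w k x - w₀ x) 2 μ) atTop (𝓝 0)) :
    Tendsto (fun k => ∫ x, ⟪w k x, f k x⟫ ∂μ) atTop (𝓝 (∫ x, ⟪w₀ x, f₀ x⟫ ∂μ)) := by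
  have h1 := tendsto_toLp hw hw₀ ht
  have h2 : Tendsto (fun k => ⟪(hw k).toLp (w k) - hw₀.toLp w₀, (hf k).toLp (f k)⟫) atTop
      (𝓝 0) := by
    refine squeeze_zero_norm (a := fun k => ‖(hw k).toLp (w k) - hw₀.toLp w₀‖ * max C 0)
      (fun k => ?_) ?_
    · refine (norm_inner_le_norm _ _).trans (mul_le_mul_of_nonneg_left ?_ (norm_nonneg _))
      rw [Lp.norm_toLp]
      have := ENNReal.toReal_mono ENNReal.ofReal_ne_top (hC k)
      rwa [ENNReal.toReal_ofReal'] at this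
    · simpa using (tendsto_iff_norm_sub_tendsto_zero.1 h1).mul_const (max C 0)
  have h3 := h2.add (h w₀ hw₀)
  rw [zero_add] at h3
  refine h3.congr fun k => ?_
  rw [inner_sub_left, inner_toLp, inner_toLp]
  ring

/-- Bounded sequences in a separable `L²` space have weakly convergent subsequences. -/
lemma exists_weakL2_subseq [CompleteSpace G] [TopologicalSpace.SeparableSpace G] [IsSeparable μ]
    {f : ℕ → X → G} (hf : ∀ k, MemLp (f k) 2 μ) {C : ℝ}
    (hC : ∀ k, eLpNorm (f k) 2 μ ≤ ENNReal.ofReal C) :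
    ∃ (f₀ : X → G) (θ : ℕ → ℕ), StrictMono θ ∧ MemLp f₀ 2 μ ∧ WeakL2 μ (fun k => f (θ k)) f₀ := by
  have : Fact ((2 : ℝ≥0∞) ≠ ⊤) := ⟨by norm_num⟩
  -- sequential Banach–Alaoglu in the dual of the separable Hilbert space `L²`
  let D := InnerProductSpace.toDual ℝ (Lp G 2 μ)
  let a : ℕ → WeakDual ℝ (Lp G 2 μ) := fun k => StrongDual.toWeakDual (D ((hf k).toLp (f k)))
  have ha : ∀ k, a k ∈ WeakDual.toStrongDual ⁻¹'
      Metric.closedBall (0 : StrongDual ℝ (Lp G 2 μ)) (max C 0) := by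
    intro k
    have e : ‖D ((hf k).toLp (f k))‖ ≤ max C 0 := by
      rw [LinearIsometryEquiv.norm_map, Lp.norm_toLp]
      have := ENNReal.toReal_mono ENNReal.ofReal_ne_top (hC k)
      rwa [ENNReal.toReal_ofReal'] at this
    rw [mem_preimage, Metric.mem_closedBall]
    exact (dist_zero_right (D ((hf k).toLp (f k)))).trans_le e
  obtain ⟨b, -, θ, hθ, hlim⟩ := WeakDual.isSeqCompact_closedBall ℝ (Lp G 2 μ) 0 (max C 0) ha
  set g := D.symm (WeakDual.toStrongDual b) with hg
  refine ⟨g, θ, hθ, Lp.memLp g, fun w hw => ?_⟩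
  have h1 := ((WeakDual.eval_continuous (hw.toLp w)).tendsto b).comp hlim
  have e0 : b (hw.toLp w) = ∫ x, ⟪w x, g x⟫ ∂μ := by
    have : b (hw.toLp w) = ⟪g, hw.toLp w⟫ := by
      rw [hg, InnerProductSpace.toDual_symm_apply]; rfl
    rw [this, real_inner_comm]
    conv_lhs => rw [← Lp.toLp_coeFn g (Lp.memLp g)]
    rw [inner_toLp]
  have e1 : ∀ k, a (θ k) (hw.toLp w) = ∫ x, ⟪w x, f (θ k) x⟫ ∂μ := fun k => by
    have : a (θ k) (hw.toLp w) = ⟪(hf (θ k)).toLp (f (θ k)), hw.toLp w⟫ := rfl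
    rw [this, real_inner_comm, inner_toLp]
  rw [← e0]
  refine Tendsto.congr e1 ?_
  exact h1

/-- Integral functionals with nonnegative convex continuous integrand are weakly lower
semicontinuous on `L²`: their sublevel sets are convex and closed. -/
lemma lintegral_le_of_weakL2 [CompleteSpace G] {Φ : G → ℝ} (hΦ : ConvexOn ℝ univ Φ)
    (hΦc : Continuous Φ) (hΦ0 : ∀ a, 0 ≤ Φ a) {f : ℕ → X → G} {f₀ : X → G}
    (hf : ∀ k, MemLp (f k) 2 μ) (hf₀ : MemLp f₀ 2 μ) (h : WeakL2 μ f f₀) {c : ℝ≥0∞}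
    (hc : ∀ k, ∫⁻ x, ENNReal.ofReal (Φ (f k x)) ∂μ ≤ c) :
    ∫⁻ x, ENNReal.ofReal (Φ (f₀ x)) ∂μ ≤ c := by
  set A : Set (Lp G 2 μ) := {g | ∫⁻ x, ENNReal.ofReal (Φ (g x)) ∂μ ≤ c} with hA
  have hmeas : ∀ g : Lp G 2 μ, AEMeasurable (fun x => ENNReal.ofReal (Φ (g x))) μ := fun g =>
    (hΦc.comp_aestronglyMeasurable (Lp.aestronglyMeasurable g)).aemeasurable.ennreal_ofReal
  have htoLp : ∀ {g : X → G} (hg : MemLp g 2 μ),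
      hg.toLp g ∈ A ↔ ∫⁻ x, ENNReal.ofReal (Φ (g x)) ∂μ ≤ c := fun hg => by
    rw [hA, mem_ofPred_eq, lintegral_congr_ae]
    filter_upwards [hg.coeFn_toLp] with x hx
    rw [hx]
  have hconv : Convex ℝ A := by
    intro g hg g' hg' s t hs ht hst
    have e : ∀ᵐ x ∂μ, ENNReal.ofReal (Φ ((s • g + t • g' : Lp G 2 μ) x)) ≤
        ENNReal.ofReal s * ENNReal.ofReal (Φ (g x)) +
          ENNReal.ofReal t * ENNReal.ofReal (Φ (g' x)) := by
      filter_upwards [Lp.coeFn_add (s • g) (t • g'), Lp.coeFn_smul s g, Lp.coeFn_smul t g']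
        with x h1 h2 h3
      rw [h1, Pi.add_apply, h2, h3, Pi.smul_apply, Pi.smul_apply, ← ENNReal.ofReal_mul hs,
        ← ENNReal.ofReal_mul ht, ← ENNReal.ofReal_add (mul_nonneg hs (hΦ0 _))
          (mul_nonneg ht (hΦ0 _))]
      exact ENNReal.ofReal_le_ofReal (hΦ.2 (mem_univ _) (mem_univ _) hs ht hst)
    calc ∫⁻ x, ENNReal.ofReal (Φ ((s • g + t • g' : Lp G 2 μ) x)) ∂μ
        ≤ ∫⁻ x, (ENNReal.ofReal s * ENNReal.ofReal (Φ (g x)) +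
          ENNReal.ofReal t * ENNReal.ofReal (Φ (g' x))) ∂μ := lintegral_mono_ae e
      _ = ENNReal.ofReal s * ∫⁻ x, ENNReal.ofReal (Φ (g x)) ∂μ +
          ENNReal.ofReal t * ∫⁻ x, ENNReal.ofReal (Φ (g' x)) ∂μ := by
        rw [lintegral_add_left' ((hmeas g).const_mul _), lintegral_const_mul'' _ (hmeas g),
          lintegral_const_mul'' _ (hmeas g')]
      _ ≤ ENNReal.ofReal s * c + ENNReal.ofReal t * c := by gcongr <;> assumption
      _ = c := by rw [← add_mul, ← ENNReal.ofReal_add hs ht, hst, ENNReal.ofReal_one, one_mul]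
  have hclosed : IsClosed A := by
    -- Fatou's lemma along an almost everywhere convergent subsequence
    refine IsSeqClosed.isClosed fun g g₀ hg hlim => ?_
    have h1 : TendstoInMeasure μ (fun k => (g k : X → G)) atTop g₀ :=
      tendstoInMeasure_of_tendsto_Lp hlim
    obtain ⟨θ, -, hae⟩ := h1.exists_seq_tendsto_ae
    calc ∫⁻ x, ENNReal.ofReal (Φ (g₀ x)) ∂μ
        = ∫⁻ x, liminf (fun k => ENNReal.ofReal (Φ (g (θ k) x))) atTop ∂μ := by
          refine lintegral_congr_ae ?_
          filter_upwards [hae] with x hx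
          exact (((ENNReal.continuous_ofReal.comp hΦc).tendsto _).comp hx).liminf_eq.symm
      _ ≤ liminf (fun k => ∫⁻ x, ENNReal.ofReal (Φ (g (θ k) x)) ∂μ) atTop :=
          lintegral_liminf_le' fun k => hmeas _
      _ ≤ c := liminf_le_of_le (by isBoundedDefault) fun b hb => by
          obtain ⟨k, hk⟩ := hb.exists
          exact hk.trans (hg (θ k))
  rw [← htoLp hf₀]
  -- otherwise a functional separates the limit strictly from the sublevel set
  by_contra hn
  obtain ⟨ℓ, s, hs1, hs2⟩ := geometric_hahn_banach_closed_point hconv hclosed hn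
  set w := (InnerProductSpace.toDual ℝ (Lp G 2 μ)).symm ℓ with hw
  have hℓ : ∀ {g : X → G} (hg : MemLp g 2 μ), ℓ (hg.toLp g) = ∫ x, ⟪w x, g x⟫ ∂μ := fun hg => by
    rw [← InnerProductSpace.toDual_symm_apply, ← hw]
    conv_lhs => rw [← Lp.toLp_coeFn w (Lp.memLp w)]
    rw [inner_toLp]
  have h1 := h w (Lp.memLp w)
  rw [hℓ] at hs2
  have h2 : ∫ x, ⟪w x, f₀ x⟫ ∂μ ≤ s := le_of_tendsto h1 (Eventually.of_forall fun k => by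
    rw [← hℓ (hf k)]
    exact (hs1 _ ((htoLp (hf k)).2 (hc k))).le)
  linarith

end L2

/-! ### Calculus in `H¹` -/

section ProductRule

variable {F G H : Type*} [NormedAddCommGroup F] [NormedSpace ℝ F] [NormedAddCommGroup G]
  [NormedSpace ℝ G] [NormedAddCommGroup H] [NormedSpace ℝ H]

lemma isFiniteMeasure_restrict {S : Set E2} (hS : Bornology.IsBounded S) :
    IsFiniteMeasure ((volume : Measure E2).restrict S) :=
  ⟨by rw [Measure.restrict_apply_univ]; exact hS.measure_lt_top⟩

lemma memLp_of_continuous {F : Type*} [NormedAddCommGroup F] {S : Set E2}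
    (hS : Bornology.IsBounded S) (hSm : MeasurableSet S) {φ : E2 → F} (hφ : Continuous φ) :
    MemLp φ 2 (volume.restrict S) := by
  have := isFiniteMeasure_restrict hS
  obtain ⟨C, hC⟩ := hS.isCompact_closure.exists_bound_of_continuousOn hφ.continuousOn
  refine MemLp.of_bound hφ.aestronglyMeasurable C ?_
  filter_upwards [ae_restrict_mem hSm] with x hx using hC x (subset_closure hx)

/-- Smooth functions on the plane are Sobolev functions on bounded sets. -/
lemma hasWeakGrad_of_contDiff {S : Set E2} (hS : Bornology.IsBounded S) (hSm : MeasurableSet S)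
    {φ : E2 → F} (hφ : ContDiff ℝ ∞ φ) : HasWeakGrad S φ fun i x => fderiv ℝ φ x (dir i) := by
  refine ⟨memLp_of_continuous hS hSm hφ.continuous, fun i =>
    memLp_of_continuous hS hSm (continuous_partial hφ (by simp) i), fun i η hη hηc hηS => ?_⟩
  have h1 := integral_smul_fderiv_eq_neg_fderiv_smul_of_integrable (μ := (volume : Measure E2))
    (f := η) (g := φ) (v := dir i)
    (((continuous_partial hη (by simp) i).smul hφ.continuous).integrable_of_hasCompactSupport
      (hasCompactSupport_partial hηc i).smul_right)
    ((hη.continuous.smul (continuous_partial hφ (by simp) i)).integrable_of_hasCompactSupport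
      hηc.smul_right)
    ((hη.continuous.smul hφ.continuous).integrable_of_hasCompactSupport hηc.smul_right)
    (fun x _ => hη.differentiable (by simp) x) (fun x _ => hφ.differentiable (by simp) x)
  have hz : ∀ x ∉ S, η x = 0 := fun x hx => image_eq_zero_of_notMem_tsupport fun h => hx (hηS h)
  have hz' : ∀ x ∉ S, fderiv ℝ η x = 0 := fun x hx =>
    image_eq_zero_of_notMem_tsupport fun h => hx (hηS (tsupport_fderiv_subset ℝ h))
  rw [setIntegral_eq_integral_of_forall_compl_eq_zero (fun x hx => by rw [hz' x hx]; simp),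
    setIntegral_eq_integral_of_forall_compl_eq_zero (fun x hx => by rw [hz x hx, zero_smul]), h1,
    neg_neg]

lemma tendsto_eLpNorm_test_smul {S : Set E2} {χ : E2 → ℝ} (hχ : Continuous χ)
    (hχc : HasCompactSupport χ) {f : ℕ → E2 → F} {f₀ : E2 → F}
    (h : Tendsto (fun k => eLpNorm (fun x => f k x - f₀ x) 2 (volume.restrict S)) atTop (𝓝 0)) :
    Tendsto (fun k => eLpNorm (fun x => χ x • f k x - χ x • f₀ x) 2 (volume.restrict S)) atTop
      (𝓝 0) := by
  obtain ⟨C, hC⟩ := hχc.exists_bound_of_continuous hχ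
  have h1 := ENNReal.Tendsto.const_mul h (a := ENNReal.ofReal C) (Or.inr ENNReal.ofReal_ne_top)
  rw [mul_zero] at h1
  refine tendsto_of_tendsto_of_tendsto_of_le_of_le tendsto_const_nhds h1 (fun _ => bot_le)
    fun k => eLpNorm_le_mul_eLpNorm_of_ae_le_mul (Eventually.of_forall fun x => ?_) 2
  rw [← smul_sub, norm_smul]
  exact mul_le_mul_of_nonneg_right (hC x) (norm_nonneg _)

/-- The product rule for a bilinear map applied to two Sobolev functions. -/
lemma HasWeakGrad.isWeakPartial_bilin [CompleteSpace F] [CompleteSpace G] [CompleteSpace H]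
    {S : Set E2} (hS : IsBoundedLipschitzDomain S) (B : F →L[ℝ] G →L[ℝ] H) {u : E2 → F}
    {u' : Fin 2 → E2 → F} {v : E2 → G} {v' : Fin 2 → E2 → G} (hu : HasWeakGrad S u u')
    (hv : HasWeakGrad S v v') (i : Fin 2) :
    IsWeakPartial S i (fun x => B (u x) (v x)) (fun x => B (u' i x) (v x) + B (u x) (v' i x)) := by
  have := isFiniteMeasure_restrict hS.isBounded
  have hSm := hS.isOpen.measurableSet
  obtain ⟨_, -, hJ⟩ := hS.exists_smooth_approx (F := F)
  obtain ⟨φ, hφ, hφ0, hφ1, -⟩ := hJ u u' hu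
  obtain ⟨_, -, hJ⟩ := hS.exists_smooth_approx (F := G)
  obtain ⟨ψ, hψ, hψ0, hψ1, -⟩ := hJ v v' hv
  intro η hη hηc hηS
  have hη' := continuous_partial hη (by simp) i
  have hηc' := hasCompactSupport_partial hηc i
  have mφ := fun k => memLp_of_continuous hS.isBounded hSm (hφ k).continuous
  have mψ := fun k => memLp_of_continuous hS.isBounded hSm (hψ k).continuous
  have mφ' := fun k => memLp_of_continuous hS.isBounded hSm
    (continuous_partial (hφ k) (by simp) i)
  have mψ' := fun k => memLp_of_continuous hS.isBounded hSm
    (continuous_partial (hψ k) (by simp) i)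
  have t0 := tendsto_integral_bilin B (fun k => memLp_test_smul hη' hηc' (mφ k))
    (memLp_test_smul hη' hηc' hu.memLp) mψ hv.memLp
    (tendsto_eLpNorm_test_smul hη' hηc' hφ0) hψ0
  have t1 := tendsto_integral_bilin B (fun k => memLp_test_smul hη.continuous hηc (mφ' k))
    (memLp_test_smul hη.continuous hηc (hu.memLp_grad i)) mψ hv.memLp
    (tendsto_eLpNorm_test_smul hη.continuous hηc (hφ1 i)) hψ0
  have t2 := tendsto_integral_bilin B (fun k => memLp_test_smul hη.continuous hηc (mφ k))
    (memLp_test_smul hη.continuous hηc hu.memLp) mψ' (hv.memLp_grad i)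
    (tendsto_eLpNorm_test_smul hη.continuous hηc hφ0) (hψ1 i)
  have i1 := integrable_bilin B (memLp_test_smul hη.continuous hηc (hu.memLp_grad i)) hv.memLp
  have i2 := integrable_bilin B (memLp_test_smul hη.continuous hηc hu.memLp) (hv.memLp_grad i)
  simp_rw [map_smul, smul_apply] at t0 t1 t2 i1 i2
  simp_rw [smul_add]
  rw [integral_add i1 i2]
  -- both sides are limits of the corresponding expressions for smooth approximations
  refine tendsto_nhds_unique t0 ((t1.add t2).neg.congr fun k => ?_)
  have j1 := integrable_bilin B (memLp_test_smul hη.continuous hηc (mφ' k)) (mψ k)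
  have j2 := integrable_bilin B (memLp_test_smul hη.continuous hηc (mφ k)) (mψ' k)
  simp_rw [map_smul, smul_apply] at j1 j2
  have hB : ContDiff ℝ ∞ fun x => B (φ k x) (ψ k x) :=
    (B.contDiff.comp (hφ k)).clm_apply (hψ k)
  have hw := (hasWeakGrad_of_contDiff hS.isBounded hSm hB).weak i η hη hηc hηS
  rw [hw, ← integral_add j1 j2]
  congr 2
  ext x
  have hd := (B.isBoundedBilinearMap.hasFDerivAt (φ k x, ψ k x)).comp x
    (((hφ k).differentiable (by simp) x).hasFDerivAt.prodMk
      ((hψ k).differentiable (by simp) x).hasFDerivAt)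
  have hd' : HasFDerivAt (fun x => B (φ k x) (ψ k x)) _ x := hd
  beta_reduce
  rw [hd'.fderiv, ← smul_add]
  simp [add_comm]

end ProductRule

section Limits

variable {G : Type*} [NormedAddCommGroup G] [InnerProductSpace ℝ G]

/-- The real inner product as a continuous bilinear map. -/
noncomputable def innerB (G : Type*) [NormedAddCommGroup G] [InnerProductSpace ℝ G] :
    G →L[ℝ] G →L[ℝ] ℝ := innerSL ℝ

lemma innerB_apply (a b : G) : innerB G a b = ⟪a, b⟫ := rfl

lemma tendsto_integral_inner_zero {X : Type*} [MeasurableSpace X] {μ : Measure X}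
    {e f : ℕ → X → G} (he : ∀ k, MemLp (e k) 2 μ) (hf : ∀ k, MemLp (f k) 2 μ) {C : ℝ}
    (hC : ∀ k, eLpNorm (f k) 2 μ ≤ ENNReal.ofReal C)
    (h : Tendsto (fun k => eLpNorm (e k) 2 μ) atTop (𝓝 0)) :
    Tendsto (fun k => ∫ x, ⟪e k x, f k x⟫ ∂μ) atTop (𝓝 0) := by
  have h0 := (ENNReal.tendsto_toReal ENNReal.zero_ne_top).comp h
  refine squeeze_zero_norm (a := fun k => (eLpNorm (e k) 2 μ).toReal * max C 0) (fun k => ?_) ?_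
  · rw [← inner_toLp (he k) (hf k)]
    refine (norm_inner_le_norm _ _).trans ?_
    rw [Lp.norm_toLp, Lp.norm_toLp]
    refine mul_le_mul_of_nonneg_left ?_ ENNReal.toReal_nonneg
    have := ENNReal.toReal_mono ENNReal.ofReal_ne_top (hC k)
    rwa [ENNReal.toReal_ofReal'] at this
  · simpa using h0.mul_const (max C 0)

variable [CompleteSpace G]

/-- Weak derivatives pass to weak limits: test with the fields `φ e`, `e` a fixed vector. -/
lemma isWeakPartial_of_weakL2 {S : Set E2} [IsFiniteMeasure ((volume : Measure E2).restrict S)]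
    {i : Fin 2} {u v : ℕ → E2 → G} {u₀ v₀ : E2 → G}
    (h : ∀ k, IsWeakPartial S i (u k) (v k)) (hu : ∀ k, MemLp (u k) 2 (volume.restrict S))
    (hv : ∀ k, MemLp (v k) 2 (volume.restrict S)) (hu₀ : MemLp u₀ 2 (volume.restrict S))
    (hv₀ : MemLp v₀ 2 (volume.restrict S)) (hut : WeakL2 (volume.restrict S) u u₀)
    (hvt : WeakL2 (volume.restrict S) v v₀) : IsWeakPartial S i u₀ v₀ := by
  intro φ hφ hc hsub
  have hφ' := continuous_partial hφ (by simp) i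
  have hc' := hasCompactSupport_partial hc i
  refine ext_inner_left ℝ fun e => ?_
  have key : ∀ {χ : E2 → ℝ} (_ : Continuous χ) (_ : HasCompactSupport χ) {w : E2 → G}
      (_ : MemLp w 2 (volume.restrict S)),
      ⟪e, ∫ x in S, χ x • w x⟫ = ∫ x in S, ⟪χ x • e, w x⟫ := by
    intro χ hχ hχc w hw
    rw [← integral_inner (integrable_test_smul hχ hχc (hw.integrable one_le_two))]
    simp_rw [real_inner_smul_left, real_inner_smul_right]
  have t0 := hut (fun x => fderiv ℝ φ x (dir i) • e) (memLp_test_smul hφ' hc' (memLp_const e))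
  have t1 := hvt (fun x => φ x • e) (memLp_test_smul hφ.continuous hc (memLp_const e))
  rw [← key hφ' hc' hu₀] at t0
  rw [← key hφ.continuous hc hv₀] at t1
  rw [inner_neg_right]
  refine tendsto_nhds_unique t0 (t1.neg.congr fun k => ?_)
  rw [← key hφ' hc' (hu k), ← key hφ.continuous hc (hv k), h k φ hφ hc hsub, inner_neg_right]

/-- Weak closure of `H¹`: a weak `L²` limit of functions with bounded weak gradients has a weak
gradient, which is the weak limit of the gradients along a subsequence. -/
lemma exists_hasWeakGrad_limit [TopologicalSpace.SeparableSpace G] {S : Set E2}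
    [IsFiniteMeasure ((volume : Measure E2).restrict S)] {u : ℕ → E2 → G}
    {v : ℕ → Fin 2 → E2 → G} {u₀ : E2 → G} (h : ∀ k, HasWeakGrad S (u k) (v k))
    (hu₀ : MemLp u₀ 2 (volume.restrict S)) (hut : WeakL2 (volume.restrict S) u u₀) {C : ℝ}
    (hC : ∀ k i, eLpNorm (v k i) 2 (volume.restrict S) ≤ ENNReal.ofReal C) :
    ∃ (v₀ : Fin 2 → E2 → G) (θ : ℕ → ℕ), StrictMono θ ∧ HasWeakGrad S u₀ v₀ ∧
      ∀ i, WeakL2 (volume.restrict S) (fun k => v (θ k) i) (v₀ i) := by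
  obtain ⟨a, θ, hθ, ha, hat⟩ := exists_weakL2_subseq (fun k => (h k).memLp_grad 0)
    (fun k => hC k 0)
  obtain ⟨b, θ', hθ', hb, hbt⟩ := exists_weakL2_subseq (fun k => (h (θ k)).memLp_grad 1)
    (fun k => hC (θ k) 1)
  have hw : ∀ i, WeakL2 (volume.restrict S) (fun k => v (θ (θ' k)) i) (![a, b] i) := by
    intro i
    fin_cases i
    · exact hat.subseq hθ'
    · exact hbt
  have hm : ∀ i, MemLp (![a, b] i) 2 (volume.restrict S) := by
    intro i
    fin_cases i
    exacts [ha, hb]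
  exact ⟨![a, b], θ ∘ θ', hθ.comp hθ', ⟨hu₀, hm, fun i =>
    isWeakPartial_of_weakL2 (fun k => (h _).weak i) (fun k => (h _).memLp)
      (fun k => (h _).memLp_grad i) hu₀ (hm i) (hut.subseq (hθ.comp hθ')) (hw i)⟩, hw⟩

/-- Interpolation: if `e k → 0` in `L²` and the second derivatives are bounded in `L²`, the first
derivatives converge to zero locally in `L²`. -/
lemma tendsto_integral_cutoff_grad {S : Set E2} (hS : IsBoundedLipschitzDomain S) {e : ℕ → E2 → G}
    {d : ℕ → Fin 2 → E2 → G} {z : ℕ → Fin 2 → Fin 2 → E2 → G}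
    (he : ∀ k, HasWeakGrad S (e k) (d k)) (hd : ∀ k i, HasWeakGrad S (d k i) (z k i)) {C : ℝ}
    (hdC : ∀ k i, eLpNorm (d k i) 2 (volume.restrict S) ≤ ENNReal.ofReal C)
    (hzC : ∀ k i j, eLpNorm (z k i j) 2 (volume.restrict S) ≤ ENNReal.ofReal C)
    (hlim : Tendsto (fun k => eLpNorm (e k) 2 (volume.restrict S)) atTop (𝓝 0)) {ζ : E2 → ℝ}
    (hζ : ContDiff ℝ ∞ ζ) (hζc : HasCompactSupport ζ) (hζS : tsupport ζ ⊆ S) (i : Fin 2) :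
    Tendsto (fun k => ∫ x in S, ζ x * ‖d k i x‖ ^ 2) atTop (𝓝 0) := by
  have hζ' := continuous_partial hζ (by simp) i
  have hζc' := hasCompactSupport_partial hζc i
  have hsm : ∀ {χ : E2 → ℝ}, Continuous χ → HasCompactSupport χ →
      Tendsto (fun k => eLpNorm (fun x => χ x • e k x) 2 (volume.restrict S)) atTop (𝓝 0) := by
    intro χ hχ hχc
    have := tendsto_eLpNorm_test_smul (S := S) hχ hχc (f := e) (f₀ := fun _ => 0)
      (by simpa using hlim)
    simpa using this
  have t0 := tendsto_integral_inner_zero (fun k => memLp_test_smul hζ' hζc' (he k).memLp)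
    (fun k => (he k).memLp_grad i) (fun k => hdC k i) (hsm hζ' hζc')
  have t1 := tendsto_integral_inner_zero
    (fun k => memLp_test_smul hζ.continuous hζc (he k).memLp)
    (fun k => (hd k i).memLp_grad i) (fun k => hzC k i i) (hsm hζ.continuous hζc)
  have t2 := (t0.add t1).neg
  rw [add_zero, neg_zero] at t2
  refine t2.congr fun k => ?_
  -- integrate by parts: `∫ ζ |∂e|² = -∫ ∂ζ e · ∂e - ∫ ζ e · ∂²e`
  have hw := HasWeakGrad.isWeakPartial_bilin hS (innerB G) (he k) (hd k i) i ζ hζ hζc hζS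
  have i1 : Integrable (fun x => ζ x * ⟪d k i x, d k i x⟫) (volume.restrict S) := by
    have := integrable_bilin (innerB G) (memLp_test_smul hζ.continuous hζc ((he k).memLp_grad i))
      ((he k).memLp_grad i)
    simpa only [innerB_apply, real_inner_smul_left] using this
  have i2 : Integrable (fun x => ζ x * ⟪e k x, z k i i x⟫) (volume.restrict S) := by
    have := integrable_bilin (innerB G) (memLp_test_smul hζ.continuous hζc (he k).memLp)
      ((hd k i).memLp_grad i)
    simpa only [innerB_apply, real_inner_smul_left] using this
  simp only [innerB_apply, smul_eq_mul, mul_add] at hw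
  rw [integral_add i1 i2] at hw
  simp_rw [real_inner_smul_left, ← real_inner_self_eq_norm_sq]
  linarith

end Limits

open scoped Manifold in
lemma exists_cutoff {K S : Set E2} (hK : IsCompact K) (hS : IsOpen S) (hKS : K ⊆ S) :
    ∃ ζ : E2 → ℝ, ContDiff ℝ ∞ ζ ∧ HasCompactSupport ζ ∧ tsupport ζ ⊆ S ∧
      (∀ x, ζ x ∈ Icc (0 : ℝ) 1) ∧ ∀ x ∈ K, ζ x = 1 := by
  obtain ⟨L, hL, hKL, hLS⟩ := exists_compact_between hK hS hKS
  obtain ⟨f, hf, hr, hsupp, h1⟩ := exists_contMDiff_support_eq_eq_one_iff (n := (⊤ : ℕ∞)) 𝓘(ℝ, E2)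
    isOpen_interior hK.isClosed hKL
  have hts : tsupport f ⊆ L := by
    rw [tsupport, hsupp]
    exact closure_minimal interior_subset hL.isClosed
  exact ⟨f, contMDiff_iff_contDiff.1 hf, hL.of_isClosed_subset (isClosed_tsupport f) hts,
    hts.trans hLS, fun x => hr (mem_range_self x), fun x hx => (h1 x).1 hx⟩

/-- If `d k` is uniformly bounded and converges to `d₀` locally in `L²(S)`, it converges in
`L²(S)`. -/
lemma tendsto_eLpNorm_of_local {G : Type*} [NormedAddCommGroup G] {S : Set E2} (hS : IsOpen S)
    [IsFiniteMeasure ((volume : Measure E2).restrict S)] {d : ℕ → E2 → G} {d₀ : E2 → G}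
    (hd : ∀ k, MemLp (d k) 2 (volume.restrict S)) (hd₀ : MemLp d₀ 2 (volume.restrict S))
    (hb : ∀ k, ∀ᵐ x ∂(volume.restrict S), ‖d k x‖ ≤ 1)
    (hloc : ∀ ζ : E2 → ℝ, ContDiff ℝ ∞ ζ → HasCompactSupport ζ → tsupport ζ ⊆ S →
      Tendsto (fun k => ∫ x in S, ζ x * ‖d k x - d₀ x‖ ^ 2) atTop (𝓝 0)) :
    Tendsto (fun k => eLpNorm (fun x => d k x - d₀ x) 2 (volume.restrict S)) atTop (𝓝 0) := by
  have hSm := hS.measurableSet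
  -- an integrable bound for the squared differences
  set w : E2 → ℝ≥0∞ := fun x => 2 + 2 * ‖d₀ x‖ₑ ^ 2 with hw
  have hwi : ∫⁻ x in S, w x ≠ ⊤ := by
    have h2 : ∫⁻ x in S, ‖d₀ x‖ₑ ^ 2 ≠ ⊤ := by
      rw [← sq_eLpNorm_two]; exact ENNReal.pow_ne_top hd₀.2.ne
    rw [hw, lintegral_add_left measurable_const, lintegral_const,
      lintegral_const_mul' _ _ (by simp)]
    exact ENNReal.add_ne_top.2 ⟨ENNReal.mul_ne_top (by simp) (measure_ne_top _ _),
      ENNReal.mul_ne_top (by simp) h2⟩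
  have hpt : ∀ k, ∀ᵐ x ∂(volume.restrict S), ‖d k x - d₀ x‖ₑ ^ 2 ≤ w x := fun k => by
    filter_upwards [hb k] with x hx
    have h1 : ‖d k x - d₀ x‖ ^ 2 ≤ 2 + 2 * ‖d₀ x‖ ^ 2 := by
      have := norm_sub_le (d k x) (d₀ x)
      have h0 := norm_nonneg (d k x - d₀ x)
      nlinarith [norm_nonneg (d k x), norm_nonneg (d₀ x), sq_nonneg (‖d k x‖ - ‖d₀ x‖)]
    have h2 := ENNReal.ofReal_le_ofReal h1
    rwa [ENNReal.ofReal_add (by norm_num) (by positivity), ENNReal.ofReal_mul (by norm_num),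
      ENNReal.ofReal_pow (norm_nonneg _), ENNReal.ofReal_pow (norm_nonneg _), ofReal_norm,
      ofReal_norm, ENNReal.ofReal_ofNat] at h2
  have hsq : Tendsto (fun k => ∫⁻ x in S, ‖d k x - d₀ x‖ₑ ^ 2) atTop (𝓝 0) := by
    refine ENNReal.tendsto_nhds_zero.2 fun ε hε => ?_
    have hfin : (volume.restrict S).withDensity w S ≠ ⊤ := by
      rw [withDensity_apply _ hSm, Measure.restrict_restrict hSm, inter_self]
      exact hwi
    have hfm : IsFiniteMeasure ((volume.restrict S).withDensity w) :=
      isFiniteMeasure_withDensity hwi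
    -- outside a compact set the dominating function `w` has small integral
    obtain ⟨K, hKS, hK, hKε⟩ := hSm.exists_isCompact_sdiff_lt hfin (ENNReal.half_pos hε.ne').ne'
    obtain ⟨ζ, hζ, hζc, hζS, hζ01, hζ1⟩ := exists_cutoff hK hS hKS
    have h1 := (ENNReal.tendsto_ofReal (hloc ζ hζ hζc hζS)).eventually
      (ENNReal.tendsto_nhds_zero.1 (by simpa using tendsto_id) (ε / 2) (ENNReal.half_pos hε.ne'))
    filter_upwards [h1] with k hk
    have hmK : MeasurableSet (S \ K) := hSm.diff hK.measurableSet
    have hint : Integrable (fun x => ζ x * ‖d k x - d₀ x‖ ^ 2) (volume.restrict S) := by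
      have := integrable_test_smul (μ := volume.restrict S) hζ.continuous hζc
        ((memLp_two_iff_integrable_sq_norm ((hd k).sub hd₀).aestronglyMeasurable).1
          ((hd k).sub hd₀))
      simpa using this
    calc ∫⁻ x in S, ‖d k x - d₀ x‖ₑ ^ 2
        ≤ ∫⁻ x in S, (ENNReal.ofReal (ζ x * ‖d k x - d₀ x‖ ^ 2) + (S \ K).indicator w x) := by
          refine lintegral_mono_ae ?_
          filter_upwards [hpt k, ae_restrict_mem hSm] with x hx hxS
          by_cases hxK : x ∈ K
          · rw [hζ1 x hxK, one_mul, ENNReal.ofReal_pow (norm_nonneg _), ofReal_norm]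
            exact le_self_add
          · rw [indicator_of_mem (show x ∈ S \ K from ⟨hxS, hxK⟩)]
            exact hx.trans le_add_self
      _ = ENNReal.ofReal (∫ x in S, ζ x * ‖d k x - d₀ x‖ ^ 2) +
            (volume.restrict S).withDensity w (S \ K) := by
          rw [lintegral_add_left' hint.aestronglyMeasurable.aemeasurable.ennreal_ofReal,
            lintegral_indicator hmK, withDensity_apply _ hmK,
            ofReal_integral_eq_lintegral_ofReal hint (Eventually.of_forall fun x =>
              mul_nonneg (hζ01 x).1 (sq_nonneg _))]
      _ ≤ ε / 2 + ε / 2 := add_le_add hk hKε.le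
      _ = ε := ENNReal.add_halves ε
  simp_rw [← sq_eLpNorm_two] at hsq
  have := (ENNReal.continuous_rpow_const (y := 1 / 2)).tendsto 0 |>.comp hsq
  rw [ENNReal.zero_rpow_of_pos (by norm_num)] at this
  refine this.congr fun k => ?_
  simp only [Function.comp]
  rw [← ENNReal.rpow_natCast, ← ENNReal.rpow_mul]
  norm_num

/-! ### Estimates along normal fibres -/

/-- The normal fibres of length `d` over `P ⊆ Γ` cover a part of `S`, with controlled overlap and
distortion. -/
structure IsFibred (S Γ P : Set E2) (c : ℝ≥0∞) (d : ℝ) : Prop where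
  ne_top : c ≠ ⊤
  measurable : Measurable (stripMap S Γ)
  finite : IsFiniteMeasure (arcMeasure Γ)
  subset : P ⊆ Γ
  norm_le : ∀ ξ, ‖Γ.indicator (outerNormal S) ξ‖ ≤ 1
  map_le : (fibreMeasure P d).map (stripMap S Γ) ≤ c • volume.restrict S

lemma arcMeasure_mono {P Γ : Set E2} (h : P ⊆ Γ) : arcMeasure P ≤ arcMeasure Γ :=
  Measure.restrict_mono h le_rfl

lemma fibreMeasure_mono {P Γ : Set E2} [SFinite (arcMeasure P)] [SFinite (arcMeasure Γ)]
    (h : P ⊆ Γ) {σ d : ℝ} (hσ : σ ≤ d) : fibreMeasure P σ ≤ fibreMeasure Γ d :=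
  Measure.prod_mono (arcMeasure_mono h)
    (Measure.restrict_mono (Ioo_subset_Ioo_right hσ) le_rfl)

lemma IsFibred.finite' {S Γ P : Set E2} {c : ℝ≥0∞} {d : ℝ} (h : IsFibred S Γ P c d) :
    IsFiniteMeasure (arcMeasure P) :=
  have := h.finite
  isFiniteMeasure_of_le _ (arcMeasure_mono h.subset)

lemma IsFibred.mono {S Γ P P' : Set E2} {c : ℝ≥0∞} {d d' : ℝ} (h : IsFibred S Γ P c d)
    (hP : P' ⊆ P) (hd : d' ≤ d) : IsFibred S Γ P' c d' := by
  have := h.finite'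
  have : IsFiniteMeasure (arcMeasure P') := isFiniteMeasure_of_le _ (arcMeasure_mono hP)
  exact ⟨h.ne_top, h.measurable, h.finite, hP.trans h.subset, h.norm_le,
    (Measure.map_mono (fibreMeasure_mono hP hd) h.measurable).trans h.map_le⟩

/-- The fibres of length `d` over the points of `Γ` at distance at least `d` from the rest of the
boundary. -/
theorem exists_isFibred {S Γ : Set E2} (hS : IsBoundedLipschitzDomain S)
    (hΓ : IsRegularBoundaryPart S Γ) : ∃ d₀ > (0 : ℝ), ∀ d ≤ d₀,
      IsFibred S Γ (innerPart S Γ d) 2 d := by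
  obtain ⟨L, δ, H⟩ := exists_hasSmoothNormal hS hΓ
  have hb : Bornology.IsBounded Γ :=
    (hΓ.isCompact_closure hS).isBounded.subset subset_closure
  obtain ⟨ρ, hρ, h⟩ := H.exists_isGoodWidth hb hΓ.measurableSet one_pos
  have hL := H.L_pos
  refine ⟨min ρ (min δ (1 / L)), lt_min hρ (lt_min H.δ_pos (by positivity)), fun d hd => ?_⟩
  have hg := h d (hd.trans (min_le_left _ _))
  have := hg.finite
  have hms := measurableSet_innerPart (S := S) hΓ.measurableSet d
  have : IsFiniteMeasure (arcMeasure (innerPart S Γ d)) :=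
    isFiniteMeasure_of_le _ (arcMeasure_mono (innerPart_subset d))
  refine ⟨by simp, hg.measurable, hg.finite, innerPart_subset d, fun ξ => ?_, ?_⟩
  · by_cases hξ : ξ ∈ Γ
    · rw [indicator_of_mem hξ, H.norm_outerNormal hξ]
    · rw [indicator_of_notMem hξ]; simp
  · refine Measure.le_iff.2 fun A hA => ?_
    have h1 : fibreMeasure (innerPart S Γ d) d (stripMap S Γ ⁻¹' A) =
        fibreMeasure (innerPart S Γ d) d (stripMap S Γ ⁻¹' (A ∩ S)) := by
      refine measure_congr ?_
      filter_upwards [ae_mem_fibreMeasure hms d] with x hx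
      have := H.mem_of_innerPart hS.isOpen (hd.trans (min_le_right _ _)) hx.1 hx.2
      exact propext ⟨fun hxA => ⟨hxA, this⟩, fun hxA => hxA.1⟩
    rw [Measure.map_apply hg.measurable hA, h1]
    have hAS := hA.inter hS.isOpen.measurableSet
    calc fibreMeasure (innerPart S Γ d) d (stripMap S Γ ⁻¹' (A ∩ S))
        ≤ fibreMeasure Γ d (stripMap S Γ ⁻¹' (A ∩ S)) :=
          fibreMeasure_mono (innerPart_subset d) le_rfl _
      _ = (fibreMeasure Γ d).map (stripMap S Γ) (A ∩ S) :=
          (Measure.map_apply hg.measurable hAS).symm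
      _ ≤ (ENNReal.ofReal (1 + 1) • volume.restrict (strip S Γ d)) (A ∩ S) := hg.map_le _
      _ ≤ ((2 : ℝ≥0∞) • volume.restrict S) A := by
        simp only [Measure.smul_apply, smul_eq_mul]
        rw [Measure.restrict_apply hA, Measure.restrict_apply hAS, one_add_one_eq_two,
          ENNReal.ofReal_ofNat]
        exact mul_le_mul_right (measure_mono inter_subset_left) _

section Fibre

variable {F : Type*} [NormedAddCommGroup F]

lemma IsFibred.lintegral_le {S Γ P : Set E2} {c : ℝ≥0∞} {d : ℝ} (h : IsFibred S Γ P c d)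
    {g : E2 → ℝ≥0∞} (hg : AEMeasurable g (volume.restrict S)) :
    ∫⁻ x, g (stripMap S Γ x) ∂(fibreMeasure P d) ≤ c * ∫⁻ x in S, g x := by
  have hac : (fibreMeasure P d).map (stripMap S Γ) ≪ volume.restrict S :=
    Measure.absolutelyContinuous_of_le_smul h.map_le
  rw [← lintegral_map' (hg.mono_ac hac) h.measurable.aemeasurable]
  exact (lintegral_mono' h.map_le le_rfl).trans (lintegral_smul_measure _ _).le

lemma IsFibred.quasiMeasurePreserving {S Γ P : Set E2} {c : ℝ≥0∞} {d : ℝ}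
    (h : IsFibred S Γ P c d) :
    Measure.QuasiMeasurePreserving (stripMap S Γ) (fibreMeasure P d) (volume.restrict S) :=
  ⟨h.measurable, Measure.absolutelyContinuous_of_le_smul h.map_le⟩

lemma IsFibred.sq_eLpNorm_comp_le {S Γ P : Set E2} {c : ℝ≥0∞} {d : ℝ} (h : IsFibred S Γ P c d)
    {u : E2 → F} (hu : AEStronglyMeasurable u (volume.restrict S)) :
    eLpNorm (fun x => u (stripMap S Γ x)) 2 (fibreMeasure P d) ^ 2 ≤
      c * eLpNorm u 2 (volume.restrict S) ^ 2 := by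
  rw [sq_eLpNorm_two, sq_eLpNorm_two]
  exact h.lintegral_le (hu.enorm.pow_const 2)

variable [NormedSpace ℝ F]

/-- The squared norm of the gradient. -/
noncomputable def gradSq (φ : E2 → F) (x : E2) : ℝ≥0∞ := ∑ i, ‖fderiv ℝ φ x (dir i)‖ₑ ^ 2

lemma enorm_fderiv_sq_le (φ : E2 → F) (x : E2) {n : E2} (hn : ‖n‖ ≤ 1) :
    ‖fderiv ℝ φ x n‖ₑ ^ 2 ≤ gradSq φ x := by
  have e : n = n 0 • dir 0 + n 1 • dir 1 := by
    ext i; fin_cases i <;> simp [dir]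
  have hn2 : n 0 ^ 2 + n 1 ^ 2 ≤ 1 := by
    have := EuclideanSpace.real_norm_sq_eq n
    rw [Fin.sum_univ_two] at this
    nlinarith [norm_nonneg n]
  have h : ‖fderiv ℝ φ x n‖ ^ 2 ≤ ‖fderiv ℝ φ x (dir 0)‖ ^ 2 + ‖fderiv ℝ φ x (dir 1)‖ ^ 2 := by
    set A := fderiv ℝ φ x
    have h1 : ‖A n‖ ≤ |n 0| * ‖A (dir 0)‖ + |n 1| * ‖A (dir 1)‖ := by
      conv_lhs => rw [e]
      rw [map_add, map_smul, map_smul]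
      refine (norm_add_le _ _).trans (le_of_eq ?_)
      rw [norm_smul, norm_smul, Real.norm_eq_abs, Real.norm_eq_abs]
    have h2 : |n 0| ^ 2 + |n 1| ^ 2 ≤ 1 := by rwa [sq_abs, sq_abs]
    calc ‖A n‖ ^ 2 ≤ (|n 0| * ‖A (dir 0)‖ + |n 1| * ‖A (dir 1)‖) ^ 2 := by gcongr
      _ ≤ (|n 0| ^ 2 + |n 1| ^ 2) * (‖A (dir 0)‖ ^ 2 + ‖A (dir 1)‖ ^ 2) := by
        nlinarith [sq_nonneg (|n 0| * ‖A (dir 1)‖ - |n 1| * ‖A (dir 0)‖)]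
      _ ≤ 1 * (‖A (dir 0)‖ ^ 2 + ‖A (dir 1)‖ ^ 2) := by gcongr
      _ = _ := one_mul _
  have h2 := ENNReal.ofReal_le_ofReal h
  rwa [ENNReal.ofReal_add (by positivity) (by positivity), ENNReal.ofReal_pow (norm_nonneg _),
    ENNReal.ofReal_pow (norm_nonneg _), ENNReal.ofReal_pow (norm_nonneg _), ofReal_norm,
    ofReal_norm, ofReal_norm, ← Fin.sum_univ_two (f := fun i => ‖fderiv ℝ φ x (dir i)‖ₑ ^ 2)] at h2

/-- The fundamental theorem of calculus and the Cauchy-Schwarz inequality. -/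
lemma enorm_sub_sq_le_lintegral [CompleteSpace F] {f f' : ℝ → F} (hf : ∀ t, HasDerivAt f (f' t) t)
    (hf' : Continuous f') {d s t : ℝ} (hs : s ∈ Icc 0 d) (ht : t ∈ Icc 0 d) :
    ‖f s - f t‖ₑ ^ 2 ≤ ENNReal.ofReal d * ∫⁻ r in Ioo 0 d, ‖f' r‖ₑ ^ 2 := by
  wlog hst : t ≤ s generalizing s t
  · rw [← enorm_neg, neg_sub]
    exact this ht hs (not_le.1 hst).le
  have hd : 0 ≤ d := hs.1.trans hs.2
  have e := intervalIntegral.integral_eq_sub_of_hasDerivAt (fun r _ => hf r)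
    (hf'.intervalIntegrable t s)
  rw [intervalIntegral.integral_of_le hst] at e
  have h1 : ‖f s - f t‖ₑ ≤ eLpNorm f' 1 (volume.restrict (Ioo 0 d)) := by
    rw [← e, eLpNorm_one_eq_lintegral_enorm, ← restrict_Ioo_eq_restrict_Ioc]
    exact (enorm_integral_le_lintegral_enorm _).trans
      (lintegral_mono_set (Ioo_subset_Ioo ht.1 hs.2))
  have h2 := eLpNorm_le_eLpNorm_mul_rpow_measure_univ (μ := volume.restrict (Ioo 0 d))
    (one_le_two (α := ℝ≥0∞)) hf'.aestronglyMeasurable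
  calc ‖f s - f t‖ₑ ^ 2
      ≤ (eLpNorm f' 2 (volume.restrict (Ioo 0 d)) * (volume.restrict (Ioo 0 d)) univ ^
        (1 / ENNReal.toReal 1 - 1 / ENNReal.toReal 2)) ^ 2 := by gcongr; exact h1.trans h2
    _ = _ := by
      rw [mul_pow, sq_eLpNorm_two, Measure.restrict_apply_univ, Real.volume_Ioo, sub_zero,
        ← ENNReal.rpow_natCast (ENNReal.ofReal d ^ _), ← ENNReal.rpow_mul, mul_comm]
      norm_num

lemma IsFibred.enorm_sub_sq_le [CompleteSpace F] {S Γ P : Set E2} {c : ℝ≥0∞} {d : ℝ}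
    (h : IsFibred S Γ P c d) {φ : E2 → F} (hφ : ContDiff ℝ ∞ φ) (ξ : E2) {s t : ℝ}
    (hs : s ∈ Icc 0 d) (ht : t ∈ Icc 0 d) :
    ‖φ (stripMap S Γ (ξ, s)) - φ (stripMap S Γ (ξ, t))‖ₑ ^ 2 ≤
      ENNReal.ofReal d * ∫⁻ r in Ioo 0 d, gradSq φ (stripMap S Γ (ξ, r)) := by
  set n := Γ.indicator (outerNormal S) ξ with hn
  have hd : ∀ r, HasDerivAt (fun r => φ (stripMap S Γ (ξ, r)))
      (fderiv ℝ φ (stripMap S Γ (ξ, r)) (-n)) r := fun r => by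
    have h1 : HasDerivAt (fun r : ℝ => stripMap S Γ (ξ, r)) (-n) r := by
      have := ((hasDerivAt_id r).smul_const n).const_sub ξ
      simpa [stripMap] using this
    exact ((hφ.differentiable (by simp) _).hasFDerivAt).comp_hasDerivAt r h1
  have hc : Continuous fun r : ℝ => fderiv ℝ φ (stripMap S Γ (ξ, r)) (-n) := by
    have h1 : Continuous fun r : ℝ => stripMap S Γ (ξ, r) := by
      simp only [stripMap]; fun_prop
    exact ((hφ.continuous_fderiv (by simp)).comp h1).clm_apply continuous_const
  refine (enorm_sub_sq_le_lintegral hd hc hs ht).trans ?_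
  gcongr with r
  exact enorm_fderiv_sq_le φ _ (by rw [norm_neg]; exact h.norm_le ξ)

lemma measurable_gradSq {φ : E2 → F} (hφ : ContDiff ℝ ∞ φ) : Measurable (gradSq φ) :=
  Finset.measurable_sum _ fun i _ =>
    ((continuous_partial hφ (by simp) i).enorm.measurable.pow_const 2)

lemma lintegral_gradSq {S : Set E2} {φ : E2 → F} (hφ : ContDiff ℝ ∞ φ) :
    ∫⁻ x in S, gradSq φ x =
      ∑ i, eLpNorm (fun x => fderiv ℝ φ x (dir i)) 2 (volume.restrict S) ^ 2 := by
  simp_rw [sq_eLpNorm_two, gradSq]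
  exact lintegral_finsetSum _ fun i _ =>
    ((continuous_partial hφ (by simp) i).enorm.measurable.pow_const 2)

lemma IsFibred.lintegral_lintegral_gradSq_le {S Γ P : Set E2} {c : ℝ≥0∞} {d : ℝ}
    (h : IsFibred S Γ P c d) {φ : E2 → F} (hφ : ContDiff ℝ ∞ φ) :
    ∫⁻ ξ, ∫⁻ r in Ioo 0 d, gradSq φ (stripMap S Γ (ξ, r)) ∂volume ∂(arcMeasure P) ≤
      c * ∑ i, eLpNorm (fun x => fderiv ℝ φ x (dir i)) 2 (volume.restrict S) ^ 2 := by
  have := h.finite'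
  rw [← lintegral_gradSq hφ]
  refine le_trans (le_of_eq ?_) (h.lintegral_le (measurable_gradSq hφ).aemeasurable)
  rw [fibreMeasure, lintegral_prod (fun x => gradSq φ (stripMap S Γ x))
    ((measurable_gradSq hφ).comp h.measurable).aemeasurable]

/-- A smooth function differs from its boundary values, on fibres of length `d`, by a quantity of
order `d` in the mean. -/
lemma IsFibred.sq_eLpNorm_sub_fst_le [CompleteSpace F] {S Γ P : Set E2} {c : ℝ≥0∞} {d : ℝ}
    (h : IsFibred S Γ P c d) {φ : E2 → F} (hφ : ContDiff ℝ ∞ φ) :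
    eLpNorm (fun x => φ (stripMap S Γ x) - φ x.1) 2 (fibreMeasure P d) ^ 2 ≤
      ENNReal.ofReal d ^ 2 * (c *
        ∑ i, eLpNorm (fun x => fderiv ℝ φ x (dir i)) 2 (volume.restrict S) ^ 2) := by
  have := h.finite'
  have hm : AEStronglyMeasurable (fun x : E2 × ℝ => φ (stripMap S Γ x) - φ x.1)
      (fibreMeasure P d) :=
    (hφ.continuous.stronglyMeasurable.comp_measurable h.measurable).aestronglyMeasurable.sub
      (hφ.continuous.comp continuous_fst).aestronglyMeasurable
  have e0 : ∀ ξ : E2, stripMap S Γ (ξ, 0) = ξ := fun ξ => by simp [stripMap]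
  rw [sq_eLpNorm_two, fibreMeasure, lintegral_prod _ (hm.enorm.pow_const 2)]
  calc ∫⁻ ξ, ∫⁻ s in Ioo 0 d, ‖φ (stripMap S Γ (ξ, s)) - φ ξ‖ₑ ^ 2 ∂volume ∂(arcMeasure P)
      ≤ ∫⁻ ξ, ENNReal.ofReal d ^ 2 *
          ∫⁻ r in Ioo 0 d, gradSq φ (stripMap S Γ (ξ, r)) ∂volume ∂(arcMeasure P) := by
        refine lintegral_mono fun ξ => ?_
        calc ∫⁻ s in Ioo 0 d, ‖φ (stripMap S Γ (ξ, s)) - φ ξ‖ₑ ^ 2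
            ≤ ∫⁻ s in Ioo 0 d, ENNReal.ofReal d *
                ∫⁻ r in Ioo 0 d, gradSq φ (stripMap S Γ (ξ, r)) := by
              refine setLIntegral_mono' measurableSet_Ioo fun s hs => ?_
              have := h.enorm_sub_sq_le hφ ξ ⟨hs.1.le, hs.2.le⟩ (t := 0)
                ⟨le_rfl, hs.1.le.trans hs.2.le⟩
              rwa [e0] at this
          _ = _ := by
              rw [lintegral_const, Measure.restrict_apply_univ, Real.volume_Ioo, sub_zero]
              ring
    _ = ENNReal.ofReal d ^ 2 *
          ∫⁻ ξ, ∫⁻ r in Ioo 0 d, gradSq φ (stripMap S Γ (ξ, r)) ∂volume ∂(arcMeasure P) :=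
        lintegral_const_mul' _ _ (by finiteness)
    _ ≤ _ := by gcongr; exact h.lintegral_lintegral_gradSq_le hφ

/-- On a fibre, the value of a smooth function at one point is controlled by its mean and its
derivative. -/
lemma IsFibred.mul_enorm_sq_le [CompleteSpace F] {S Γ P : Set E2} {c : ℝ≥0∞} {d : ℝ}
    (h : IsFibred S Γ P c d) {φ : E2 → F} (hφ : ContDiff ℝ ∞ φ) (ξ : E2) {s : ℝ}
    (hs : s ∈ Icc 0 d) :
    ENNReal.ofReal d * ‖φ (stripMap S Γ (ξ, s))‖ₑ ^ 2 ≤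
      2 * (∫⁻ t in Ioo 0 d, ‖φ (stripMap S Γ (ξ, t))‖ₑ ^ 2) +
        2 * ENNReal.ofReal d ^ 2 * ∫⁻ r in Ioo 0 d, gradSq φ (stripMap S Γ (ξ, r)) := by
  set I := ∫⁻ r in Ioo 0 d, gradSq φ (stripMap S Γ (ξ, r)) with hI
  have hmeas : Measurable fun t : ℝ => ‖φ (stripMap S Γ (ξ, t))‖ₑ ^ 2 :=
    ((hφ.continuous.enorm.measurable).comp
      (h.measurable.comp measurable_prodMk_left)).pow_const 2
  calc ENNReal.ofReal d * ‖φ (stripMap S Γ (ξ, s))‖ₑ ^ 2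
      = ∫⁻ _t in Ioo 0 d, ‖φ (stripMap S Γ (ξ, s))‖ₑ ^ 2 := by
        rw [lintegral_const, Measure.restrict_apply_univ, Real.volume_Ioo, sub_zero, mul_comm]
    -- compare the value at `s` with the value at every other height of the fibre
    _ ≤ ∫⁻ t in Ioo 0 d, (2 * ‖φ (stripMap S Γ (ξ, t))‖ₑ ^ 2 + 2 * (ENNReal.ofReal d * I)) := by
        refine setLIntegral_mono' measurableSet_Ioo fun t ht => ?_
        have h1 := h.enorm_sub_sq_le hφ ξ hs ⟨ht.1.le, ht.2.le⟩
        have h2 : ‖φ (stripMap S Γ (ξ, s))‖ₑ ≤ ‖φ (stripMap S Γ (ξ, t))‖ₑ +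
            ‖φ (stripMap S Γ (ξ, s)) - φ (stripMap S Γ (ξ, t))‖ₑ := by
          have := enorm_add_le (φ (stripMap S Γ (ξ, t)))
            (φ (stripMap S Γ (ξ, s)) - φ (stripMap S Γ (ξ, t)))
          rwa [add_sub_cancel] at this
        calc _ ≤ (‖φ (stripMap S Γ (ξ, t))‖ₑ +
            ‖φ (stripMap S Γ (ξ, s)) - φ (stripMap S Γ (ξ, t))‖ₑ) ^ 2 := by gcongr
          _ ≤ 2 * (‖φ (stripMap S Γ (ξ, t))‖ₑ ^ 2 +
            ‖φ (stripMap S Γ (ξ, s)) - φ (stripMap S Γ (ξ, t))‖ₑ ^ 2) := by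
              have := ENNReal.rpow_add_le_mul_rpow_add_rpow ‖φ (stripMap S Γ (ξ, t))‖ₑ
                ‖φ (stripMap S Γ (ξ, s)) - φ (stripMap S Γ (ξ, t))‖ₑ (one_le_two (α := ℝ))
              norm_num at this
              exact this
          _ ≤ _ := by rw [mul_add]; gcongr
    _ = _ := by
        rw [lintegral_add_right _ measurable_const, lintegral_const_mul _ hmeas, lintegral_const,
          Measure.restrict_apply_univ, Real.volume_Ioo, sub_zero]
        ring

/-- The right-hand side of `IsFibred.mul_enorm_sq_le`, integrated over the base points, is an `H¹`
norm on `S`. -/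
lemma IsFibred.lintegral_fibre_bound_le {S Γ P : Set E2} {c : ℝ≥0∞} {d : ℝ}
    (h : IsFibred S Γ P c d) {φ : E2 → F} (hφ : ContDiff ℝ ∞ φ) :
    ∫⁻ ξ, (2 * (∫⁻ t in Ioo 0 d, ‖φ (stripMap S Γ (ξ, t))‖ₑ ^ 2) +
        2 * ENNReal.ofReal d ^ 2 * ∫⁻ r in Ioo 0 d, gradSq φ (stripMap S Γ (ξ, r)))
          ∂(arcMeasure P) ≤
      c * (2 * eLpNorm φ 2 (volume.restrict S) ^ 2 + 2 * ENNReal.ofReal d ^ 2 *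
        ∑ i, eLpNorm (fun x => fderiv ℝ φ x (dir i)) 2 (volume.restrict S) ^ 2) := by
  have := h.finite'
  have hm0 : Measurable fun x => ‖φ (stripMap S Γ x)‖ₑ ^ 2 :=
    (hφ.continuous.enorm.measurable.comp h.measurable).pow_const 2
  have hm1 := (measurable_gradSq hφ).comp h.measurable
  have h0 : ∫⁻ ξ, ∫⁻ t in Ioo 0 d, ‖φ (stripMap S Γ (ξ, t))‖ₑ ^ 2 ∂volume ∂(arcMeasure P) ≤
      c * eLpNorm φ 2 (volume.restrict S) ^ 2 := by
    refine le_trans (le_of_eq ?_) (h.sq_eLpNorm_comp_le hφ.continuous.aestronglyMeasurable)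
    rw [sq_eLpNorm_two, fibreMeasure, lintegral_prod _ hm0.aemeasurable]
  rw [lintegral_add_left (hm0.lintegral_prod_right'.const_mul 2),
    lintegral_const_mul' _ _ (by simp), lintegral_const_mul' _ _ (by finiteness)]
  calc _ ≤ 2 * (c * eLpNorm φ 2 (volume.restrict S) ^ 2) + 2 * ENNReal.ofReal d ^ 2 *
        (c * ∑ i, eLpNorm (fun x => fderiv ℝ φ x (dir i)) 2 (volume.restrict S) ^ 2) :=
        add_le_add (by gcongr) (mul_le_mul_right (h.lintegral_lintegral_gradSq_le hφ) _)
    _ = _ := by ring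

/-- The trace inequality for smooth functions, over base points with fibres of length `d`
in `S`. -/
lemma IsFibred.mul_sq_eLpNorm_arcMeasure_le [CompleteSpace F] {S Γ P : Set E2} {c : ℝ≥0∞} {d : ℝ}
    (h : IsFibred S Γ P c d) (hd : 0 ≤ d) {φ : E2 → F} (hφ : ContDiff ℝ ∞ φ) :
    ENNReal.ofReal d * eLpNorm φ 2 (arcMeasure P) ^ 2 ≤
      c * (2 * eLpNorm φ 2 (volume.restrict S) ^ 2 + 2 * ENNReal.ofReal d ^ 2 *
        ∑ i, eLpNorm (fun x => fderiv ℝ φ x (dir i)) 2 (volume.restrict S) ^ 2) := by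
  refine le_trans ?_ (h.lintegral_fibre_bound_le hφ)
  rw [sq_eLpNorm_two, ← lintegral_const_mul' _ _ ENNReal.ofReal_ne_top]
  refine lintegral_mono fun ξ => ?_
  have := h.mul_enorm_sq_le hφ ξ (s := 0) ⟨le_rfl, hd⟩
  simpa [stripMap] using this

/-- The square norm on fibres of length `σ ≤ d` is `O(σ)`, since the value at each height is
controlled through fibres of length `d`. -/
lemma IsFibred.mul_sq_eLpNorm_fibreMeasure_le [CompleteSpace F] {S Γ P : Set E2} {c : ℝ≥0∞}
    {d σ : ℝ} (h : IsFibred S Γ P c d) (hσd : σ ≤ d) {φ : E2 → F} (hφ : ContDiff ℝ ∞ φ) :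
    ENNReal.ofReal d * eLpNorm (fun x => φ (stripMap S Γ x)) 2 (fibreMeasure P σ) ^ 2 ≤
      ENNReal.ofReal σ * (c * (2 * eLpNorm φ 2 (volume.restrict S) ^ 2 + 2 * ENNReal.ofReal d ^ 2 *
        ∑ i, eLpNorm (fun x => fderiv ℝ φ x (dir i)) 2 (volume.restrict S) ^ 2)) := by
  have := h.finite'
  have hm0 : Measurable fun x => ‖φ (stripMap S Γ x)‖ₑ ^ 2 :=
    (hφ.continuous.enorm.measurable.comp h.measurable).pow_const 2
  refine le_trans ?_ (mul_le_mul_right (h.lintegral_fibre_bound_le hφ) _)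
  rw [sq_eLpNorm_two, fibreMeasure, lintegral_prod _ hm0.aemeasurable,
    ← lintegral_const_mul' _ _ ENNReal.ofReal_ne_top,
    ← lintegral_const_mul' _ _ ENNReal.ofReal_ne_top]
  refine lintegral_mono fun ξ => ?_
  rw [← lintegral_const_mul' _ _ ENNReal.ofReal_ne_top]
  refine (setLIntegral_mono' measurableSet_Ioo fun s hs =>
    h.mul_enorm_sq_le hφ ξ ⟨hs.1.le, hs.2.le.trans hσd⟩).trans (le_of_eq ?_)
  rw [lintegral_const, Measure.restrict_apply_univ, Real.volume_Ioo, sub_zero, mul_comm]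

end Fibre

/-! ### Traces -/

lemma tendsto_zero_of_sq {ι : Type*} {l : Filter ι} {a : ι → ℝ≥0∞}
    (h : Tendsto (fun k => a k ^ 2) l (𝓝 0)) : Tendsto a l (𝓝 0) := by
  have := ((ENNReal.continuous_rpow_const (y := 1 / 2)).tendsto 0).comp h
  rw [ENNReal.zero_rpow_of_pos (by norm_num)] at this
  refine this.congr fun k => ?_
  simp only [Function.comp]
  rw [← ENNReal.rpow_natCast, ← ENNReal.rpow_mul]
  norm_num

lemma tendsto_sq_zero {ι : Type*} {l : Filter ι} {a : ι → ℝ≥0∞} (h : Tendsto a l (𝓝 0)) :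
    Tendsto (fun k => a k ^ 2) l (𝓝 0) := by
  simpa using ENNReal.Tendsto.pow (n := 2) h

lemma tendsto_eLpNorm_of_sub {X F : Type*} [MeasurableSpace X] {μ : Measure X}
    [NormedAddCommGroup F] {f : ℕ → X → F} {g : X → F} (hf : ∀ k, MemLp (f k) 2 μ)
    (hg : MemLp g 2 μ) (h : Tendsto (fun k => eLpNorm (fun x => f k x - g x) 2 μ) atTop (𝓝 0)) :
    Tendsto (fun k => eLpNorm (f k) 2 μ) atTop (𝓝 (eLpNorm g 2 μ)) := by
  have := (continuous_enorm.tendsto _).comp (tendsto_toLp hf hg h)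
  rw [Lp.enorm_toLp] at this
  exact this.congr fun k => Lp.enorm_toLp (hf k)

section Fibre

variable {F : Type*} [NormedAddCommGroup F]

lemma IsFibred.memLp_comp {S Γ P : Set E2} {c : ℝ≥0∞} {d : ℝ} (h : IsFibred S Γ P c d)
    {u : E2 → F} (hu : MemLp u 2 (volume.restrict S)) :
    MemLp (fun x => u (stripMap S Γ x)) 2 (fibreMeasure P d) := by
  refine ⟨hu.1.comp_quasiMeasurePreserving h.quasiMeasurePreserving, ?_⟩
  have h1 := h.sq_eLpNorm_comp_le hu.1
  have h2 : c * eLpNorm u 2 (volume.restrict S) ^ 2 < ⊤ :=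
    ENNReal.mul_lt_top h.ne_top.lt_top (ENNReal.pow_lt_top hu.2)
  exact lt_top_iff_ne_top.2 fun h3 => by
    rw [h3] at h1
    exact absurd (h1.trans_lt h2) (by simp)

lemma IsFibred.tendsto_comp {S Γ P : Set E2} {c : ℝ≥0∞} {d : ℝ} (h : IsFibred S Γ P c d)
    {f : ℕ → E2 → F} {u : E2 → F} (hf : ∀ k, MemLp (f k) 2 (volume.restrict S))
    (hu : MemLp u 2 (volume.restrict S))
    (hlim : Tendsto (fun k => eLpNorm (fun x => f k x - u x) 2 (volume.restrict S)) atTop (𝓝 0)) :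
    Tendsto (fun k => eLpNorm (fun x => f k (stripMap S Γ x) - u (stripMap S Γ x)) 2
      (fibreMeasure P d)) atTop (𝓝 0) := by
  have h1 := ENNReal.Tendsto.const_mul (tendsto_sq_zero hlim) (a := c) (Or.inr h.ne_top)
  rw [mul_zero] at h1
  exact tendsto_zero_of_sq (tendsto_of_tendsto_of_tendsto_of_le_of_le tendsto_const_nhds h1
    (fun _ => bot_le) fun k => h.sq_eLpNorm_comp_le (u := fun x => f k x - u x)
      ((hf k).sub hu).aestronglyMeasurable)

lemma sq_eLpNorm_fst {P : Set E2} [IsFiniteMeasure (arcMeasure P)] (d : ℝ) {w : E2 → F}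
    (hw : AEStronglyMeasurable w (arcMeasure P)) :
    eLpNorm (fun x : E2 × ℝ => w x.1) 2 (fibreMeasure P d) ^ 2 =
      ENNReal.ofReal d * eLpNorm w 2 (arcMeasure P) ^ 2 := by
  rw [sq_eLpNorm_two, sq_eLpNorm_two, fibreMeasure,
    lintegral_prod (fun x : E2 × ℝ => ‖w x.1‖ₑ ^ 2)
    ((hw.comp_quasiMeasurePreserving Measure.quasiMeasurePreserving_fst).enorm.pow_const 2)]
  simp_rw [lintegral_const, Measure.restrict_apply_univ, Real.volume_Ioo, sub_zero]
  rw [lintegral_mul_const' _ _ ENNReal.ofReal_ne_top, mul_comm]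

variable [NormedSpace ℝ F] [CompleteSpace F]

/-- On short fibres, a Sobolev function is controlled in the mean by its `H¹` norm. -/
lemma IsFibred.mul_sq_eLpNorm_le {S Γ P : Set E2} {c : ℝ≥0∞} {d σ : ℝ}
    (h : IsFibred S Γ P c d) (hσd : σ ≤ d) (hS : IsBoundedLipschitzDomain S) {u : E2 → F}
    {v : Fin 2 → E2 → F} (hu : HasWeakGrad S u v) :
    ENNReal.ofReal d * eLpNorm (fun x => u (stripMap S Γ x)) 2 (fibreMeasure P σ) ^ 2 ≤
      ENNReal.ofReal σ * (c * (2 * eLpNorm u 2 (volume.restrict S) ^ 2 +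
        2 * ENNReal.ofReal d ^ 2 * ∑ i, eLpNorm (v i) 2 (volume.restrict S) ^ 2)) := by
  have := isFiniteMeasure_restrict hS.isBounded
  have hSm := hS.isOpen.measurableSet
  obtain ⟨_, -, hJ⟩ := hS.exists_smooth_approx (F := F)
  obtain ⟨φ, hφ, hφ0, hφ1, -⟩ := hJ u v hu
  have mφ := fun k => memLp_of_continuous hS.isBounded hSm (hφ k).continuous
  have mφ' := fun k i => memLp_of_continuous hS.isBounded hSm
    (continuous_partial (hφ k) (by simp) i)
  have hσ := h.mono (P' := P) Subset.rfl hσd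
  have t0 := tendsto_eLpNorm_of_sub (fun k => hσ.memLp_comp (mφ k)) (hσ.memLp_comp hu.memLp)
    (hσ.tendsto_comp mφ hu.memLp hφ0)
  have t1 := tendsto_eLpNorm_of_sub mφ hu.memLp hφ0
  have t2 := fun i => tendsto_eLpNorm_of_sub (fun k => mφ' k i) (hu.memLp_grad i) (hφ1 i)
  refine le_of_tendsto_of_tendsto' (ENNReal.Tendsto.const_mul (ENNReal.Tendsto.pow t0)
      (Or.inr ENNReal.ofReal_ne_top)) (ENNReal.Tendsto.const_mul (ENNReal.Tendsto.const_mul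
      ((ENNReal.Tendsto.const_mul (ENNReal.Tendsto.pow t1) (Or.inr (by simp))).add
      (ENNReal.Tendsto.const_mul (tendsto_finsetSum _ fun i _ => ENNReal.Tendsto.pow (t2 i))
      (Or.inr (by finiteness)))) (Or.inr h.ne_top)) (Or.inr ENNReal.ofReal_ne_top)) fun k =>
    h.mul_sq_eLpNorm_fibreMeasure_le hσd (hφ k)

/-- On short fibres, a Sobolev function is close to its trace. -/
lemma IsFibred.sq_eLpNorm_sub_trace_le {S Γ P : Set E2} {c : ℝ≥0∞} {d : ℝ}
    (h : IsFibred S Γ P c d) (hS : IsBoundedLipschitzDomain S) {u g : E2 → F}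
    (hu : IsTrace S Γ u g) :
    eLpNorm (fun x => u (stripMap S Γ x) - g x.1) 2 (fibreMeasure P d) ^ 2 ≤
      ENNReal.ofReal d ^ 2 *
        (c * ∑ i, eLpNorm (weakPartial S i u) 2 (volume.restrict S) ^ 2) := by
  have := isFiniteMeasure_restrict hS.isBounded
  have := h.finite
  have := h.finite'
  have hSm := hS.isOpen.measurableSet
  obtain ⟨huH, hg, φ, hφ, hφ0, hφ1, hφg⟩ := hu
  have hu' := huH.hasWeakGrad
  have mφ := fun k => memLp_of_continuous hS.isBounded hSm (hφ k).continuous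
  have mφ' := fun k i => memLp_of_continuous hS.isBounded hSm
    (continuous_partial (hφ k) (by simp) i)
  have hac := arcMeasure_mono h.subset
  have hgP : MemLp g 2 (arcMeasure P) := hg.mono_measure hac
  have hfg : Tendsto (fun k => eLpNorm (fun x : E2 × ℝ => φ k x.1 - g x.1) 2 (fibreMeasure P d))
      atTop (𝓝 0) := by
    refine tendsto_zero_of_sq ?_
    have e := fun k => sq_eLpNorm_fst (P := P) d (w := fun x => φ k x - g x)
      ((hφ k).continuous.aestronglyMeasurable.sub hgP.1)
    simp_rw [e]
    have h1 := ENNReal.Tendsto.const_mul (tendsto_sq_zero hφg) (a := ENNReal.ofReal d)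
      (Or.inr ENNReal.ofReal_ne_top)
    rw [mul_zero] at h1
    refine tendsto_of_tendsto_of_tendsto_of_le_of_le tendsto_const_nhds h1 (fun _ => bot_le)
      fun k => ?_
    exact mul_le_mul_right (pow_le_pow_left₀ bot_le (eLpNorm_mono_measure _ hac) 2) _
  have hcomp := h.tendsto_comp mφ hu'.memLp hφ0
  have hgm : AEStronglyMeasurable (fun x : E2 × ℝ => g x.1) (fibreMeasure P d) :=
    hgP.1.comp_quasiMeasurePreserving Measure.quasiMeasurePreserving_fst
  have hφm : ∀ k, AEStronglyMeasurable (fun x : E2 × ℝ => φ k x.1) (fibreMeasure P d) :=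
    fun k => ((hφ k).continuous.comp continuous_fst).aestronglyMeasurable
  have t2 := fun i => tendsto_eLpNorm_of_sub (fun k => mφ' k i) (hu'.memLp_grad i) (hφ1 i)
  have hlim := ENNReal.Tendsto.const_mul (a := ENNReal.ofReal d ^ 2)
    (ENNReal.Tendsto.const_mul (a := c)
    (tendsto_finsetSum Finset.univ fun i _ => ENNReal.Tendsto.pow (n := 2) (t2 i))
    (Or.inr h.ne_top)) (Or.inr (by finiteness))
  -- pass through a smooth approximation on the fibre and at its foot
  have hle : ∀ k, eLpNorm (fun x => u (stripMap S Γ x) - g x.1) 2 (fibreMeasure P d) ≤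
      eLpNorm (fun x => φ k (stripMap S Γ x) - u (stripMap S Γ x)) 2 (fibreMeasure P d) +
      eLpNorm (fun x : E2 × ℝ => φ k x.1 - g x.1) 2 (fibreMeasure P d) +
      eLpNorm (fun x => φ k (stripMap S Γ x) - φ k x.1) 2 (fibreMeasure P d) := by
    intro k
    have m1 := (h.memLp_comp (mφ k)).1
    have m2 := (h.memLp_comp hu'.memLp).1
    have e : (fun x => u (stripMap S Γ x) - g x.1) = (fun x => (-(φ k (stripMap S Γ x) -
        u (stripMap S Γ x)) + (φ k x.1 - g x.1)) + (φ k (stripMap S Γ x) - φ k x.1)) := by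
      ext x; abel
    rw [e]
    refine (eLpNorm_add_le ((m1.sub m2).neg.add ((hφm k).sub hgm)) (m1.sub (hφm k))
      one_le_two).trans (add_le_add ?_ le_rfl)
    refine (eLpNorm_add_le (m1.sub m2).neg ((hφm k).sub hgm) one_le_two).trans
      (add_le_add ?_ le_rfl)
    exact (eLpNorm_neg (fun x => φ k (stripMap S Γ x) - u (stripMap S Γ x)) 2 _).le
  have hroot : ∀ a b : ℝ≥0∞, a ^ 2 ≤ b → a ≤ b ^ (1 / 2 : ℝ) := fun a b hab => by
    have := ENNReal.rpow_le_rpow hab (z := 1 / 2) (by norm_num)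
    rwa [← ENNReal.rpow_natCast, ← ENNReal.rpow_mul, Nat.cast_ofNat,
      show (2 : ℝ) * (1 / 2) = 1 by norm_num, ENNReal.rpow_one] at this
  have hfin := (hcomp.add hfg).add
    ((ENNReal.continuous_rpow_const (y := 1 / 2)).tendsto _ |>.comp hlim)
  rw [add_zero, zero_add] at hfin
  have := ge_of_tendsto' hfin fun k => (hle k).trans
    (add_le_add le_rfl (hroot _ _ (h.sq_eLpNorm_sub_fst_le (hφ k))))
  calc _ ≤ (_ : ℝ≥0∞) ^ 2 := pow_le_pow_left₀ bot_le this 2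
    _ = _ := by
      rw [← ENNReal.rpow_natCast, ← ENNReal.rpow_mul]
      norm_num

/-- Bounded Sobolev functions have a trace on `Γ`: smooth approximations which are uniformly bounded
are Cauchy in `L²` on the inner parts of `Γ`, and the length of the remaining part tends to zero. -/
theorem exists_isTrace {S Γ : Set E2} (hS : IsBoundedLipschitzDomain S)
    (hΓ : IsRegularBoundaryPart S Γ) {u : E2 → F} (hu : MemH1 S u) {B : ℝ} (hB0 : 0 ≤ B)
    (hB : ∀ᵐ x ∂(volume.restrict S), ‖u x‖ ≤ B) : ∃ g, IsTrace S Γ u g := by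
  have := isFiniteMeasure_restrict hS.isBounded
  have hSm := hS.isOpen.measurableSet
  obtain ⟨d₀, hd₀, hfib⟩ := exists_isFibred hS hΓ
  obtain ⟨C, σ₀, hC, hσ₀, hend⟩ := exists_measure_diff_innerPart_le hS hΓ
  have := (hfib d₀ le_rfl).finite
  have hu' := hu.hasWeakGrad
  obtain ⟨J, hJ0, hJ⟩ := hS.exists_smooth_approx (F := F)
  obtain ⟨φ, hφ, hφ0, hφ1, hφB⟩ := hJ u _ hu'
  have hbd := hφB B hB0 hB
  have mφ := fun k => memLp_of_continuous hS.isBounded hSm (hφ k).continuous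
  have mφ' := fun k i => memLp_of_continuous hS.isBounded hSm
    (continuous_partial (hφ k) (by simp) i)
  have mΓ : ∀ k, MemLp (φ k) 2 (arcMeasure Γ) := fun k =>
    MemLp.of_bound (hφ k).continuous.aestronglyMeasurable (J * B) (Eventually.of_forall (hbd k))
  have hcau : CauchySeq fun k => (mΓ k).toLp (φ k) := by
    rw [EMetric.cauchySeq_iff]
    -- sequences converging in `L²(S)` are Cauchy there, with the double limit as a product filter
    have hpair : ∀ {w : ℕ → E2 → F} {w₀ : E2 → F}, (∀ k, MemLp (w k) 2 (volume.restrict S)) →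
        MemLp w₀ 2 (volume.restrict S) →
        Tendsto (fun k => eLpNorm (fun x => w k x - w₀ x) 2 (volume.restrict S)) atTop (𝓝 0) →
        Tendsto (fun p : ℕ × ℕ => eLpNorm (fun x => w p.1 x - w p.2 x) 2 (volume.restrict S))
          (atTop ×ˢ atTop) (𝓝 0) := by
      intro w w₀ hw hw₀ hlim
      have hs := (hlim.comp tendsto_fst).add (hlim.comp (tendsto_snd (f := atTop (α := ℕ))))
      rw [add_zero] at hs
      refine tendsto_of_tendsto_of_tendsto_of_le_of_le tendsto_const_nhds hs (fun _ => bot_le)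
        fun p => ?_
      have e : (fun x => w p.1 x - w p.2 x) = fun x => (w p.1 x - w₀ x) - (w p.2 x - w₀ x) := by
        ext x; abel
      simp only [Function.comp]
      rw [e]
      exact eLpNorm_sub_le ((hw p.1).sub hw₀).1 ((hw p.2).sub hw₀).1 one_le_two
    have hsq : Tendsto (fun p : ℕ × ℕ => eLpNorm (fun x => φ p.1 x - φ p.2 x) 2 (arcMeasure Γ))
        (atTop ×ˢ atTop) (𝓝 0) := by
      refine tendsto_zero_of_sq (ENNReal.tendsto_nhds_zero.2 fun ε hε => ?_)
      -- base points with short fibres have length `O(d)`, so the bounded approximations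
      -- contribute at most `ε / 2` there
      obtain ⟨d, hd0, hdd, hdσ, hdε⟩ : ∃ d : ℝ, 0 < d ∧ d ≤ d₀ ∧ d ≤ σ₀ ∧
          ENNReal.ofReal ((2 * (J * B)) ^ 2) * ENNReal.ofReal (C * d) ≤ ε / 2 := by
        have h1 : Tendsto (fun d : ℝ => ENNReal.ofReal ((2 * (J * B)) ^ 2) *
            ENNReal.ofReal (C * d)) (𝓝[>] 0) (𝓝 0) := by
          have : Continuous fun d : ℝ => ENNReal.ofReal ((2 * (J * B)) ^ 2) *
              ENNReal.ofReal (C * d) :=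
            (ENNReal.continuous_const_mul ENNReal.ofReal_ne_top).comp
              (ENNReal.continuous_ofReal.comp (continuous_const.mul continuous_id))
          have := (this.tendsto 0).mono_left (nhdsWithin_le_nhds (s := Ioi (0 : ℝ)))
          simpa using this
        have h2 := (ENNReal.tendsto_nhds_zero.1 h1 (ε / 2) (ENNReal.half_pos hε.ne')).and
          (Ioo_mem_nhdsGT (lt_min hd₀ hσ₀))
        obtain ⟨d, hd1, hd2⟩ := h2.exists
        exact ⟨d, hd2.1, hd2.2.le.trans (min_le_left _ _), hd2.2.le.trans (min_le_right _ _), hd1⟩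
      set P := innerPart S Γ d with hP
      have hPm : MeasurableSet P := measurableSet_innerPart hΓ.measurableSet d
      have hf := hfib d hdd
      -- over the other base points the trace inequality applies, with `d` now fixed
      have hsmall : Tendsto (fun p : ℕ × ℕ =>
          eLpNorm (fun x => φ p.1 x - φ p.2 x) 2 (arcMeasure P) ^ 2)
          (atTop ×ˢ atTop) (𝓝 0) := by
        have hder := fun i => hpair (fun k => mφ' k i) (hu'.memLp_grad i) (hφ1 i)
        have hlim := ENNReal.Tendsto.const_mul (a := 2)
          ((ENNReal.Tendsto.const_mul (a := 2)
            (tendsto_sq_zero (hpair mφ hu'.memLp hφ0)) (Or.inr (by simp))).add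
          (ENNReal.Tendsto.const_mul (a := 2 * ENNReal.ofReal d ^ 2)
            (tendsto_finsetSum Finset.univ fun i _ => tendsto_sq_zero (hder i))
            (Or.inr (by finiteness)))) (Or.inr (by simp))
        have hlim2 := ENNReal.Tendsto.const_mul (a := (ENNReal.ofReal d)⁻¹) hlim
          (Or.inr (by simpa using hd0))
        simp only [Finset.sum_const_zero, mul_zero, add_zero] at hlim2
        refine tendsto_of_tendsto_of_tendsto_of_le_of_le tendsto_const_nhds hlim2
          (fun _ => bot_le) fun p => ?_
        have h1 := hf.mul_sq_eLpNorm_arcMeasure_le hd0.le ((hφ p.1).sub (hφ p.2))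
        have e : ∀ i x, fderiv ℝ (fun x => φ p.1 x - φ p.2 x) x (dir i) =
            fderiv ℝ (φ p.1) x (dir i) - fderiv ℝ (φ p.2) x (dir i) := fun i x => by
          rw [fderiv_fun_sub ((hφ p.1).differentiable (by simp) x)
            ((hφ p.2).differentiable (by simp) x)]
          rfl
        simp_rw [e] at h1
        rwa [← ENNReal.div_eq_inv_mul, ENNReal.le_div_iff_mul_le (by simp [hd0]) (by simp),
          mul_comm]
      filter_upwards [ENNReal.tendsto_nhds_zero.1 hsmall (ε / 2) (ENNReal.half_pos hε.ne')]
        with p hp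
      have hsplit : arcMeasure Γ = arcMeasure P + (arcMeasure Γ).restrict (Γ \ P) := by
        have h1 : arcMeasure P = (arcMeasure Γ).restrict P := by
          rw [arcMeasure, arcMeasure, Measure.restrict_restrict hPm,
            inter_eq_self_of_subset_left (innerPart_subset d)]
        have h2 : arcMeasure Γ = (arcMeasure Γ).restrict Γ := by
          rw [arcMeasure, Measure.restrict_restrict hΓ.measurableSet, inter_self]
        rw [h1]
        conv_lhs => rw [h2]
        rw [← Measure.restrict_union disjoint_sdiff_right (hΓ.measurableSet.diff hPm),
          union_sdiff_cancel (innerPart_subset d)]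
      rw [sq_eLpNorm_two] at hp ⊢
      rw [hsplit, lintegral_add_measure]
      calc _ ≤ ε / 2 + ε / 2 := add_le_add hp ?_
        _ = ε := ENNReal.add_halves ε
      calc ∫⁻ x, ‖φ p.1 x - φ p.2 x‖ₑ ^ 2 ∂((arcMeasure Γ).restrict (Γ \ P))
          ≤ ∫⁻ _, ENNReal.ofReal ((2 * (J * B)) ^ 2) ∂((arcMeasure Γ).restrict (Γ \ P)) := by
            refine lintegral_mono fun x => ?_
            rw [ENNReal.ofReal_pow (by positivity), ← ofReal_norm]
            gcongr
            have := norm_sub_le (φ p.1 x) (φ p.2 x)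
            linarith [hbd p.1 x, hbd p.2 x]
        _ = ENNReal.ofReal ((2 * (J * B)) ^ 2) * arcMeasure Γ (Γ \ P) := by
            rw [lintegral_const, Measure.restrict_apply_univ]
        _ ≤ _ := (mul_le_mul_right (hend d hd0 hdσ) _).trans hdε
    intro ε hε
    have h1 := hsq.eventually (gt_mem_nhds hε)
    rw [prod_atTop_atTop_eq] at h1
    obtain ⟨⟨N, M⟩, hN⟩ := eventually_atTop.1 h1
    refine ⟨max N M, fun m hm n hn => ?_⟩
    rw [Lp.edist_toLp_toLp]
    exact hN (m, n) ⟨(le_max_left _ _).trans hm, (le_max_right _ _).trans hn⟩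
  obtain ⟨g, hg⟩ := cauchySeq_tendsto_of_complete hcau
  refine ⟨g, hu, Lp.memLp g, φ, hφ, hφ0, hφ1, ?_⟩
  rw [← Lp.toLp_coeFn g (Lp.memLp g), Lp.tendsto_Lp_iff_tendsto_eLpNorm'' φ mΓ g (Lp.memLp g)] at hg
  exact hg

lemma isTrace_traceOn {S Γ : Set E2} (hS : IsBoundedLipschitzDomain S)
    (hΓ : IsRegularBoundaryPart S Γ) {u : E2 → F} (hu : MemH1 S u) {B : ℝ} (hB0 : 0 ≤ B)
    (hB : ∀ᵐ x ∂(volume.restrict S), ‖u x‖ ≤ B) : IsTrace S Γ u (traceOn S Γ u) := by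
  have h := exists_isTrace hS hΓ hu hB0 hB
  rw [traceOn, dif_pos h]
  exact h.choose_spec

end Fibre

/-! ### The quadratic form of the stored energy -/

/-- The symmetric part of a matrix. -/
noncomputable def symPart {n : ℕ} (G : Matrix (Fin n) (Fin n) ℝ) : Matrix (Fin n) (Fin n) ℝ :=
  (1 / 2 : ℝ) • (G + Gᵀ)

lemma frobSq_nonneg {m n : ℕ} (A : Matrix (Fin m) (Fin n) ℝ) : 0 ≤ frobSq A :=
  Finset.sum_nonneg fun _ _ => Finset.sum_nonneg fun _ _ => sq_nonneg _

lemma frobSq_smul {m n : ℕ} (a : ℝ) (A : Matrix (Fin m) (Fin n) ℝ) :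
    frobSq (a • A) = a ^ 2 * frobSq A := by
  simp [frobSq, Finset.mul_sum, mul_pow]

lemma frob_smul {m n : ℕ} {a : ℝ} (ha : 0 ≤ a) (A : Matrix (Fin m) (Fin n) ℝ) :
    frob (a • A) = a * frob A := by
  rw [frob, frob, frobSq_smul, Real.sqrt_mul (sq_nonneg a), Real.sqrt_sq ha]

lemma frob_pos {m n : ℕ} {A : Matrix (Fin m) (Fin n) ℝ} (hA : A ≠ 0) : 0 < frob A := by
  refine Real.sqrt_pos.2 (lt_of_le_of_ne (frobSq_nonneg A) fun h => hA ?_)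
  ext i j
  have h1 := (Finset.sum_eq_zero_iff_of_nonneg fun i _ => Finset.sum_nonneg
    fun j _ => sq_nonneg (A i j)).1 h.symm i (Finset.mem_univ i)
  have h2 := (Finset.sum_eq_zero_iff_of_nonneg fun j _ => sq_nonneg (A i j)).1 h1 j
    (Finset.mem_univ j)
  simpa using h2

open scoped Matrix.Norms.Frobenius in
lemma frobSq_eq_sq_norm {m n : ℕ} (A : Matrix (Fin m) (Fin n) ℝ) : frobSq A = ‖A‖ ^ 2 := by
  have h0 : 0 ≤ ∑ i, ∑ j, ‖A i j‖ ^ (2 : ℝ) :=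
    Finset.sum_nonneg fun _ _ => Finset.sum_nonneg fun _ _ => by positivity
  rw [Matrix.frobenius_norm_def, ← Real.sqrt_eq_rpow, Real.sq_sqrt h0]
  simp [frobSq]

open scoped Matrix.Norms.Frobenius in
/-- The distance of `1 + ε G` to the rotations is, to first order, at least `ε` times the length of
the symmetric part of `G`: a rotation `R` satisfies `1 - sym R = (R - 1)ᵀ (R - 1) / 2`. -/
lemma le_distSqSO3 (G : M3) {ε : ℝ} (hε : 0 < ε) :
    ε ^ 2 * max (frob (symPart G) - 2 * ε * frobSq G) 0 ^ 2 ≤ distSqSO3 (1 + ε • G) := by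
  have hfrob : frob (symPart G) = ‖symPart G‖ := by
    rw [frob, frobSq_eq_sq_norm, Real.sqrt_sq (norm_nonneg _)]
  rw [distSqSO3]
  refine le_ciInf fun R => ?_
  have hR : (R.1)ᵀ * R.1 = 1 := by
    have := (Matrix.mem_orthogonalGroup_iff' (Fin 3) ℝ).1
      (Matrix.mem_specialOrthogonalGroup_iff.1 R.2).1
    simpa [Matrix.star_eq_conjTranspose] using this
  generalize R.1 = R at hR ⊢
  rw [frobSq_eq_sq_norm, frobSq_eq_sq_norm, hfrob, ← mul_pow]
  refine pow_le_pow_left₀ (by positivity) ?_ 2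
  set ρ := ‖1 + ε • G - R‖ with hρ
  have hsym : ‖symPart G‖ ≤ ‖G‖ := by
    rw [symPart, norm_smul, Real.norm_of_nonneg (by norm_num)]
    have := norm_add_le G Gᵀ
    rw [Matrix.frobenius_norm_transpose] at this
    linarith
  rcases le_total (ε * ‖G‖) ρ with h | h
  -- far from `R` there is nothing to show
  · have h1 : max (‖symPart G‖ - 2 * ε * ‖G‖ ^ 2) 0 ≤ ‖G‖ :=
      max_le (by nlinarith [sq_nonneg ‖G‖]) (norm_nonneg _)
    nlinarith
  -- otherwise `‖R - 1‖ ≤ 2 ε ‖G‖`, and the symmetric part of `R - 1` is quadratically small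
  · have e : ε • symPart G = symPart (1 + ε • G - R) - (1 / 2 : ℝ) • ((R - 1)ᵀ * (R - 1)) := by
      have : (R - 1)ᵀ * (R - 1) = (2 : ℝ) • (1 : M3) - R - Rᵀ := by
        rw [Matrix.transpose_sub, Matrix.transpose_one, sub_mul, mul_sub, mul_sub, hR, mul_one,
          one_mul, mul_one, two_smul]
        abel
      rw [this, symPart, symPart, Matrix.transpose_sub, Matrix.transpose_add,
        Matrix.transpose_one, Matrix.transpose_smul]
      module
    have h2 : ‖symPart (1 + ε • G - R)‖ ≤ ρ := by
      rw [symPart, norm_smul, Real.norm_of_nonneg (by norm_num)]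
      have := norm_add_le (1 + ε • G - R) (1 + ε • G - R)ᵀ
      rw [Matrix.frobenius_norm_transpose] at this
      linarith
    have h3 : ‖R - 1‖ ≤ ρ + ε * ‖G‖ := by
      have e' : R - 1 = ε • G - (1 + ε • G - R) := by abel
      rw [e']
      refine (norm_sub_le _ _).trans ?_
      rw [norm_smul, Real.norm_of_nonneg hε.le, add_comm]
    have h4 : ‖(R - 1)ᵀ * (R - 1)‖ ≤ (2 * (ε * ‖G‖)) ^ 2 := by
      refine (Matrix.frobenius_norm_mul _ _).trans ?_
      rw [Matrix.frobenius_norm_transpose, sq]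
      gcongr <;> linarith
    have h5 : ε * ‖symPart G‖ ≤ ρ + 1 / 2 * (2 * (ε * ‖G‖)) ^ 2 := by
      have := norm_sub_le (symPart (1 + ε • G - R)) ((1 / 2 : ℝ) • ((R - 1)ᵀ * (R - 1)))
      rw [← e, norm_smul, norm_smul, Real.norm_of_nonneg hε.le,
        Real.norm_of_nonneg (by norm_num)] at this
      linarith
    rcases max_cases (‖symPart G‖ - 2 * ε * ‖G‖ ^ 2) 0 with ⟨h6, -⟩ | ⟨h6, -⟩ <;> rw [h6]
    · nlinarith
    · rw [mul_zero]; exact norm_nonneg _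

lemma distSqSO3_le (G : M3) : distSqSO3 (1 + G) ≤ frobSq G := by
  refine (ciInf_le ⟨0, ?_⟩ (1 : Matrix.specialOrthogonalGroup (Fin 3) ℝ)).trans ?_
  · rintro _ ⟨R, rfl⟩
    exact frobSq_nonneg _
  · simp

namespace StoredEnergy

variable {W : ℝ → M3 → ℝ≥0∞} {Q : ℝ → QuadraticForm ℝ M3} {C q : ℝ} {r : ℝ≥0 → ℝ≥0∞}

/-- The open interval of thickness coordinates. -/
abbrev thickness : Set ℝ := Ioo (-(1 / 2) : ℝ) (1 / 2)

lemma ne_top_and_abs_sub_le (hW : StoredEnergy W Q C q r) {t : ℝ} (ht : t ∈ thickness) {G : M3}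
    (hr : r (frob G).toNNReal ≠ ⊤) :
    W t (1 + G) ≠ ⊤ ∧
      |(W t (1 + G)).toReal - Q t G| ≤ frobSq G * (r (frob G).toNNReal).toReal := by
  have h := hW.expansion t ht G
  have hfin : ENNReal.ofReal (frobSq G) * r (frob G).toNNReal ≠ ⊤ :=
    ENNReal.mul_ne_top ENNReal.ofReal_ne_top hr
  have hWt : W t (1 + G) ≠ ⊤ := by
    intro htop
    rw [htop, EReal.coe_ennreal_top, EReal.top_sub_coe, EReal.abs_top, top_le_iff] at h
    exact hfin h
  refine ⟨hWt, ?_⟩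
  rw [← EReal.coe_toReal (x := (W t (1 + G) : EReal)) (by simpa using hWt) (by simp),
    EReal.toReal_coe_ennreal, ← EReal.coe_sub, EReal.abs_def] at h
  have := ENNReal.toReal_mono hfin h
  rwa [ENNReal.toReal_ofReal (abs_nonneg _), ENNReal.toReal_mul,
    ENNReal.toReal_ofReal (frobSq_nonneg _)] at this

lemma tendsto_modulus (hW : StoredEnergy W Q C q r) {G : M3} (hG : G ≠ 0) :
    Tendsto (fun n : ℕ => r (frob ((1 / ((n : ℝ) + 1)) • G)).toNNReal) atTop (𝓝 0) := by
  refine hW.r_lim.comp (tendsto_nhdsWithin_iff.2 ⟨?_, Eventually.of_forall fun n => ?_⟩)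
  · have h1 : Tendsto (fun n : ℕ => (1 / ((n : ℝ) + 1)) * frob G) atTop (𝓝 0) := by
      simpa using tendsto_one_div_add_atTop_nhds_zero_nat.mul_const (frob G)
    have h2 := (continuous_real_toNNReal.tendsto 0).comp h1
    rw [Real.toNNReal_zero] at h2
    refine h2.congr fun n => ?_
    rw [frob_smul (by positivity)]; rfl
  · rw [mem_Ioi, frob_smul (by positivity), Real.toNNReal_pos]
    have := frob_pos hG
    positivity

/-- The quadratic form is the rescaled limit of the stored energy at the identity. -/
lemma tendsto_energy (hW : StoredEnergy W Q C q r) {t : ℝ} (ht : t ∈ thickness) (G : M3) :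
    Tendsto (fun n : ℕ => (W t (1 + (1 / ((n : ℝ) + 1)) • G)).toReal / (1 / ((n : ℝ) + 1)) ^ 2)
      atTop (𝓝 (Q t G)) := by
  by_cases hG : G = 0
  · subst hG
    have h1 : W t 1 = 0 := by
      have hd : distSqSO3 1 ≤ 0 := by
        have := distSqSO3_le 0
        simpa [frobSq] using this
      have hC := hW.C_pos
      have := hW.upper t ht 1 (hd.trans (by positivity))
      rw [ENNReal.ofReal_of_nonpos (mul_nonpos_of_nonneg_of_nonpos hC.le hd)] at this
      exact le_antisymm this bot_le
    simp [h1]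
  · have hr := hW.tendsto_modulus hG
    have hr' := (ENNReal.tendsto_toReal ENNReal.zero_ne_top).comp hr
    rw [ENNReal.toReal_zero] at hr'
    rw [tendsto_iff_norm_sub_tendsto_zero]
    have hlim : Tendsto (fun n : ℕ => frobSq G *
        (r (frob ((1 / ((n : ℝ) + 1)) • G)).toNNReal).toReal) atTop (𝓝 0) := by
      simpa using hr'.const_mul (frobSq G)
    refine squeeze_zero' (Eventually.of_forall fun n => norm_nonneg _) ?_ hlim
    filter_upwards [hr.eventually (gt_mem_nhds ENNReal.zero_lt_top)] with n hn
    have hε : (0 : ℝ) < 1 / ((n : ℝ) + 1) := by positivity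
    set ε := 1 / ((n : ℝ) + 1) with hεdef
    have h2 := (hW.ne_top_and_abs_sub_le ht hn.ne).2
    rw [frobSq_smul, QuadraticMap.map_smul, smul_eq_mul] at h2
    have e : (W t (1 + ε • G)).toReal / ε ^ 2 - Q t G =
        ((W t (1 + ε • G)).toReal - ε * ε * Q t G) / ε ^ 2 := by
      field_simp
    rw [e, Real.norm_eq_abs, abs_div, abs_of_pos (by positivity : 0 < ε ^ 2),
      div_le_iff₀ (by positivity)]
    linarith

/-- The quadratic form is coercive on symmetric parts: this is the rescaled limit of the lower
bound of the stored energy by the squared distance to the rotations. -/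
lemma le_quadratic (hW : StoredEnergy W Q C q r) {t : ℝ} (ht : t ∈ thickness) (G : M3) :
    1 / C * frobSq (symPart G) ≤ Q t G := by
  have hC := hW.C_pos
  have hlim : Tendsto (fun n : ℕ => 1 / C *
      max (frob (symPart G) - 2 * (1 / ((n : ℝ) + 1)) * frobSq G) 0 ^ 2) atTop
      (𝓝 (1 / C * max (frob (symPart G) - 2 * 0 * frobSq G) 0 ^ 2)) := by
    refine ((((tendsto_const_nhds.sub ((tendsto_one_div_add_atTop_nhds_zero_nat.const_mul
      2).mul_const _)).max tendsto_const_nhds).pow 2).const_mul _)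
  have hsq : frob (symPart G) ^ 2 = frobSq (symPart G) := Real.sq_sqrt (frobSq_nonneg _)
  have h0 : 0 ≤ frob (symPart G) := Real.sqrt_nonneg _
  rw [mul_zero, zero_mul, sub_zero, max_eq_left h0, hsq] at hlim
  have hr : ∀ᶠ n : ℕ in atTop, W t (1 + (1 / ((n : ℝ) + 1)) • G) ≠ ⊤ := by
    by_cases hG : G = 0
    · refine Eventually.of_forall fun n => ?_
      have hd := distSqSO3_le 0
      simp only [frobSq, Matrix.zero_apply, add_zero] at hd
      norm_num at hd
      have := hW.upper t ht 1 (hd.trans (by positivity))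
      rw [hG, smul_zero, add_zero]
      exact ne_top_of_le_ne_top ENNReal.ofReal_ne_top this
    · filter_upwards [(hW.tendsto_modulus hG).eventually (gt_mem_nhds ENNReal.zero_lt_top)]
        with n hn using (hW.ne_top_and_abs_sub_le ht hn.ne).1
  refine le_of_tendsto_of_tendsto hlim (hW.tendsto_energy ht G) ?_
  filter_upwards [hr] with n hn
  have hε : (0 : ℝ) < 1 / ((n : ℝ) + 1) := by positivity
  set ε := 1 / ((n : ℝ) + 1) with hεdef
  rw [le_div_iff₀ (by positivity)]
  have h1 := le_distSqSO3 G hε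
  have h2 := hW.lower t ht (1 + ε • G)
  have h3 := (ENNReal.ofReal_le_iff_le_toReal hn).1 h2
  have h4 : 1 / C * (ε ^ 2 * max (frob (symPart G) - 2 * ε * frobSq G) 0 ^ 2) ≤
      1 / C * distSqSO3 (1 + ε • G) := by gcongr
  linarith

lemma quadratic_le (hW : StoredEnergy W Q C q r) {t : ℝ} (ht : t ∈ thickness) (G : M3) :
    Q t G ≤ C * frobSq G := by
  have hC := hW.C_pos
  refine le_of_tendsto (hW.tendsto_energy ht G) ?_
  have hsmall : Tendsto (fun n : ℕ => (1 / ((n : ℝ) + 1)) ^ 2 * frobSq G) atTop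
      (𝓝 (0 ^ 2 * frobSq G)) :=
    (tendsto_one_div_add_atTop_nhds_zero_nat.pow 2).mul_const _
  rw [zero_pow two_ne_zero, zero_mul] at hsmall
  filter_upwards [hsmall.eventually (gt_mem_nhds (show (0 : ℝ) < 1 / C by positivity))] with n hn
  have hε : (0 : ℝ) < 1 / ((n : ℝ) + 1) := by positivity
  set ε := 1 / ((n : ℝ) + 1) with hεdef
  have h1 := distSqSO3_le (ε • G)
  rw [frobSq_smul] at h1
  have h2 := hW.upper t ht (1 + ε • G) (h1.trans hn.le)
  have h3 : (W t (1 + ε • G)).toReal ≤ C * (ε ^ 2 * frobSq G) := by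
    refine ENNReal.toReal_le_of_le_ofReal (by have := frobSq_nonneg G; positivity)
      (h2.trans (ENNReal.ofReal_le_ofReal ?_))
    gcongr
  rw [div_le_iff₀ (by positivity)]
  linarith

lemma quadratic_nonneg (hW : StoredEnergy W Q C q r) {t : ℝ} (ht : t ∈ thickness) (G : M3) :
    0 ≤ Q t G := by
  have hC := hW.C_pos
  have := frobSq_nonneg (symPart G)
  exact le_trans (by positivity) (hW.le_quadratic ht G)

lemma measurable_quadratic (hW : StoredEnergy W Q C q r) (G : M3) :
    Measurable fun t : thickness => Q t G := by
  refine measurable_of_tendsto_metrizable (f := fun (n : ℕ) (t : thickness) =>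
    (W t (1 + (1 / ((n : ℝ) + 1)) • G)).toReal / (1 / ((n : ℝ) + 1)) ^ 2) (fun n => ?_)
    (tendsto_pi_nhds.2 fun t => hW.tendsto_energy t.2 G)
  have h1 : Measurable fun t : thickness =>
      ((t, fun i j => (1 + (1 / ((n : ℝ) + 1)) • G) i j) : thickness × (Fin 3 → Fin 3 → ℝ)) :=
    measurable_id.prodMk measurable_const
  exact (hW.borel.comp h1).ennreal_toReal.div_const _

lemma quadratic_convex (hW : StoredEnergy W Q C q r) {t : ℝ} (ht : t ∈ thickness) :
    ConvexOn ℝ univ (Q t) := by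
  refine ⟨convex_univ, fun G _ G' _ a b ha hb hab => ?_⟩
  have h0 := hW.quadratic_nonneg ht (G - G')
  have e1 : Q t (G - G') = Q t G + Q t G' - QuadraticMap.polar (Q t) G G' := by
    rw [sub_eq_add_neg, QuadraticMap.map_add (Q t), QuadraticMap.map_neg,
      QuadraticMap.polar_neg_right]
    ring
  have e2 : Q t (a • G + b • G') = a * a * Q t G + b * b * Q t G' +
      a * (b * QuadraticMap.polar (Q t) G G') := by
    rw [QuadraticMap.map_add (Q t), QuadraticMap.map_smul, QuadraticMap.map_smul,
      QuadraticMap.polar_smul_left, QuadraticMap.polar_smul_right]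
    simp [smul_eq_mul]
  rw [e2, smul_eq_mul, smul_eq_mul]
  have hb' : b = 1 - a := by linarith
  subst hb'
  nlinarith [mul_nonneg (mul_nonneg ha hb) h0]

end StoredEnergy

/-! ### The effective quantities -/

/-- Partial minimization preserves convexity. -/
lemma convexOn_iInf_of_exists {E ι : Type*} [AddCommGroup E] [Module ℝ E] [Nonempty ι]
    {f : E → ι → ℝ} (h0 : ∀ x i, 0 ≤ f x i)
    (h : ∀ (x y : E) (i j : ι) (a b : ℝ), 0 ≤ a → 0 ≤ b → a + b = 1 →
      ∃ k, f (a • x + b • y) k ≤ a * f x i + b * f y j) :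
    ConvexOn ℝ univ fun x => ⨅ i, f x i := by
  refine ⟨convex_univ, fun x _ y _ a b ha hb hab => ?_⟩
  refine le_of_forall_pos_le_add fun ε hε => ?_
  obtain ⟨i, hi⟩ := exists_lt_of_ciInf_lt (lt_add_of_pos_right (⨅ i, f x i) hε)
  obtain ⟨j, hj⟩ := exists_lt_of_ciInf_lt (lt_add_of_pos_right (⨅ i, f y i) hε)
  obtain ⟨k, hk⟩ := h x y i j a b ha hb hab
  have h1 : ⨅ i, f (a • x + b • y) i ≤ f (a • x + b • y) k :=
    ciInf_le ⟨0, by rintro _ ⟨i, rfl⟩; exact h0 _ _⟩ k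
  simp only [smul_eq_mul]
  have h2 := mul_le_mul_of_nonneg_left hi.le ha
  have h3 := mul_le_mul_of_nonneg_left hj.le hb
  nlinarith

/-- The space of `2 × 2` matrices with its Euclidean structure. -/
abbrev MatV := EuclideanSpace ℝ (Fin 2 × Fin 2)

/-- The matrix with the given entries. -/
def matOf : MatV →ₗ[ℝ] M2 where
  toFun B := Matrix.of fun i j => B (i, j)
  map_add' A B := by ext i j; simp
  map_smul' a B := by ext i j; simp

/-- The vector of entries of a matrix. -/
noncomputable def vecOf (A : M2) : MatV := WithLp.toLp 2 fun p => A p.1 p.2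

@[simp] lemma matOf_vecOf (A : M2) : matOf (vecOf A) = A := by
  ext i j; simp [matOf, vecOf]

lemma frobSq_matOf (B : MatV) : frobSq (matOf B) = ‖B‖ ^ 2 := by
  rw [EuclideanSpace.norm_sq_eq, Fintype.sum_prod_type]
  simp [frobSq, matOf]

lemma symE3_apply (d : Fin 3 → ℝ) (i j : Fin 3) :
    symE3 d i j = 1 / 2 * (d i * ![0, 0, 1] j + ![0, 0, 1] i * d j) := by
  simp only [symE3, Matrix.smul_apply, Matrix.add_apply, Matrix.vecMulVec_apply, smul_eq_mul]

lemma iota_symE3_combine (A A' : M2) (d d' : Fin 3 → ℝ) (a b : ℝ) :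
    iota (a • A + b • A') + symE3 (a • d + b • d') =
      a • (iota A + symE3 d) + b • (iota A' + symE3 d') := by
  ext i j
  fin_cases i <;> fin_cases j <;>
    simp [iota, symE3_apply] <;> ring

/-- The components of `sym (d ⊗ e₃)` are orthogonal to the planar block. -/
lemma frobSq_symPart_le (A : M2) (d : Fin 3 → ℝ) :
    frobSq (symPart A) ≤ frobSq (symPart (iota A + symE3 d)) := by
  have e : frobSq (symPart (iota A + symE3 d)) = frobSq (symPart A) +
      (d 0 ^ 2 / 2 + d 1 ^ 2 / 2 + d 2 ^ 2) := by
    simp [frobSq, symPart, iota, symE3_apply, Fin.sum_univ_succ]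
    ring
  rw [e]
  have h0 := sq_nonneg (d 0)
  have h1 := sq_nonneg (d 1)
  have h2 := sq_nonneg (d 2)
  linarith

lemma frobSq_iota (A : M2) : frobSq (iota A) = frobSq A := by
  simp [frobSq, iota, Fin.sum_univ_succ]

lemma frobSq_add_le {m n : ℕ} (A B : Matrix (Fin m) (Fin n) ℝ) :
    frobSq (A + B) ≤ 2 * frobSq A + 2 * frobSq B := by
  simp only [frobSq, Finset.mul_sum, ← Finset.sum_add_distrib, Matrix.add_apply]
  exact Finset.sum_le_sum fun i _ => Finset.sum_le_sum fun j _ => by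
    nlinarith [sq_nonneg (A i j - B i j)]

namespace StoredEnergy

variable {W : ℝ → M3 → ℝ≥0∞} {Q : ℝ → QuadraticForm ℝ M3} {C q : ℝ} {r : ℝ≥0 → ℝ≥0∞}

lemma Q2_nonneg (hW : StoredEnergy W Q C q r) {t : ℝ} (ht : t ∈ thickness) (A : M2) :
    0 ≤ Q2 Q t A := le_ciInf fun _ => hW.quadratic_nonneg ht _

lemma le_Q2 (hW : StoredEnergy W Q C q r) {t : ℝ} (ht : t ∈ thickness) (A : M2) :
    1 / C * frobSq (symPart A) ≤ Q2 Q t A := by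
  have := hW.C_pos
  refine le_ciInf fun d => le_trans ?_ (hW.le_quadratic ht _)
  have := frobSq_symPart_le A d
  gcongr

lemma Q2_le (hW : StoredEnergy W Q C q r) {t : ℝ} (ht : t ∈ thickness) (A : M2) :
    Q2 Q t A ≤ C * frobSq A := by
  refine (ciInf_le ⟨0, ?_⟩ (0 : Fin 3 → ℝ)).trans ?_
  · rintro _ ⟨d, rfl⟩
    exact hW.quadratic_nonneg ht _
  · have e : symE3 0 = 0 := by simp [symE3]
    rw [e, add_zero, ← frobSq_iota]
    exact hW.quadratic_le ht _

lemma Q2_convex (hW : StoredEnergy W Q C q r) {t : ℝ} (ht : t ∈ thickness) :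
    ConvexOn ℝ univ (Q2 Q t) := by
  refine convexOn_iInf_of_exists (fun A d => hW.quadratic_nonneg ht _)
    fun A A' d d' a b ha hb hab => ⟨a • d + b • d', ?_⟩
  rw [iota_symE3_combine]
  exact (hW.quadratic_convex ht).2 (mem_univ _) (mem_univ _) ha hb hab

lemma continuous_Q2 (hW : StoredEnergy W Q C q r) {t : ℝ} (ht : t ∈ thickness) :
    Continuous fun B : MatV => Q2 Q t (matOf B) := by
  have h : ConvexOn ℝ univ fun B : MatV => Q2 Q t (matOf B) :=
    (hW.Q2_convex ht).comp_linearMap matOf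
  exact continuousOn_univ.1 (h.continuousOn isOpen_univ)

/-- By continuity the infimum over `d` may be taken over a countable dense set. -/
lemma measurable_Q2 (hW : StoredEnergy W Q C q r) (A : M2) :
    Measurable fun t : thickness => Q2 Q t A := by
  have hc : ∀ t : thickness, Continuous fun d : Fin 3 → ℝ => Q t (iota A + symE3 d) := fun t => by
    have h : ConvexOn ℝ univ fun d : Fin 3 → ℝ => Q t (iota A + symE3 d) := by
      refine ⟨convex_univ, fun d _ d' _ a b ha hb hab => ?_⟩
      have := iota_symE3_combine A A d d' a b
      rw [← add_smul, hab, one_smul] at this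
      beta_reduce
      rw [this]
      exact (hW.quadratic_convex t.2).2 (mem_univ _) (mem_univ _) ha hb hab
    exact continuousOn_univ.1 (h.continuousOn isOpen_univ)
  have e : (fun t : thickness => Q2 Q t A) = fun t : thickness =>
      ⨅ n : ℕ, Q t (iota A + symE3 (TopologicalSpace.denseSeq (Fin 3 → ℝ) n)) := by
    ext t
    refine le_antisymm ?_ ?_
    · refine le_ciInf fun n => ciInf_le ⟨0, ?_⟩ _
      rintro _ ⟨d, rfl⟩
      exact hW.quadratic_nonneg t.2 _
    · refine le_ciInf fun d => ?_
      have hcl : IsClosed {d : Fin 3 → ℝ | (⨅ n : ℕ, Q t (iota A +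
          symE3 (TopologicalSpace.denseSeq (Fin 3 → ℝ) n))) ≤ Q t (iota A + symE3 d)} :=
        isClosed_le continuous_const (hc t)
      have hd : range (TopologicalSpace.denseSeq (Fin 3 → ℝ)) ⊆ {d : Fin 3 → ℝ |
          (⨅ n : ℕ, Q t (iota A + symE3 (TopologicalSpace.denseSeq (Fin 3 → ℝ) n))) ≤
            Q t (iota A + symE3 d)} := by
        rintro _ ⟨n, rfl⟩
        rw [mem_ofPred_eq]
        refine ciInf_le ⟨0, ?_⟩ n
        rintro _ ⟨d, rfl⟩
        exact hW.quadratic_nonneg t.2 _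
      exact hcl.closure_subset_iff.2 hd (TopologicalSpace.denseRange_denseSeq _ d)
  rw [e]
  exact Measurable.iInf fun n => hW.measurable_quadratic _

lemma integrable_Q2 (hW : StoredEnergy W Q C q r) {B : ℝ → M2} {K : ℝ}
    (hB : ∀ i j, Measurable fun t => B t i j) (hK : ∀ t ∈ thickness, frobSq (B t) ≤ K) :
    IntegrableOn (fun t => Q2 Q t (B t)) thickness := by
  have hC := hW.C_pos
  have hm : Measurable (Function.uncurry fun (A : MatV) (t : thickness) => Q2 Q t (matOf A)) :=
    measurable_uncurry_of_continuous_of_measurable (fun t => hW.continuous_Q2 t.2)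
      fun A => hW.measurable_Q2 _
  have hBm : Measurable fun t => vecOf (B t) :=
    (PiLp.continuous_toLp 2 _).measurable.comp (measurable_pi_iff.2 fun p => hB p.1 p.2)
  have hm' : AEMeasurable (fun t => Q2 Q t (B t)) (volume.restrict thickness) := by
    refine aemeasurable_restrict_of_measurable_subtype measurableSet_Ioo ?_
    have := hm.comp ((hBm.comp measurable_subtype_coe).prodMk measurable_id)
    simpa [Function.comp_def, Function.uncurry] using this
  refine Integrable.of_bound (C := C * K) hm'.aestronglyMeasurable ?_
  filter_upwards [ae_restrict_mem measurableSet_Ioo] with t ht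
  rw [Real.norm_of_nonneg (hW.Q2_nonneg ht _)]
  refine (hW.Q2_le ht _).trans ?_
  have := hK t ht
  gcongr

/-- The integrand of the cell problems is integrable over the thickness. -/
lemma integrable_layer (hW : StoredEnergy W Q C q r) (A M U : M2) :
    IntegrableOn (fun t => Q2 Q t (t • A + M + (topLayer t * (1 / 2)) • U)) thickness := by
  have htop : Measurable topLayer := Measurable.ite measurableSet_Ioi measurable_const
    measurable_const
  refine hW.integrable_Q2 (K := 2 * (2 * frobSq A + 2 * frobSq M) + 2 * frobSq U)
    (fun i j => ?_) fun t ht => ?_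
  · simp only [Matrix.add_apply, Matrix.smul_apply, smul_eq_mul]
    fun_prop
  · have h1 := frobSq_add_le (t • A + M) ((topLayer t * (1 / 2)) • U)
    have h2 := frobSq_add_le (t • A) M
    rw [frobSq_smul] at h1 h2
    have h3 : t ^ 2 ≤ 1 := by nlinarith [ht.1, ht.2]
    have h4 : (topLayer t * (1 / 2)) ^ 2 ≤ 1 := by
      rw [topLayer]; split_ifs <;> norm_num
    have h5 := mul_le_mul_of_nonneg_right h3 (frobSq_nonneg A)
    have h6 := mul_le_mul_of_nonneg_right h4 (frobSq_nonneg U)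
    linarith

lemma layer_nonneg (hW : StoredEnergy W Q C q r) (B : ℝ → M2) :
    0 ≤ ∫ t in (-(1 / 2) : ℝ)..(1 / 2), Q2 Q t (B t) := by
  rw [intervalIntegral.integral_of_le (by norm_num), integral_Ioc_eq_integral_Ioo]
  exact setIntegral_nonneg measurableSet_Ioo fun t ht => hW.Q2_nonneg ht _

lemma layer_convex (hW : StoredEnergy W Q C q r) (A M U A' M' U' : M2) {a b : ℝ} (ha : 0 ≤ a)
    (hb : 0 ≤ b) (hab : a + b = 1) :
    (∫ t in (-(1 / 2) : ℝ)..(1 / 2), Q2 Q t (t • (a • A + b • A') + (a • M + b • M') +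
      (topLayer t * (1 / 2)) • (a • U + b • U'))) ≤
    a * (∫ t in (-(1 / 2) : ℝ)..(1 / 2), Q2 Q t (t • A + M + (topLayer t * (1 / 2)) • U)) +
    b * ∫ t in (-(1 / 2) : ℝ)..(1 / 2), Q2 Q t (t • A' + M' + (topLayer t * (1 / 2)) • U') := by
  simp only [intervalIntegral.integral_of_le (show (-(1 / 2) : ℝ) ≤ 1 / 2 by norm_num),
    integral_Ioc_eq_integral_Ioo]
  rw [← integral_const_mul, ← integral_const_mul, ← integral_add
    ((hW.integrable_layer A M U).const_mul a) ((hW.integrable_layer A' M' U').const_mul b)]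
  refine setIntegral_mono_on (hW.integrable_layer _ _ _)
    (((hW.integrable_layer A M U).const_mul a).add ((hW.integrable_layer A' M' U').const_mul b))
    measurableSet_Ioo fun t ht => ?_
  have := (hW.Q2_convex ht).2 (mem_univ (t • A + M + (topLayer t * (1 / 2)) • U))
    (mem_univ (t • A' + M' + (topLayer t * (1 / 2)) • U')) ha hb hab
  refine le_trans (le_of_eq ?_) this
  congr 1
  module

lemma isSymm_combine (M M' : Sym2x2) (a b : ℝ) : (a • M.1 + b • M'.1).IsSymm :=
  (M.2.smul a).add (M'.2.smul b)

lemma Qel_nonneg (hW : StoredEnergy W Q C q r) (A : M2) : 0 ≤ Qel Q A :=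
  have : Nonempty Sym2x2 := ⟨⟨0, Matrix.isSymm_zero⟩⟩
  le_ciInf fun _ => hW.layer_nonneg _

lemma Eres_nonneg (hW : StoredEnergy W Q C q r) (U : M2) : 0 ≤ Eres Q U :=
  have : Nonempty Sym2x2 := ⟨⟨0, Matrix.isSymm_zero⟩⟩
  le_ciInf fun _ => hW.layer_nonneg _

lemma Qel_convex (hW : StoredEnergy W Q C q r) : ConvexOn ℝ univ (Qel Q) := by
  have : Nonempty Sym2x2 := ⟨⟨0, Matrix.isSymm_zero⟩⟩
  refine convexOn_iInf_of_exists (fun A M => hW.layer_nonneg _)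
    fun A A' M M' a b ha hb hab => ⟨⟨_, isSymm_combine M M' a b⟩, ?_⟩
  have := hW.layer_convex A M.1 0 A' M'.1 0 ha hb hab
  simpa only [smul_zero, add_zero] using this

lemma Eres_convex (hW : StoredEnergy W Q C q r) : ConvexOn ℝ univ (Eres Q) := by
  have : Nonempty Sym2x2 := ⟨⟨0, Matrix.isSymm_zero⟩⟩
  refine convexOn_iInf_of_exists (fun U p => hW.layer_nonneg _)
    fun U U' p p' a b ha hb hab =>
      ⟨⟨⟨_, isSymm_combine p.1 p'.1 a b⟩, ⟨_, isSymm_combine p.2 p'.2 a b⟩⟩, ?_⟩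
  exact hW.layer_convex _ _ _ _ _ _ ha hb hab

lemma convexOn_Qel (hW : StoredEnergy W Q C q r) :
    ConvexOn ℝ univ fun B : MatV => Qel Q (matOf B) := hW.Qel_convex.comp_linearMap matOf

lemma continuous_Qel (hW : StoredEnergy W Q C q r) :
    Continuous fun B : MatV => Qel Q (matOf B) :=
  continuousOn_univ.1 (hW.convexOn_Qel.continuousOn isOpen_univ)

lemma continuous_Eres (hW : StoredEnergy W Q C q r) :
    Continuous fun B : MatV => Eres Q (matOf B) := by
  have h : ConvexOn ℝ univ fun B : MatV => Eres Q (matOf B) := hW.Eres_convex.comp_linearMap matOf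
  exact continuousOn_univ.1 (h.continuousOn isOpen_univ)

/-- `Q_el` is coercive on symmetric matrices; the constant is the second moment of the
thickness. -/
lemma le_Qel (hW : StoredEnergy W Q C q r) (A : M2) :
    1 / (12 * C) * frobSq (symPart A) ≤ Qel Q A := by
  have hC := hW.C_pos
  have : Nonempty Sym2x2 := ⟨⟨0, Matrix.isSymm_zero⟩⟩
  refine le_ciInf fun M => ?_
  -- the mixed term is odd in `t`, so that it integrates to zero
  set m : ℝ := ∑ i, ∑ j, symPart A i j * symPart M.1 i j with hm
  have hexp : ∀ t : ℝ, frobSq (symPart (t • A + M.1)) =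
      t ^ 2 * frobSq (symPart A) + 2 * t * m + frobSq (symPart M.1) := fun t => by
    simp only [frobSq, hm, Finset.mul_sum, ← Finset.sum_add_distrib, symPart, Matrix.add_apply,
      Matrix.smul_apply, Matrix.transpose_apply, smul_eq_mul]
    exact Finset.sum_congr rfl fun i _ => Finset.sum_congr rfl fun j _ => by ring
  have e : ∫ t in (-(1 / 2) : ℝ)..(1 / 2), 1 / C * (t ^ 2 * frobSq (symPart A) + 2 * t * m) =
      1 / (12 * C) * frobSq (symPart A) := by
    rw [intervalIntegral.integral_const_mul, intervalIntegral.integral_add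
      (Continuous.intervalIntegrable (by fun_prop) _ _)
      (Continuous.intervalIntegrable (by fun_prop) _ _), intervalIntegral.integral_mul_const,
      intervalIntegral.integral_mul_const, intervalIntegral.integral_const_mul, integral_pow,
      integral_id]
    field_simp
    norm_num
    ring
  rw [← e, intervalIntegral.integral_of_le (by norm_num), integral_Ioc_eq_integral_Ioo,
    intervalIntegral.integral_of_le (by norm_num), integral_Ioc_eq_integral_Ioo]
  have hint := hW.integrable_layer A M.1 0
  simp only [smul_zero, add_zero] at hint
  refine setIntegral_mono_on ?_ hint measurableSet_Ioo fun t ht => ?_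
  · have hc : Continuous fun t : ℝ => 1 / C * (t ^ 2 * frobSq (symPart A) + 2 * t * m) := by
      fun_prop
    exact (hc.continuousOn.integrableOn_compact isCompact_Icc).mono_set Ioo_subset_Icc_self
  · refine le_trans ?_ (hW.le_Q2 ht _)
    rw [hexp]
    have := frobSq_nonneg (symPart M.1)
    exact mul_le_mul_of_nonneg_left (by linarith) (by positivity)

end StoredEnergy

/-- `𝔹` as a linear map on vectors of matrix entries. -/
noncomputable def vecBB (Q : ℝ → QuadraticForm ℝ M3) : MatV →ₗ[ℝ] MatV where
  toFun B := vecOf (BB Q (matOf B))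
  map_add' A B := by
    ext p
    simp only [vecOf, BB, map_add, Matrix.transpose_add, add_mul, Matrix.trace_add, add_smul,
      Finset.sum_add_distrib]
    rfl
  map_smul' a B := by
    ext p
    simp only [vecOf, BB, map_smul, Matrix.transpose_smul, smul_mul_assoc, Matrix.trace_smul,
      smul_assoc, ← Finset.smul_sum]
    rfl

lemma matOf_vecBB (Q : ℝ → QuadraticForm ℝ M3) (B : MatV) :
    matOf (vecBB Q B) = BB Q (matOf B) := matOf_vecOf _

/-! ### Bounded Sobolev functions under bilinear maps -/

section Bilinear

variable {F G H : Type*} [NormedAddCommGroup F] [NormedSpace ℝ F] [NormedAddCommGroup G]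
  [NormedSpace ℝ G] [NormedAddCommGroup H] [NormedSpace ℝ H]
  {X : Type*} [MeasurableSpace X] {μ : Measure X}

lemma memLp_bilin_left (B : F →L[ℝ] G →L[ℝ] H) {u : X → F} {v : X → G} (hu : MemLp u 2 μ)
    (hv : AEStronglyMeasurable v μ) (hvb : ∀ᵐ x ∂μ, ‖v x‖ ≤ 1) :
    MemLp (fun x => B (u x) (v x)) 2 μ := by
  refine MemLp.of_le_mul (c := ‖B‖) hu (B.aestronglyMeasurable_comp₂ hu.1 hv) ?_
  filter_upwards [hvb] with x hx
  refine (B.le_opNorm₂ _ _).trans ?_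
  exact mul_le_of_le_one_right (by positivity) hx

lemma memLp_bilin_right (B : F →L[ℝ] G →L[ℝ] H) {u : X → F} {v : X → G} (hv : MemLp v 2 μ)
    (hu : AEStronglyMeasurable u μ) (hub : ∀ᵐ x ∂μ, ‖u x‖ ≤ 1) :
    MemLp (fun x => B (u x) (v x)) 2 μ :=
  memLp_bilin_left B.flip hv hu hub

lemma eLpNorm_bilin_le (B : F →L[ℝ] G →L[ℝ] H) {u u' : X → F} {v v' : X → G}
    (hu' : AEStronglyMeasurable u' μ) (hv' : AEStronglyMeasurable v' μ)
    (hub : ∀ᵐ x ∂μ, ‖u x‖ ≤ 1) (hvb : ∀ᵐ x ∂μ, ‖v x‖ ≤ 1) :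
    eLpNorm (fun x => B (u' x) (v x) + B (u x) (v' x)) 2 μ ≤
      ENNReal.ofReal ‖B‖ * (eLpNorm u' 2 μ + eLpNorm v' 2 μ) := by
  have h1 : eLpNorm (fun x => B (u' x) (v x) + B (u x) (v' x)) 2 μ ≤
      ENNReal.ofReal ‖B‖ * eLpNorm (fun x => ‖u' x‖ + ‖v' x‖) 2 μ := by
    refine eLpNorm_le_mul_eLpNorm_of_ae_le_mul ?_ 2
    filter_upwards [hub, hvb] with x hux hvx
    rw [Real.norm_of_nonneg (by positivity), mul_add]
    refine (norm_add_le _ _).trans (add_le_add ?_ ?_)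
    · exact (B.le_opNorm₂ _ _).trans (mul_le_of_le_one_right (by positivity) hvx)
    · refine (B.le_opNorm₂ _ _).trans ?_
      exact mul_le_mul_of_nonneg_right (mul_le_of_le_one_right (norm_nonneg B) hux) (norm_nonneg _)
  refine h1.trans (mul_le_mul_right ((eLpNorm_add_le hu'.norm hv'.norm one_le_two).trans ?_) _)
  rw [eLpNorm_norm, eLpNorm_norm]

lemma tendsto_eLpNorm_bilin (B : F →L[ℝ] G →L[ℝ] H) {u : ℕ → X → F} {u₀ : X → F}
    {v : ℕ → X → G} {v₀ : X → G} (hu : ∀ k, AEStronglyMeasurable (u k) μ)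
    (hu₀ : AEStronglyMeasurable u₀ μ) (hv : ∀ k, AEStronglyMeasurable (v k) μ)
    (hv₀ : AEStronglyMeasurable v₀ μ)
    (hub : ∀ᵐ x ∂μ, ‖u₀ x‖ ≤ 1) (hvb : ∀ k, ∀ᵐ x ∂μ, ‖v k x‖ ≤ 1)
    (hut : Tendsto (fun k => eLpNorm (fun x => u k x - u₀ x) 2 μ) atTop (𝓝 0))
    (hvt : Tendsto (fun k => eLpNorm (fun x => v k x - v₀ x) 2 μ) atTop (𝓝 0)) :
    Tendsto (fun k => eLpNorm (fun x => B (u k x) (v k x) - B (u₀ x) (v₀ x)) 2 μ) atTop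
      (𝓝 0) := by
  have h1 := ENNReal.Tendsto.const_mul (a := ENNReal.ofReal ‖B‖) (hut.add hvt)
    (Or.inr ENNReal.ofReal_ne_top)
  rw [add_zero, mul_zero] at h1
  refine tendsto_of_tendsto_of_tendsto_of_le_of_le tendsto_const_nhds h1 (fun k => bot_le)
    fun k => ?_
  have h2 := eLpNorm_bilin_le B (u := u₀) (u' := fun x => u k x - u₀ x) (v := v k)
    (v' := fun x => v k x - v₀ x) ((hu k).sub hu₀) ((hv k).sub hv₀) hub (hvb k)
  refine le_trans (le_of_eq ?_) h2
  congr 1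
  ext x
  simp only [map_sub, sub_apply]
  abel

lemma HasWeakGrad.bilin [CompleteSpace F] [CompleteSpace G] [CompleteSpace H]
    {S : Set E2} (hS : IsBoundedLipschitzDomain S) (B : F →L[ℝ] G →L[ℝ] H) {u : E2 → F}
    {u' : Fin 2 → E2 → F} {v : E2 → G} {v' : Fin 2 → E2 → G} (hu : HasWeakGrad S u u')
    (hv : HasWeakGrad S v v') (hub : ∀ᵐ x ∂(volume.restrict S), ‖u x‖ ≤ 1)
    (hvb : ∀ᵐ x ∂(volume.restrict S), ‖v x‖ ≤ 1) :
    HasWeakGrad S (fun x => B (u x) (v x)) (fun i x => B (u' i x) (v x) + B (u x) (v' i x)) :=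
  ⟨memLp_bilin_left B hu.memLp hv.memLp.1 hvb,
    fun i => (memLp_bilin_left B (hu.memLp_grad i) hv.memLp.1 hvb).add
      (memLp_bilin_right B (hv.memLp_grad i) hu.memLp.1 hub),
    fun i => hu.isWeakPartial_bilin hS B hv i⟩

end Bilinear

/-- Weak partial derivatives of second order commute. -/
lemma HasWeakGrad.symm_ae {F : Type*} [NormedAddCommGroup F] [NormedSpace ℝ F] [CompleteSpace F]
    {S : Set E2} (hS : IsOpen S) [IsFiniteMeasure ((volume : Measure E2).restrict S)] {u : E2 → F}
    {v : Fin 2 → E2 → F} {z : Fin 2 → Fin 2 → E2 → F} (hu : HasWeakGrad S u v)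
    (hv : ∀ i, HasWeakGrad S (v i) (z i)) (i j : Fin 2) :
    z i j =ᵐ[volume.restrict S] z j i := by
  have key : ∀ (i j : Fin 2) (φ : E2 → ℝ), ContDiff ℝ ∞ φ → HasCompactSupport φ → tsupport φ ⊆ S →
      ∫ x in S, φ x • z i j x =
        ∫ x in S, fderiv ℝ (fun y => fderiv ℝ φ y (dir j)) x (dir i) • u x := by
    intro i j φ hφ hc hs
    have h1 := (hv i).weak j φ hφ hc hs
    have h2 := (hu.weak i) (fun y => fderiv ℝ φ y (dir j))
      ((hφ.fderiv_right (m := ∞) (by simp)).clm_apply contDiff_const)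
      (hasCompactSupport_partial hc j)
      ((closure_minimal (fun x hx => by
        rw [Function.mem_support] at hx
        exact support_fderiv_subset ℝ fun h => hx (by simp [h]))
          (isClosed_tsupport φ)).trans hs)
    rw [h2, h1, neg_neg]
  refine ((hv i).weak j).ae_eq hS (fun φ hφ hc hs => ?_) ((hv i).integrable_grad j)
    ((hv j).integrable_grad i)
  rw [(hv i).weak j φ hφ hc hs, key i j φ hφ hc hs, key j i φ hφ hc hs]
  congr 1
  refine integral_congr_ae (Eventually.of_forall fun x => ?_)
  have hd : ∀ a b : E2, fderiv ℝ (fun y => fderiv ℝ φ y a) x b = fderiv ℝ (fderiv ℝ φ) x b a :=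
    fun a b => by
      have := ((hφ.fderiv_right (m := ∞) (by simp)).differentiable (by simp) x).hasFDerivAt
      rw [(this.clm_apply (hasFDerivAt_const a x)).fderiv]
      simp
  beta_reduce
  rw [hd, hd, (hφ.contDiffAt.isSymmSndFDerivAt (by
    rw [minSmoothness_of_isRCLikeNormedField]
    exact (mod_cast le_top : ((2 : ℕ∞) : WithTop ℕ∞) ≤ ((⊤ : ℕ∞) : WithTop ℕ∞)))).eq]

/-! ### Algebra of orthonormal frames -/

/-- The vector product. -/
noncomputable def crossC : E3 →L[ℝ] E3 →L[ℝ] E3 :=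
  IsBilinearMap.toContinuousBilinearMap (𝕜 := ℝ)
    (f := fun a b : E3 => (WithLp.toLp 2 (a.ofLp ⨯₃ b.ofLp) : E3))
    { add_left := fun a a' b => by simp
      smul_left := fun c a b => by simp
      add_right := fun a b b' => by simp
      smul_right := fun c a b => by simp }

lemma crossC_apply (a b : E3) : crossC a b = WithLp.toLp 2 (a.ofLp ⨯₃ b.ofLp) := rfl

/-- The map `(a, b) ↦ (a · b) eⱼ`. -/
noncomputable def compC (j : Fin 3) : E3 →L[ℝ] E3 →L[ℝ] E3 :=
  IsBilinearMap.toContinuousBilinearMap (𝕜 := ℝ)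
    (f := fun a b : E3 => (⟪a, b⟫ • EuclideanSpace.single j (1 : ℝ) : E3))
    { add_left := fun a a' b => by rw [inner_add_left, add_smul]
      smul_left := fun c a b => by rw [real_inner_smul_left, mul_smul]
      add_right := fun a b b' => by rw [inner_add_right, add_smul]
      smul_right := fun c a b => by rw [real_inner_smul_right, mul_smul] }

lemma compC_apply (j : Fin 3) (a b : E3) :
    compC j a b = ⟪a, b⟫ • EuclideanSpace.single j (1 : ℝ) := rfl

/-- The tensor product of the first two components. -/
noncomputable def tensC : E3 →L[ℝ] E3 →L[ℝ] MatV :=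
  IsBilinearMap.toContinuousBilinearMap (𝕜 := ℝ)
    (f := fun a b : E3 => (WithLp.toLp 2 fun p : Fin 2 × Fin 2 =>
      a p.1.castSucc * b p.2.castSucc : MatV))
    { add_left := fun a a' b => by ext p; simp [add_mul]
      smul_left := fun c a b => by ext p; simp [mul_assoc]
      add_right := fun a b b' => by ext p; simp [mul_add]
      smul_right := fun c a b => by ext p; simp [mul_left_comm] }

lemma inner_E3 (a b : E3) : ⟪a, b⟫ = a 0 * b 0 + a 1 * b 1 + a 2 * b 2 := by
  simp [PiLp.inner_apply, Fin.sum_univ_succ]; ring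

/-- The Gram determinant of three vectors is the square of their determinant. -/
lemma sq_inner_crossC (v a b : E3) : ⟪v, crossC a b⟫ ^ 2 =
    ⟪v, v⟫ * (⟪a, a⟫ * ⟪b, b⟫ - ⟪a, b⟫ ^ 2) - ⟪v, a⟫ * (⟪v, a⟫ * ⟪b, b⟫ - ⟪a, b⟫ * ⟪v, b⟫) +
      ⟪v, b⟫ * (⟪v, a⟫ * ⟪a, b⟫ - ⟪a, a⟫ * ⟪v, b⟫) := by
  simp only [inner_E3, crossC_apply, cross_apply]
  simp
  ring

lemma inner_crossC_left (a b v w : E3) :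
    ⟪a, crossC v b + crossC a w⟫ = -⟪v, crossC a b⟫ := by
  simp only [inner_E3, crossC_apply, cross_apply, PiLp.add_apply]
  simp
  ring

lemma inner_crossC_right (a b v w : E3) :
    ⟪b, crossC v b + crossC a w⟫ = -⟪w, crossC a b⟫ := by
  simp only [inner_E3, crossC_apply, cross_apply, PiLp.add_apply]
  simp
  ring

/-! ### Isometric immersions -/

section Isometry

variable {S : Set E2} {y n : E2 → E3}

lemma MemH2iso.norm_partial (h : MemH2iso S y) :
    ∀ᵐ x ∂(volume.restrict S), ∀ i, ‖weakPartial S i y x‖ = 1 := by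
  filter_upwards [h.2] with x hx i
  have := hx i i
  rw [if_pos rfl, real_inner_self_eq_norm_sq] at this
  nlinarith [norm_nonneg (weakPartial S i y x)]

lemma MemH2iso.norm_partial_le (h : MemH2iso S y) (i : Fin 2) :
    ∀ᵐ x ∂(volume.restrict S), ‖weakPartial S i y x‖ ≤ 1 := by
  filter_upwards [h.norm_partial] with x hx using (hx i).le

lemma MemH2iso.hasWeakGrad_partial (h : MemH2iso S y) (i : Fin 2) :
    HasWeakGrad S (weakPartial S i y) fun j => weakPartial S j (weakPartial S i y) :=
  (h.1.2 i).hasWeakGrad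

/-- The second derivatives of an isometric immersion are normal: `⟪∂ᵢ∂ⱼy, ∂ₖy⟫` is symmetric in
`i, j` and skew in `i, k`. -/
lemma MemH2iso.inner_hessian (h : MemH2iso S y) (hS : IsBoundedLipschitzDomain S) :
    ∀ᵐ x ∂(volume.restrict S), ∀ i j k,
      ⟪weakPartial S j (weakPartial S i y) x, weakPartial S k y x⟫ = 0 := by
  have := isFiniteMeasure_restrict hS.isBounded
  have hsymm : ∀ᵐ x ∂(volume.restrict S), ∀ i j,
      weakPartial S j (weakPartial S i y) x = weakPartial S i (weakPartial S j y) x := by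
    rw [ae_all_iff]; intro i; rw [ae_all_iff]; intro j
    exact h.1.1.hasWeakGrad.symm_ae hS.isOpen h.hasWeakGrad_partial i j
  have hskew : ∀ᵐ x ∂(volume.restrict S), ∀ i k j,
      ⟪weakPartial S j (weakPartial S i y) x, weakPartial S k y x⟫ +
        ⟪weakPartial S i y x, weakPartial S j (weakPartial S k y) x⟫ = 0 := by
    rw [ae_all_iff]; intro i; rw [ae_all_iff]; intro k; rw [ae_all_iff]; intro j
    have h1 := (h.hasWeakGrad_partial i).bilin hS (innerB E3) (h.hasWeakGrad_partial k)
      (h.norm_partial_le i) (h.norm_partial_le k)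
    have h2 := hasWeakGrad_of_contDiff hS.isBounded hS.isOpen.measurableSet
      (contDiff_const (c := (if i = k then 1 else 0 : ℝ)) (𝕜 := ℝ) (E := E2) (n := ∞))
    have h3 := (h2.congr (u' := fun x => innerB E3 (weakPartial S i y x) (weakPartial S k y x)) (by
      filter_upwards [h.2] with x hx using (hx i k).symm) fun j => ae_eq_refl _)
    have h4 := (h1.weak j).ae_eq hS.isOpen (h3.weak j) (h1.integrable_grad j)
      (h3.integrable_grad j)
    filter_upwards [h4] with x hx
    simpa [innerB_apply] using hx
  filter_upwards [hsymm, hskew] with x h1 h2 i j k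
  set c : Fin 2 → Fin 2 → Fin 2 → ℝ := fun i j k =>
    ⟪weakPartial S j (weakPartial S i y) x, weakPartial S k y x⟫ with hc
  have e1 : ∀ i j k, c i j k = c j i k := fun i j k => by simp only [hc, h1 i j]
  have e2 : ∀ i j k, c i j k + c k j i = 0 := fun i j k => by
    simpa only [hc, real_inner_comm] using h2 i k j
  change c i j k = 0
  -- three instances of skewness, rewritten by symmetry, determine the form
  have f1 := e2 i j k
  have f2 := e2 j k i
  have f3 := e2 k i j
  rw [e1 k j] at f1
  rw [e1 i k] at f2
  rw [e1 j i] at f3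
  linarith

lemma normalField_eq (S : Set E2) (y : E2 → E3) :
    normalField S y = fun x => crossC (weakPartial S 0 y x) (weakPartial S 1 y x) := rfl

lemma MemH2iso.hasWeakGrad_normal (h : MemH2iso S y) (hS : IsBoundedLipschitzDomain S) :
    HasWeakGrad S (normalField S y) fun j x =>
      crossC (weakPartial S j (weakPartial S 0 y) x) (weakPartial S 1 y x) +
        crossC (weakPartial S 0 y x) (weakPartial S j (weakPartial S 1 y) x) :=
  (h.hasWeakGrad_partial 0).bilin hS crossC (h.hasWeakGrad_partial 1) (h.norm_partial_le 0)
    (h.norm_partial_le 1)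

/-- Parseval's identity in the orthonormal frame `a, b, a × b` of `ℝ³`. -/
lemma sq_inner_crossC_of_orthonormal {a b : E3} (ha : ⟪a, a⟫ = 1) (hb : ⟪b, b⟫ = 1)
    (hab : ⟪a, b⟫ = 0) (v : E3) :
    ⟪v, crossC a b⟫ ^ 2 = ⟪v, v⟫ - ⟪v, a⟫ ^ 2 - ⟪v, b⟫ ^ 2 := by
  rw [sq_inner_crossC, ha, hb, hab]; ring

lemma norm_crossC_of_orthonormal {a b : E3} (ha : ⟪a, a⟫ = 1) (hb : ⟪b, b⟫ = 1)
    (hab : ⟪a, b⟫ = 0) : ‖crossC a b‖ = 1 := by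
  have e : ⟪crossC a b, crossC a b⟫ = ⟪a, a⟫ * ⟪b, b⟫ - ⟪a, b⟫ ^ 2 := by
    simp only [inner_E3, crossC_apply, cross_apply]
    simp
    ring
  rw [ha, hb, hab, real_inner_self_eq_norm_sq] at e
  nlinarith [norm_nonneg (crossC a b)]

lemma MemH2iso.norm_normal (h : MemH2iso S y) :
    ∀ᵐ x ∂(volume.restrict S), ‖normalField S y x‖ = 1 := by
  filter_upwards [h.2] with x hx
  have h00 := hx 0 0
  have h11 := hx 1 1
  have h01 := hx 0 1
  norm_num at h00 h11 h01
  exact norm_crossC_of_orthonormal (by simp [h00]) (by simp [h11]) h01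

/-- The second fundamental form is the normal component of the Hessian and determines its
length. -/
lemma MemH2iso.secondForm_ae (h : MemH2iso S y) (hS : IsBoundedLipschitzDomain S) :
    ∀ᵐ x ∂(volume.restrict S), ∀ i j,
      secondForm S y x i j = -⟪weakPartial S j (weakPartial S i y) x, normalField S y x⟫ ∧
      ‖weakPartial S j (weakPartial S i y) x‖ ^ 2 = secondForm S y x i j ^ 2 ∧
      secondForm S y x i j = secondForm S y x j i := by
  have := isFiniteMeasure_restrict hS.isBounded
  have hsymm : ∀ᵐ x ∂(volume.restrict S), ∀ i j,
      weakPartial S j (weakPartial S i y) x = weakPartial S i (weakPartial S j y) x := by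
    rw [ae_all_iff]; intro i; rw [ae_all_iff]; intro j
    exact h.1.1.hasWeakGrad.symm_ae hS.isOpen h.hasWeakGrad_partial i j
  have hn : ∀ᵐ x ∂(volume.restrict S), ∀ j, weakPartial S j (normalField S y) x =
      crossC (weakPartial S j (weakPartial S 0 y) x) (weakPartial S 1 y x) +
        crossC (weakPartial S 0 y x) (weakPartial S j (weakPartial S 1 y) x) := by
    rw [ae_all_iff]; intro j
    exact (h.hasWeakGrad_normal hS).weakPartial_ae_eq hS.isOpen j
  filter_upwards [hsymm, hn, h.inner_hessian hS, h.2] with x h1 h2 h3 h4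
  have key : ∀ i j, secondForm S y x i j =
      -⟪weakPartial S j (weakPartial S i y) x, normalField S y x⟫ := by
    intro i j
    rw [secondForm, Matrix.of_apply, h2 j]
    fin_cases i
    · exact inner_crossC_left _ _ _ _
    · exact inner_crossC_right _ _ _ _
  intro i j
  refine ⟨key i j, ?_, ?_⟩
  · have h00 := h4 0 0
    have h11 := h4 1 1
    have h01 := h4 0 1
    rw [if_pos rfl] at h00 h11
    rw [if_neg (by simp)] at h01
    rw [key, neg_sq, normalField_eq, sq_inner_crossC_of_orthonormal h00 h11 h01, h3 i j 0,
      h3 i j 1, real_inner_self_eq_norm_sq]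
    ring
  · rw [key i j, key j i, h1 i j]

lemma localDirector_eq (S : Set E2) (y n : E2 → E3) (x : E2) : localDirector S y n x =
    compC 0 (weakPartial S 0 y x) (n x) + compC 1 (weakPartial S 1 y x) (n x) +
      compC 2 (normalField S y x) (n x) := by
  ext i
  simp only [compC_apply, localDirector, frame, inner_E3]
  fin_cases i <;> simp [Matrix.mulVec, dotProduct, Fin.sum_univ_succ] <;> ring

/-- The weak gradient of the director in local coordinates. -/
noncomputable def gradDirector (S : Set E2) (y n : E2 → E3) (i : Fin 2) (x : E2) : E3 :=
  (compC 0 (weakPartial S i (weakPartial S 0 y) x) (n x) +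
      compC 0 (weakPartial S 0 y x) (weakPartial S i n x)) +
    (compC 1 (weakPartial S i (weakPartial S 1 y) x) (n x) +
      compC 1 (weakPartial S 1 y x) (weakPartial S i n x)) +
    (compC 2 (crossC (weakPartial S i (weakPartial S 0 y) x) (weakPartial S 1 y x) +
        crossC (weakPartial S 0 y x) (weakPartial S i (weakPartial S 1 y) x)) (n x) +
      compC 2 (normalField S y x) (weakPartial S i n x))

lemma MemA2.norm_director_le (h : MemA2 S y n) : ∀ᵐ x ∂(volume.restrict S), ‖n x‖ ≤ 1 := by
  filter_upwards [h.2.2] with x hx using hx.le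

lemma MemH2iso.norm_normal_le (h : MemH2iso S y) :
    ∀ᵐ x ∂(volume.restrict S), ‖normalField S y x‖ ≤ 1 := by
  filter_upwards [h.norm_normal] with x hx using hx.le

lemma MemA2.hasWeakGrad_localDirector (h : MemA2 S y n) (hS : IsBoundedLipschitzDomain S) :
    HasWeakGrad S (localDirector S y n) (gradDirector S y n) := by
  have := isFiniteMeasure_restrict hS.isBounded
  have hn := h.2.1.hasWeakGrad
  have e : localDirector S y n = fun x => (compC 0 (weakPartial S 0 y x) (n x) +
      compC 1 (weakPartial S 1 y x) (n x)) + compC 2 (normalField S y x) (n x) :=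
    funext fun x => localDirector_eq S y n x
  rw [e]
  exact (((h.1.hasWeakGrad_partial 0).bilin hS (compC 0) hn (h.1.norm_partial_le 0)
    h.norm_director_le).add ((h.1.hasWeakGrad_partial 1).bilin hS (compC 1) hn
      (h.1.norm_partial_le 1) h.norm_director_le)).add
    ((h.1.hasWeakGrad_normal hS).bilin hS (compC 2) hn h.1.norm_normal_le h.norm_director_le)

lemma MemA2.norm_localDirector (h : MemA2 S y n) :
    ∀ᵐ x ∂(volume.restrict S), ‖localDirector S y n x‖ = 1 := by
  filter_upwards [h.1.2, h.2.2] with x hx hnx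
  have h00 := hx 0 0
  have h11 := hx 1 1
  have h01 := hx 0 1
  rw [if_pos rfl] at h00 h11
  rw [if_neg (by simp)] at h01
  have e : ‖localDirector S y n x‖ ^ 2 = ⟪n x, weakPartial S 0 y x⟫ ^ 2 +
      ⟪n x, weakPartial S 1 y x⟫ ^ 2 + ⟪n x, normalField S y x⟫ ^ 2 := by
    rw [localDirector_eq, EuclideanSpace.norm_sq_eq]
    simp [compC_apply, Fin.sum_univ_succ, real_inner_comm]
    ring
  rw [normalField_eq, sq_inner_crossC_of_orthonormal h00 h11 h01, real_inner_self_eq_norm_sq,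
    hnx] at e
  nlinarith [norm_nonneg (localDirector S y n x)]

/-- The gradient of the director in local coordinates is controlled by the Hessian of the
deformation and the gradient of the director. -/
lemma MemA2.eLpNorm_gradDirector_le (hS : IsBoundedLipschitzDomain S) (C : ℝ) :
    ∃ C' : ℝ, ∀ y n : E2 → E3, MemA2 S y n →
      (∀ i j, eLpNorm (weakPartial S j (weakPartial S i y)) 2 (volume.restrict S) ≤
        ENNReal.ofReal C) →
      (∀ i, eLpNorm (weakPartial S i n) 2 (volume.restrict S) ≤ ENNReal.ofReal C) →
      ∀ i, eLpNorm (gradDirector S y n i) 2 (volume.restrict S) ≤ ENNReal.ofReal C' := by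
  set K : ℝ≥0∞ := ENNReal.ofReal ‖compC 0‖ * (ENNReal.ofReal C + ENNReal.ofReal C) +
    ENNReal.ofReal ‖compC 1‖ * (ENNReal.ofReal C + ENNReal.ofReal C) +
    ENNReal.ofReal ‖compC 2‖ * (ENNReal.ofReal ‖crossC‖ * (ENNReal.ofReal C + ENNReal.ofReal C) +
      ENNReal.ofReal C) with hK
  have hKt : K ≠ ⊤ := by simp [hK, ENNReal.mul_eq_top]
  refine ⟨K.toReal, fun y n h hy hn i => ?_⟩
  rw [ENNReal.ofReal_toReal hKt]
  have hz := fun i j => ((h.1.hasWeakGrad_partial i).memLp_grad j).1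
  have hg := fun i => (h.2.1.hasWeakGrad.memLp_grad i).1
  have hb := (h.1.hasWeakGrad_normal hS).memLp_grad i
  have hw := fun (j : Fin 2) (k : Fin 3) => ((h.1.hasWeakGrad_partial j).bilin hS (compC k)
    h.2.1.hasWeakGrad (h.1.norm_partial_le j) h.norm_director_le).memLp_grad i
  have hw2 := ((h.1.hasWeakGrad_normal hS).bilin hS (compC 2)
    h.2.1.hasWeakGrad h.1.norm_normal_le h.norm_director_le).memLp_grad i
  have hb' : eLpNorm
      (fun x => crossC (weakPartial S i (weakPartial S 0 y) x) (weakPartial S 1 y x) +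
      crossC (weakPartial S 0 y x) (weakPartial S i (weakPartial S 1 y) x)) 2
      (volume.restrict S) ≤ ENNReal.ofReal ‖crossC‖ * (ENNReal.ofReal C + ENNReal.ofReal C) :=
    (eLpNorm_bilin_le crossC (hz 0 i) (hz 1 i) (h.1.norm_partial_le 0)
      (h.1.norm_partial_le 1)).trans (mul_le_mul_right (add_le_add (hy 0 i) (hy 1 i)) _)
  refine (eLpNorm_add_le ((hw 0 0).add (hw 1 1)).1 hw2.1 one_le_two).trans (add_le_add
    ((eLpNorm_add_le (hw 0 0).1 (hw 1 1).1 one_le_two).trans (add_le_add ?_ ?_)) ?_)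
  · exact (eLpNorm_bilin_le _ (hz 0 i) (hg i) (h.1.norm_partial_le 0)
      h.norm_director_le).trans (mul_le_mul_right (add_le_add (hy 0 i) (hn i)) _)
  · exact (eLpNorm_bilin_le _ (hz 1 i) (hg i) (h.1.norm_partial_le 1)
      h.norm_director_le).trans (mul_le_mul_right (add_le_add (hy 1 i) (hn i)) _)
  · exact (eLpNorm_bilin_le _ hb.1 (hg i) h.1.norm_normal_le
      h.norm_director_le).trans (mul_le_mul_right (add_le_add hb' (hn i)) _)

end Isometry

/-! ### Weak convergence: products and lower semicontinuity -/

section Weak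

variable {X : Type*} [MeasurableSpace X] {μ : Measure X}
  {G H : Type*} [NormedAddCommGroup G] [InnerProductSpace ℝ G] [NormedAddCommGroup H]
  [InnerProductSpace ℝ H]

lemma WeakL2.add {f g : ℕ → X → G} {f₀ g₀ : X → G} (hf : ∀ k, MemLp (f k) 2 μ)
    (hf₀ : MemLp f₀ 2 μ) (hg : ∀ k, MemLp (g k) 2 μ) (hg₀ : MemLp g₀ 2 μ) (h : WeakL2 μ f f₀)
    (h' : WeakL2 μ g g₀) : WeakL2 μ (fun k x => f k x + g k x) (fun x => f₀ x + g₀ x) := by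
  intro w hw
  have e : ∀ {a b : X → G}, MemLp a 2 μ → MemLp b 2 μ →
      ∫ x, ⟪w x, a x + b x⟫ ∂μ = ∫ x, ⟪w x, a x⟫ ∂μ + ∫ x, ⟪w x, b x⟫ ∂μ := fun ha hb => by
    simp_rw [inner_add_right]
    exact integral_add (integrable_bilin (innerB G) hw ha) (integrable_bilin (innerB G) hw hb)
  rw [e hf₀ hg₀]
  simp_rw [fun k => e (hf k) (hg k)]
  exact (h w hw).add (h' w hw)

lemma WeakL2.clm_comp [CompleteSpace G] [CompleteSpace H] (A : G →L[ℝ] H) {f : ℕ → X → G}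
    {f₀ : X → G} (h : WeakL2 μ f f₀) : WeakL2 μ (fun k x => A (f k x)) (fun x => A (f₀ x)) := by
  intro w hw
  have := h (fun x => A.adjoint (w x)) (A.adjoint.comp_memLp' hw)
  simpa only [ContinuousLinearMap.adjoint_inner_left] using this

/-- The product of a weakly convergent sequence with a bounded sequence that converges almost
everywhere converges weakly. -/
lemma WeakL2.inner_of_ae {f b : ℕ → X → G} {f₀ b₀ : X → G} (h : WeakL2 μ f f₀)
    (hf : ∀ k, MemLp (f k) 2 μ) {C : ℝ} (hC : ∀ k, eLpNorm (f k) 2 μ ≤ ENNReal.ofReal C)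
    (hb : ∀ k, AEStronglyMeasurable (b k) μ) (hb₀ : AEStronglyMeasurable b₀ μ)
    (hb1 : ∀ k, ∀ᵐ x ∂μ, ‖b k x‖ ≤ 1) (hlim : ∀ᵐ x ∂μ, Tendsto (fun k => b k x) atTop (𝓝 (b₀ x))) :
    WeakL2 μ (fun k x => ⟪f k x, b k x⟫) (fun x => ⟪f₀ x, b₀ x⟫) := by
  intro w hw
  have hb01 : ∀ᵐ x ∂μ, ‖b₀ x‖ ≤ 1 := by
    filter_upwards [ae_all_iff.2 hb1, hlim] with x h1 h2
    exact le_of_tendsto h2.norm (Eventually.of_forall h1)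
  have hm : ∀ {b : X → G}, AEStronglyMeasurable b μ → (∀ᵐ x ∂μ, ‖b x‖ ≤ 1) →
      MemLp (fun x => w x • b x) 2 μ := fun hb h1 =>
    hw.of_le (hw.1.smul hb) (by
      filter_upwards [h1] with x hx
      rw [norm_smul]
      exact mul_le_of_le_one_right (norm_nonneg _) hx)
  have ht : Tendsto (fun k => eLpNorm (fun x => w x • b k x - w x • b₀ x) 2 μ) atTop (𝓝 0) := by
    refine tendsto_zero_of_sq ?_
    simp_rw [sq_eLpNorm_two]
    have h0 : ∫⁻ _ : X, (0 : ℝ≥0∞) ∂μ = 0 := lintegral_zero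
    rw [← h0]
    have hfin : ∫⁻ x, 4 * ‖w x‖ₑ ^ 2 ∂μ ≠ ⊤ := by
      rw [lintegral_const_mul' _ _ (by simp), ← sq_eLpNorm_two]
      exact ENNReal.mul_ne_top (by simp) (ENNReal.pow_ne_top hw.2.ne)
    refine tendsto_lintegral_of_dominated_convergence' (fun x => 4 * ‖w x‖ₑ ^ 2)
      (fun k => (((hm (hb k) (hb1 k)).1.sub (hm hb₀ hb01).1).enorm.pow_const 2)) (fun k => ?_)
      hfin ?_
    · filter_upwards [hb1 k, hb01] with x h1 h2
      have h3 : ‖w x • b k x - w x • b₀ x‖ ≤ 2 * ‖w x‖ := by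
        rw [← smul_sub, norm_smul, mul_comm]
        refine mul_le_mul_of_nonneg_right ?_ (norm_nonneg _)
        exact (norm_sub_le _ _).trans (by linarith)
      have h4 : ‖w x • b k x - w x • b₀ x‖ₑ ≤ 2 * ‖w x‖ₑ := by
        rw [← ofReal_norm, ← ofReal_norm]
        refine (ENNReal.ofReal_le_ofReal h3).trans_eq ?_
        rw [ENNReal.ofReal_mul (by norm_num)]
        simp
      calc ‖w x • b k x - w x • b₀ x‖ₑ ^ 2 ≤ (2 * ‖w x‖ₑ) ^ 2 := by gcongr
        _ = 4 * ‖w x‖ₑ ^ 2 := by rw [mul_pow]; norm_num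
    · filter_upwards [hlim] with x hx
      have h1 : Tendsto (fun k => w x • b k x - w x • b₀ x) atTop (𝓝 0) := by
        simpa using (hx.const_smul (w x)).sub_const (w x • b₀ x)
      have h2 := (continuous_enorm.tendsto _).comp h1
      rw [enorm_zero] at h2
      exact tendsto_sq_zero h2
  have key := h.tendsto_integral hf hC (fun k => hm (hb k) (hb1 k)) (hm hb₀ hb01) ht
  refine (key.congr fun k => ?_).trans (le_of_eq ?_)
  · refine integral_congr_ae (Eventually.of_forall fun x => ?_)
    beta_reduce
    rw [real_inner_smul_left, real_inner_comm (f k x)]; simp [mul_comm]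
  · congr 1
    refine integral_congr_ae (Eventually.of_forall fun x => ?_)
    beta_reduce
    rw [real_inner_smul_left, real_inner_comm (f₀ x)]; simp [mul_comm]

/-- Weak lower semicontinuity of convex integral functionals, in terms of the lower limit. -/
lemma lintegral_le_liminf_of_weakL2 [CompleteSpace G] {Φ : G → ℝ} (hΦ : ConvexOn ℝ univ Φ)
    (hΦc : Continuous Φ) (hΦ0 : ∀ a, 0 ≤ Φ a) {f : ℕ → X → G} {f₀ : X → G}
    (hf : ∀ k, MemLp (f k) 2 μ) (hf₀ : MemLp f₀ 2 μ) (h : WeakL2 μ f f₀) :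
    ∫⁻ x, ENNReal.ofReal (Φ (f₀ x)) ∂μ ≤
      liminf (fun k => ∫⁻ x, ENNReal.ofReal (Φ (f k x)) ∂μ) atTop := by
  refine le_of_forall_gt fun c hc => ?_
  obtain ⟨c', hc', hcc'⟩ := exists_between hc
  obtain ⟨θ, hθ, hle⟩ := extraction_of_frequently_atTop
    (frequently_lt_of_liminf_lt (by isBoundedDefault) hc')
  exact (lintegral_le_of_weakL2 hΦ hΦc hΦ0 (fun k => hf (θ k)) hf₀ (h.subseq hθ)
    fun k => (hle k).le).trans_lt hcc'

lemma exists_subseq_ae_of_eLpNorm {F : Type*} [NormedAddCommGroup F] {f : ℕ → X → F} {f₀ : X → F}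
    (hf : ∀ k, MemLp (f k) 2 μ) (hf₀ : MemLp f₀ 2 μ)
    (h : Tendsto (fun k => eLpNorm (fun x => f k x - f₀ x) 2 μ) atTop (𝓝 0)) :
    ∃ θ : ℕ → ℕ, StrictMono θ ∧ ∀ᵐ x ∂μ, Tendsto (fun k => f (θ k) x) atTop (𝓝 (f₀ x)) :=
  (tendstoInMeasure_of_tendsto_eLpNorm (by simp) (fun k => (hf k).1) hf₀.1 h).exists_seq_tendsto_ae

lemma eLpNorm_le_of_lintegral_sq_le {F : Type*} [NormedAddCommGroup F] {f : X → F} {K : ℝ≥0∞}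
    (hK : K ≠ ⊤)
    (h : ∫⁻ x, ‖f x‖ₑ ^ 2 ∂μ ≤ K) : eLpNorm f 2 μ ≤ ENNReal.ofReal (√K.toReal) := by
  rw [← sq_eLpNorm_two] at h
  have h1 : eLpNorm f 2 μ ^ 2 ≤ ENNReal.ofReal (√K.toReal) ^ 2 := by
    rw [← ENNReal.ofReal_pow (Real.sqrt_nonneg _), Real.sq_sqrt ENNReal.toReal_nonneg,
      ENNReal.ofReal_toReal hK]
    exact h
  exact (ENNReal.pow_le_pow_left_iff two_ne_zero).1 h1

end Weak

/-! ### The plate energy in terms of vectors of matrix entries -/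

section Energy

variable {S : Set E2} {y n : E2 → E3} {W : ℝ → M3 → ℝ≥0∞} {Q : ℝ → QuadraticForm ℝ M3} {C q : ℝ}
  {r : ℝ≥0 → ℝ≥0∞}

/-- The entries of the second fundamental form. -/
noncomputable def formV (S : Set E2) (y : E2 → E3) (x : E2) : MatV := vecOf (secondForm S y x)

/-- The entries of the nematic strain, in terms of the director in local coordinates. -/
noncomputable def strainV (S : Set E2) (y n : E2 → E3) (x : E2) : MatV :=
  vecOf ((1 / 3 : ℝ) • (1 : M2)) - tensC (localDirector S y n x) (localDirector S y n x)

lemma matOf_formV (x : E2) : matOf (formV S y x) = secondForm S y x := matOf_vecOf _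

lemma matOf_strainV (x : E2) : matOf (strainV S y n x) = nematicStrain S y n x := by
  have e : ∀ i : Fin 2, (localDirector S y n x) i.castSucc = tangential S y n x i := fun i => by
    rw [localDirector_eq]
    fin_cases i <;> simp [compC_apply, tangential]
  rw [strainV, map_sub, matOf_vecOf, nematicStrain]
  congr 1
  ext i j
  rw [Matrix.vecMulVec_apply, ← e, ← e]
  rfl

/-- `𝔹` as a continuous linear map on vectors of matrix entries. -/
noncomputable def clmBB (Q : ℝ → QuadraticForm ℝ M3) : MatV →L[ℝ] MatV :=
  LinearMap.toContinuousLinearMap (vecBB Q)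

lemma matOf_clmBB (B : MatV) : matOf (clmBB Q B) = BB Q (matOf B) := matOf_vecBB Q B

lemma frobSq_symPart_le_frobSq (A : M2) : frobSq (symPart A) ≤ frobSq A := by
  simp [frobSq, symPart, Fin.sum_univ_succ]
  nlinarith [sq_nonneg (A 0 1 - A 1 0)]

lemma symPart_add (A B : M2) : symPart (A + B) = symPart A + symPart B := by
  rw [symPart, symPart, symPart, Matrix.transpose_add]; module

lemma norm_strainV_le {x : E2} (h : ‖localDirector S y n x‖ = 1) :
    ‖strainV S y n x‖ ≤ ‖vecOf ((1 / 3 : ℝ) • (1 : M2))‖ + ‖tensC‖ := by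
  refine (norm_sub_le _ _).trans (add_le_add le_rfl ?_)
  refine (tensC.le_opNorm₂ _ _).trans_eq ?_
  rw [h, mul_one, mul_one]

lemma MemH2iso.memLp_formV (h : MemH2iso S y) (hS : IsBoundedLipschitzDomain S) :
    MemLp (formV S y) 2 (volume.restrict S) := by
  have e : ∀ p : Fin 2 × Fin 2, MemLp (fun x => secondForm S y x p.1 p.2) 2
      (volume.restrict S) := fun p => by
    have h1 := memLp_bilin_left (innerB E3) ((h.hasWeakGrad_partial p.1).memLp_grad p.2)
      (h.hasWeakGrad_normal hS).memLp.1 h.norm_normal_le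
    refine h1.neg.ae_eq ?_
    filter_upwards [h.secondForm_ae hS] with x hx
    rw [(hx p.1 p.2).1]; rfl
  have e2 : formV S y = fun x => ∑ p : Fin 2 × Fin 2,
      secondForm S y x p.1 p.2 • EuclideanSpace.single p (1 : ℝ) := by
    ext x p
    simp [formV, vecOf, Pi.single_apply]
  rw [e2]
  exact memLp_finsetSum _ fun p _ =>
    ((ContinuousLinearMap.id ℝ ℝ).smulRight (EuclideanSpace.single p (1 : ℝ))).comp_memLp' (e p)

lemma MemA2.memLp_strainV (h : MemA2 S y n) (hS : IsBoundedLipschitzDomain S) :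
    MemLp (strainV S y n) 2 (volume.restrict S) := by
  have := isFiniteMeasure_restrict hS.isBounded
  have hw : ∀ᵐ x ∂(volume.restrict S), ‖localDirector S y n x‖ ≤ 1 := by
    filter_upwards [h.norm_localDirector] with x hx using hx.le
  have hm := (h.hasWeakGrad_localDirector hS).memLp
  exact (memLp_const _).sub (memLp_bilin_left tensC hm hm.1 hw)

/-- The plate energy as a sum of integrals of convex functions of the second fundamental form, the
nematic strain and the gradient of the director. -/
lemma plateEnergy_eq (hW : StoredEnergy W Q C q r) (hS : IsBoundedLipschitzDomain S)
    {rbar ebar : ℝ} {p : State S} (h : MemA2 S p.1 p.2) :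
    plateEnergy Q rbar ebar S p =
      (∫⁻ x in S, ENNReal.ofReal (Qel Q (matOf
          (formV S p.1 x + rbar • clmBB Q (strainV S p.1 p.2 x))))) +
        (∫⁻ x in S, ENNReal.ofReal (rbar ^ 2 * Eres Q (matOf (strainV S p.1 p.2 x)))) +
      ((∫⁻ x in S, ENNReal.ofReal (ebar ^ 2 / 2 * ‖weakPartial S 0 p.2 x‖ ^ 2)) +
        ∫⁻ x in S, ENNReal.ofReal (ebar ^ 2 / 2 * ‖weakPartial S 1 p.2 x‖ ^ 2)) := by
  rw [plateEnergy, extendTop, if_pos h]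
  congr 1
  · have hm : AEMeasurable (fun x => ENNReal.ofReal (Qel Q (matOf
        (formV S p.1 x + rbar • clmBB Q (strainV S p.1 p.2 x))))) (volume.restrict S) :=
      (hW.continuous_Qel.comp_aestronglyMeasurable ((h.1.memLp_formV hS).1.add
        (((clmBB Q).continuous.comp_aestronglyMeasurable
          (h.memLp_strainV hS).1).const_smul rbar))).aemeasurable.ennreal_ofReal
    rw [← lintegral_add_left' hm, elasticEnergy]
    refine lintegral_congr fun x => ?_
    rw [map_add, map_smul, matOf_clmBB, matOf_formV, matOf_strainV,
      ENNReal.ofReal_add (hW.Qel_nonneg _) (mul_nonneg (sq_nonneg _) (hW.Eres_nonneg _))]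
  · have hm : AEMeasurable (fun x => ENNReal.ofReal (ebar ^ 2 / 2 * ‖weakPartial S 0 p.2 x‖ ^ 2))
        (volume.restrict S) :=
      (((h.2.1.hasWeakGrad.memLp_grad 0).1.norm.aemeasurable.pow_const 2).const_mul
        _).ennreal_ofReal
    rw [← lintegral_add_left' hm, oseenFrank, ← mul_assoc, ← ENNReal.ofReal_mul (sq_nonneg _),
      ← lintegral_const_mul' _ _ ENNReal.ofReal_ne_top]
    refine lintegral_congr fun x => ?_
    rw [← ENNReal.ofReal_mul (by positivity), ← ENNReal.ofReal_add (by positivity) (by positivity),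
      Fin.sum_univ_two]
    congr 1
    ring

lemma memA2_of_plateEnergy_ne_top {rbar ebar : ℝ} {p : State S}
    (h : plateEnergy Q rbar ebar S p ≠ ⊤) : MemA2 S p.1 p.2 := by
  by_contra h'
  exact h (by rw [plateEnergy, extendTop, if_neg h'])

/-- The plate energy controls the second derivatives of the deformation and the gradient of the
director. -/
lemma exists_bound_of_plateEnergy (hW : StoredEnergy W Q C q r) (hS : IsBoundedLipschitzDomain S)
    (rbar : ℝ) {ebar : ℝ} (he : 0 < ebar) {c : ℝ≥0∞} (hc : c ≠ ⊤) :
    ∃ K : ℝ, ∀ p : State S, plateEnergy Q rbar ebar S p ≤ c →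
      (∀ i j, eLpNorm (weakPartial S j (weakPartial S i p.1)) 2 (volume.restrict S) ≤
        ENNReal.ofReal K) ∧
      ∀ i, eLpNorm (weakPartial S i p.2) 2 (volume.restrict S) ≤ ENNReal.ofReal K := by
  have := isFiniteMeasure_restrict hS.isBounded
  have hC := hW.C_pos
  -- `s` bounds the nematic strain, so that coercivity of `Q_el` controls the second fundamental
  -- form up to the constant `L`
  set s : ℝ := ‖vecOf ((1 / 3 : ℝ) • (1 : M2))‖ + ‖tensC‖ with hs
  set L : ℝ := 2 * (|rbar| * (‖clmBB Q‖ * s)) ^ 2 with hL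
  set K₁ : ℝ≥0∞ := ENNReal.ofReal (24 * C) * c + ENNReal.ofReal L * volume.restrict S univ with hK₁
  set K₂ : ℝ≥0∞ := ENNReal.ofReal (2 / ebar ^ 2) * c with hK₂
  have hK₁t : K₁ ≠ ⊤ := ENNReal.add_ne_top.2 ⟨ENNReal.mul_ne_top ENNReal.ofReal_ne_top hc,
    ENNReal.mul_ne_top ENNReal.ofReal_ne_top (measure_ne_top _ _)⟩
  have hK₂t : K₂ ≠ ⊤ := ENNReal.mul_ne_top ENNReal.ofReal_ne_top hc
  refine ⟨max √K₁.toReal √K₂.toReal, fun p hp => ?_⟩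
  have h := memA2_of_plateEnergy_ne_top (ne_top_of_le_ne_top hc hp)
  rw [plateEnergy_eq hW hS h] at hp
  refine ⟨fun i j => ?_, fun i => ?_⟩
  · refine (eLpNorm_le_of_lintegral_sq_le hK₁t ?_).trans
      (ENNReal.ofReal_le_ofReal (le_max_left _ _))
    calc ∫⁻ x in S, ‖weakPartial S j (weakPartial S i p.1) x‖ₑ ^ 2
        ≤ ∫⁻ x in S, (ENNReal.ofReal (24 * C) * ENNReal.ofReal (Qel Q (matOf
            (formV S p.1 x + rbar • clmBB Q (strainV S p.1 p.2 x)))) + ENNReal.ofReal L) := by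
          refine lintegral_mono_ae ?_
          filter_upwards [h.1.secondForm_ae hS, h.norm_localDirector] with x hx hwx
          rw [← ofReal_norm, ← ENNReal.ofReal_pow (norm_nonneg _), (hx i j).2.1,
            ← ENNReal.ofReal_mul (by positivity), ← ENNReal.ofReal_add
              (mul_nonneg (by positivity) (hW.Qel_nonneg _)) (by positivity)]
          refine ENNReal.ofReal_le_ofReal ?_
          -- the Hessian is as long as `A`, and `|A|² ≤ 2 |sym (A + B)|² + 2 |B|²`
          set A := secondForm S p.1 x with hA
          set B := matOf (rbar • clmBB Q (strainV S p.1 p.2 x)) with hB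
          have e1 : A i j ^ 2 ≤ frobSq A := by
            refine (Finset.single_le_sum (f := fun j => A i j ^ 2) (fun j _ => sq_nonneg _)
              (Finset.mem_univ j)).trans ?_
            exact Finset.single_le_sum (f := fun i => ∑ j, A i j ^ 2)
              (fun i _ => Finset.sum_nonneg fun j _ => sq_nonneg _) (Finset.mem_univ i)
          have e2 : symPart A = A := by
            ext k l
            simp only [symPart, Matrix.smul_apply, Matrix.add_apply, Matrix.transpose_apply,
              smul_eq_mul]
            have := (hx l k).2.2
            linarith
          have e3 : A = symPart (A + B) + (-1 : ℝ) • symPart B := by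
            rw [symPart_add, e2]; module
          have e4 := frobSq_add_le (symPart (A + B)) ((-1 : ℝ) • symPart B)
          rw [← e3, frobSq_smul] at e4
          have e5 : frobSq (symPart B) ≤ (|rbar| * (‖clmBB Q‖ * s)) ^ 2 := by
            refine (frobSq_symPart_le_frobSq B).trans ?_
            rw [hB, frobSq_matOf, norm_smul, Real.norm_eq_abs]
            have := (clmBB Q).le_opNorm_of_le (norm_strainV_le hwx)
            gcongr
          have e6 := hW.le_Qel (A + B)
          rw [map_add, matOf_formV, ← hA, ← hB]
          have e7 : frobSq (symPart (A + B)) ≤ 12 * C * Qel Q (A + B) := by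
            rw [div_mul_eq_mul_div, one_mul, div_le_iff₀ (by positivity)] at e6
            linarith
          rw [hL]
          linarith
      _ ≤ K₁ := by
          rw [lintegral_add_right _ measurable_const, lintegral_const,
            lintegral_const_mul' _ _ ENNReal.ofReal_ne_top]
          refine add_le_add (mul_le_mul_right ?_ _) le_rfl
          exact (le_add_right le_self_add).trans hp
  · refine (eLpNorm_le_of_lintegral_sq_le hK₂t ?_).trans
      (ENNReal.ofReal_le_ofReal (le_max_right _ _))
    have h1 : ∫⁻ x in S, ENNReal.ofReal (ebar ^ 2 / 2 * ‖weakPartial S i p.2 x‖ ^ 2) ≤ c := by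
      refine le_trans ?_ hp
      fin_cases i
      · exact le_self_add.trans le_add_self
      · exact le_add_self.trans le_add_self
    have e : ∀ x, ‖weakPartial S i p.2 x‖ₑ ^ 2 = ENNReal.ofReal (2 / ebar ^ 2) *
        ENNReal.ofReal (ebar ^ 2 / 2 * ‖weakPartial S i p.2 x‖ ^ 2) := fun x => by
      rw [← ofReal_norm, ← ENNReal.ofReal_pow (norm_nonneg _),
        ← ENNReal.ofReal_mul (by positivity)]
      congr 1
      field_simp
    simp_rw [e]
    rw [lintegral_const_mul' _ _ ENNReal.ofReal_ne_top]
    exact mul_le_mul_right h1 _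

end Energy

/-! ### Compactness and lower semicontinuity of the plate energy -/

lemma MemH2.of_hasWeakGrad {F : Type*} [NormedAddCommGroup F] [NormedSpace ℝ F] [CompleteSpace F]
    {S : Set E2} (hS : IsOpen S) [IsFiniteMeasure ((volume : Measure E2).restrict S)] {u : E2 → F}
    {v : Fin 2 → E2 → F} {z : Fin 2 → Fin 2 → E2 → F} (hu : HasWeakGrad S u v)
    (hv : ∀ i, HasWeakGrad S (v i) (z i)) :
    MemH2 S u ∧ (∀ i, weakPartial S i u =ᵐ[volume.restrict S] v i) ∧
      ∀ i j, weakPartial S j (weakPartial S i u) =ᵐ[volume.restrict S] z i j := by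
  have h1 := hu.weakPartial_ae_eq hS
  have h2 : ∀ i, HasWeakGrad S (weakPartial S i u) (z i) := fun i =>
    (hv i).congr (h1 i).symm fun j => ae_eq_refl _
  exact ⟨⟨hu.memH1, fun i => (h2 i).memH1⟩, h1, fun i => (h2 i).weakPartial_ae_eq hS⟩

/-- Isometric immersions converging in `L²` with bounded Hessians converge strongly in `H¹` and
weakly in `H²` along a subsequence; in particular the limit is isometric. -/
lemma exists_isometry_limit {S : Set E2} (hS : IsBoundedLipschitzDomain S) {y : ℕ → E2 → E3}
    {y₀ : E2 → E3} (hy : ∀ k, MemH2iso S (y k)) (hy₀ : MemLp y₀ 2 (volume.restrict S))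
    (hlim : Tendsto (fun k => eLpNorm (fun x => y k x - y₀ x) 2 (volume.restrict S)) atTop (𝓝 0))
    {K : ℝ} (hK : ∀ k i j, eLpNorm (weakPartial S j (weakPartial S i (y k))) 2 (volume.restrict S) ≤
      ENNReal.ofReal K) :
    MemH2iso S y₀ ∧ ∃ θ : ℕ → ℕ, StrictMono θ ∧
      (∀ i, Tendsto (fun k => eLpNorm (fun x => weakPartial S i (y (θ k)) x - weakPartial S i y₀ x)
        2 (volume.restrict S)) atTop (𝓝 0)) ∧
      (∀ᵐ x ∂(volume.restrict S), ∀ i,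
        Tendsto (fun k => weakPartial S i (y (θ k)) x) atTop (𝓝 (weakPartial S i y₀ x))) ∧
      ∀ i j, WeakL2 (volume.restrict S) (fun k => weakPartial S j (weakPartial S i (y (θ k))))
        (weakPartial S j (weakPartial S i y₀)) := by
  have := isFiniteMeasure_restrict hS.isBounded
  set μ := (volume : Measure E2).restrict S with hμ
  have hd := fun k => (hy k).hasWeakGrad_partial
  -- the first derivatives are bounded since they are unit vectors
  obtain ⟨K₁, hK₁⟩ : ∃ K₁ : ℝ, ∀ k i, eLpNorm (weakPartial S i (y k)) 2 μ ≤ ENNReal.ofReal K₁ := by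
    refine ⟨(μ univ ^ ((2 : ℝ≥0∞).toReal⁻¹) * ENNReal.ofReal 1).toReal, fun k i => ?_⟩
    rw [ENNReal.ofReal_toReal (ENNReal.mul_ne_top (ENNReal.rpow_ne_top_of_nonneg (by positivity)
      (measure_ne_top _ _)) ENNReal.ofReal_ne_top)]
    exact eLpNorm_le_of_ae_bound ((hy k).norm_partial_le i)
  obtain ⟨d₀, θ₁, hθ₁, hd₀, hw₁⟩ := exists_hasWeakGrad_limit
    (fun k => (hy k).1.1.hasWeakGrad) hy₀
    (WeakL2.of_strong (fun k => (hy k).1.1.hasWeakGrad.memLp) hy₀ hlim) hK₁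
  obtain ⟨z₀, θ₂, hθ₂, hz₀, hw₂⟩ := exists_hasWeakGrad_limit (fun k => hd (θ₁ k) 0)
    (hd₀.memLp_grad 0) (hw₁ 0) fun k j => hK (θ₁ k) 0 j
  obtain ⟨z₁, θ₃, hθ₃, hz₁, hw₃⟩ := exists_hasWeakGrad_limit (fun k => hd (θ₁ (θ₂ k)) 1)
    (hd₀.memLp_grad 1) ((hw₁ 1).subseq hθ₂) fun k j => hK (θ₁ (θ₂ k)) 1 j
  set z : Fin 2 → Fin 2 → E2 → E3 := ![z₀, z₁] with hzdef
  have hz : ∀ i, HasWeakGrad S (d₀ i) (z i) := by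
    intro i; fin_cases i
    · exact hz₀
    · exact hz₁
  set θ := fun k => θ₁ (θ₂ (θ₃ k)) with hθdef
  have hθ : StrictMono θ := hθ₁.comp (hθ₂.comp hθ₃)
  have hw : ∀ i j, WeakL2 μ (fun k => weakPartial S j (weakPartial S i (y (θ k)))) (z i j) := by
    intro i j; fin_cases i
    · exact (hw₂ j).subseq hθ₃
    · exact hw₃ j
  obtain ⟨hH2, hdae, hzae⟩ := MemH2.of_hasWeakGrad hS.isOpen hd₀ hz
  -- strong convergence of the first derivatives, by interpolation in the interior
  have hstrong : ∀ i, Tendsto (fun k => eLpNorm (fun x => weakPartial S i (y (θ k)) x - d₀ i x) 2 μ)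
      atTop (𝓝 0) := by
    intro i
    obtain ⟨K₂, hK₂⟩ : ∃ K₂ : ℝ, (∀ i, eLpNorm (d₀ i) 2 μ ≤ ENNReal.ofReal K₂) ∧
        ∀ i j, eLpNorm (z i j) 2 μ ≤ ENNReal.ofReal K₂ := by
      refine ⟨(∑ i, eLpNorm (d₀ i) 2 μ + ∑ i, ∑ j, eLpNorm (z i j) 2 μ).toReal, ?_, ?_⟩ <;>
      rw [ENNReal.ofReal_toReal (ENNReal.add_ne_top.2
        ⟨ENNReal.sum_ne_top.2 fun i _ => (hd₀.memLp_grad i).2.ne,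
          ENNReal.sum_ne_top.2 fun i _ => ENNReal.sum_ne_top.2 fun j _ =>
            ((hz i).memLp_grad j).2.ne⟩)]
      · exact fun i => (Finset.single_le_sum (f := fun i => eLpNorm (d₀ i) 2 μ)
          (fun _ _ => bot_le) (Finset.mem_univ i)).trans le_self_add
      · exact fun i j => ((Finset.single_le_sum (f := fun j => eLpNorm (z i j) 2 μ)
          (fun _ _ => bot_le) (Finset.mem_univ j)).trans
          (Finset.single_le_sum (f := fun i => ∑ j, eLpNorm (z i j) 2 μ)
          (fun _ _ => bot_le) (Finset.mem_univ i))).trans le_add_self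
    have hsum : ∀ {f g : E2 → E3} {a b : ℝ}, MemLp f 2 μ → MemLp g 2 μ →
        eLpNorm f 2 μ ≤ ENNReal.ofReal a → eLpNorm g 2 μ ≤ ENNReal.ofReal b →
        eLpNorm (fun x => f x - g x) 2 μ ≤ ENNReal.ofReal (max a 0 + max b 0) := by
      intro f g a b hf hg ha hb
      rw [ENNReal.ofReal_add (le_max_right _ _) (le_max_right _ _)]
      exact (eLpNorm_sub_le hf.1 hg.1 one_le_two).trans (add_le_add
        (ha.trans (ENNReal.ofReal_le_ofReal (le_max_left _ _)))
        (hb.trans (ENNReal.ofReal_le_ofReal (le_max_left _ _))))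
    refine tendsto_eLpNorm_of_local hS.isOpen (fun k => (hd (θ k) i).memLp) (hd₀.memLp_grad i)
      (fun k => (hy (θ k)).norm_partial_le i) fun ζ hζ hζc hζS => ?_
    refine tendsto_integral_cutoff_grad hS (e := fun k x => y (θ k) x - y₀ x)
      (C := max (max K₁ 0 + max K₂ 0) (max K 0 + max K₂ 0))
      (fun k => (hy (θ k)).1.1.hasWeakGrad.sub hd₀) (fun k i => (hd (θ k) i).sub (hz i))
      (fun k i => ?_) (fun k i j => ?_) (hlim.comp hθ.tendsto_atTop) hζ hζc hζS i
    · exact (hsum (hd (θ k) i).memLp (hd₀.memLp_grad i) (hK₁ _ i) (hK₂.1 i)).trans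
        (ENNReal.ofReal_le_ofReal (le_max_left _ _))
    · exact (hsum ((hd (θ k) i).memLp_grad j) ((hz i).memLp_grad j) (hK _ i j) (hK₂.2 i j)).trans
        (ENNReal.ofReal_le_ofReal (le_max_right _ _))
  have hstrong' : ∀ i, Tendsto (fun k => eLpNorm
      (fun x => weakPartial S i (y (θ k)) x - weakPartial S i y₀ x) 2 μ) atTop (𝓝 0) := fun i => by
    refine (hstrong i).congr fun k => eLpNorm_congr_ae ?_
    filter_upwards [hdae i] with x hx
    rw [hx]
  have hm : ∀ i, MemLp (weakPartial S i y₀) 2 μ := fun i => (hH2.2 i).1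
  obtain ⟨θ₄, hθ₄, hae₀⟩ := exists_subseq_ae_of_eLpNorm (fun k => (hd (θ k) 0).memLp) (hm 0)
    (hstrong' 0)
  obtain ⟨θ₅, hθ₅, hae₁⟩ := exists_subseq_ae_of_eLpNorm (fun k => (hd (θ (θ₄ k)) 1).memLp) (hm 1)
    ((hstrong' 1).comp hθ₄.tendsto_atTop)
  have hae : ∀ᵐ x ∂μ, ∀ i, Tendsto (fun k => weakPartial S i (y (θ (θ₄ (θ₅ k)))) x) atTop
      (𝓝 (weakPartial S i y₀ x)) := by
    filter_upwards [hae₀, hae₁] with x h0 h1 i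
    fin_cases i
    · exact h0.comp hθ₅.tendsto_atTop
    · exact h1
  refine ⟨⟨hH2, ?_⟩, fun k => θ (θ₄ (θ₅ k)), hθ.comp (hθ₄.comp hθ₅), fun i =>
    (hstrong' i).comp (hθ₄.comp hθ₅).tendsto_atTop, hae, fun i j =>
      ((hw i j).subseq (hθ₄.comp hθ₅)).congr (fun k => ae_eq_refl _) (hzae i j).symm⟩
  filter_upwards [hae, ae_all_iff.2 fun k => (hy k).2] with x hx hk i j
  exact tendsto_nhds_unique ((hx i).inner (hx j))
      (tendsto_const_nhds.congr fun k => (hk _ i j).symm)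

lemma tendsto_bilin {F G H : Type*} [NormedAddCommGroup F] [NormedSpace ℝ F] [NormedAddCommGroup G]
    [NormedSpace ℝ G] [NormedAddCommGroup H] [NormedSpace ℝ H] (B : F →L[ℝ] G →L[ℝ] H)
    {a : ℕ → F} {b : ℕ → G} {a₀ : F} {b₀ : G} (ha : Tendsto a atTop (𝓝 a₀))
    (hb : Tendsto b atTop (𝓝 b₀)) : Tendsto (fun k => B (a k) (b k)) atTop (𝓝 (B a₀ b₀)) :=
  ((B.continuous₂).tendsto (a₀, b₀)).comp (ha.prodMk_nhds hb)

/-- The second fundamental forms converge weakly. -/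
lemma weakL2_formV {S : Set E2} (hS : IsBoundedLipschitzDomain S) {y : ℕ → E2 → E3}
    {y₀ : E2 → E3} (hy : ∀ k, MemH2iso S (y k)) (hy₀ : MemH2iso S y₀)
    {K : ℝ} (hK : ∀ k i j, eLpNorm (weakPartial S j (weakPartial S i (y k))) 2 (volume.restrict S) ≤
      ENNReal.ofReal K)
    (hae : ∀ᵐ x ∂(volume.restrict S), ∀ i,
        Tendsto (fun k => weakPartial S i (y k) x) atTop (𝓝 (weakPartial S i y₀ x)))
    (hw : ∀ i j, WeakL2 (volume.restrict S) (fun k => weakPartial S j (weakPartial S i (y k)))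
        (weakPartial S j (weakPartial S i y₀))) :
    WeakL2 (volume.restrict S) (fun k => formV S (y k)) (formV S y₀) := by
  set μ := (volume : Measure E2).restrict S with hμ
  have hb : ∀ᵐ x ∂μ, Tendsto (fun k => normalField S (y k) x) atTop (𝓝 (normalField S y₀ x)) := by
    filter_upwards [hae] with x hx
    exact tendsto_bilin crossC (hx 0) (hx 1)
  have h1 : ∀ i j, WeakL2 μ
      (fun k x => ⟪weakPartial S j (weakPartial S i (y k)) x, normalField S (y k) x⟫)
      (fun x => ⟪weakPartial S j (weakPartial S i y₀) x, normalField S y₀ x⟫) := fun i j =>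
    (hw i j).inner_of_ae (fun k => ((hy k).hasWeakGrad_partial i).memLp_grad j)
      (fun k => hK k i j) (fun k => ((hy k).hasWeakGrad_normal hS).memLp.1)
      (hy₀.hasWeakGrad_normal hS).memLp.1 (fun k => (hy k).norm_normal_le) hb
  set A : Fin 2 × Fin 2 → ℝ →L[ℝ] MatV := fun p =>
    (ContinuousLinearMap.id ℝ ℝ).smulRight (-EuclideanSpace.single p (1 : ℝ)) with hA
  have h2 := fun i j => (h1 i j).clm_comp (A (i, j))
  have hm : ∀ {y : E2 → E3}, MemH2iso S y → ∀ i j, MemLp (fun x => A (i, j)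
      ⟪weakPartial S j (weakPartial S i y) x, normalField S y x⟫) 2 μ := fun hy i j =>
    (A (i, j)).comp_memLp' (memLp_bilin_left (innerB E3) ((hy.hasWeakGrad_partial i).memLp_grad j)
      (hy.hasWeakGrad_normal hS).memLp.1 hy.norm_normal_le)
  have he : ∀ {y : E2 → E3}, MemH2iso S y → (fun x =>
      (A (0, 0) ⟪weakPartial S 0 (weakPartial S 0 y) x, normalField S y x⟫ +
        A (0, 1) ⟪weakPartial S 1 (weakPartial S 0 y) x, normalField S y x⟫) +
      (A (1, 0) ⟪weakPartial S 0 (weakPartial S 1 y) x, normalField S y x⟫ +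
        A (1, 1) ⟪weakPartial S 1 (weakPartial S 1 y) x, normalField S y x⟫)) =ᵐ[μ] formV S y := by
    intro y hy
    filter_upwards [hy.secondForm_ae hS] with x hx
    have e : ∀ i j, formV S y x (i, j) = _ := fun i j => (hx i j).1
    ext p
    obtain ⟨i, j⟩ := p
    rw [e]
    fin_cases i <;> fin_cases j <;> simp [A]
  refine WeakL2.congr ?_ (fun k => he (hy k)) (he hy₀)
  exact WeakL2.add (fun k => (hm (hy k) 0 0).add (hm (hy k) 0 1)) ((hm hy₀ 0 0).add (hm hy₀ 0 1))
    (fun k => (hm (hy k) 1 0).add (hm (hy k) 1 1)) ((hm hy₀ 1 0).add (hm hy₀ 1 1))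
    (WeakL2.add (fun k => hm (hy k) 0 0) (hm hy₀ 0 0) (fun k => hm (hy k) 0 1) (hm hy₀ 0 1)
      (h2 0 0) (h2 0 1))
    (WeakL2.add (fun k => hm (hy k) 1 0) (hm hy₀ 1 0) (fun k => hm (hy k) 1 1) (hm hy₀ 1 1)
      (h2 1 0) (h2 1 1))

/-- The directors in local coordinates converge strongly. -/
lemma tendsto_localDirector {S : Set E2} (hS : IsBoundedLipschitzDomain S) {y n : ℕ → E2 → E3}
    {y₀ n₀ : E2 → E3} (h : ∀ k, MemA2 S (y k) (n k)) (h₀ : MemA2 S y₀ n₀)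
    (hd : ∀ i, Tendsto (fun k => eLpNorm (fun x => weakPartial S i (y k) x - weakPartial S i y₀ x)
        2 (volume.restrict S)) atTop (𝓝 0))
    (hn : Tendsto (fun k => eLpNorm (fun x => n k x - n₀ x) 2 (volume.restrict S)) atTop (𝓝 0)) :
    Tendsto (fun k => eLpNorm (fun x => localDirector S (y k) (n k) x - localDirector S y₀ n₀ x) 2
      (volume.restrict S)) atTop (𝓝 0) := by
  set μ := (volume : Measure E2).restrict S with hμ
  have hdm := fun k i => ((h k).1.hasWeakGrad_partial i).memLp.1
  have hdm₀ := fun i => (h₀.1.hasWeakGrad_partial i).memLp.1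
  have hbm := fun k => ((h k).1.hasWeakGrad_normal hS).memLp.1
  have hbm₀ := (h₀.1.hasWeakGrad_normal hS).memLp.1
  have hnm := fun k => (h k).2.1.1.1
  have hb : Tendsto (fun k => eLpNorm (fun x => normalField S (y k) x - normalField S y₀ x) 2 μ)
      atTop (𝓝 0) :=
    tendsto_eLpNorm_bilin crossC (fun k => hdm k 0) (hdm₀ 0) (fun k => hdm k 1) (hdm₀ 1)
      (h₀.1.norm_partial_le 0) (fun k => (h k).1.norm_partial_le 1) (hd 0) (hd 1)
  have h1 := fun (i : Fin 2) (j : Fin 3) => tendsto_eLpNorm_bilin (compC j) (fun k => hdm k i)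
    (hdm₀ i) hnm h₀.2.1.1.1 (h₀.1.norm_partial_le i) (fun k => (h k).norm_director_le) (hd i) hn
  have h2 := tendsto_eLpNorm_bilin (compC 2) hbm hbm₀ hnm h₀.2.1.1.1 h₀.1.norm_normal_le
    (fun k => (h k).norm_director_le) hb hn
  have h3 := ((h1 0 0).add (h1 1 1)).add h2
  rw [add_zero, add_zero] at h3
  refine tendsto_of_tendsto_of_tendsto_of_le_of_le tendsto_const_nhds h3 (fun k => bot_le)
    fun k => ?_
  have hc : ∀ {a b : E2 → E3} (j : Fin 3), AEStronglyMeasurable a μ → AEStronglyMeasurable b μ →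
      AEStronglyMeasurable (fun x => compC j (a x) (b x)) μ := fun j ha hb =>
    (compC j).aestronglyMeasurable_comp₂ ha hb
  have e : (fun x => localDirector S (y k) (n k) x - localDirector S y₀ n₀ x) = fun x =>
      ((compC 0 (weakPartial S 0 (y k) x) (n k x) - compC 0 (weakPartial S 0 y₀ x) (n₀ x)) +
      (compC 1 (weakPartial S 1 (y k) x) (n k x) - compC 1 (weakPartial S 1 y₀ x) (n₀ x))) +
      (compC 2 (normalField S (y k) x) (n k x) - compC 2 (normalField S y₀ x) (n₀ x)) := by
    ext1 x
    rw [localDirector_eq, localDirector_eq]; abel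
  have hs := fun (i : Fin 2) (j : Fin 3) => (hc j (hdm k i) (hnm k)).sub
    (hc j (hdm₀ i) h₀.2.1.1.1)
  rw [e]
  exact (eLpNorm_add_le ((hs 0 0).add (hs 1 1)) ((hc 2 (hbm k) (hnm k)).sub
    (hc 2 hbm₀ h₀.2.1.1.1)) one_le_two).trans
      (add_le_add (eLpNorm_add_le (hs 0 0) (hs 1 1) one_le_two) le_rfl)

lemma add_le_liminf_add {a b : ℝ≥0∞} {u v : ℕ → ℝ≥0∞} (ha : a ≤ liminf u atTop)
    (hb : b ≤ liminf v atTop) : a + b ≤ liminf (fun k => u k + v k) atTop := by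
  refine (add_le_add ha hb).trans ?_
  simp only [liminf_eq_iSup_iInf_of_nat]
  rw [ENNReal.iSup_add_iSup_of_monotone]
  · refine iSup_mono fun n => le_iInf₂ fun i hi => add_le_add (iInf₂_le i hi) (iInf₂_le i hi)
  all_goals exact fun m n hmn => le_iInf₂ fun i hi => iInf₂_le i (hmn.trans hi)

section LowerBound

variable {S : Set E2} {W : ℝ → M3 → ℝ≥0∞} {Q : ℝ → QuadraticForm ℝ M3} {C q : ℝ}
  {r : ℝ≥0 → ℝ≥0∞}

/-- Sequences of bounded plate energy that converge in `L²`: the limit is admissible, and along a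
subsequence the local directors converge strongly, with bounded gradients, and the plate energy is
lower semicontinuous. -/
theorem exists_subseq_plateEnergy_le_liminf (hW : StoredEnergy W Q C q r)
    (hS : IsBoundedLipschitzDomain S) (rbar : ℝ) {ebar : ℝ} (he : 0 < ebar) {c : ℝ≥0∞}
    (hc : c ≠ ⊤) {p : ℕ → State S} {p₀ : State S} (hp : Tendsto p atTop (𝓝 p₀))
    (hle : ∀ k, plateEnergy Q rbar ebar S (p k) ≤ c) :
    MemA2 S p₀.1 p₀.2 ∧ ∃ θ : ℕ → ℕ, StrictMono θ ∧
      Tendsto (fun k => eLpNorm (fun x => localDirector S (p (θ k)).1 (p (θ k)).2 x -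
        localDirector S p₀.1 p₀.2 x) 2 (volume.restrict S)) atTop (𝓝 0) ∧
      (∃ K : ℝ, ∀ k i, eLpNorm (gradDirector S (p (θ k)).1 (p (θ k)).2 i) 2 (volume.restrict S) ≤
        ENNReal.ofReal K) ∧
      plateEnergy Q rbar ebar S p₀ ≤
        liminf (fun k => plateEnergy Q rbar ebar S (p (θ k))) atTop := by
  have := isFiniteMeasure_restrict hS.isBounded
  set μ := (volume : Measure E2).restrict S with hμ
  have hA : ∀ k, MemA2 S (p k).1 (p k).2 := fun k =>
    memA2_of_plateEnergy_ne_top (ne_top_of_le_ne_top hc (hle k))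
  -- bounds on the Hessians of the deformations and on the gradients of the directors
  obtain ⟨K, hK⟩ := exists_bound_of_plateEnergy hW hS rbar he hc
  have hy := (Lp.tendsto_Lp_iff_tendsto_eLpNorm' _ _).1 ((continuous_fst.tendsto p₀).comp hp)
  have hn := (Lp.tendsto_Lp_iff_tendsto_eLpNorm' _ _).1 ((continuous_snd.tendsto p₀).comp hp)
  obtain ⟨hiso, θ₁, hθ₁, hd, hae, hz⟩ := exists_isometry_limit hS (fun k => (hA k).1)
    (Lp.memLp p₀.1) hy (fun k => (hK _ (hle k)).1)
  obtain ⟨m, θ₂, hθ₂, hm, hwm⟩ := exists_hasWeakGrad_limit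
    (fun k => (hA (θ₁ k)).2.1.hasWeakGrad) (Lp.memLp p₀.2)
    (WeakL2.of_strong (fun k => Lp.memLp (p (θ₁ k)).2) (Lp.memLp p₀.2)
      (hn.comp hθ₁.tendsto_atTop)) (fun k => (hK _ (hle (θ₁ k))).2)
  -- pointwise convergence shows that the limit is a unit field
  obtain ⟨θ₃, hθ₃, haen⟩ := exists_subseq_ae_of_eLpNorm (fun k => Lp.memLp (p (θ₁ (θ₂ k))).2)
    (Lp.memLp p₀.2) (hn.comp (hθ₁.comp hθ₂).tendsto_atTop)
  have hA₀ : MemA2 S p₀.1 p₀.2 := by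
    refine ⟨hiso, hm.memH1, ?_⟩
    filter_upwards [haen, ae_all_iff.2 fun k => (hA k).2.2] with x hx hk
    exact tendsto_nhds_unique hx.norm (tendsto_const_nhds.congr fun k => (hk _).symm)
  set θ := fun k => θ₁ (θ₂ (θ₃ k)) with hθdef
  have hθ : StrictMono θ := hθ₁.comp (hθ₂.comp hθ₃)
  have hθ' : StrictMono fun k => θ₂ (θ₃ k) := hθ₂.comp hθ₃
  have hw : Tendsto (fun k => eLpNorm (fun x => localDirector S (p (θ k)).1 (p (θ k)).2 x -
        localDirector S p₀.1 p₀.2 x) 2 μ) atTop (𝓝 0) :=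
    tendsto_localDirector hS (fun k => hA (θ k)) hA₀ (fun i => (hd i).comp hθ'.tendsto_atTop)
      (hn.comp hθ.tendsto_atTop)
  obtain ⟨K', hK'⟩ := MemA2.eLpNorm_gradDirector_le hS K
  refine ⟨hA₀, θ, hθ, hw, ⟨K', fun k i => hK' _ _ (hA (θ k)) (hK _ (hle (θ k))).1
    (hK _ (hle (θ k))).2 i⟩, ?_⟩
  rw [plateEnergy_eq hW hS hA₀]
  simp_rw [fun k => plateEnergy_eq hW hS (hA (θ k)) (rbar := rbar) (ebar := ebar)]
  have hform : WeakL2 μ (fun k => formV S (p (θ k)).1) (formV S p₀.1) :=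
    weakL2_formV hS (fun k => (hA (θ k)).1) hiso (fun k => (hK _ (hle (θ k))).1)
      (by filter_upwards [hae] with x hx i using (hx i).comp hθ'.tendsto_atTop)
      fun i j => (hz i j).subseq hθ'
  -- the strain is quadratic in the local director and hence converges strongly
  have hstrainm := fun k => (hA (θ k)).memLp_strainV hS
  have hstrain : WeakL2 μ (fun k => strainV S (p (θ k)).1 (p (θ k)).2) (strainV S p₀.1 p₀.2) := by
    refine WeakL2.of_strong hstrainm (hA₀.memLp_strainV hS) ?_
    have hb : ∀ {y n : E2 → E3}, MemA2 S y n → ∀ᵐ x ∂μ, ‖localDirector S y n x‖ ≤ 1 := fun h => by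
      filter_upwards [h.norm_localDirector] with x hx using hx.le
    have hwm := fun k => ((hA (θ k)).hasWeakGrad_localDirector hS).memLp.1
    have hwm₀ := (hA₀.hasWeakGrad_localDirector hS).memLp.1
    refine (tendsto_eLpNorm_bilin tensC hwm hwm₀ hwm hwm₀ (hb hA₀) (fun k => hb (hA (θ k)))
      hw hw).congr fun k => ?_
    rw [← eLpNorm_neg]
    congr 1
    ext1 x
    simp only [Pi.neg_apply, strainV]
    abel
  have hsum : WeakL2 μ
      (fun k x => formV S (p (θ k)).1 x + rbar • clmBB Q (strainV S (p (θ k)).1 (p (θ k)).2 x))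
      (fun x => formV S p₀.1 x + rbar • clmBB Q (strainV S p₀.1 p₀.2 x)) :=
    WeakL2.add (fun k => (hA (θ k)).1.memLp_formV hS) (hiso.memLp_formV hS)
      (fun k => (rbar • clmBB Q).comp_memLp' (hstrainm k))
      ((rbar • clmBB Q).comp_memLp' (hA₀.memLp_strainV hS)) hform
      (hstrain.clm_comp (rbar • clmBB Q))
  have hgrad : ∀ i, WeakL2 μ (fun k => weakPartial S i (p (θ k)).2) (weakPartial S i p₀.2) :=
    fun i => ((hwm i).subseq hθ₃).congr (fun k => ae_eq_refl _)
      (hm.weakPartial_ae_eq hS.isOpen i).symm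
  -- each of the four summands is a convex integral of a weakly convergent sequence
  have h1 := lintegral_le_liminf_of_weakL2 hW.convexOn_Qel hW.continuous_Qel
    (fun B => hW.Qel_nonneg _) (fun k => ((hA (θ k)).1.memLp_formV hS).add
      ((rbar • clmBB Q).comp_memLp' (hstrainm k))) ((hiso.memLp_formV hS).add
      ((rbar • clmBB Q).comp_memLp' (hA₀.memLp_strainV hS))) hsum
  have h2 := lintegral_le_liminf_of_weakL2 (Φ := fun B => rbar ^ 2 * Eres Q (matOf B))
    ((hW.Eres_convex.comp_linearMap matOf).smul (sq_nonneg rbar))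
    (continuous_const.mul hW.continuous_Eres)
    (fun B => mul_nonneg (sq_nonneg _) (hW.Eres_nonneg _)) hstrainm (hA₀.memLp_strainV hS) hstrain
  have h3 := fun i => lintegral_le_liminf_of_weakL2 (Φ := fun a : E3 => ebar ^ 2 / 2 * ‖a‖ ^ 2)
    (((convexOn_norm convex_univ).pow (fun _ _ => norm_nonneg _) 2).smul (by positivity))
    (by fun_prop) (fun a => by positivity)
    (fun k => (hA (θ k)).2.1.hasWeakGrad.memLp_grad i)
    (hA₀.2.1.hasWeakGrad.memLp_grad i) (hgrad i)
  exact add_le_liminf_add (add_le_liminf_add h1 h2) (add_le_liminf_add (h3 0) (h3 1))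

end LowerBound

/-! ### Strip integrals and boundary integrals -/

/-- The pointwise anchoring penalties `|w - N|` and `|w · N|`: the properties used in the passage
from the strip to the boundary. -/
structure IsPenalty (A : E3 → E3 → ℝ) : Prop where
  continuous : Continuous fun p : E3 × E3 => A p.1 p.2
  nonneg : ∀ w N, 0 ≤ A w N
  le_add : ∀ w w' N, ‖N‖ = 1 → A w N ≤ A w' N + ‖w - w'‖
  le_two : ∀ w N, ‖w‖ = 1 → ‖N‖ = 1 → A w N ≤ 2

lemma isPenalty_norm_sub : IsPenalty fun w N => ‖w - N‖ where
  continuous := by fun_prop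
  nonneg _ _ := norm_nonneg _
  le_add w w' N _ := by
    have := norm_add_le (w' - N) (w - w')
    rwa [show w' - N + (w - w') = w - N by abel] at this
  le_two w N hw hN := (norm_sub_le _ _).trans (by rw [hw, hN]; norm_num)

lemma isPenalty_abs_inner : IsPenalty fun w N => |⟪w, N⟫| where
  continuous := by fun_prop
  nonneg _ _ := abs_nonneg _
  le_add w w' N hN := by
    have h1 : ⟪w, N⟫ = ⟪w', N⟫ + ⟪w - w', N⟫ := by rw [inner_sub_left]; ring
    have h2 := abs_real_inner_le_norm (w - w') N
    rw [hN, mul_one] at h2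
    rw [h1]
    exact (abs_add_le _ _).trans (by linarith)
  le_two w N hw hN := by
    have := abs_real_inner_le_norm w N
    rw [hw, hN] at this
    linarith

/-- The mean of the squared penalty over the strip of width `σ`. -/
noncomputable def stripMean (A : E3 → E3 → ℝ) (S Γ : Set E2) (N : E2 → E3) (σ : ℝ)
    (w : E2 → E3) : ℝ≥0∞ :=
  ENNReal.ofReal (1 / σ) * ∫⁻ x in S ∩ strip S Γ σ, ENNReal.ofReal (A (w x) (N x) ^ 2)

lemma le_ofReal_sqrt_mul {x B : ℝ≥0∞} {σ : ℝ} (hσ : 0 ≤ σ) (h : x ^ 2 ≤ ENNReal.ofReal σ * B) :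
    x ≤ ENNReal.ofReal (√σ) * B ^ (1 / 2 : ℝ) := by
  have h1 := ENNReal.rpow_le_rpow h (show (0 : ℝ) ≤ 1 / 2 by norm_num)
  rw [ENNReal.mul_rpow_of_nonneg _ _ (by norm_num), ENNReal.ofReal_rpow_of_nonneg hσ (by norm_num),
    ← Real.sqrt_eq_rpow, ← ENNReal.rpow_natCast, ← ENNReal.rpow_mul] at h1
  norm_num at h1
  simpa using h1

/-- Short fibres over points whose fibres lie in `S` are controlled by the part of the strip in
`S`. -/
lemma IsGoodWidth.map_le_inter {S Γ P : Set E2} {c : ℝ≥0∞} {σ : ℝ} (h : IsGoodWidth S Γ c σ)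
    (hS : MeasurableSet S) (hP : P ⊆ Γ) (hPm : MeasurableSet P)
    (hin : ∀ ξ ∈ P, ∀ s ∈ Ioo 0 σ, stripMap S Γ (ξ, s) ∈ S) :
    (fibreMeasure P σ).map (stripMap S Γ) ≤ c • volume.restrict (S ∩ strip S Γ σ) := by
  have := h.finite
  have : IsFiniteMeasure (arcMeasure P) := isFiniteMeasure_of_le _ (arcMeasure_mono hP)
  refine Measure.le_iff.2 fun A hA => ?_
  have h1 : fibreMeasure P σ (stripMap S Γ ⁻¹' A) =
      fibreMeasure P σ (stripMap S Γ ⁻¹' (A ∩ S)) := by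
    refine measure_congr ?_
    filter_upwards [ae_mem_fibreMeasure hPm σ] with x hx
    have := hin x.1 hx.1 x.2 hx.2
    exact propext ⟨fun hxA => ⟨hxA, this⟩, fun hxA => hxA.1⟩
  have hAS := hA.inter hS
  rw [Measure.map_apply h.measurable hA, h1]
  calc fibreMeasure P σ (stripMap S Γ ⁻¹' (A ∩ S))
      ≤ fibreMeasure Γ σ (stripMap S Γ ⁻¹' (A ∩ S)) := fibreMeasure_mono hP le_rfl _
    _ = (fibreMeasure Γ σ).map (stripMap S Γ) (A ∩ S) := (Measure.map_apply h.measurable hAS).symm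
    _ ≤ (c • volume.restrict (strip S Γ σ)) (A ∩ S) := h.map_le _
    _ = (c • volume.restrict (S ∩ strip S Γ σ)) A := by
      rw [Measure.smul_apply, Measure.smul_apply, Measure.restrict_apply hA,
        Measure.restrict_apply hAS, inter_assoc]

section Steps

variable {S Γ : Set E2} {A : E3 → E3 → ℝ} {g N : E2 → E3} {c c₀ : ℝ≥0∞} {σ σ₀ d : ℝ}

/-- On the fibres of a shorter strip, the canonical extension is given by the datum. -/
lemma IsCanonicalExtension.ae_fibre_of_le (hN : IsCanonicalExtension S Γ σ₀ g N)
    (h₀ : IsGoodWidth S Γ c₀ σ₀) (hg : MemL2Sphere Γ g) (hσ : σ ≤ σ₀) {P : Set E2} (hP : P ⊆ Γ) :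
    ∀ᵐ x ∂(fibreMeasure P σ), N (stripMap S Γ x) = g x.1 ∧ ‖g x.1‖ = 1 := by
  have := h₀.finite
  have : IsFiniteMeasure (arcMeasure P) := isFiniteMeasure_of_le _ (arcMeasure_mono hP)
  have h1 : ∀ᵐ x ∂(fibreMeasure P σ), N (stripMap S Γ x) = g x.1 :=
    (fibreMeasure_mono hP hσ).absolutelyContinuous.ae_le
      (hN.ae_fibre h₀ hg.1.aestronglyMeasurable)
  have h2 : ∀ᵐ x ∂(fibreMeasure Γ σ₀), ‖g x.1‖ = 1 :=
    Measure.quasiMeasurePreserving_fst.ae hg.2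
  filter_upwards [h1, (fibreMeasure_mono hP hσ).absolutelyContinuous.ae_le h2] with x a b
    using ⟨a, b⟩

lemma sq_eLpNorm_penalty (hA : IsPenalty A) {X : Type*} [MeasurableSpace X] (μ : Measure X)
    (w n : X → E3) : eLpNorm (fun x => A (w x) (n x)) 2 μ ^ 2 =
      ∫⁻ x, ENNReal.ofReal (A (w x) (n x) ^ 2) ∂μ := by
  rw [sq_eLpNorm_two]
  refine lintegral_congr fun x => ?_
  rw [Real.enorm_of_nonneg (hA.nonneg _ _), ENNReal.ofReal_pow (hA.nonneg _ _)]

lemma IsPenalty.aestronglyMeasurable (hA : IsPenalty A) {X : Type*} [MeasurableSpace X]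
    {μ : Measure X} {w n : X → E3} (hw : AEStronglyMeasurable w μ) (hn : AEStronglyMeasurable n μ) :
    AEStronglyMeasurable (fun x => A (w x) (n x)) μ :=
  hA.continuous.comp_aestronglyMeasurable (hw.prodMk hn)

lemma IsPenalty.eLpNorm_le_add (hA : IsPenalty A) {X : Type*} [MeasurableSpace X]
    {μ : Measure X} {w w' n : X → E3} (hw : AEStronglyMeasurable w μ)
    (hw' : AEStronglyMeasurable w' μ) (hn : AEStronglyMeasurable n μ)
    (hn1 : ∀ᵐ x ∂μ, ‖n x‖ = 1) :
    eLpNorm (fun x => A (w x) (n x)) 2 μ ≤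
      eLpNorm (fun x => A (w' x) (n x)) 2 μ + eLpNorm (fun x => w x - w' x) 2 μ := by
  have h1 : eLpNorm (fun x => A (w x) (n x)) 2 μ ≤
      eLpNorm (fun x => A (w' x) (n x) + ‖w x - w' x‖) 2 μ := by
    refine eLpNorm_mono_ae ?_
    filter_upwards [hn1] with x hx
    rw [Real.norm_of_nonneg (hA.nonneg _ _), Real.norm_of_nonneg
      (add_nonneg (hA.nonneg _ _) (norm_nonneg _))]
    exact hA.le_add _ _ _ hx
  refine h1.trans ((eLpNorm_add_le (hA.aestronglyMeasurable hw' hn) (hw.sub hw').norm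
    one_le_two).trans (add_le_add le_rfl (eLpNorm_norm _).le))

/-- The boundary penalty over the points at distance at least `d` from the rest of the boundary is
bounded by the strip mean over a strip of width `σ ≤ d`, up to errors from the trace (in `σ`) and
from the distance of the two functions (in `d`). -/
lemma eLpNorm_trace_le (hS : IsBoundedLipschitzDomain S) (hΓ : IsRegularBoundaryPart S Γ)
    (hA : IsPenalty A)
    (h₀ : IsGoodWidth S Γ c₀ σ₀) (hg : MemL2Sphere Γ g) (hN : IsCanonicalExtension S Γ σ₀ g N)
    (hfib : IsFibred S Γ (innerPart S Γ d) 2 d) (h : IsGoodWidth S Γ c σ) (hσ : 0 < σ)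
    (hσd : σ ≤ d) (hσσ₀ : σ ≤ σ₀)
    (hin : ∀ ξ ∈ innerPart S Γ d, ∀ s ∈ Ioo 0 σ, stripMap S Γ (ξ, s) ∈ S)
    {w w₀ tr : E2 → E3} {v v₀ : Fin 2 → E2 → E3} (hw : HasWeakGrad S w v)
    (hw₀ : HasWeakGrad S w₀ v₀) (htr : IsTrace S Γ w₀ tr) :
    eLpNorm (fun ξ => A (tr ξ) (g ξ)) 2 (arcMeasure (innerPart S Γ d)) ≤
      (c * stripMean A S Γ N σ w) ^ (1 / 2 : ℝ) +
      (ENNReal.ofReal (1 / d) * (2 * (2 * eLpNorm (fun x => w x - w₀ x) 2 (volume.restrict S) ^ 2 +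
        2 * ENNReal.ofReal d ^ 2 * ∑ i, eLpNorm (fun x => v i x - v₀ i x) 2
          (volume.restrict S) ^ 2))) ^ (1 / 2 : ℝ) +
      (ENNReal.ofReal σ * (2 * ∑ i, eLpNorm (weakPartial S i w₀) 2 (volume.restrict S) ^ 2))
        ^ (1 / 2 : ℝ) := by
  have := isFiniteMeasure_restrict hS.isBounded
  have hd : 0 < d := hσ.trans_le hσd
  have hPΓ : innerPart S Γ d ⊆ Γ := innerPart_subset d
  have hPm := measurableSet_innerPart (S := S) hΓ.measurableSet d
  set P := innerPart S Γ d with hP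
  set κ := fibreMeasure P σ with hκ
  have hfinP := hfib.finite'
  have hfσ : IsFibred S Γ P 2 σ := hfib.mono Subset.rfl hσd
  have hdat := hN.ae_fibre_of_le h₀ hg hσσ₀ hPΓ
  have hgm : AEStronglyMeasurable g (arcMeasure P) :=
    hg.1.aestronglyMeasurable.mono_measure (arcMeasure_mono hPΓ)
  have htm : AEStronglyMeasurable tr (arcMeasure P) :=
    htr.2.1.aestronglyMeasurable.mono_measure (arcMeasure_mono hPΓ)
  have hq : Measure.QuasiMeasurePreserving (Prod.fst : E2 × ℝ → E2) κ (arcMeasure P) :=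
    Measure.quasiMeasurePreserving_fst
  have mg : AEStronglyMeasurable (fun x : E2 × ℝ => g x.1) κ :=
    hgm.comp_quasiMeasurePreserving hq
  have mt : AEStronglyMeasurable (fun x : E2 × ℝ => tr x.1) κ :=
    htm.comp_quasiMeasurePreserving hq
  have mw : ∀ {u : E2 → E3}, MemLp u 2 (volume.restrict S) →
      AEStronglyMeasurable (fun x => u (stripMap S Γ x)) κ := fun hu => (hfσ.memLp_comp hu).1
  have hg1 : ∀ᵐ x ∂κ, ‖g x.1‖ = 1 := hdat.mono fun x hx => hx.2
  -- the three terms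
  have e1 : eLpNorm (fun x : E2 × ℝ => A (w (stripMap S Γ x)) (g x.1)) 2 κ ≤
      ENNReal.ofReal (√σ) * (c * stripMean A S Γ N σ w) ^ (1 / 2 : ℝ) := by
    refine le_ofReal_sqrt_mul hσ.le ?_
    rw [sq_eLpNorm_penalty hA]
    have hmap := h.map_le_inter hS.isOpen.measurableSet hPΓ hPm hin
    have hac := Measure.absolutelyContinuous_of_le_smul hmap
    have hstr : strip S Γ σ ⊆ strip S Γ σ₀ := by
      rintro z ⟨ξ, hξ, s, hs, rfl⟩
      exact ⟨ξ, hξ, s, ⟨hs.1, hs.2.trans_le hσσ₀⟩, rfl⟩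
    have mN : AEStronglyMeasurable N (volume.restrict (S ∩ strip S Γ σ)) :=
      hN.memLp.1.mono_measure (Measure.restrict_mono (inter_subset_right.trans hstr) le_rfl)
    have mw' : AEStronglyMeasurable w (volume.restrict (S ∩ strip S Γ σ)) :=
      hw.memLp.1.mono_measure (Measure.restrict_mono inter_subset_left le_rfl)
    have mf : AEMeasurable (fun z => ENNReal.ofReal (A (w z) (N z) ^ 2))
        (volume.restrict (S ∩ strip S Γ σ)) :=
      ((hA.aestronglyMeasurable mw' mN).aemeasurable.pow_const 2).ennreal_ofReal
    calc ∫⁻ x, ENNReal.ofReal (A (w (stripMap S Γ x)) (g x.1) ^ 2) ∂κ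
        = ∫⁻ x, ENNReal.ofReal (A (w (stripMap S Γ x)) (N (stripMap S Γ x)) ^ 2) ∂κ := by
          refine lintegral_congr_ae ?_
          filter_upwards [hdat] with x hx
          rw [hx.1]
      _ = ∫⁻ z, ENNReal.ofReal (A (w z) (N z) ^ 2) ∂(κ.map (stripMap S Γ)) :=
          (lintegral_map' (mf.mono_ac hac) h.measurable.aemeasurable).symm
      _ ≤ ∫⁻ z, ENNReal.ofReal (A (w z) (N z) ^ 2) ∂(c • volume.restrict (S ∩ strip S Γ σ)) :=
          lintegral_mono' hmap le_rfl
      _ = ENNReal.ofReal σ * (c * stripMean A S Γ N σ w) := by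
          rw [lintegral_smul_measure, smul_eq_mul, stripMean, mul_left_comm c, ← mul_assoc,
            ← ENNReal.ofReal_mul hσ.le, mul_one_div_cancel hσ.ne', ENNReal.ofReal_one, one_mul]
  have e2 : eLpNorm (fun x => w (stripMap S Γ x) - w₀ (stripMap S Γ x)) 2 κ ≤
      ENNReal.ofReal (√σ) * (ENNReal.ofReal (1 / d) *
        (2 * (2 * eLpNorm (fun x => w x - w₀ x) 2 (volume.restrict S) ^ 2 +
        2 * ENNReal.ofReal d ^ 2 * ∑ i, eLpNorm (fun x => v i x - v₀ i x) 2
          (volume.restrict S) ^ 2))) ^ (1 / 2 : ℝ) := by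
    refine le_ofReal_sqrt_mul hσ.le ?_
    have h1 := mul_le_mul_right (hfib.mul_sq_eLpNorm_le hσd hS (hw.sub hw₀))
      (ENNReal.ofReal (1 / d))
    rwa [← mul_assoc, ← ENNReal.ofReal_mul (by positivity), one_div_mul_cancel hd.ne',
      ENNReal.ofReal_one, one_mul, mul_left_comm] at h1
  have e3 : eLpNorm (fun x => w₀ (stripMap S Γ x) - tr x.1) 2 κ ≤ ENNReal.ofReal (√σ) *
      (ENNReal.ofReal σ * (2 * ∑ i, eLpNorm (weakPartial S i w₀) 2 (volume.restrict S) ^ 2))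
        ^ (1 / 2 : ℝ) := by
    refine le_ofReal_sqrt_mul hσ.le ?_
    rw [← mul_assoc, ← sq]
    exact hfσ.sq_eLpNorm_sub_trace_le hS htr
  have e0 : eLpNorm (fun x : E2 × ℝ => A (tr x.1) (g x.1)) 2 κ =
      ENNReal.ofReal (√σ) * eLpNorm (fun ξ => A (tr ξ) (g ξ)) 2 (arcMeasure P) := by
    have h1 := sq_eLpNorm_fst σ (hA.aestronglyMeasurable htm hgm)
    rw [← Real.sq_sqrt hσ.le, ENNReal.ofReal_pow (Real.sqrt_nonneg _), ← mul_pow] at h1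
    rw [Real.sq_sqrt hσ.le] at h1
    exact le_antisymm ((ENNReal.pow_le_pow_left_iff two_ne_zero).1 h1.le)
      ((ENNReal.pow_le_pow_left_iff two_ne_zero).1 h1.ge)
  have tri1 := hA.eLpNorm_le_add mt (mw hw.memLp) mg hg1
  have tri2 : eLpNorm (fun x => tr x.1 - w (stripMap S Γ x)) 2 κ ≤
      eLpNorm (fun x => w (stripMap S Γ x) - w₀ (stripMap S Γ x)) 2 κ +
        eLpNorm (fun x => w₀ (stripMap S Γ x) - tr x.1) 2 κ := by
    rw [← eLpNorm_neg]
    refine le_trans (le_of_eq ?_) (eLpNorm_add_le ((mw hw.memLp).sub (mw hw₀.memLp))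
      ((mw hw₀.memLp).sub mt) one_le_two)
    congr 1
    ext1 x
    simp only [Pi.neg_apply, Pi.add_apply]
    abel
  have hs0 : ENNReal.ofReal (√σ) ≠ 0 := by
    rw [Ne, ENNReal.ofReal_eq_zero, not_le]; exact Real.sqrt_pos.2 hσ
  rw [← ENNReal.mul_le_mul_iff_right hs0 ENNReal.ofReal_ne_top, ← e0, mul_add, mul_add, add_assoc]
  exact tri1.trans (add_le_add e1 (tri2.trans (add_le_add e2 e3)))

/-- The strip mean is bounded by the boundary penalty, up to an error from the trace and the
contribution of the fibres that start close to the rest of the boundary. -/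
lemma stripMean_le (hS : IsBoundedLipschitzDomain S) (hΓ : IsRegularBoundaryPart S Γ)
    (hA : IsPenalty A)
    (h₀ : IsGoodWidth S Γ c₀ σ₀) (hg : MemL2Sphere Γ g) (hN : IsCanonicalExtension S Γ σ₀ g N)
    (hfib : IsFibred S Γ (innerPart S Γ σ) 2 σ) (h : IsGoodWidth S Γ c σ) (hσ : 0 < σ)
    (hσσ₀ : σ ≤ σ₀) {C : ℝ}
    (hbad : arcMeasure Γ (Γ \ innerPart S Γ σ) ≤ ENNReal.ofReal (C * σ))
    {w tr : E2 → E3} (hw1 : ∀ᵐ x ∂(volume.restrict S), ‖w x‖ = 1) (htr : IsTrace S Γ w tr) :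
    stripMean A S Γ N σ w ≤ c *
      ((eLpNorm (fun ξ => A (tr ξ) (g ξ)) 2 (arcMeasure Γ) +
        (ENNReal.ofReal σ * (2 * ∑ i, eLpNorm (weakPartial S i w) 2 (volume.restrict S) ^ 2))
          ^ (1 / 2 : ℝ)) ^ 2 + 4 * ENNReal.ofReal (C * σ)) := by
  have := isFiniteMeasure_restrict hS.isBounded
  have hPΓ : innerPart S Γ σ ⊆ Γ := innerPart_subset σ
  have hPm := measurableSet_innerPart (S := S) hΓ.measurableSet σ
  set P := innerPart S Γ σ with hP
  have hfin := h.finite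
  have hfinP := hfib.finite'
  have hR : Γ \ P ⊆ Γ := sdiff_subset
  have hfinR : IsFiniteMeasure (arcMeasure (Γ \ P)) :=
    isFiniteMeasure_of_le _ (arcMeasure_mono hR)
  have hsplit : fibreMeasure Γ σ = fibreMeasure P σ + fibreMeasure (Γ \ P) σ := by
    have h1 : arcMeasure Γ = arcMeasure P + arcMeasure (Γ \ P) := by
      rw [arcMeasure, arcMeasure, arcMeasure, ← Measure.restrict_union disjoint_sdiff_right
        (hΓ.measurableSet.diff hPm), union_sdiff_cancel hPΓ]
    rw [fibreMeasure, h1, Measure.add_prod]; rfl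
  have hdat := hN.ae_fibre_of_le h₀ hg hσσ₀ hPΓ
  have hgm : AEStronglyMeasurable g (arcMeasure P) :=
    hg.1.aestronglyMeasurable.mono_measure (arcMeasure_mono hPΓ)
  have htm : AEStronglyMeasurable tr (arcMeasure P) :=
    htr.2.1.aestronglyMeasurable.mono_measure (arcMeasure_mono hPΓ)
  have hq : Measure.QuasiMeasurePreserving (Prod.fst : E2 × ℝ → E2) (fibreMeasure P σ)
      (arcMeasure P) := Measure.quasiMeasurePreserving_fst
  have mg : AEStronglyMeasurable (fun x : E2 × ℝ => g x.1) (fibreMeasure P σ) :=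
    hgm.comp_quasiMeasurePreserving hq
  have mt : AEStronglyMeasurable (fun x : E2 × ℝ => tr x.1) (fibreMeasure P σ) :=
    htm.comp_quasiMeasurePreserving hq
  set f : E2 → ℝ≥0∞ := S.indicator fun z => ENNReal.ofReal (A (w z) (N z) ^ 2) with hf
  -- the good fibres
  have e1 : ∫⁻ x, f (stripMap S Γ x) ∂(fibreMeasure P σ) ≤ ENNReal.ofReal σ *
      (eLpNorm (fun ξ => A (tr ξ) (g ξ)) 2 (arcMeasure Γ) +
        (ENNReal.ofReal σ * (2 * ∑ i, eLpNorm (weakPartial S i w) 2 (volume.restrict S) ^ 2))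
          ^ (1 / 2 : ℝ)) ^ 2 := by
    have h1 : ∫⁻ x, f (stripMap S Γ x) ∂(fibreMeasure P σ) ≤
        eLpNorm (fun x : E2 × ℝ => A (w (stripMap S Γ x)) (g x.1)) 2 (fibreMeasure P σ) ^ 2 := by
      rw [sq_eLpNorm_penalty hA]
      refine lintegral_mono_ae ?_
      filter_upwards [hdat] with x hx
      rw [← hx.1]
      exact indicator_le_self _ _ _
    have h2 := hA.eLpNorm_le_add (hfib.memLp_comp htr.1.1).1 mt mg (hdat.mono fun x hx => hx.2)
    have h3 : eLpNorm (fun x => w (stripMap S Γ x) - tr x.1) 2 (fibreMeasure P σ) ≤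
        ENNReal.ofReal (√σ) * (ENNReal.ofReal σ *
          (2 * ∑ i, eLpNorm (weakPartial S i w) 2 (volume.restrict S) ^ 2)) ^ (1 / 2 : ℝ) := by
      refine le_ofReal_sqrt_mul hσ.le ?_
      rw [← mul_assoc, ← sq]
      exact hfib.sq_eLpNorm_sub_trace_le hS htr
    have h4 : eLpNorm (fun x : E2 × ℝ => A (tr x.1) (g x.1)) 2 (fibreMeasure P σ) ≤
        ENNReal.ofReal (√σ) * eLpNorm (fun ξ => A (tr ξ) (g ξ)) 2 (arcMeasure Γ) := by
      have h1 := sq_eLpNorm_fst σ (hA.aestronglyMeasurable htm hgm)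
      have h5 : eLpNorm (fun ξ => A (tr ξ) (g ξ)) 2 (arcMeasure P) ≤
          eLpNorm (fun ξ => A (tr ξ) (g ξ)) 2 (arcMeasure Γ) :=
        eLpNorm_mono_measure _ (arcMeasure_mono hPΓ)
      have h6 := le_ofReal_sqrt_mul hσ.le (h1.le.trans (mul_le_mul_right
        (pow_le_pow_left' h5 2) _))
      rwa [← ENNReal.rpow_natCast, ← ENNReal.rpow_mul, Nat.cast_ofNat,
        mul_one_div_cancel two_ne_zero, ENNReal.rpow_one] at h6
    refine h1.trans ?_
    calc eLpNorm (fun x : E2 × ℝ => A (w (stripMap S Γ x)) (g x.1)) 2 (fibreMeasure P σ) ^ 2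
        ≤ (ENNReal.ofReal (√σ) * (eLpNorm (fun ξ => A (tr ξ) (g ξ)) 2 (arcMeasure Γ) +
        (ENNReal.ofReal σ * (2 * ∑ i, eLpNorm (weakPartial S i w) 2 (volume.restrict S) ^ 2))
          ^ (1 / 2 : ℝ))) ^ 2 := by
          refine pow_le_pow_left' ?_ 2
          rw [mul_add]
          exact h2.trans (add_le_add h4 h3)
      _ = _ := by rw [mul_pow, ← ENNReal.ofReal_pow (Real.sqrt_nonneg _), Real.sq_sqrt hσ.le]
  -- the remaining fibres
  have e2 : ∫⁻ x, f (stripMap S Γ x) ∂(fibreMeasure (Γ \ P) σ) ≤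
      ENNReal.ofReal σ * (4 * ENNReal.ofReal (C * σ)) := by
    have h1 : ∀ᵐ z ∂(volume.restrict (strip S Γ σ)), z ∈ S → ‖w z‖ = 1 := by
      have := (ae_restrict_iff' hS.isOpen.measurableSet).1 hw1
      exact ae_restrict_of_ae this
    have h2 : ∀ᵐ x ∂(fibreMeasure (Γ \ P) σ), stripMap S Γ x ∈ S → ‖w (stripMap S Γ x)‖ = 1 :=
      (fibreMeasure_mono hR le_rfl).absolutelyContinuous.ae_le (h.quasiMeasurePreserving.ae h1)
    have h3 : ∫⁻ x, f (stripMap S Γ x) ∂(fibreMeasure (Γ \ P) σ) ≤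
        ∫⁻ _, 4 ∂(fibreMeasure (Γ \ P) σ) := by
      refine lintegral_mono_ae ?_
      filter_upwards [h2, hN.ae_fibre_of_le h₀ hg hσσ₀ hR] with x hx hgx
      by_cases hxS : stripMap S Γ x ∈ S
      · rw [hf, indicator_of_mem hxS, hgx.1]
        have h4 := hA.le_two _ _ (hx hxS) hgx.2
        have h5 := hA.nonneg (w (stripMap S Γ x)) (g x.1)
        refine (ENNReal.ofReal_le_ofReal (show _ ≤ (4 : ℝ) by nlinarith)).trans_eq (by simp)
      · rw [hf, indicator_of_notMem hxS]; exact bot_le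
    refine h3.trans ?_
    rw [lintegral_const, fibreMeasure, ← univ_prod_univ, Measure.prod_prod,
      Measure.restrict_apply_univ, Real.volume_Ioo, sub_zero]
    have h4 : arcMeasure (Γ \ P) univ ≤ ENNReal.ofReal (C * σ) := by
      refine le_trans (le_of_eq ?_) hbad
      rw [arcMeasure, arcMeasure, Measure.restrict_apply_univ,
        Measure.restrict_apply (hΓ.measurableSet.diff hPm), inter_eq_left.2 hR]
    rw [mul_comm (arcMeasure _ _), mul_left_comm]
    exact mul_le_mul_right (mul_le_mul_right h4 _) _
  have e3 : ∫⁻ x in S ∩ strip S Γ σ, ENNReal.ofReal (A (w x) (N x) ^ 2) ≤ c *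
      ∫⁻ x, f (stripMap S Γ x) ∂(fibreMeasure Γ σ) := by
    calc ∫⁻ x in S ∩ strip S Γ σ, ENNReal.ofReal (A (w x) (N x) ^ 2)
        = ∫⁻ x in strip S Γ σ, f x := by
          rw [hf, lintegral_indicator hS.isOpen.measurableSet,
            Measure.restrict_restrict hS.isOpen.measurableSet]
      _ ≤ ∫⁻ x, f x ∂(c • (fibreMeasure Γ σ).map (stripMap S Γ)) := lintegral_mono' h.le_map le_rfl
      _ ≤ c * ∫⁻ x, f (stripMap S Γ x) ∂(fibreMeasure Γ σ) := by
          rw [lintegral_smul_measure, smul_eq_mul]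
          exact mul_le_mul_right (lintegral_map_le _ _) _
  rw [hsplit, lintegral_add_measure] at e3
  have e4 := e3.trans (mul_le_mul_right (add_le_add e1 e2) c)
  rw [← mul_add, mul_left_comm] at e4
  have e5 := mul_le_mul_right e4 (ENNReal.ofReal (1 / σ))
  rwa [← mul_assoc (ENNReal.ofReal (1 / σ)) (ENNReal.ofReal σ),
    ← ENNReal.ofReal_mul (by positivity), one_div_mul_cancel hσ.ne', ENNReal.ofReal_one,
    one_mul] at e5

end Steps

/-! ### Limits of the strip anchorings -/

/-- For all small widths the strip is comparable to the product of `Γ` with an interval, with a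
constant close to one, and the fibres over the inner part of `Γ` run in `S`. -/
lemma exists_width_isGoodWidth {S Γ : Set E2} (hS : IsBoundedLipschitzDomain S)
    (hΓ : IsRegularBoundaryPart S Γ) {ε : ℝ} (hε : 0 < ε) :
    ∃ ρ > (0 : ℝ), ∀ σ ≤ ρ, IsGoodWidth S Γ (ENNReal.ofReal (1 + ε)) σ ∧
      IsFibred S Γ (innerPart S Γ σ) 2 σ ∧
      ∀ ξ ∈ innerPart S Γ σ, ∀ s ∈ Ioo 0 σ, stripMap S Γ (ξ, s) ∈ S := by
  obtain ⟨L, δ, H⟩ := exists_hasSmoothNormal hS hΓ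
  obtain ⟨ρ, hρ, h⟩ := H.exists_isGoodWidth
    ((hΓ.isCompact_closure hS).isBounded.subset subset_closure) hΓ.measurableSet hε
  obtain ⟨d₀, hd₀, hf⟩ := exists_isFibred hS hΓ
  have hL := H.L_pos
  refine ⟨min (min ρ d₀) (min δ (1 / L)), lt_min (lt_min hρ hd₀)
    (lt_min H.δ_pos (by positivity)), fun σ hσ => ⟨?_, ?_, ?_⟩⟩
  · exact h σ (hσ.trans ((min_le_left _ _).trans (min_le_left _ _)))
  · exact hf σ (hσ.trans ((min_le_left _ _).trans (min_le_right _ _)))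
  · exact fun ξ hξ s hs => H.mem_of_innerPart hS.isOpen (hσ.trans (min_le_right _ _)) hξ hs

lemma le_of_forall_one_add_mul_le {a b : ℝ≥0∞}
    (h : ∀ ε : ℝ, 0 < ε → a ≤ ENNReal.ofReal (1 + ε) * b) : a ≤ b := by
  have h1 : Tendsto (fun ε : ℝ => ENNReal.ofReal (1 + ε) * b) (𝓝[>] 0)
      (𝓝 (ENNReal.ofReal (1 + 0) * b)) := by
    refine ENNReal.Tendsto.mul_const (ENNReal.tendsto_ofReal ?_) (Or.inl (by simp))
    exact (Continuous.tendsto (by fun_prop : Continuous fun ε : ℝ => 1 + ε) 0).mono_left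
      nhdsWithin_le_nhds
  have h2 := ge_of_tendsto h1 (by
    filter_upwards [self_mem_nhdsWithin] with ε hε using h ε hε)
  simpa using h2

section Limits

variable {S Γ : Set E2} {A : E3 → E3 → ℝ} {g N : E2 → E3} {c₀ : ℝ≥0∞} {σ₀ : ℝ} {σ : ℕ → ℝ}

lemma tendsto_ofReal_of_tendsto_nhdsGT (hσ : Tendsto σ atTop (𝓝[>] 0)) (C : ℝ) :
    Tendsto (fun k => ENNReal.ofReal (C * σ k)) atTop (𝓝 0) := by
  have h := ENNReal.tendsto_ofReal ((tendsto_nhds_of_tendsto_nhdsWithin hσ).const_mul C)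
  simpa using h

lemma tendsto_mul_rpow_half (hσ : Tendsto σ atTop (𝓝[>] 0)) {B : ℝ≥0∞} (hB : B ≠ ⊤) :
    Tendsto (fun k => (ENNReal.ofReal (σ k) * B) ^ (1 / 2 : ℝ)) atTop (𝓝 0) := by
  have h1 := ENNReal.Tendsto.mul_const (tendsto_ofReal_of_tendsto_nhdsGT hσ 1) (Or.inr hB)
  have h2 := (ENNReal.continuous_rpow_const (y := 1 / 2)).tendsto _ |>.comp h1
  simpa [Function.comp_def] using h2

lemma tendsto_lintegral_innerPart (hΓ : IsRegularBoundaryPart S Γ) (f : E2 → ℝ≥0∞) :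
    Tendsto (fun n : ℕ => ∫⁻ ξ, f ξ ∂(arcMeasure (innerPart S Γ (1 / ((n : ℝ) + 1))))) atTop
      (𝓝 (∫⁻ ξ, f ξ ∂(arcMeasure Γ))) := by
  have hm : Monotone fun n : ℕ => innerPart S Γ (1 / ((n : ℝ) + 1)) := fun m n h =>
    innerPart_anti (one_div_le_one_div_of_le (by positivity) (by gcongr))
  have h1 : ∫⁻ ξ, f ξ ∂(arcMeasure Γ) =
      ⨆ n : ℕ, ∫⁻ ξ, f ξ ∂(arcMeasure (innerPart S Γ (1 / ((n : ℝ) + 1)))) := by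
    have h2 := setLIntegral_iUnion_of_directed (μ := (μH[1] : Measure E2)) f hm.directed_le
    rwa [iUnion_innerPart hΓ] at h2
  rw [h1]
  exact tendsto_atTop_iSup fun m n h => lintegral_mono' (arcMeasure_mono (hm h)) le_rfl

lemma HasWeakGrad.sum_sq_ne_top {w : E2 → E3} {v : Fin 2 → E2 → E3} (hw : HasWeakGrad S w v) :
    2 * ∑ i, eLpNorm (weakPartial S i w) 2 (volume.restrict S) ^ 2 ≠ ⊤ :=
  ENNReal.mul_ne_top ENNReal.ofNat_ne_top (ENNReal.sum_ne_top.2 fun i _ =>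
    ENNReal.pow_ne_top (hw.memH1.hasWeakGrad.memLp_grad i).2.ne)

/-- If the strip means of a sequence bounded in `H¹` are bounded by `c`, then so is the boundary
penalty of the limit. For fixed `d`, the length of the fibres on which the functions are compared,
the error terms tend to zero up to a term of order `d`. -/
lemma lintegral_trace_le_of_stripMean_le (hS : IsBoundedLipschitzDomain S)
    (hΓ : IsRegularBoundaryPart S Γ) (hA : IsPenalty A) (hσ₀ : 0 < σ₀)
    (h₀ : IsGoodWidth S Γ c₀ σ₀) (hg : MemL2Sphere Γ g) (hN : IsCanonicalExtension S Γ σ₀ g N)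
    (hσ : Tendsto σ atTop (𝓝[>] 0)) {w : ℕ → E2 → E3} {v : ℕ → Fin 2 → E2 → E3} {w₀ tr : E2 → E3}
    {v₀ : Fin 2 → E2 → E3} (hw : ∀ k, HasWeakGrad S (w k) (v k)) (hw₀ : HasWeakGrad S w₀ v₀)
    (htr : IsTrace S Γ w₀ tr)
    (hlim : Tendsto (fun k => eLpNorm (fun x => w k x - w₀ x) 2 (volume.restrict S)) atTop (𝓝 0))
    {K : ℝ} (hK : ∀ k i, eLpNorm (v k i) 2 (volume.restrict S) ≤ ENNReal.ofReal K) {c : ℝ≥0∞}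
    (hc : ∀ k, stripMean A S Γ N (σ k) (w k) ≤ c) :
    ∫⁻ ξ, ENNReal.ofReal (A (tr ξ) (g ξ) ^ 2) ∂(arcMeasure Γ) ≤ c := by
  refine le_of_forall_one_add_mul_le fun ε hε => ?_
  obtain ⟨ρ, hρ, h⟩ := exists_width_isGoodWidth hS hΓ hε
  set B := 2 * ∑ i, eLpNorm (weakPartial S i w₀) 2 (volume.restrict S) ^ 2 with hB
  set M := ∑ i : Fin 2, (ENNReal.ofReal K + eLpNorm (v₀ i) 2 (volume.restrict S)) ^ 2 with hM
  have hMt : M ≠ ⊤ := ENNReal.sum_ne_top.2 fun i _ => ENNReal.pow_ne_top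
    (ENNReal.add_ne_top.2 ⟨ENNReal.ofReal_ne_top, (hw₀.memLp_grad i).2.ne⟩)
  have hMv : ∀ k, ∑ i, eLpNorm (fun x => v k i x - v₀ i x) 2 (volume.restrict S) ^ 2 ≤ M :=
    fun k => Finset.sum_le_sum fun i _ => pow_le_pow_left' ((eLpNorm_sub_le
      ((hw k).memLp_grad i).1 (hw₀.memLp_grad i).1 one_le_two).trans (add_le_add (hK k i) le_rfl)) 2
  set a := (ENNReal.ofReal (1 + ε) * c) ^ (1 / 2 : ℝ) with ha
  have hsmall : ∀ {τ : ℝ}, 0 < τ → ∀ᶠ k in atTop, 0 < σ k ∧ σ k < τ := fun {τ} hτ => by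
    filter_upwards [hσ (Ioo_mem_nhdsGT hτ)] with k hk using hk
  -- the limit `k → ∞`
  have key : ∀ d : ℝ, 0 < d → d ≤ ρ →
      eLpNorm (fun ξ => A (tr ξ) (g ξ)) 2 (arcMeasure (innerPart S Γ d)) ≤
        a + (ENNReal.ofReal d * (4 * M)) ^ (1 / 2 : ℝ) := by
    intro d hd hdρ
    have e : Tendsto (fun k => a + (ENNReal.ofReal (1 / d) * (2 * (2 *
        eLpNorm (fun x => w k x - w₀ x) 2 (volume.restrict S) ^ 2 +
        2 * ENNReal.ofReal d ^ 2 * M))) ^ (1 / 2 : ℝ) +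
        (ENNReal.ofReal (σ k) * B) ^ (1 / 2 : ℝ)) atTop
        (𝓝 (a + (ENNReal.ofReal (1 / d) * (2 * (2 * 0 ^ 2 + 2 * ENNReal.ofReal d ^ 2 * M))) ^
          (1 / 2 : ℝ) + 0)) := by
      refine (tendsto_const_nhds.add ?_).add (tendsto_mul_rpow_half hσ hw₀.sum_sq_ne_top)
      refine (ENNReal.continuous_rpow_const.tendsto _).comp ?_
      refine ENNReal.Tendsto.const_mul (ENNReal.Tendsto.const_mul (Tendsto.add
        (ENNReal.Tendsto.const_mul (ENNReal.Tendsto.pow hlim) (Or.inr ENNReal.ofNat_ne_top))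
        tendsto_const_nhds) (Or.inr ENNReal.ofNat_ne_top)) (Or.inr ENNReal.ofReal_ne_top)
    have e1 : ENNReal.ofReal (1 / d) * (2 * (2 * 0 ^ 2 + 2 * ENNReal.ofReal d ^ 2 * M)) =
        ENNReal.ofReal d * (4 * M) := by
      have e2 : ENNReal.ofReal (1 / d) * ENNReal.ofReal d = 1 := by
        rw [← ENNReal.ofReal_mul (by positivity), one_div_mul_cancel hd.ne', ENNReal.ofReal_one]
      calc ENNReal.ofReal (1 / d) * (2 * (2 * 0 ^ 2 + 2 * ENNReal.ofReal d ^ 2 * M))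
          = (ENNReal.ofReal (1 / d) * ENNReal.ofReal d) * (ENNReal.ofReal d * (4 * M)) := by ring
        _ = _ := by rw [e2, one_mul]
    rw [e1, add_zero] at e
    refine ge_of_tendsto e ?_
    filter_upwards [hsmall hd, hsmall hσ₀] with k hk hk₀
    have e3 := eLpNorm_trace_le hS hΓ hA h₀ hg hN (h d hdρ).2.1 (h (σ k) (hk.2.le.trans hdρ)).1
      hk.1 hk.2.le hk₀.2.le (fun ξ hξ s hs => (h d hdρ).2.2 ξ hξ s ⟨hs.1, hs.2.trans hk.2⟩)
      (hw k) hw₀ htr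
    refine e3.trans ?_
    gcongr
    · exact ENNReal.rpow_le_rpow (mul_le_mul_right (hc k) _) (by norm_num)
    · exact hMv k
  -- the limit `d → 0`
  have hd : Tendsto (fun n : ℕ => 1 / ((n : ℝ) + 1)) atTop (𝓝[>] 0) :=
    tendsto_nhdsWithin_iff.2 ⟨tendsto_one_div_add_atTop_nhds_zero_nat,
      Eventually.of_forall fun n => by simp only [mem_Ioi]; positivity⟩
  have h2 : Tendsto (fun n : ℕ => (a + (ENNReal.ofReal (1 / ((n : ℝ) + 1)) * (4 * M)) ^
      (1 / 2 : ℝ)) ^ 2) atTop (𝓝 ((a + 0) ^ 2)) :=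
    ENNReal.Tendsto.pow (tendsto_const_nhds.add (tendsto_mul_rpow_half hd
      (ENNReal.mul_ne_top ENNReal.ofNat_ne_top hMt)))
  have h3 : (a + 0) ^ 2 = ENNReal.ofReal (1 + ε) * c := by
    rw [add_zero, ha, ← ENNReal.rpow_natCast, ← ENNReal.rpow_mul, Nat.cast_ofNat,
      one_div_mul_cancel two_ne_zero, ENNReal.rpow_one]
  rw [h3] at h2
  refine le_of_tendsto_of_tendsto (tendsto_lintegral_innerPart hΓ _) h2 ?_
  filter_upwards [hd (Ioo_mem_nhdsGT hρ)] with n hn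
  rw [← sq_eLpNorm_penalty hA]
  exact pow_le_pow_left' (key _ hn.1 hn.2.le) 2

/-- The boundary penalty is lower semicontinuous along the strip means. -/
lemma lintegral_trace_le_liminf (hS : IsBoundedLipschitzDomain S)
    (hΓ : IsRegularBoundaryPart S Γ) (hA : IsPenalty A) (hσ₀ : 0 < σ₀)
    (h₀ : IsGoodWidth S Γ c₀ σ₀) (hg : MemL2Sphere Γ g) (hN : IsCanonicalExtension S Γ σ₀ g N)
    (hσ : Tendsto σ atTop (𝓝[>] 0)) {w : ℕ → E2 → E3} {v : ℕ → Fin 2 → E2 → E3} {w₀ tr : E2 → E3}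
    {v₀ : Fin 2 → E2 → E3} (hw : ∀ k, HasWeakGrad S (w k) (v k)) (hw₀ : HasWeakGrad S w₀ v₀)
    (htr : IsTrace S Γ w₀ tr)
    (hlim : Tendsto (fun k => eLpNorm (fun x => w k x - w₀ x) 2 (volume.restrict S)) atTop (𝓝 0))
    {K : ℝ} (hK : ∀ k i, eLpNorm (v k i) 2 (volume.restrict S) ≤ ENNReal.ofReal K) :
    ∫⁻ ξ, ENNReal.ofReal (A (tr ξ) (g ξ) ^ 2) ∂(arcMeasure Γ) ≤
      liminf (fun k => stripMean A S Γ N (σ k) (w k)) atTop := by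
  refine le_of_forall_gt_imp_ge_of_dense fun c hc => ?_
  obtain ⟨θ, hθ, hle⟩ := extraction_of_frequently_atTop
    (frequently_lt_of_liminf_lt (by isBoundedDefault) hc)
  exact lintegral_trace_le_of_stripMean_le hS hΓ hA hσ₀ h₀ hg hN (hσ.comp hθ.tendsto_atTop)
    (fun k => hw (θ k)) hw₀ htr (hlim.comp hθ.tendsto_atTop) (fun k => hK (θ k))
    fun k => (hle k).le

/-- If the strip means, multiplied by a weight that blows up, do not tend to infinity, then the
boundary penalty of the limit vanishes. -/
lemma lintegral_trace_eq_zero_of_liminf_lt_top (hS : IsBoundedLipschitzDomain S)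
    (hΓ : IsRegularBoundaryPart S Γ) (hA : IsPenalty A) (hσ₀ : 0 < σ₀)
    (h₀ : IsGoodWidth S Γ c₀ σ₀) (hg : MemL2Sphere Γ g) (hN : IsCanonicalExtension S Γ σ₀ g N)
    (hσ : Tendsto σ atTop (𝓝[>] 0)) {w : ℕ → E2 → E3} {v : ℕ → Fin 2 → E2 → E3} {w₀ tr : E2 → E3}
    {v₀ : Fin 2 → E2 → E3} (hw : ∀ k, HasWeakGrad S (w k) (v k)) (hw₀ : HasWeakGrad S w₀ v₀)
    (htr : IsTrace S Γ w₀ tr)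
    (hlim : Tendsto (fun k => eLpNorm (fun x => w k x - w₀ x) 2 (volume.restrict S)) atTop (𝓝 0))
    {K : ℝ} (hK : ∀ k i, eLpNorm (v k i) 2 (volume.restrict S) ≤ ENNReal.ofReal K) {β : ℝ}
    (hβ : 0 < β) (hfin : liminf (fun k => ENNReal.ofReal (σ k ^ (-β)) *
      stripMean A S Γ N (σ k) (w k)) atTop < ⊤) :
    ∫⁻ ξ, ENNReal.ofReal (A (tr ξ) (g ξ) ^ 2) ∂(arcMeasure Γ) = 0 := by
  obtain ⟨c, hc, hct⟩ := exists_between hfin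
  obtain ⟨θ, hθ, hle⟩ := extraction_of_frequently_atTop
    (frequently_lt_of_liminf_lt (by isBoundedDefault) hc)
  have hσθ := hσ.comp hθ.tendsto_atTop
  have h1 := lintegral_trace_le_liminf hS hΓ hA hσ₀ h₀ hg hN hσθ (fun k => hw (θ k)) hw₀ htr
    (hlim.comp hθ.tendsto_atTop) (fun k => hK (θ k))
  have h2 : Tendsto (fun k => ENNReal.ofReal (σ (θ k) ^ β) * c) atTop (𝓝 0) := by
    have h3 := (Real.continuousAt_rpow_const 0 β (Or.inr hβ.le)).tendsto.comp
      (tendsto_nhds_of_tendsto_nhdsWithin hσθ)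
    have h4 := ENNReal.Tendsto.mul_const (ENNReal.tendsto_ofReal h3) (Or.inr hct.ne)
    simpa [Function.comp_def, Real.zero_rpow hβ.ne'] using h4
  have h5 : Tendsto (fun k => stripMean A S Γ N (σ (θ k)) (w (θ k))) atTop (𝓝 0) := by
    refine tendsto_of_tendsto_of_tendsto_of_le_of_le' tendsto_const_nhds h2
      (Eventually.of_forall fun _ => bot_le) ?_
    filter_upwards [hσθ self_mem_nhdsWithin] with k hk
    have hk : 0 < σ (θ k) := hk
    have h6 := mul_le_mul_right (hle k).le (ENNReal.ofReal (σ (θ k) ^ β))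
    rwa [← mul_assoc, ← ENNReal.ofReal_mul (by positivity), ← Real.rpow_add hk, add_neg_cancel,
      Real.rpow_zero, ENNReal.ofReal_one, one_mul] at h6
  refine le_antisymm (h1.trans_eq ?_) bot_le
  exact h5.liminf_eq

/-- The strip means of a fixed unit field do not exceed the boundary penalty in the limit. -/
lemma limsup_stripMean_le (hS : IsBoundedLipschitzDomain S)
    (hΓ : IsRegularBoundaryPart S Γ) (hA : IsPenalty A) (hσ₀ : 0 < σ₀)
    (h₀ : IsGoodWidth S Γ c₀ σ₀) (hg : MemL2Sphere Γ g) (hN : IsCanonicalExtension S Γ σ₀ g N)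
    (hσ : Tendsto σ atTop (𝓝[>] 0)) {w tr : E2 → E3} {v : Fin 2 → E2 → E3}
    (hw : HasWeakGrad S w v) (hw1 : ∀ᵐ x ∂(volume.restrict S), ‖w x‖ = 1)
    (htr : IsTrace S Γ w tr) :
    limsup (fun k => stripMean A S Γ N (σ k) w) atTop ≤
      ∫⁻ ξ, ENNReal.ofReal (A (tr ξ) (g ξ) ^ 2) ∂(arcMeasure Γ) := by
  refine le_of_forall_one_add_mul_le fun ε hε => ?_
  obtain ⟨ρ, hρ, h⟩ := exists_width_isGoodWidth hS hΓ hε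
  obtain ⟨C, τ, -, hτ, hbad⟩ := exists_measure_diff_innerPart_le hS hΓ
  rw [← sq_eLpNorm_penalty hA]
  set T := eLpNorm (fun ξ => A (tr ξ) (g ξ)) 2 (arcMeasure Γ)
  have h1 : Tendsto (fun k => ENNReal.ofReal (1 + ε) * ((T + (ENNReal.ofReal (σ k) *
      (2 * ∑ i, eLpNorm (weakPartial S i w) 2 (volume.restrict S) ^ 2)) ^ (1 / 2 : ℝ)) ^ 2 +
      4 * ENNReal.ofReal (C * σ k))) atTop
      (𝓝 (ENNReal.ofReal (1 + ε) * ((T + 0) ^ 2 + 4 * 0))) :=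
    ENNReal.Tendsto.const_mul ((ENNReal.Tendsto.pow (tendsto_const_nhds.add
      (tendsto_mul_rpow_half hσ hw.sum_sq_ne_top))).add (ENNReal.Tendsto.const_mul
      (tendsto_ofReal_of_tendsto_nhdsGT hσ C) (Or.inr ENNReal.ofNat_ne_top)))
      (Or.inr ENNReal.ofReal_ne_top)
  rw [add_zero, mul_zero, add_zero] at h1
  rw [← h1.limsup_eq]
  refine limsup_le_limsup ?_
  filter_upwards [hσ (Ioo_mem_nhdsGT (lt_min (lt_min hρ hτ) hσ₀))] with k hk
  have hkρ := hk.2.le.trans ((min_le_left _ _).trans (min_le_left _ _))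
  exact stripMean_le hS hΓ hA h₀ hg hN (h _ hkρ).2.1 (h _ hkρ).1 hk.1
    (hk.2.le.trans (min_le_right _ _))
    (hbad _ hk.1 (hk.2.le.trans ((min_le_left _ _).trans (min_le_right _ _)))) hw1 htr

/-- If the boundary penalty vanishes then the strip means are of order `σ`, since the trace is
attained at rate `√σ` in `L²`. -/
lemma tendsto_mul_stripMean_zero (hS : IsBoundedLipschitzDomain S)
    (hΓ : IsRegularBoundaryPart S Γ) (hA : IsPenalty A) (hσ₀ : 0 < σ₀)
    (h₀ : IsGoodWidth S Γ c₀ σ₀) (hg : MemL2Sphere Γ g) (hN : IsCanonicalExtension S Γ σ₀ g N)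
    (hσ : Tendsto σ atTop (𝓝[>] 0)) {w tr : E2 → E3} {v : Fin 2 → E2 → E3}
    (hw : HasWeakGrad S w v) (hw1 : ∀ᵐ x ∂(volume.restrict S), ‖w x‖ = 1)
    (htr : IsTrace S Γ w tr) {β : ℝ} (hβ : β < 1)
    (hzero : ∫⁻ ξ, ENNReal.ofReal (A (tr ξ) (g ξ) ^ 2) ∂(arcMeasure Γ) = 0) :
    Tendsto (fun k => ENNReal.ofReal (σ k ^ (-β)) * stripMean A S Γ N (σ k) w) atTop (𝓝 0) := by
  obtain ⟨ρ, hρ, h⟩ := exists_width_isGoodWidth hS hΓ one_pos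
  obtain ⟨C, τ, hC, hτ, hbad⟩ := exists_measure_diff_innerPart_le hS hΓ
  rw [← sq_eLpNorm_penalty hA, pow_eq_zero_iff two_ne_zero] at hzero
  set B := 2 * ∑ i, eLpNorm (weakPartial S i w) 2 (volume.restrict S) ^ 2 with hB
  set K := ENNReal.ofReal (1 + 1) * (B + 4 * ENNReal.ofReal C) with hKdef
  have hK : K ≠ ⊤ := ENNReal.mul_ne_top ENNReal.ofReal_ne_top (ENNReal.add_ne_top.2
    ⟨hw.sum_sq_ne_top, ENNReal.mul_ne_top ENNReal.ofNat_ne_top ENNReal.ofReal_ne_top⟩)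
  have h2 : Tendsto (fun k => ENNReal.ofReal (σ k ^ (1 - β)) * K) atTop (𝓝 0) := by
    have h3 := (Real.continuousAt_rpow_const 0 (1 - β) (Or.inr (by linarith))).tendsto.comp
      (tendsto_nhds_of_tendsto_nhdsWithin hσ)
    have h4 := ENNReal.Tendsto.mul_const (ENNReal.tendsto_ofReal h3) (Or.inr hK)
    simpa [Function.comp_def, Real.zero_rpow (sub_pos.2 hβ).ne'] using h4
  refine tendsto_of_tendsto_of_tendsto_of_le_of_le' tendsto_const_nhds h2
    (Eventually.of_forall fun _ => bot_le) ?_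
  filter_upwards [hσ (Ioo_mem_nhdsGT (lt_min (lt_min hρ hτ) hσ₀))] with k hk
  have hkρ := hk.2.le.trans ((min_le_left _ _).trans (min_le_left _ _))
  have h5 := stripMean_le hS hΓ hA h₀ hg hN (h _ hkρ).2.1 (h _ hkρ).1 hk.1
    (hk.2.le.trans (min_le_right _ _))
    (hbad _ hk.1 (hk.2.le.trans ((min_le_left _ _).trans (min_le_right _ _)))) hw1 htr
  rw [hzero, zero_add, ← ENNReal.rpow_natCast, ← ENNReal.rpow_mul, Nat.cast_ofNat,
    one_div_mul_cancel two_ne_zero, ENNReal.rpow_one, ENNReal.ofReal_mul hC.le] at h5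
  have h6 : stripMean A S Γ N (σ k) w ≤ ENNReal.ofReal (σ k) * K :=
    h5.trans_eq (by rw [hKdef]; ring)
  refine (mul_le_mul_right h6 _).trans_eq ?_
  have hk0 := hk.1
  rw [← mul_assoc, ← ENNReal.ofReal_mul (by positivity), ← Real.rpow_add_one hk0.ne',
    neg_add_eq_sub]

end Limits

/-! ### Gamma-convergence of the anchored energies -/

section Gamma

variable {S Γ : Set E2} {W : ℝ → M3 → ℝ≥0∞} {Q : ℝ → QuadraticForm ℝ M3} {C q : ℝ} {r : ℝ≥0 → ℝ≥0∞}

/-- Functionals of the local director may be added to the plate energy in a `Γ`-limit if the lower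
bound holds along sequences of directors that are bounded in `H¹` and the upper bound holds for
constant sequences: bounded energy gives exactly this compactness of the directors. -/
theorem gammaConverges_of_director (hW : StoredEnergy W Q C q r)
    (hS : IsBoundedLipschitzDomain S) (rbar : ℝ) {ebar : ℝ} (he : 0 < ebar)
    {Φ : ℝ → (E2 → E3) → ℝ≥0∞} {Φ₀ : (E2 → E3) → ℝ≥0∞}
    (hlow : ∀ (σ : ℕ → ℝ), Tendsto σ atTop (𝓝[>] 0) → ∀ (w : ℕ → E2 → E3)
      (v : ℕ → Fin 2 → E2 → E3) (w₀ : E2 → E3) (v₀ : Fin 2 → E2 → E3) (K : ℝ),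
      (∀ k, HasWeakGrad S (w k) (v k)) → HasWeakGrad S w₀ v₀ →
      (∀ᵐ x ∂(volume.restrict S), ‖w₀ x‖ = 1) →
      Tendsto (fun k => eLpNorm (fun x => w k x - w₀ x) 2 (volume.restrict S)) atTop (𝓝 0) →
      (∀ k i, eLpNorm (v k i) 2 (volume.restrict S) ≤ ENNReal.ofReal K) →
      Φ₀ w₀ ≤ liminf (fun k => Φ (σ k) (w k)) atTop)
    (hup : ∀ (σ : ℕ → ℝ), Tendsto σ atTop (𝓝[>] 0) → ∀ (w : E2 → E3) (v : Fin 2 → E2 → E3),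
      HasWeakGrad S w v → (∀ᵐ x ∂(volume.restrict S), ‖w x‖ = 1) →
      limsup (fun k => Φ (σ k) w) atTop ≤ Φ₀ w) :
    GammaConverges
      (fun σ p => plateEnergy Q rbar ebar S p +
        extendTop S (fun y n => Φ σ (localDirector S y n)) p)
      (fun p => plateEnergy Q rbar ebar S p +
        extendTop S (fun y n => Φ₀ (localDirector S y n)) p) := by
  refine fun σ hσ => ⟨fun p₀ p hp => ?_, fun p => ⟨fun _ => p, tendsto_const_nhds, ?_⟩⟩
  · refine le_of_forall_gt_imp_ge_of_dense fun c hc => ?_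
    rcases eq_or_ne c ⊤ with rfl | hct
    · exact le_top
    obtain ⟨φ, hφ, hle⟩ := extraction_of_frequently_atTop
      (frequently_lt_of_liminf_lt (by isBoundedDefault) hc)
    have hleE : ∀ k, plateEnergy Q rbar ebar S (p (φ k)) ≤ c := fun k =>
      le_self_add.trans (hle k).le
    have hA : ∀ k, MemA2 S (p (φ k)).1 (p (φ k)).2 := fun k =>
      memA2_of_plateEnergy_ne_top (ne_top_of_le_ne_top hct (hleE k))
    obtain ⟨hA₀, θ, hθ, hlim, ⟨K, hK⟩, hE⟩ := exists_subseq_plateEnergy_le_liminf hW hS rbar he hct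
      (hp.comp hφ.tendsto_atTop) hleE
    have hΦ := hlow (fun k => σ (φ (θ k))) (hσ.comp (hφ.comp hθ).tendsto_atTop) _ _ _ _ K
      (fun k => (hA (θ k)).hasWeakGrad_localDirector hS) (hA₀.hasWeakGrad_localDirector hS)
      hA₀.norm_localDirector hlim hK
    simp only [extendTop, if_pos hA₀]
    refine (add_le_liminf_add hE hΦ).trans
      (liminf_le_of_frequently_le' (Eventually.of_forall fun k => ?_).frequently)
    have h1 := (hle (θ k)).le
    simp only [extendTop, if_pos (hA (θ k))] at h1
    exact h1
  · by_cases hA : MemA2 S p.1 p.2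
    · simp only [extendTop, if_pos hA]
      rw [limsup_const_add atTop _ _ (by isBoundedDefault) (by isBoundedDefault)]
      exact add_le_add le_rfl (hup σ hσ _ _ (hA.hasWeakGrad_localDirector hS) hA.norm_localDirector)
    · simp only [extendTop, if_neg hA, add_top]
      exact le_top

variable {A : E3 → E3 → ℝ} {g N : E2 → E3} {c₀ : ℝ≥0∞} {σ₀ : ℝ}

lemma HasWeakGrad.isTrace_traceOn (hS : IsBoundedLipschitzDomain S)
    (hΓ : IsRegularBoundaryPart S Γ) {w : E2 → E3} {v : Fin 2 → E2 → E3} (hw : HasWeakGrad S w v)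
    (hw1 : ∀ᵐ x ∂(volume.restrict S), ‖w x‖ = 1) : IsTrace S Γ w (traceOn S Γ w) :=
  LCEPlate.isTrace_traceOn hS hΓ hw.memH1 zero_le_one (hw1.mono fun _ h => h.le)

/-- Strip anchorings of a fixed strength converge to the weak boundary anchoring. -/
theorem gammaConverges_weak (hW : StoredEnergy W Q C q r) (hS : IsBoundedLipschitzDomain S)
    (hΓ : IsRegularBoundaryPart S Γ) (rbar : ℝ) {ebar : ℝ} (he : 0 < ebar) (hA : IsPenalty A)
    (hσ₀ : 0 < σ₀) (h₀ : IsGoodWidth S Γ c₀ σ₀) (hg : MemL2Sphere Γ g)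
    (hN : IsCanonicalExtension S Γ σ₀ g N) :
    GammaConverges
      (fun σ p => plateEnergy Q rbar ebar S p +
        extendTop S (fun y n => stripMean A S Γ N σ (localDirector S y n)) p)
      (fun p => plateEnergy Q rbar ebar S p + extendTop S (fun y n =>
        ∫⁻ x, ENNReal.ofReal (A (traceOn S Γ (localDirector S y n) x) (g x) ^ 2)
          ∂(arcMeasure Γ)) p) :=
  gammaConverges_of_director hW hS rbar he (Φ := stripMean A S Γ N)
    (Φ₀ := fun w => ∫⁻ x, ENNReal.ofReal (A (traceOn S Γ w x) (g x) ^ 2) ∂(arcMeasure Γ))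
    (fun _ hσ _ _ _ _ _ hw hw₀ hw1 hlim hK => lintegral_trace_le_liminf hS hΓ hA hσ₀ h₀ hg hN hσ
      hw hw₀ (hw₀.isTrace_traceOn hS hΓ hw1) hlim hK)
    (fun _ hσ _ _ hw hw1 => limsup_stripMean_le hS hΓ hA hσ₀ h₀ hg hN hσ hw hw1
      (hw.isTrace_traceOn hS hΓ hw1))

/-- The boundary integral of the squared penalty vanishes only if the penalty does. -/
lemma lintegral_penalty_eq_zero_iff (hA : IsPenalty A) (hg : MemL2Sphere Γ g) {w tr : E2 → E3}
    (htr : IsTrace S Γ w tr) :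
    ∫⁻ x, ENNReal.ofReal (A (tr x) (g x) ^ 2) ∂(arcMeasure Γ) = 0 ↔
      ∀ᵐ x ∂(arcMeasure Γ), A (tr x) (g x) = 0 := by
  rw [lintegral_eq_zero_iff' ((hA.aestronglyMeasurable htr.2.1.1 hg.1.1).aemeasurable.pow_const
    2).ennreal_ofReal]
  refine eventually_congr (Eventually.of_forall fun x => ?_)
  rw [Pi.zero_apply, ENNReal.ofReal_eq_zero, sq_nonpos_iff]

open Classical in
/-- Strip anchorings of diverging strength `σ^(-β)` converge to the strong boundary anchoring. -/
theorem gammaConverges_strong (hW : StoredEnergy W Q C q r) (hS : IsBoundedLipschitzDomain S)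
    (hΓ : IsRegularBoundaryPart S Γ) (rbar : ℝ) {ebar : ℝ} (he : 0 < ebar) (hA : IsPenalty A)
    (hσ₀ : 0 < σ₀) (h₀ : IsGoodWidth S Γ c₀ σ₀) (hg : MemL2Sphere Γ g)
    (hN : IsCanonicalExtension S Γ σ₀ g N) {β : ℝ} (hβ : 0 < β) (hβ1 : β < 1) :
    GammaConverges
      (fun σ p => plateEnergy Q rbar ebar S p + extendTop S (fun y n =>
        ENNReal.ofReal (σ ^ (-β)) * stripMean A S Γ N σ (localDirector S y n)) p)
      (fun p => plateEnergy Q rbar ebar S p + extendTop S (fun y n =>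
        if ∀ᵐ x ∂(arcMeasure Γ), A (traceOn S Γ (localDirector S y n) x) (g x) = 0
          then 0 else ⊤) p) := by
  refine gammaConverges_of_director hW hS rbar he
    (Φ := fun σ w => ENNReal.ofReal (σ ^ (-β)) * stripMean A S Γ N σ w)
    (Φ₀ := fun w => if ∀ᵐ x ∂(arcMeasure Γ), A (traceOn S Γ w x) (g x) = 0 then 0 else ⊤)
    (fun σ hσ w v w₀ v₀ K hw hw₀ hw1 hlim hK => ?_) (fun σ hσ w v hw hw1 => ?_)
  · have htr := hw₀.isTrace_traceOn hS hΓ hw1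
    rcases eq_or_ne (liminf (fun k => ENNReal.ofReal (σ k ^ (-β)) *
      stripMean A S Γ N (σ k) (w k)) atTop) ⊤ with h | h
    · rw [h]; exact le_top
    rw [if_pos ((lintegral_penalty_eq_zero_iff hA hg htr).1
      (lintegral_trace_eq_zero_of_liminf_lt_top hS hΓ hA hσ₀ h₀ hg hN hσ hw hw₀ htr hlim hK hβ
        h.lt_top))]
    exact bot_le
  · have htr := hw.isTrace_traceOn hS hΓ hw1
    split_ifs with h
    · exact (tendsto_mul_stripMean_zero hS hΓ hA hσ₀ h₀ hg hN hσ hw hw1 htr hβ1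
        ((lintegral_penalty_eq_zero_iff hA hg htr).2 h)).limsup_eq.le
    · exact le_top

lemma mul_extendTop {a : ℝ≥0∞} (ha : a ≠ 0) (Φ : (E2 → E3) → (E2 → E3) → ℝ≥0∞) (p : State S) :
    a * extendTop S Φ p = extendTop S (fun y n => a * Φ y n) p := by
  unfold extendTop
  split_ifs
  · rfl
  · rw [ENNReal.mul_top ha]

/-- `Γ`-convergence only depends on the functionals at positive parameters. -/
lemma GammaConverges.congr {X : Type*} [TopologicalSpace X] {F F' : ℝ → X → ℝ≥0∞} {F₀ : X → ℝ≥0∞}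
    (h : GammaConverges F F₀) (hF : ∀ σ, 0 < σ → F σ = F' σ) : GammaConverges F' F₀ := by
  intro σ hσ
  have hpos : ∀ᶠ k in atTop, 0 < σ k := hσ self_mem_nhdsWithin
  obtain ⟨h1, h2⟩ := h σ hσ
  refine ⟨fun x u hu => (h1 x u hu).trans_eq (liminf_congr ?_), fun x => ?_⟩
  · filter_upwards [hpos] with k hk
    rw [hF _ hk]
  · obtain ⟨u, hu, hle⟩ := h2 x
    refine ⟨u, hu, le_of_eq_of_le (limsup_congr ?_) hle⟩
    filter_upwards [hpos] with k hk
    rw [hF _ hk]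

lemma stripG_eq (σ : ℝ) : stripG S Γ N σ =
    extendTop S fun y n => stripMean (fun w N => ‖w - N‖) S Γ N σ (localDirector S y n) := rfl

lemma stripH_eq (σ : ℝ) : stripH S Γ N σ =
    extendTop S fun y n => stripMean (fun w N => |⟪w, N⟫|) S Γ N σ (localDirector S y n) := rfl

open Classical in
lemma strongG_eq : strongG S Γ g = extendTop S fun y n =>
    if ∀ᵐ x ∂(arcMeasure Γ), ‖traceOn S Γ (localDirector S y n) x - g x‖ = 0 then 0 else ⊤ := by
  simp only [norm_eq_zero, sub_eq_zero]; rfl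

open Classical in
lemma strongH_eq : strongH S Γ g = extendTop S fun y n =>
    if ∀ᵐ x ∂(arcMeasure Γ), |⟪traceOn S Γ (localDirector S y n) x, g x⟫| = 0 then 0 else ⊤ := by
  simp only [abs_eq_zero]; rfl

end Gamma

end LCEPlate

theorem mainTheorem7 (S Γ : Set E2) (hS : IsBoundedLipschitzDomain S)
    (hΓ : IsRegularBoundaryPart S Γ) :
    ∃ σ₀ : ℝ, 0 < σ₀ ∧
      -- each datum has a unique canonical extension to the strip of width `σ₀`
      (∀ g : E2 → E3, MemL2Sphere Γ g →
        ∃ G : E2 → E3, IsCanonicalExtension S Γ σ₀ g G ∧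
          ∀ G' : E2 → E3, IsCanonicalExtension S Γ σ₀ g G' →
            G' =ᵐ[volume.restrict (strip S Γ σ₀)] G) ∧
      -- convergence of the anchored energies built with these extensions
      ∀ (W : ℝ → M3 → ℝ≥0∞) (Q : ℝ → QuadraticForm ℝ M3) (C q : ℝ) (r : ℝ≥0 → ℝ≥0∞),
        StoredEnergy W Q C q r →
      ∀ rbar ebar : ℝ, 0 < ebar →
      ∀ nBC ν EnBC Eν : E2 → E3, MemL2Sphere Γ nBC → MemL2Sphere Γ ν →
        IsCanonicalExtension S Γ σ₀ nBC EnBC → IsCanonicalExtension S Γ σ₀ ν Eν →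
        (GammaConverges (fun σ p => plateEnergy Q rbar ebar S p + stripG S Γ EnBC σ p)
            (fun p => plateEnergy Q rbar ebar S p + weakG S Γ nBC p) ∧
          GammaConverges (fun σ p => plateEnergy Q rbar ebar S p + stripH S Γ Eν σ p)
            (fun p => plateEnergy Q rbar ebar S p + weakH S Γ ν p)) ∧
        ∀ β : ℝ, 0 < β → β < 1 / 2 →
          GammaConverges
            (fun σ p => plateEnergy Q rbar ebar S p
              + ENNReal.ofReal (σ ^ (-β)) * stripG S Γ EnBC σ p)
            (fun p => plateEnergy Q rbar ebar S p + strongG S Γ nBC p) ∧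
          GammaConverges
            (fun σ p => plateEnergy Q rbar ebar S p
              + ENNReal.ofReal (σ ^ (-β)) * stripH S Γ Eν σ p)
            (fun p => plateEnergy Q rbar ebar S p + strongH S Γ ν p) := by
  obtain ⟨L, δ, H⟩ := exists_hasSmoothNormal hS hΓ
  obtain ⟨ρ, hρ, h⟩ := H.exists_isGoodWidth
    ((hΓ.isCompact_closure hS).isBounded.subset subset_closure) hΓ.measurableSet one_pos
  have h₀ := h ρ le_rfl
  refine ⟨ρ, hρ, fun g hg => h₀.exists_canonicalExtension hg, ?_⟩
  intro W Q C q r hW rbar ebar he nBC ν EnBC Eν hn hν hEn hEν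
  simp only [stripG_eq, stripH_eq, strongG_eq, strongH_eq]
  refine ⟨⟨?_, ?_⟩, fun β hβ hβ2 => ⟨?_, ?_⟩⟩
  · exact gammaConverges_weak hW hS hΓ rbar he isPenalty_norm_sub hρ h₀ hn hEn
  · exact gammaConverges_weak hW hS hΓ rbar he isPenalty_abs_inner hρ h₀ hν hEν
  · refine (gammaConverges_strong hW hS hΓ rbar he isPenalty_norm_sub hρ h₀ hn hEn hβ
      (by linarith)).congr fun σ hσ => funext fun p => ?_
    rw [mul_extendTop (ENNReal.ofReal_pos.2 (Real.rpow_pos_of_pos hσ _)).ne']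
  · refine (gammaConverges_strong hW hS hΓ rbar he isPenalty_abs_inner hρ h₀ hν hEν hβ
      (by linarith)).congr fun σ hσ => funext fun p => ?_
    rw [mul_extendTop (ENNReal.ofReal_pos.2 (Real.rpow_pos_of_pos hσ _)).ne']
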